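/- Let $M$ be a smooth $6$-manifold and let $(J,\eta)$ be a $\mathrm U(3)$-structure or a $\mathrm U(1,2)$-structure on $M$: $J$ is an almost complex structure and $\eta$ is a real $(1,1)$-form such that near every point there are local $J$-linear coframings $\alpha=(\alpha^1,\alpha^2,\alpha^3)$ that are unitary, i.e. $\eta=\frac{i}{2}\sum_k\epsilon_k\,\alpha^k\wedge\overline{\alpha^k}$, where $\epsilon=(1,1,1)$, respectively $\epsilon=(1,-1,-1)$. Assume that $(J,\eta)$ is quasi-integrable: for every local unitary coframing $\alpha$ there is a complex function $\lambda$ such that the $(0,2)$-part of $d\alpha^i$ is $\lambda\,\epsilon_i\,\overline{\alpha^j\wedge\alpha^k}$ for every even permutation $(i,j,k)$ of $(1,2,3)$. Let $E\to M$ be a complex vector bundle of rank $r$ with a Hermitian structure $h$. Then the overdetermined system $$(\nabla^2)^{0,2}=\mathrm{tr}_\eta(\nabla^2)=0$$ for $h$-compatible connections $\nabla$ on $E$ is involutive, with Cartan characters $$(s_0,s_1,s_2,s_3,s_4,s_5,s_6)=(0,0,0,0,2r^2,3r^2,r^2).$$ In detail: let $U\subseteq M$ be the domain of a coordinate chart over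 which there are a unitary coframing $\alpha$ and an $h$-unitary frame $\mathsf u=(\mathsf u_1,\dots,\mathsf u_r)$ of $E$. On $X=U\times M_{r\times r}(\mathbb C)^3$, with matrix-valued fibre coordinates $p_1,p_2,p_3$, put $\pi=\sum_k p_k\,\alpha^k$, $A=\pi-{}^t\bar\pi$ and $F=dA+A\wedge A$. Let $\mathcal I$ be the ideal of differential forms on $X$ generated algebraically by the real and imaginary parts of the entries of $F\wedge\alpha^1\wedge\alpha^2\wedge\alpha^3$ and $F\wedge\eta^2$, and let $\Omega=i\,\alpha^1\wedge\alpha^2\wedge\alpha^3\wedge\overline{\alpha^1\wedge\alpha^2\wedge\alpha^3}$. Then: 1. Every smooth $h$-compatible connection $\nabla$ on $E|_U$ satisfies $\nabla\mathsf u=\mathsf u\otimes A$ along some smooth map $p=(p_1,p_2,p_3):U\to M_{r\times r}(\mathbb C)^3$, every smooth map $p$ arises in this way from such a connection, and, whenever $\nabla$ and $p$ are so related, $\nabla$ satisfies the system if and only if the graph of $p$ is an integral manifold of $\mathcal I$. 2. $(\mathcal I,\Omega)$ is involutive: $d\mathcal I\subseteq\mathcal I$; at each point of $X$ there is a $6$-dimensional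 integral element of $\mathcal I$ on which $\Omega\ne0$; and each such integral element $E_6$ is ordinary, i.e. it is the end of a flag $E_0\subset E_1\subset\dots\subset E_6$ of integral elements with $\dim E_k=k$ and $E_0,\dots,E_5$ Kähler-regular. 3. Every such flag has characters $s_0=c_0$, $s_k=c_k-c_{k-1}$ equal to $(0,0,0,0,2r^2,3r^2,r^2)$, where for $k\le5$ the number $c_k$ is the codimension in $TX$ of the polar space of $E_k$, and $c_6=\dim X-6=6r^2$. -/

import Mathlib

open scoped Manifold ContDiff Topology
open Bundle

/-! ### Exterior differential systems on open subsets of a normed space -/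

namespace EDS

section Forms

variable {W : Type*} [NormedAddCommGroup W] [NormedSpace ℝ W]

/-- The multilinear map `v ↦ β (v₀, …, v_{k-1}) * γ (v_k, …, v_{k+l-1})`. -/
noncomputable def tensorMul {A : Type*} [NormedCommRing A] [NormedAlgebra ℝ A] {k l : ℕ}
    (β : W [⋀^Fin k]→L[ℝ] A) (γ : W [⋀^Fin l]→L[ℝ] A) :
    ContinuousMultilinearMap ℝ (fun _ : Fin (k + l) => W) A where
  toMultilinearMap :=
    ((LinearMap.mul' ℝ A).compMultilinearMap
      (β.toAlternatingMap.toMultilinearMap.domCoprod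
        γ.toAlternatingMap.toMultilinearMap)).domDomCongr finSumFinEquiv
  cont := by
    change Continuous fun v : Fin (k + l) → W =>
      β (fun i => v (finSumFinEquiv (Sum.inl i))) * γ (fun i => v (finSumFinEquiv (Sum.inr i)))
    refine Continuous.mul ?_ ?_
    · exact β.cont.comp (continuous_pi fun i => continuous_apply _)
    · exact γ.cont.comp (continuous_pi fun i => continuous_apply _)

theorem tensorMul_apply {A : Type*} [NormedCommRing A] [NormedAlgebra ℝ A] {k l : ℕ}
    (β : W [⋀^Fin k]→L[ℝ] A) (γ : W [⋀^Fin l]→L[ℝ] A) (v : Fin (k + l) → W) :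
    tensorMul β γ v = β (fun i => v (Fin.castAdd l i)) * γ (fun i => v (Fin.natAdd k i)) := rfl

/-- The exterior product, `(β ∧ γ)(v) = (k! l!)⁻¹ ∑_σ sign σ β(v_{σ 0}, …) γ(v_{σ k}, …)`. -/
noncomputable def wedge {A : Type*} [NormedCommRing A] [NormedAlgebra ℝ A] {k l : ℕ}
    (β : W [⋀^Fin k]→L[ℝ] A) (γ : W [⋀^Fin l]→L[ℝ] A) : W [⋀^Fin (k + l)]→L[ℝ] A :=
  ((k.factorial * l.factorial : ℝ)⁻¹) •
    ContinuousMultilinearMap.alternatization (tensorMul β γ)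

theorem wedge_apply {A : Type*} [NormedCommRing A] [NormedAlgebra ℝ A] {k l : ℕ}
    (β : W [⋀^Fin k]→L[ℝ] A) (γ : W [⋀^Fin l]→L[ℝ] A) (v : Fin (k + l) → W) :
    wedge β γ v = ((k.factorial * l.factorial : ℝ)⁻¹) •
      ∑ σ : Equiv.Perm (Fin (k + l)), Equiv.Perm.sign σ •
        (β (fun i => v (σ (Fin.castAdd l i))) * γ (fun i => v (σ (Fin.natAdd k i)))) := by
  simp [wedge, ContinuousMultilinearMap.alternatization_apply_apply, tensorMul_apply]

/-- A complex-valued covector as a `1`-form. -/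
noncomputable def oneForm (L : W →L[ℝ] ℂ) : W [⋀^Fin 1]→L[ℝ] ℂ :=
  ContinuousAlternatingMap.ofSubsingleton ℝ W ℂ (0 : Fin 1) L

/-- Complex conjugate of a complex-valued form. -/
noncomputable def conjForm {k : ℕ} (β : W [⋀^Fin k]→L[ℝ] ℂ) : W [⋀^Fin k]→L[ℝ] ℂ :=
  (Complex.conjCLE : ℂ →L[ℝ] ℂ).compContinuousAlternatingMap β

/-- Real part of a complex-valued form. -/
noncomputable def reForm {k : ℕ} (β : W [⋀^Fin k]→L[ℝ] ℂ) : W [⋀^Fin k]→L[ℝ] ℝ :=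
  Complex.reCLM.compContinuousAlternatingMap β

/-- Imaginary part of a complex-valued form. -/
noncomputable def imForm {k : ℕ} (β : W [⋀^Fin k]→L[ℝ] ℂ) : W [⋀^Fin k]→L[ℝ] ℝ :=
  Complex.imCLM.compContinuousAlternatingMap β

variable (W) in
/-- A family of sets of real differential forms, one for each degree. -/
abbrev FormFamily := ∀ k : ℕ, Set (W → W [⋀^Fin k]→L[ℝ] ℝ)

/-- The (algebraic) ideal, in the algebra of smooth forms on the open set `X`, generated by the
forms in `G`.  Forms are total functions on `W`, of which only the restriction to `X` matters. -/
inductive AlgIdeal (X : Set W) (G : FormFamily W) :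
    ∀ k : ℕ, (W → W [⋀^Fin k]→L[ℝ] ℝ) → Prop
  | gen {k : ℕ} {ψ : W → W [⋀^Fin k]→L[ℝ] ℝ} (h : ψ ∈ G k) : AlgIdeal X G k ψ
  | zero (k : ℕ) : AlgIdeal X G k (fun _ => 0)
  | add {k : ℕ} {ψ χ : W → W [⋀^Fin k]→L[ℝ] ℝ} (hψ : AlgIdeal X G k ψ)
      (hχ : AlgIdeal X G k χ) : AlgIdeal X G k (fun z => ψ z + χ z)
  | smul {k : ℕ} {f : W → ℝ} {ψ : W → W [⋀^Fin k]→L[ℝ] ℝ} (hf : ContDiffOn ℝ ∞ f X)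
      (hψ : AlgIdeal X G k ψ) : AlgIdeal X G k (fun z => f z • ψ z)
  | wedge {j k : ℕ} {β : W → W [⋀^Fin j]→L[ℝ] ℝ} {ψ : W → W [⋀^Fin k]→L[ℝ] ℝ}
      (hβ : ContDiffOn ℝ ∞ β X) (hψ : AlgIdeal X G k ψ) :
      AlgIdeal X G (j + k) (fun z => wedge (β z) (ψ z))
  | congr {k : ℕ} {ψ χ : W → W [⋀^Fin k]→L[ℝ] ℝ} (hψ : AlgIdeal X G k ψ)
      (h : Set.EqOn ψ χ X) : AlgIdeal X G k χ

/-- The ideal generated by `G` as a family of sets of forms. -/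
def ideal (X : Set W) (G : FormFamily W) : FormFamily W := fun k => {ψ | AlgIdeal X G k ψ}

/-- `d I ⊆ I`. -/
def DiffClosed (I : FormFamily W) : Prop :=
  ∀ (k : ℕ) (ψ : W → W [⋀^Fin k]→L[ℝ] ℝ), ψ ∈ I k → (fun z => extDeriv ψ z) ∈ I (k + 1)

/-- The subspace `E` of the tangent space `W` at `z` is an integral element of `I`: every form
of `I` vanishes on it. -/
def IsIntegralElement (I : FormFamily W) (z : W) (E : Submodule ℝ W) : Prop :=
  ∀ (k : ℕ) (ψ : W → W [⋀^Fin k]→L[ℝ] ℝ), ψ ∈ I k →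
    ∀ w : Fin k → W, (∀ i, w i ∈ E) → ψ z w = 0

/-- The polar space `H(E)` of the `k`-plane `E` spanned by `v` at `z`: the vectors `w` such that
all `(k+1)`-forms of `I` vanish on `(w, v₀, …, v_{k-1})`. -/
def polarSpace (I : FormFamily W) (z : W) {k : ℕ} (v : Fin k → W) : Submodule ℝ W where
  carrier := {w | ∀ ψ : W → W [⋀^Fin (k + 1)]→L[ℝ] ℝ, ψ ∈ I (k + 1) → ψ z (Fin.cons w v) = 0}
  zero_mem' := fun ψ _ => (ψ z).map_coord_zero 0 (by simp)
  add_mem' := by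
    intro a b ha hb ψ hψ
    have h := (ψ z).toMultilinearMap.cons_add v a b
    change ψ z (Fin.cons (a + b) v) = ψ z (Fin.cons a v) + ψ z (Fin.cons b v) at h
    rw [h, ha ψ hψ, hb ψ hψ, add_zero]
  smul_mem' := by
    intro c a ha ψ hψ
    have h := (ψ z).toMultilinearMap.cons_smul v c a
    change ψ z (Fin.cons (c • a) v) = c • ψ z (Fin.cons a v) at h
    rw [h, ha ψ hψ, smul_zero]

/-- The rank `c(E)` of the polar equations of `E = span v`, i.e. the codimension of `H(E)`. -/
noncomputable def polarRank (I : FormFamily W) (z : W) {k : ℕ} (v : Fin k → W) : ℕ :=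
  Module.finrank ℝ (W ⧸ polarSpace I z v)

/-- `span v` (with `v` linearly independent) is a Kähler-ordinary integral element at `z`: it is
an integral element, and near it the integral `k`-planes are the common zeros of finitely many
of the functions `(z', v') ↦ ψ(z')(v')`, `ψ` a `k`-form of `I`, with independent differentials at
`(z, v)`.  Planes are parametrized by their frames. -/
def IsKahlerOrdinary (I : FormFamily W) (z : W) {k : ℕ} (v : Fin k → W) : Prop :=
  LinearIndependent ℝ v ∧ IsIntegralElement I z (Submodule.span ℝ (Set.range v)) ∧
  ∃ (q : ℕ) (ψ : Fin q → W → W [⋀^Fin k]→L[ℝ] ℝ), (∀ a, ψ a ∈ I k) ∧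
    LinearIndependent ℝ (fun a =>
      fderiv ℝ (fun p : W × (Fin k → W) => ψ a p.1 p.2) (z, v)) ∧
    ∀ᶠ p : W × (Fin k → W) in 𝓝 (z, v),
      (IsIntegralElement I p.1 (Submodule.span ℝ (Set.range p.2)) ↔ ∀ a, ψ a p.1 p.2 = 0)

/-- Kähler-regular: Kähler-ordinary, and the dimension of the polar space is constant on the
integral `k`-planes near `span v`. -/
def IsKahlerRegular (I : FormFamily W) (z : W) {k : ℕ} (v : Fin k → W) : Prop :=
  IsKahlerOrdinary I z v ∧
    ∀ᶠ p : W × (Fin k → W) in 𝓝 (z, v),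
      IsIntegralElement I p.1 (Submodule.span ℝ (Set.range p.2)) →
        polarRank I p.1 p.2 = polarRank I z v

/-- The first `k` vectors of a frame. -/
def initialFrame {n : ℕ} (v : Fin n → W) (k : ℕ) (hk : k ≤ n) : Fin k → W :=
  fun i => v (Fin.castLE hk i)

/-- The flag `E₀ ⊂ E₁ ⊂ ⋯ ⊂ E_n`, `E_k = span (v₀, …, v_{k-1})`, is an ordinary integral flag
at `z`: `E_n` is an integral element (of dimension `n`) and `E₀, …, E_{n-1}` are
Kähler-regular. -/
def IsOrdinaryFlag (I : FormFamily W) (z : W) {n : ℕ} (v : Fin n → W) : Prop :=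
  LinearIndependent ℝ v ∧ IsIntegralElement I z (Submodule.span ℝ (Set.range v)) ∧
    ∀ (k : ℕ) (hk : k < n), IsKahlerRegular I z (initialFrame v k hk.le)

/-- `E ∈ V_n(I, Ω)` at `z`: an `n`-dimensional integral element on which `Ω` is non-zero. -/
def IsAdmissibleElement {n : ℕ} (I : FormFamily W) (Ω : W → W [⋀^Fin n]→L[ℝ] ℝ) (z : W)
    (E : Submodule ℝ W) : Prop :=
  Module.finrank ℝ E = n ∧ IsIntegralElement I z E ∧ ∃ w : Fin n → W, (∀ i, w i ∈ E) ∧ Ω z w ≠ 0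

/-- The exterior differential system with independence condition `(I, Ω)` on the open set `X` is
involutive: `I` is differentially closed, there are admissible integral elements at each point,
and each of them is ordinary, i.e. is the last term of an ordinary integral flag. -/
def IsInvolutive {n : ℕ} (X : Set W) (I : FormFamily W) (Ω : W → W [⋀^Fin n]→L[ℝ] ℝ) : Prop :=
  DiffClosed I ∧ ∀ z ∈ X, (∃ E : Submodule ℝ W, IsAdmissibleElement I Ω z E) ∧
    ∀ E : Submodule ℝ W, IsAdmissibleElement I Ω z E →
      ∃ v : Fin n → W, Submodule.span ℝ (Set.range v) = E ∧ IsOrdinaryFlag I z v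

/-- `c_k` of a flag: the rank of the polar equations of `E_k` for `k < n`, and
`c_n = dim X - n`. -/
noncomputable def flagRank {n : ℕ} (I : FormFamily W) (z : W) (v : Fin n → W) (k : ℕ) : ℤ :=
  if hk : k < n then (polarRank I z (initialFrame v k hk.le) : ℤ)
  else (Module.finrank ℝ W : ℤ) - n

/-- The Cartan characters `s₀ = c₀`, `s_k = c_k - c_{k-1}` of a flag. -/
noncomputable def cartanCharacter {n : ℕ} (I : FormFamily W) (z : W) (v : Fin n → W)
    (k : Fin (n + 1)) : ℤ :=
  flagRank I z v k - if (k : ℕ) = 0 then 0 else flagRank I z v (k - 1)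

/-- `(I, Ω)` has Cartan characters `s`: all ordinary flags of `(I, Ω)` have characters `s`. -/
def HasCartanCharacters {n : ℕ} (X : Set W) (I : FormFamily W) (Ω : W → W [⋀^Fin n]→L[ℝ] ℝ)
    (s : Fin (n + 1) → ℤ) : Prop :=
  ∀ z ∈ X, ∀ v : Fin n → W, IsOrdinaryFlag I z v →
    IsAdmissibleElement I Ω z (Submodule.span ℝ (Set.range v)) → cartanCharacter I z v = s

end Forms

end EDS

/-! ### Almost Hermitian structures on `6`-manifolds -/

namespace PseudoHYM

/-- The model `ℝ⁶`. -/
abbrev R6 := EuclideanSpace ℝ (Fin 6)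

/-- An `ℝ`-linear map `A = (α¹, α², α³) : T → ℂ³` is unitary for `(J, η)`, where `η` has
signature `ε`: it is a `J`-linear isomorphism and `η = (i/2) ∑ ε_i α^i ∧ conj α^i`. -/
def IsUnitaryCoframe {T : Type*} [AddCommGroup T] [Module ℝ T] [TopologicalSpace T]
    (ε : Fin 3 → ℝ) (J : T →L[ℝ] T) (η : T → T → ℝ) (A : T →L[ℝ] (Fin 3 → ℂ)) : Prop :=
  Function.Bijective A ∧ (∀ v, A (J v) = Complex.I • A v) ∧
    ∀ v w, ((η v w : ℝ) : ℂ) = ∑ i, (Complex.I / 2) * (ε i : ℂ) *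
      (A v i * (starRingEnd ℂ) (A w i) - A w i * (starRingEnd ℂ) (A v i))

section Manifold

variable (M : Type*) [TopologicalSpace M] [ChartedSpace R6 M] [IsManifold (𝓡 6) ∞ M]

/-- A smooth unitary structure `(J, η)` on `M⁶`: an almost complex structure and a nondegenerate
real `(1,1)`-form with Hermitian signature `ε`.  With `ε = (1,1,1)` this is a `U(3)`-structure,
and with `ε = (1,-1,-1)` a `U(1,2)`-structure.  (Existence of a unitary coframe at each point
says precisely that `J² = -1` and that `η` is a `(1,1)`-form of signature `ε`.) -/
structure UnitaryStructure (ε : Fin 3 → ℝ) where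
  J : ∀ x : M, TangentSpace (𝓡 6) x →L[ℝ] TangentSpace (𝓡 6) x
  η : ∀ x : M, TangentSpace (𝓡 6) x →L[ℝ] TangentSpace (𝓡 6) x →L[ℝ] ℝ
  smooth_J : ContMDiff (𝓡 6) ((𝓡 6).prod 𝓘(ℝ, R6 →L[ℝ] R6)) ∞
    (fun x => TotalSpace.mk' (R6 →L[ℝ] R6)
      (E := fun x : M => TangentSpace (𝓡 6) x →L[ℝ] TangentSpace (𝓡 6) x) x (J x))
  smooth_η : ContMDiff (𝓡 6) ((𝓡 6).prod 𝓘(ℝ, R6 →L[ℝ] R6 →L[ℝ] ℝ)) ∞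
    (fun x => TotalSpace.mk' (R6 →L[ℝ] R6 →L[ℝ] ℝ)
      (E := fun x : M => TangentSpace (𝓡 6) x →L[ℝ] TangentSpace (𝓡 6) x →L[ℝ] ℝ) x (η x))
  unitary : ∀ x : M, ∃ A : TangentSpace (𝓡 6) x →L[ℝ] (Fin 3 → ℂ),
    IsUnitaryCoframe ε (J x) (fun v w => η x v w) A

variable {M} {ε : Fin 3 → ℝ}

/-- The tangent map `ℝ⁶ → T_x M`, `x = φ⁻¹(y)`, of the inverse of a chart `φ`. -/
noncomputable def tangentMap (φ : OpenPartialHomeomorph M R6) (y : R6) :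
    R6 →L[ℝ] TangentSpace (𝓡 6) (φ.symm y) :=
  mfderiv (𝓡 6) (𝓡 6) φ.symm y

/-- The almost complex structure in the coordinates `φ`. -/
noncomputable def UnitaryStructure.coordJ (S : UnitaryStructure M ε)
    (φ : OpenPartialHomeomorph M R6) (y : R6) : R6 →L[ℝ] R6 :=
  ContinuousLinearMap.comp (mfderiv (𝓡 6) (𝓡 6) φ (φ.symm y))
    ((S.J (φ.symm y)).comp (tangentMap φ y))

/-- The form `η` in the coordinates `φ`. -/
noncomputable def UnitaryStructure.coordη (S : UnitaryStructure M ε)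
    (φ : OpenPartialHomeomorph M R6) (y : R6) (v w : R6) : ℝ :=
  S.η (φ.symm y) (tangentMap φ y v) (tangentMap φ y w)

/-- A smooth `(J, η)`-unitary coframing `α = (α¹, α², α³)` on the domain of the chart `φ`,
written in the coordinates `φ`. -/
structure UnitaryStructure.IsUnitaryCoframing (S : UnitaryStructure M ε)
    (φ : OpenPartialHomeomorph M R6) (α : R6 → R6 →L[ℝ] (Fin 3 → ℂ)) : Prop where
  smooth : ContDiffOn ℝ ∞ α φ.target
  unitary : ∀ y ∈ φ.target, IsUnitaryCoframe ε (S.coordJ φ y) (S.coordη φ y) (α y)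

/-- The component `α^i` of a coframing, at the point `y`. -/
noncomputable def comp (α : R6 → R6 →L[ℝ] (Fin 3 → ℂ)) (i : Fin 3) (y : R6) : R6 →L[ℝ] ℂ :=
  (ContinuousLinearMap.proj i : (Fin 3 → ℂ) →L[ℝ] ℂ).comp (α y)

/-- The value at `(v, w)` of the `(0,2)`-part of a `2`-form `τ` with values in a complex vector
space: each argument `v` is replaced by its `(0,1)`-part `(v + iJv)/2`, `τ` being extended
complex-bilinearly. -/
noncomputable def part02 {Z : Type*} [AddCommGroup Z] [Module ℂ Z] (J : R6 →L[ℝ] R6)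
    (τ : R6 → R6 → Z) (v w : R6) : Z :=
  (1 / 4 : ℂ) • (τ v w + Complex.I • τ (J v) w + Complex.I • τ v (J w) - τ (J v) (J w))

/-- The matrix `N` represents the Nijenhuis tensor in the coframing `α` at `y`:
`d^{-1,2} α = N · ᵗ(conj(α²∧α³), conj(α³∧α¹), conj(α¹∧α²))`, where `d^{-1,2} α^i` is the
`(0,2)`-part of `d α^i`. -/
def IsNijenhuisMatrix (J : R6 →L[ℝ] R6) (α : R6 → R6 →L[ℝ] (Fin 3 → ℂ)) (y : R6)
    (N : Matrix (Fin 3) (Fin 3) ℂ) : Prop :=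
  ∀ (i : Fin 3) (v w : R6),
    part02 J (fun v w => extDeriv (fun y => EDS.oneForm (comp α i y)) y ![v, w]) v w =
      ∑ j : Fin 3, N i j * (starRingEnd ℂ)
        (α y v (j + 1) * α y w (j + 2) - α y w (j + 1) * α y v (j + 2))

/-- `(J, η)` is quasi-integrable: for each local unitary coframing `α` the matrix `N(α)` of the
Nijenhuis tensor is `λ · diag(ε)` for some complex function `λ`. -/
def UnitaryStructure.IsQuasiIntegrable (S : UnitaryStructure M ε) : Prop :=
  ∀ φ ∈ IsManifold.maximalAtlas (𝓡 6) ∞ M, ∀ α : R6 → R6 →L[ℝ] (Fin 3 → ℂ),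
    S.IsUnitaryCoframing φ α → ∀ y ∈ φ.target, ∃ c : ℂ,
      IsNijenhuisMatrix (S.coordJ φ y) α y (Matrix.diagonal fun i => c * (ε i : ℂ))

end Manifold

/-! ### Hermitian bundles, compatible connections, and the equations -/

section BundleDefs

variable {M : Type*} [TopologicalSpace M] [ChartedSpace R6 M] [IsManifold (𝓡 6) ∞ M]
  (r : ℕ) (E : M → Type*) [TopologicalSpace (TotalSpace (Fin r → ℂ) E)]
  [∀ x, TopologicalSpace (E x)] [∀ x, AddCommGroup (E x)] [∀ x, Module ℂ (E x)]
  [FiberBundle (Fin r → ℂ) E]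

/-- A smooth Hermitian structure on the complex vector bundle `E` (conjugate-linear in the
first argument). -/
structure HermitianStructure where
  inner : ∀ x : M, E x →ₗ⋆[ℂ] E x →ₗ[ℂ] ℂ
  conj_symm : ∀ x (a b : E x), (starRingEnd ℂ) (inner x a b) = inner x b a
  pos : ∀ x (a : E x), a ≠ 0 → 0 < (inner x a a).re
  smooth : ∀ U : Set M, IsOpen U → ∀ s t : (∀ x, E x),
    ContMDiffOn (𝓡 6) ((𝓡 6).prod 𝓘(ℝ, Fin r → ℂ)) ∞
      (fun x => TotalSpace.mk' (Fin r → ℂ) x (s x)) U →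
    ContMDiffOn (𝓡 6) ((𝓡 6).prod 𝓘(ℝ, Fin r → ℂ)) ∞
      (fun x => TotalSpace.mk' (Fin r → ℂ) x (t x)) U →
    ContMDiffOn (𝓡 6) 𝓘(ℝ, ℂ) ∞ (fun x => inner x (s x) (t x)) U

variable {r} {E}

/-- A smooth `h`-unitary frame `(u₁, …, u_r)` of `E` over `U`. -/
structure HermitianStructure.IsUnitaryFrame (h : HermitianStructure r E) (U : Set M)
    (u : Fin r → ∀ x, E x) : Prop where
  smooth : ∀ i, ContMDiffOn (𝓡 6) ((𝓡 6).prod 𝓘(ℝ, Fin r → ℂ)) ∞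
    (fun x => TotalSpace.mk' (Fin r → ℂ) x (u i x)) U
  orthonormal : ∀ x ∈ U, ∀ i j, h.inner x (u i x) (u j x) = if i = j then 1 else 0

variable [∀ x, IsTopologicalAddGroup (E x)] [∀ x, ContinuousSMul ℝ (E x)]
  [VectorBundle ℝ (Fin r → ℂ) E]

/-- `cov` is a smooth `h`-compatible connection on the complex bundle `E` over the open
set `U`. -/
structure HermitianStructure.IsCompatibleConnectionOn (h : HermitianStructure r E) (U : Set M)
    (cov : (∀ x, E x) → ∀ x : M, TangentSpace (𝓡 6) x →L[ℝ] E x) : Prop where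
  covariant : IsCovariantDerivativeOn (I := 𝓡 6) (Fin r → ℂ) cov U
  smooth : ContMDiffCovariantDerivativeOn (I := 𝓡 6) (Fin r → ℂ) ∞ cov U
  complex_linear : ∀ s : (∀ x, E x), ∀ x ∈ U,
    MDifferentiableAt (𝓡 6) ((𝓡 6).prod 𝓘(ℝ, Fin r → ℂ))
      (fun x => TotalSpace.mk' (Fin r → ℂ) x (s x)) x →
    ∀ v, cov (fun x => Complex.I • s x) x v = Complex.I • cov s x v
  compatible : ∀ s t : (∀ x, E x), ∀ x ∈ U,
    MDifferentiableAt (𝓡 6) ((𝓡 6).prod 𝓘(ℝ, Fin r → ℂ))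
      (fun x => TotalSpace.mk' (Fin r → ℂ) x (s x)) x →
    MDifferentiableAt (𝓡 6) ((𝓡 6).prod 𝓘(ℝ, Fin r → ℂ))
      (fun x => TotalSpace.mk' (Fin r → ℂ) x (t x)) x →
    ∀ v : TangentSpace (𝓡 6) x,
      (mfderiv (𝓡 6) 𝓘(ℝ, ℂ) (fun x => h.inner x (s x) (t x)) x v : ℂ) =
        h.inner x (cov s x v) (t x) + h.inner x (s x) (cov t x v)

/-- The derivative `∇_{∂_v} s` along the coordinate vector field `∂_v` of the chart `φ`
determined by the constant vector `v ∈ ℝ⁶`. -/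
noncomputable def coordCov (φ : OpenPartialHomeomorph M R6)
    (cov : (∀ x, E x) → ∀ x : M, TangentSpace (𝓡 6) x →L[ℝ] E x)
    (v : R6) (s : ∀ x, E x) : ∀ x, E x :=
  fun x => cov s x (mfderiv (𝓡 6) (𝓡 6) φ.symm (φ x) v)

/-- The curvature `∇²(∂_v, ∂_w) s = ∇_{∂_v} ∇_{∂_w} s - ∇_{∂_w} ∇_{∂_v} s` at the point with
coordinates `y` (coordinate vector fields commute). -/
noncomputable def curvature (φ : OpenPartialHomeomorph M R6)
    (cov : (∀ x, E x) → ∀ x : M, TangentSpace (𝓡 6) x →L[ℝ] E x)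
    (s : ∀ x, E x) (y : R6) (v w : R6) : E (φ.symm y) :=
  coordCov φ cov v (coordCov φ cov w s) (φ.symm y) -
    coordCov φ cov w (coordCov φ cov v s) (φ.symm y)

/-- `(∇²)^{0,2} = 0` and `tr_η(∇²) = 0` on the domain of the chart `φ`.  Here
`tr_η τ = ∑ ε_i τ(e_i, J e_i)` for any unitary basis `(e_i)`. -/
def UnitaryStructure.IsSolution {ε : Fin 3 → ℝ} (S : UnitaryStructure M ε)
    (φ : OpenPartialHomeomorph M R6)
    (cov : (∀ x, E x) → ∀ x : M, TangentSpace (𝓡 6) x →L[ℝ] E x) : Prop :=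
  ∀ s : (∀ x, E x),
    ContMDiffOn (𝓡 6) ((𝓡 6).prod 𝓘(ℝ, Fin r → ℂ)) ∞
      (fun x => TotalSpace.mk' (Fin r → ℂ) x (s x)) φ.source →
    ∀ y ∈ φ.target,
      (∀ v w : R6, part02 (S.coordJ φ y) (curvature φ cov s y) v w = 0) ∧
      ∀ A : R6 →L[ℝ] (Fin 3 → ℂ), IsUnitaryCoframe ε (S.coordJ φ y) (S.coordη φ y) A →
        ∀ e : Fin 3 → R6, (∀ i, A (e i) = Pi.single i 1) →
          ∑ i, (ε i : ℂ) • curvature φ cov s y (e i) (S.coordJ φ y (e i)) = 0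

end BundleDefs

/-! ### The associated exterior differential system -/

section System

/-- The fibre coordinates `p = (p₁, p₂, p₃)`, three complex `r × r` matrices. -/
abbrev Fib (r : ℕ) := Fin 3 → Fin r → Fin r → ℂ

/-- The space `ℝ⁶ × M_r(ℂ)³` containing `X = φ(U) × M_r(ℂ)³`. -/
abbrev Tot (r : ℕ) := R6 × Fib r

variable {r : ℕ}

/-- The `(i,j)` entry of `π - π*`, `π = p₁ α¹ + p₂ α² + p₃ α³`, at `y`. -/
noncomputable def connMatrix (α : R6 → R6 →L[ℝ] (Fin 3 → ℂ)) (y : R6) (p : Fib r)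
    (i j : Fin r) : R6 →L[ℝ] ℂ :=
  ∑ k, (p k i j • comp α k y -
    (starRingEnd ℂ) (p k j i) • (Complex.conjCLE : ℂ →L[ℝ] ℂ).comp (comp α k y))

/-- `∇u = u ⊗ (π - π*)` over the domain of the chart, where `π` is given by the functions `p`
of the coordinates. -/
def IsConnectionMatrix {M : Type*} [TopologicalSpace M] [ChartedSpace R6 M]
    {E : M → Type*} [∀ x, TopologicalSpace (E x)] [∀ x, AddCommGroup (E x)]
    [∀ x, Module ℂ (E x)]
    (φ : OpenPartialHomeomorph M R6) (α : R6 → R6 →L[ℝ] (Fin 3 → ℂ)) (u : Fin r → ∀ x, E x)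
    (cov : (∀ x, E x) → ∀ x : M, TangentSpace (𝓡 6) x →L[ℝ] E x) (p : R6 → Fib r) : Prop :=
  ∀ y ∈ φ.target, ∀ (j : Fin r) (v : R6),
    cov (u j) (φ.symm y) (tangentMap φ y v) =
      ∑ i, connMatrix α y (p y) i j v • u i (φ.symm y)

/-- The `1`-form `α^k` pulled back to `X`. -/
noncomputable def theta (r : ℕ) (α : R6 → R6 →L[ℝ] (Fin 3 → ℂ)) (k : Fin 3) (z : Tot r) :
    Tot r [⋀^Fin 1]→L[ℝ] ℂ :=
  EDS.oneForm ((comp α k z.1).comp (ContinuousLinearMap.fst ℝ R6 (Fib r)))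

/-- The `(i,j)` entry of the tautological matrix `π - π*` of `1`-forms on `X`. -/
noncomputable def tautForm (α : R6 → R6 →L[ℝ] (Fin 3 → ℂ)) (i j : Fin r) (z : Tot r) :
    Tot r [⋀^Fin 1]→L[ℝ] ℂ :=
  EDS.oneForm ((connMatrix α z.1 z.2 i j).comp (ContinuousLinearMap.fst ℝ R6 (Fib r)))

/-- The `(i,j)` entry of `F = d(π - π*) + (π - π*) ∧ (π - π*)`. -/
noncomputable def curvForm (α : R6 → R6 →L[ℝ] (Fin 3 → ℂ)) (i j : Fin r) (z : Tot r) :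
    Tot r [⋀^Fin 2]→L[ℝ] ℂ :=
  extDeriv (tautForm α i j) z + ∑ k, EDS.wedge (tautForm α i k z) (tautForm α k j z)

/-- `α¹ ∧ α² ∧ α³` on `X`. -/
noncomputable def theta123 (r : ℕ) (α : R6 → R6 →L[ℝ] (Fin 3 → ℂ)) (z : Tot r) :
    Tot r [⋀^Fin 3]→L[ℝ] ℂ :=
  EDS.wedge (EDS.wedge (theta r α 0 z) (theta r α 1 z)) (theta r α 2 z)

/-- `η = (i/2) ∑ ε_k α^k ∧ conj α^k` on `X`. -/
noncomputable def etaForm (r : ℕ) (ε : Fin 3 → ℝ) (α : R6 → R6 →L[ℝ] (Fin 3 → ℂ)) (z : Tot r) :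
    Tot r [⋀^Fin 2]→L[ℝ] ℂ :=
  ∑ k, ((Complex.I / 2) * (ε k : ℂ)) •
    EDS.wedge (theta r α k z) (EDS.conjForm (theta r α k z))

/-- The entries of `Υ = F ∧ α¹ ∧ α² ∧ α³`. -/
noncomputable def Upsilon (α : R6 → R6 →L[ℝ] (Fin 3 → ℂ)) (i j : Fin r) (z : Tot r) :
    Tot r [⋀^Fin 5]→L[ℝ] ℂ :=
  EDS.wedge (curvForm α i j z) (theta123 r α z)

/-- The entries of `Ψ = F ∧ η²`. -/
noncomputable def Psi (ε : Fin 3 → ℝ) (α : R6 → R6 →L[ℝ] (Fin 3 → ℂ)) (i j : Fin r)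
    (z : Tot r) : Tot r [⋀^Fin 6]→L[ℝ] ℂ :=
  EDS.wedge (curvForm α i j z) (EDS.wedge (etaForm r ε α z) (etaForm r ε α z))

/-- The real and imaginary parts of the entries of `Υ` and `Ψ`. -/
inductive IsGenerator (ε : Fin 3 → ℝ) (α : R6 → R6 →L[ℝ] (Fin 3 → ℂ)) :
    ∀ k : ℕ, (Tot r → Tot r [⋀^Fin k]→L[ℝ] ℝ) → Prop
  | upsilon_re (i j : Fin r) : IsGenerator ε α 5 (fun z => EDS.reForm (Upsilon α i j z))
  | upsilon_im (i j : Fin r) : IsGenerator ε α 5 (fun z => EDS.imForm (Upsilon α i j z))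
  | psi_re (i j : Fin r) : IsGenerator ε α 6 (fun z => EDS.reForm (Psi ε α i j z))
  | psi_im (i j : Fin r) : IsGenerator ε α 6 (fun z => EDS.imForm (Psi ε α i j z))

/-- The manifold `X = V × M_r(ℂ)³`, for `V ⊆ ℝ⁶` open. -/
def domX (r : ℕ) (V : Set R6) : Set (Tot r) := V ×ˢ Set.univ

/-- The ideal generated by the components of `Υ` and `Ψ` on `X = V × M_r(ℂ)³`. -/
def hymIdeal (r : ℕ) (ε : Fin 3 → ℝ) (V : Set R6) (α : R6 → R6 →L[ℝ] (Fin 3 → ℂ)) :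
    EDS.FormFamily (Tot r) :=
  EDS.ideal (domX r V) fun k => {ψ | IsGenerator ε α k ψ}

/-- The independence form `i α¹∧α²∧α³∧conj(α¹∧α²∧α³)` (which is real). -/
noncomputable def indepForm (r : ℕ) (α : R6 → R6 →L[ℝ] (Fin 3 → ℂ)) (z : Tot r) :
    Tot r [⋀^Fin 6]→L[ℝ] ℝ :=
  EDS.reForm (Complex.I • EDS.wedge (theta123 r α z) (EDS.conjForm (theta123 r α z)))

/-- The graph of `p` is an integral manifold of `I` over `V`: all forms of `I` pull back to `0`
under `y ↦ (y, p y)`. -/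
def IsIntegralGraph (V : Set R6) (I : EDS.FormFamily (Tot r)) (p : R6 → Fib r) : Prop :=
  ∀ (k : ℕ) (ψ : Tot r → Tot r [⋀^Fin k]→L[ℝ] ℝ), ψ ∈ I k → ∀ y ∈ V,
    (ψ (y, p y)).compContinuousLinearMap (fderiv ℝ (fun y => (y, p y)) y) = 0

end System

end PseudoHYM

/-! Everything reduces to linear algebra of the matrix-valued 2-form F at one point of X. In the
real frame dual to α, F ∧ α¹α²α³ sees exactly the (0,2)-part of F. Likewise F ∧ η² sees exactly its
η-trace, since η² pairs F(e_i, Je_i) with 2ε_jε_k = 2ε₀ε₁ε₂·ε_i. So a 6-plane that is the range of a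
section L of X → ℝ⁶ is integral if and only if L*F has no (0,2)-part and no trace
(`isIntegralElement_range_iff`). For the graph of p the pullback is dA + A ∧ A, the curvature in the
unitary frame; this gives the correspondence with solutions (`isSolution_iff_isIntegralGraph`).

Closure under d. The Bianchi identity disposes of dF, so only F ∧ d(α¹α²α³) and F ∧ d(η²) matter.
Since A is skew-Hermitian, so is F, and conjugating F ∧ α¹α²α³ puts F ∧ conj(α¹α²α³) into the ideal.
Every 5-form on the base is divisible, up to a sum of two terms, by α¹α²α³ or its conjugate, so F ∧
d(η²) lies in the ideal whatever dη is. Quasi-integrability together with ε₀ε₁ε₂ = 1 gives d(α¹α²α³)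
= κ ∧ α¹α²α³ + μη² (`extDeriv_volForm`), so F ∧ d(α¹α²α³) is a combination of the two kinds of
generators.

Polar spaces. A fibre direction q satisfies F(q, ·) = qα − (qα)* (`curvForm_vertical`). The ideal
starts in degree 5, so c₀ = … = c₃ = 0. On a 4-plane where some conj α^k ∧ α¹α²α³ is nonzero, the r²
complex polar equations are independent and c₄ = 2r². Let a 5-plane be integral with conormal ξ, and
let s be the (0,1)-coefficients of ξ. Extending it by a vector with fibre part q changes L*F by ξ ∧
(qα − (qα)*). Vanishing of the (0,2)-part becomes s ∧ q* = g; integrality of the 5-plane says s ∧ g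
= 0, which is the solvability condition. The remaining freedom is q_k = conj(s_k) c with c any
matrix, and the trace equation fixes the Hermitian part of c provided Σ ε_k|s_k|² ≠ 0. The polar
space then has dimension 6 + r², so c₅ = 5r² (`polarRank_five`), and c₆ = 6r².

The nondegeneracy conditions are open and involve only the projections of the vectors to ℝ⁶, so one
explicit frame of ℝ⁶, lifted to any admissible plane, spans an ordinary flag. For an arbitrary
ordinary flag the conditions may fail, but its ranks are locally constant and the conditions, being
real-analytic along lines, hold arbitrarily close by; hence all ordinary flags have the same
characters. -/

namespace EDS

/-! ### Alternating sums over permutations of the arguments. -/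

section Alternation

variable {W A : Type*} [AddCommGroup A]

/-- The alternating sum of a function of `n` vectors over all permutations of its arguments. -/
def altSum {n : ℕ} (g : (Fin n → W) → A) (v : Fin n → W) : A :=
  ∑ σ : Equiv.Perm (Fin n), Equiv.Perm.sign σ • g (fun i => v (σ i))

theorem altSum_perm {n : ℕ} (g : (Fin n → W) → A) (τ : Equiv.Perm (Fin n)) (v : Fin n → W) :
    altSum (fun w => g (fun i => w (τ i))) v = Equiv.Perm.sign τ • altSum g v := by
  unfold altSum
  rw [Finset.smul_sum, ← Equiv.sum_comp (Equiv.mulRight τ⁻¹)]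
  refine Finset.sum_congr rfl fun σ _ => ?_
  simp [smul_smul, mul_comm]

theorem altSum_sum {n : ℕ} {ι : Type*} (s : Finset ι) (g : ι → (Fin n → W) → A)
    (v : Fin n → W) : altSum (fun w => ∑ i ∈ s, g i w) v = ∑ i ∈ s, altSum (g i) v := by
  unfold altSum
  simp_rw [Finset.smul_sum]
  exact Finset.sum_comm

theorem altSum_units_smul {n : ℕ} (c : ℤˣ) (g : (Fin n → W) → A) (v : Fin n → W) :
    altSum (fun w => c • g w) v = c • altSum g v := by
  unfold altSum
  simp_rw [Finset.smul_sum, smul_comm c]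

theorem altSum_zsmul {n : ℕ} (c : ℤ) (g : (Fin n → W) → A) (v : Fin n → W) :
    altSum (fun w => c • g w) v = c • altSum g v := by
  unfold altSum
  simp_rw [Finset.smul_sum, smul_comm c]

theorem altSum_smul [Module ℝ A] {n : ℕ} (c : ℝ) (g : (Fin n → W) → A) (v : Fin n → W) :
    altSum (fun w => c • g w) v = c • altSum g v := by
  unfold altSum
  simp_rw [Finset.smul_sum, smul_comm c]

theorem altSum_cast {n m : ℕ} (h : n = m) (g : (Fin n → W) → A) (v : Fin m → W) :
    altSum (fun w => g (fun i => w (Fin.cast h i))) v = altSum g (fun i => v (Fin.cast h i)) := by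
  subst h; rfl

/-- Alternating some of the arguments first multiplies the alternating sum by a constant. -/
theorem altSum_partial {n m : ℕ} (e : Equiv.Perm (Fin m) → Equiv.Perm (Fin n))
    (he : ∀ τ, Equiv.Perm.sign (e τ) = Equiv.Perm.sign τ) (g : (Fin n → W) → A) (v : Fin n → W) :
    altSum (fun w => ∑ τ : Equiv.Perm (Fin m),
      Equiv.Perm.sign τ • g (fun i => w (e τ i))) v = m.factorial • altSum g v := by
  rw [altSum_sum]
  -- Reindexing by `e τ` produces a sign that cancels the factor `sign τ`, so all m! summands
  -- coincide.
  have : ∀ τ : Equiv.Perm (Fin m), altSum (fun w => Equiv.Perm.sign τ •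
      g (fun i => w (e τ i))) v = altSum g v := by
    intro τ
    rw [altSum_units_smul, altSum_perm, he, smul_smul]
    simp
  simp [this, Fintype.card_perm]

/-- A permutation of the first `k` among `k + l` indices. -/
def permLeft (l : ℕ) {k : ℕ} (τ : Equiv.Perm (Fin k)) : Equiv.Perm (Fin (k + l)) :=
  finSumFinEquiv.permCongr (Equiv.Perm.sumCongr τ 1)

/-- A permutation of the last `l` among `k + l` indices. -/
def permRight (k : ℕ) {l : ℕ} (τ : Equiv.Perm (Fin l)) : Equiv.Perm (Fin (k + l)) :=
  finSumFinEquiv.permCongr (Equiv.Perm.sumCongr 1 τ)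

@[simp] theorem sign_permLeft {k l : ℕ} (τ : Equiv.Perm (Fin k)) :
    Equiv.Perm.sign (permLeft l τ) = Equiv.Perm.sign τ := by
  simp [permLeft]

@[simp] theorem sign_permRight {k l : ℕ} (τ : Equiv.Perm (Fin l)) :
    Equiv.Perm.sign (permRight k τ) = Equiv.Perm.sign τ := by
  simp [permRight]

@[simp] theorem permLeft_castAdd {k l : ℕ} (τ : Equiv.Perm (Fin k)) (i : Fin k) :
    permLeft l τ (Fin.castAdd l i) = Fin.castAdd l (τ i) := by
  simp [permLeft, Equiv.permCongr_apply]

@[simp] theorem permLeft_natAdd {k l : ℕ} (τ : Equiv.Perm (Fin k)) (i : Fin l) :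
    permLeft l τ (Fin.natAdd k i) = Fin.natAdd k i := by
  simp [permLeft, Equiv.permCongr_apply]

@[simp] theorem permRight_castAdd {k l : ℕ} (τ : Equiv.Perm (Fin l)) (i : Fin k) :
    permRight k τ (Fin.castAdd l i) = Fin.castAdd l i := by
  simp [permRight, Equiv.permCongr_apply]

@[simp] theorem permRight_natAdd {k l : ℕ} (τ : Equiv.Perm (Fin l)) (i : Fin l) :
    permRight k τ (Fin.natAdd k i) = Fin.natAdd k (τ i) := by
  simp [permRight, Equiv.permCongr_apply]

/-- A permutation of the last `n` among `n + 1` indices. -/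
def permSucc {n : ℕ} (τ : Equiv.Perm (Fin n)) : Equiv.Perm (Fin (n + 1)) :=
  Equiv.Perm.decomposeFin.symm (0, τ)

@[simp] theorem sign_permSucc {n : ℕ} (τ : Equiv.Perm (Fin n)) :
    Equiv.Perm.sign (permSucc τ) = Equiv.Perm.sign τ := by
  simp [permSucc]

@[simp] theorem permSucc_zero {n : ℕ} (τ : Equiv.Perm (Fin n)) : permSucc τ 0 = 0 := by
  simp [permSucc]

@[simp] theorem permSucc_succ {n : ℕ} (τ : Equiv.Perm (Fin n)) (i : Fin n) :
    permSucc τ i.succ = (τ i).succ := by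
  simp [permSucc]

end Alternation

/-! ### Associativity of the wedge, and its compatibility with antisymmetrization. -/

section WedgeAlgebra

variable {W : Type*} [NormedAddCommGroup W] [NormedSpace ℝ W]
  {A : Type*} [NormedCommRing A] [NormedAlgebra ℝ A]

theorem altSum_alternating {n : ℕ} (β : W [⋀^Fin n]→L[ℝ] A) (v : Fin n → W) :
    altSum (fun w => β w) v = (n.factorial : ℝ) • β v := by
  have h : ∀ σ : Equiv.Perm (Fin n), Equiv.Perm.sign σ • β (fun i => v (σ i)) = β v := by
    intro σ
    have := β.toAlternatingMap.map_perm v σ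
    change β (fun i => v (σ i)) = Equiv.Perm.sign σ • β v at this
    rw [this, smul_smul]; simp
  simp only [altSum, h, Finset.sum_const, Finset.card_univ, Fintype.card_perm, Fintype.card_fin]
  rw [← Nat.cast_smul_eq_nsmul ℝ]

theorem wedge_eq_altSum {k l : ℕ} (β : W [⋀^Fin k]→L[ℝ] A) (γ : W [⋀^Fin l]→L[ℝ] A)
    (v : Fin (k + l) → W) :
    wedge β γ v = ((k.factorial * l.factorial : ℝ)⁻¹) •
      altSum (fun w => β (fun i => w (Fin.castAdd l i)) * γ (fun i => w (Fin.natAdd k i))) v :=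
  wedge_apply β γ v

theorem altSum_wedge {k l : ℕ} (β : W [⋀^Fin k]→L[ℝ] A) (γ : W [⋀^Fin l]→L[ℝ] A)
    (v : Fin (k + l) → W) :
    altSum (fun w => β (fun i => w (Fin.castAdd l i)) * γ (fun i => w (Fin.natAdd k i))) v =
      (k.factorial * l.factorial : ℝ) • wedge β γ v := by
  rw [wedge_eq_altSum, smul_smul, mul_inv_cancel₀, one_smul]
  positivity

/-- Both bracketings equal (k! l! m!)⁻¹ times the alternating sum of the triple product: the inner
wedge alternates only some of the slots, and `altSum_partial` absorbs it into the outer sum at the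
cost of a factorial that cancels a normalizing constant. -/
theorem wedge_assoc {k l m : ℕ} (β : W [⋀^Fin k]→L[ℝ] A) (γ : W [⋀^Fin l]→L[ℝ] A)
    (δ : W [⋀^Fin m]→L[ℝ] A) (v : Fin (k + l + m) → W) :
    wedge (wedge β γ) δ v =
      wedge β (wedge γ δ) (fun i => v (Fin.cast (Nat.add_assoc k l m).symm i)) := by
  have h1 : wedge (wedge β γ) δ v = ((k.factorial * l.factorial * m.factorial : ℝ)⁻¹) •
      altSum (fun w => β (fun i => w (Fin.castAdd m (Fin.castAdd l i))) *
        γ (fun i => w (Fin.castAdd m (Fin.natAdd k i))) * δ (fun i => w (Fin.natAdd (k + l) i))) v := by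
    rw [wedge_eq_altSum]
    have := altSum_partial (permLeft m) (fun τ => sign_permLeft τ)
      (fun w : Fin (k + l + m) → W => β (fun i => w (Fin.castAdd m (Fin.castAdd l i))) *
        γ (fun i => w (Fin.castAdd m (Fin.natAdd k i))) * δ (fun i => w (Fin.natAdd (k + l) i))) v
    simp only [permLeft_castAdd, permLeft_natAdd] at this
    simp only [wedge_apply, smul_mul_assoc, altSum_smul, Finset.sum_mul]
    rw [this, ← Nat.cast_smul_eq_nsmul ℝ, smul_smul, smul_smul]
    congr 1
    field_simp
  have h2 : ∀ v' : Fin (k + (l + m)) → W, wedge β (wedge γ δ) v' =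
      ((k.factorial * l.factorial * m.factorial : ℝ)⁻¹) •
      altSum (fun w => β (fun i => w (Fin.castAdd (l + m) i)) *
        (γ (fun i => w (Fin.natAdd k (Fin.castAdd m i))) *
          δ (fun i => w (Fin.natAdd k (Fin.natAdd l i))))) v' := by
    intro v'
    rw [wedge_eq_altSum]
    have := altSum_partial (permRight k) (fun τ => sign_permRight τ)
      (fun w : Fin (k + (l + m)) → W => β (fun i => w (Fin.castAdd (l + m) i)) *
        (γ (fun i => w (Fin.natAdd k (Fin.castAdd m i))) *
          δ (fun i => w (Fin.natAdd k (Fin.natAdd l i))))) v'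
    simp only [permRight_castAdd, permRight_natAdd] at this
    simp only [wedge_apply, mul_smul_comm, altSum_smul, Finset.mul_sum]
    rw [this, ← Nat.cast_smul_eq_nsmul ℝ, smul_smul, smul_smul]
    congr 1
    field_simp
  rw [h1, h2, ← altSum_cast]
  congr 2
  funext w
  rw [mul_assoc]
  congr 1
  congr 1
  · congr 1; funext i; congr 1; ext; simp [Nat.add_assoc]

/-- `alternatizeUncurryFin` is a signed sum over the position of the distinguished argument. After
alternation each position can be moved to the front by `cycleRange`, whose sign cancels the one in
the sum, so the n + 1 terms agree; comparison with (n + 1)! leaves n!. -/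
theorem altSum_uncurry {n : ℕ} (B : W →L[ℝ] W [⋀^Fin n]→L[ℝ] A) (v : Fin (n + 1) → W) :
    altSum (fun w => B (w 0) (fun i => w i.succ)) v =
      (n.factorial : ℝ) • ContinuousAlternatingMap.alternatizeUncurryFin B v := by
  have h := altSum_alternating (ContinuousAlternatingMap.alternatizeUncurryFin B) v
  have h2 : altSum (fun w => ContinuousAlternatingMap.alternatizeUncurryFin B w) v =
      ((n : ℝ) + 1) • altSum (fun w => B (w 0) (fun i => w i.succ)) v := by
    simp only [ContinuousAlternatingMap.alternatizeUncurryFin_apply]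
    rw [altSum_sum]
    have : ∀ i : Fin (n + 1), altSum (fun w => (-1 : ℤ) ^ (i : ℕ) • B (w i) (i.removeNth w)) v =
        altSum (fun w => B (w 0) (fun i => w i.succ)) v := by
      intro i
      rw [altSum_zsmul]
      have := altSum_perm (fun w => B (w 0) (fun i => w i.succ)) i.cycleRange.symm v
      simp only [Fin.cycleRange_symm_zero, Fin.cycleRange_symm_succ, Equiv.Perm.sign_symm,
        Fin.sign_cycleRange] at this
      change altSum (fun w => B (w i) (i.removeNth w)) v = _ at this
      rw [this, Units.smul_def, smul_smul]
      simp [← pow_add, ← two_mul]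
    simp only [this, Finset.sum_const, Finset.card_univ, Fintype.card_fin]
    rw [← Nat.cast_smul_eq_nsmul ℝ]; simp
  rw [h2, Nat.factorial_succ, Nat.cast_mul, mul_smul] at h
  have h3 := smul_right_injective A (show ((n : ℝ) + 1) ≠ 0 by positivity)
  apply h3
  simpa using h

/-- `(β ∧ ·)` and `(· ∧ γ)` are compatible with the antisymmetrization of a form-valued linear
map. -/
theorem wedge_alternatizeUncurryFin_left {k l : ℕ} (B : W →L[ℝ] W [⋀^Fin k]→L[ℝ] A)
    (γ : W [⋀^Fin l]→L[ℝ] A) (B' : W →L[ℝ] W [⋀^Fin (k + l)]→L[ℝ] A)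
    (hB : ∀ x, B' x = wedge (B x) γ) (v : Fin (k + 1 + l) → W) :
    wedge (ContinuousAlternatingMap.alternatizeUncurryFin B) γ v =
      ContinuousAlternatingMap.alternatizeUncurryFin B'
        (fun i => v (Fin.cast (by omega) i)) := by
  -- Up to factorials, both sides are the alternating sum of the same product B(w₀)(w₁, …) γ(…);
  -- `h1` and `h2` record the two normalizations.
  have h1 : ∀ v : Fin (k + 1 + l) → W,
      ((k + 1).factorial * l.factorial * k.factorial : ℝ) •
        wedge (ContinuousAlternatingMap.alternatizeUncurryFin B) γ v =
      ((k + 1).factorial : ℝ) • altSum (fun w => B (w (Fin.castAdd l 0))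
        (fun i => w (Fin.castAdd l i.succ)) * γ (fun i => w (Fin.natAdd (k + 1) i))) v := by
    intro v
    rw [mul_comm, mul_smul, ← altSum_wedge, ← altSum_smul]
    have := altSum_partial (permLeft l) (fun τ => sign_permLeft τ)
      (fun w : Fin (k + 1 + l) → W => B (w (Fin.castAdd l 0))
        (fun i => w (Fin.castAdd l i.succ)) * γ (fun i => w (Fin.natAdd (k + 1) i))) v
    simp only [permLeft_castAdd, permLeft_natAdd] at this
    rw [← Nat.cast_smul_eq_nsmul ℝ] at this
    rw [← this]
    congr 1
    funext w
    rw [← smul_mul_assoc, ← altSum_uncurry, altSum, Finset.sum_mul]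
    simp only [smul_mul_assoc]
  have h2 : ∀ v : Fin (k + l + 1) → W,
      (((k + l).factorial * (k.factorial * l.factorial) : ℝ)) •
        ContinuousAlternatingMap.alternatizeUncurryFin B' v =
      ((k + l).factorial : ℝ) • altSum (fun w => B (w 0) (fun i => w (Fin.castAdd l i).succ) *
        γ (fun i => w (Fin.natAdd k i).succ)) v := by
    intro v
    rw [mul_comm, mul_smul, ← altSum_uncurry, ← altSum_smul]
    have := altSum_partial permSucc (fun τ => sign_permSucc τ)
      (fun w : Fin (k + l + 1) → W => B (w 0) (fun i => w (Fin.castAdd l i).succ) *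
        γ (fun i => w (Fin.natAdd k i).succ)) v
    simp only [permSucc_zero, permSucc_succ] at this
    rw [← Nat.cast_smul_eq_nsmul ℝ] at this
    rw [← this]
    congr 1
    funext w
    rw [hB, ← altSum_wedge, altSum]
  have h1' := h1 v
  have h2' := h2 (fun i => v (Fin.cast (by omega) i))
  rw [mul_assoc, mul_smul] at h1'
  rw [mul_smul] at h2'
  have e1 := smul_right_injective A (show ((k + 1).factorial : ℝ) ≠ 0 by positivity) h1'
  have e2 := smul_right_injective A (show ((k + l).factorial : ℝ) ≠ 0 by positivity) h2'
  rw [← altSum_cast] at e2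
  have e3 : (l.factorial * k.factorial : ℝ) • wedge (ContinuousAlternatingMap.alternatizeUncurryFin B) γ v =
    (l.factorial * k.factorial : ℝ) • ContinuousAlternatingMap.alternatizeUncurryFin B' (fun i => v (Fin.cast (by omega) i)) := by
    rw [e1, mul_comm (l.factorial : ℝ), e2]
    congr 1
    funext w
    congr 1
    · congr 1; funext i; congr 1; ext; simp; omega
  exact smul_right_injective A (show (l.factorial * k.factorial : ℝ) ≠ 0 by positivity) e3

/-- The distinguished argument of `C` has to travel past the k arguments of β, which costs (-1)^k.
Together with the version for the first factor this is the Leibniz rule for `d`. -/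
theorem wedge_alternatizeUncurryFin_right {k l : ℕ} (β : W [⋀^Fin k]→L[ℝ] A)
    (C : W →L[ℝ] W [⋀^Fin l]→L[ℝ] A) (C' : W →L[ℝ] W [⋀^Fin (k + l)]→L[ℝ] A)
    (hC : ∀ x, C' x = wedge β (C x)) (v : Fin (k + (l + 1)) → W) :
    ContinuousAlternatingMap.alternatizeUncurryFin C' v = (-1 : ℤ) ^ k •
      wedge β (ContinuousAlternatingMap.alternatizeUncurryFin C) v := by
  have h1 : ((l + 1).factorial * (k.factorial * l.factorial) : ℝ) •
        wedge β (ContinuousAlternatingMap.alternatizeUncurryFin C) v =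
      ((l + 1).factorial : ℝ) • altSum (fun w => β (fun i => w (Fin.castAdd (l + 1) i)) *
        C (w (Fin.natAdd k 0)) (fun i => w (Fin.natAdd k i.succ))) v := by
    rw [show ((l + 1).factorial * (k.factorial * l.factorial) : ℝ) =
      l.factorial * (k.factorial * (l + 1).factorial) by ring, mul_smul, ← altSum_wedge,
      ← altSum_smul]
    have := altSum_partial (permRight k) (fun τ => sign_permRight τ)
      (fun w : Fin (k + (l + 1)) → W => β (fun i => w (Fin.castAdd (l + 1) i)) *
        C (w (Fin.natAdd k 0)) (fun i => w (Fin.natAdd k i.succ))) v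
    simp only [permRight_castAdd, permRight_natAdd] at this
    rw [← Nat.cast_smul_eq_nsmul ℝ] at this
    rw [← this]
    congr 1
    funext w
    rw [← mul_smul_comm, ← altSum_uncurry, altSum, Finset.mul_sum]
    simp only [mul_smul_comm]
  have h2 : (((k + l).factorial * (k.factorial * l.factorial) : ℝ)) •
        ContinuousAlternatingMap.alternatizeUncurryFin C' v =
      ((k + l).factorial : ℝ) • altSum (n := k + l + 1)
        (fun w => β (fun i => w (Fin.castAdd l i).succ) *
          C (w 0) (fun i => w (Fin.natAdd k i).succ)) v := by
    rw [mul_comm, mul_smul, ← altSum_uncurry, ← altSum_smul]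
    have := altSum_partial permSucc (fun τ => sign_permSucc τ)
      (fun w : Fin (k + l + 1) → W => β (fun i => w (Fin.castAdd l i).succ) *
          C (w 0) (fun i => w (Fin.natAdd k i).succ)) v
    simp only [permSucc_zero, permSucc_succ] at this
    rw [← Nat.cast_smul_eq_nsmul ℝ] at this
    rw [← this]
    congr 1
    funext w
    rw [hC, ← altSum_wedge, altSum]
  rw [mul_smul] at h1 h2
  have e1 := smul_right_injective A (show ((l + 1).factorial : ℝ) ≠ 0 by positivity) h1
  have e2 := smul_right_injective A (show ((k + l).factorial : ℝ) ≠ 0 by positivity) h2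
  -- The slot of the distinguished argument when the k arguments of β come first; `p.cycleRange` has
  -- sign (-1)^k.
  let p : Fin (k + l + 1) := ⟨k, by omega⟩
  have e3 := altSum_perm (n := k + l + 1) (fun w => β (fun i => w (Fin.castAdd l i).succ) *
          C (w 0) (fun i => w (Fin.natAdd k i).succ)) p.cycleRange.symm v
  simp only [Fin.cycleRange_symm_zero, Fin.cycleRange_symm_succ, Equiv.Perm.sign_symm,
        Fin.sign_cycleRange] at e3
  have e4 : (fun w : Fin (k + l + 1) → W => β (fun i => w (p.succAbove (Fin.castAdd l i))) *
      C (w p) (fun i => w (p.succAbove (Fin.natAdd k i)))) =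
      (fun w : Fin (k + (l + 1)) → W => β (fun i => w (Fin.castAdd (l + 1) i)) *
        C (w (Fin.natAdd k 0)) (fun i => w (Fin.natAdd k i.succ))) := by
    funext w
    have a1 : ∀ i : Fin k, p.succAbove (Fin.castAdd l i) = Fin.castAdd (l + 1) i := by
      intro i
      rw [Fin.succAbove_of_castSucc_lt]
      · rfl
      · simp [Fin.lt_def, p]
    have a2 : ∀ i : Fin l, p.succAbove (Fin.natAdd k i) = Fin.natAdd k i.succ := by
      intro i
      rw [Fin.succAbove_of_le_castSucc]
      · rfl
      · simp [Fin.le_def, p]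
    simp only [a1, a2]
    rfl
  rw [e4] at e3
  have e6 : (k.factorial * l.factorial : ℝ) • ((-1 : ℤ) ^ k •
      wedge β (ContinuousAlternatingMap.alternatizeUncurryFin C) v) =
      (k.factorial * l.factorial : ℝ) • ContinuousAlternatingMap.alternatizeUncurryFin C' v := by
    rw [smul_comm, e1, e2]
    simp only [Units.smul_def] at e3
    rw [e3, smul_smul]
    simp [p, ← pow_add, ← two_mul]
  exact (smul_right_injective A (show (k.factorial * l.factorial : ℝ) ≠ 0 by positivity) e6).symm

end WedgeAlgebra

end EDS

namespace EDS

/-! ### Bilinearity, smoothness and the Leibniz rule for the wedge. -/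

section WedgeCalculus

variable {W : Type*} [NormedAddCommGroup W] [NormedSpace ℝ W]
  {A : Type*} [NormedCommRing A] [NormedAlgebra ℝ A]

theorem wedge_add_left {k l : ℕ} (β β' : W [⋀^Fin k]→L[ℝ] A) (γ : W [⋀^Fin l]→L[ℝ] A) :
    wedge (β + β') γ = wedge β γ + wedge β' γ := by
  ext v
  simp [wedge_apply, add_mul, Finset.sum_add_distrib, smul_add]

theorem wedge_add_right {k l : ℕ} (β : W [⋀^Fin k]→L[ℝ] A) (γ γ' : W [⋀^Fin l]→L[ℝ] A) :
    wedge β (γ + γ') = wedge β γ + wedge β γ' := by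
  ext v
  simp [wedge_apply, mul_add, Finset.sum_add_distrib, smul_add]

theorem wedge_smul_left {k l : ℕ} (c : ℝ) (β : W [⋀^Fin k]→L[ℝ] A) (γ : W [⋀^Fin l]→L[ℝ] A) :
    wedge (c • β) γ = c • wedge β γ := by
  ext v
  simp only [wedge_apply, ContinuousAlternatingMap.smul_apply, smul_mul_assoc]
  rw [smul_comm]
  simp_rw [Finset.smul_sum, smul_comm c]

theorem wedge_smul_right {k l : ℕ} (c : ℝ) (β : W [⋀^Fin k]→L[ℝ] A) (γ : W [⋀^Fin l]→L[ℝ] A) :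
    wedge β (c • γ) = c • wedge β γ := by
  ext v
  simp only [wedge_apply, ContinuousAlternatingMap.smul_apply, mul_smul_comm]
  rw [smul_comm]
  simp_rw [Finset.smul_sum, smul_comm c]

theorem wedge_csmul_left {k l : ℕ} (c : ℂ) (β : W [⋀^Fin k]→L[ℝ] ℂ) (γ : W [⋀^Fin l]→L[ℝ] ℂ) :
    wedge (c • β) γ = c • wedge β γ := by
  ext v
  simp only [wedge_apply, ContinuousAlternatingMap.smul_apply, smul_mul_assoc]
  rw [smul_comm]
  simp_rw [Finset.smul_sum, smul_comm c]

theorem wedge_csmul_right {k l : ℕ} (c : ℂ) (β : W [⋀^Fin k]→L[ℝ] ℂ) (γ : W [⋀^Fin l]→L[ℝ] ℂ) :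
    wedge β (c • γ) = c • wedge β γ := by
  ext v
  simp only [wedge_apply, ContinuousAlternatingMap.smul_apply, mul_smul_comm]
  rw [smul_comm]
  simp_rw [Finset.smul_sum, smul_comm c]

@[simp] theorem wedge_zero_left {k l : ℕ} (γ : W [⋀^Fin l]→L[ℝ] A) :
    wedge (0 : W [⋀^Fin k]→L[ℝ] A) γ = 0 := by
  ext v; simp [wedge_apply]

@[simp] theorem wedge_zero_right {k l : ℕ} (β : W [⋀^Fin k]→L[ℝ] A) :
    wedge β (0 : W [⋀^Fin l]→L[ℝ] A) = 0 := by
  ext v; simp [wedge_apply]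

theorem wedge_sum_left {k l : ℕ} {ι : Type*} (s : Finset ι) (β : ι → W [⋀^Fin k]→L[ℝ] A)
    (γ : W [⋀^Fin l]→L[ℝ] A) : wedge (∑ i ∈ s, β i) γ = ∑ i ∈ s, wedge (β i) γ := by
  classical
  induction s using Finset.induction_on with
  | empty => simp
  | insert a s ha ih => rw [Finset.sum_insert ha, Finset.sum_insert ha, wedge_add_left, ih]

theorem wedge_sum_right {k l : ℕ} {ι : Type*} (s : Finset ι) (β : W [⋀^Fin k]→L[ℝ] A)
    (γ : ι → W [⋀^Fin l]→L[ℝ] A) : wedge β (∑ i ∈ s, γ i) = ∑ i ∈ s, wedge β (γ i) := by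
  classical
  induction s using Finset.induction_on with
  | empty => simp
  | insert a s ha ih => rw [Finset.sum_insert ha, Finset.sum_insert ha, wedge_add_right, ih]

theorem norm_wedge_apply_le {k l : ℕ} (β : W [⋀^Fin k]→L[ℝ] A) (γ : W [⋀^Fin l]→L[ℝ] A)
    (v : Fin (k + l) → W) : ‖wedge β γ v‖ ≤
      ((k.factorial * l.factorial : ℝ)⁻¹ * (k + l).factorial) * ‖β‖ * ‖γ‖ * ∏ i, ‖v i‖ := by
  rw [wedge_apply, norm_smul, Real.norm_of_nonneg (by positivity)]
  have : ∀ σ : Equiv.Perm (Fin (k + l)), ‖Equiv.Perm.sign σ •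
        (β (fun i => v (σ (Fin.castAdd l i))) * γ (fun i => v (σ (Fin.natAdd k i))))‖ ≤
        ‖β‖ * ‖γ‖ * ∏ i, ‖v i‖ := by
    intro σ
    have hs : ∀ (u : ℤˣ) (a : A), ‖u • a‖ = ‖a‖ := by
      intro u a
      rcases Int.units_eq_one_or u with h | h <;> simp [h, Units.smul_def]
    rw [hs, ← Equiv.prod_comp σ, Fin.prod_univ_add]
    calc _ ≤ ‖β (fun i => v (σ (Fin.castAdd l i)))‖ * ‖γ (fun i => v (σ (Fin.natAdd k i)))‖ :=
          norm_mul_le _ _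
      _ ≤ (‖β‖ * ∏ i, ‖v (σ (Fin.castAdd l i))‖) * (‖γ‖ * ∏ i, ‖v (σ (Fin.natAdd k i))‖) := by
          gcongr
          · exact β.le_opNorm _
          · exact γ.le_opNorm _
      _ = _ := by ring
  calc _ ≤ (k.factorial * l.factorial : ℝ)⁻¹ * ∑ _σ : Equiv.Perm (Fin (k + l)),
        ‖β‖ * ‖γ‖ * ∏ i, ‖v i‖ := by
        gcongr
        exact norm_sum_le_of_le _ fun σ _ => this σ
    _ = _ := by
        simp [Fintype.card_perm]; ring

variable (W A) in
/-- The exterior product as a continuous bilinear map. -/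
noncomputable def wedgeL (k l : ℕ) :
    (W [⋀^Fin k]→L[ℝ] A) →L[ℝ] (W [⋀^Fin l]→L[ℝ] A) →L[ℝ] (W [⋀^Fin (k + l)]→L[ℝ] A) :=
  LinearMap.mkContinuous₂
    (LinearMap.mk₂ ℝ wedge wedge_add_left wedge_smul_left wedge_add_right wedge_smul_right)
    ((k.factorial * l.factorial : ℝ)⁻¹ * (k + l).factorial) (fun β γ =>
      ContinuousAlternatingMap.opNorm_le_bound _ (by positivity) (norm_wedge_apply_le β γ))

@[simp] theorem wedgeL_apply {k l : ℕ} (β : W [⋀^Fin k]→L[ℝ] A) (γ : W [⋀^Fin l]→L[ℝ] A) :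
    wedgeL W A k l β γ = wedge β γ := rfl

/-- `extDeriv` antisymmetrizes the derivative. The derivative of a continuous bilinear map has two
terms, and the lemmas on `alternatizeUncurryFin` turn each of them into a wedge with an exterior
derivative. -/
theorem extDeriv_wedge {k l : ℕ} {β : W → W [⋀^Fin k]→L[ℝ] A} {γ : W → W [⋀^Fin l]→L[ℝ] A}
    {z : W} (hβ : DifferentiableAt ℝ β z) (hγ : DifferentiableAt ℝ γ z)
    (v : Fin (k + l + 1) → W) :
    extDeriv (fun z => wedge (β z) (γ z)) z v =
      wedge (extDeriv β z) (γ z) (fun i => v (Fin.cast (by omega) i)) +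
        (-1 : ℤ) ^ k • wedge (β z) (extDeriv γ z) v := by
  have h := ((wedgeL W A k l).hasFDerivAt_of_bilinear hβ.hasFDerivAt hγ.hasFDerivAt).fderiv
  simp only [wedgeL_apply] at h
  rw [extDeriv, h, ContinuousAlternatingMap.alternatizeUncurryFin_add,
    ContinuousAlternatingMap.add_apply, add_comm]
  congr 1
  · rw [extDeriv, wedge_alternatizeUncurryFin_left (B' := ((wedgeL W A k l).precompL W
      (fderiv ℝ β z) (γ z)))]
    · rfl
    · intro x; simp
  · rw [extDeriv, ← wedge_alternatizeUncurryFin_right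
      (C' := (((wedgeL W A k l).precompR W (β z) (fderiv ℝ γ z))))]
    intro x; simp

theorem _root_.IsBoundedBilinearMap.contDiffOn_comp {V P Q R : Type*} [NormedAddCommGroup V] [NormedSpace ℝ V]
    [NormedAddCommGroup P] [NormedSpace ℝ P] [NormedAddCommGroup Q] [NormedSpace ℝ Q]
    [NormedAddCommGroup R] [NormedSpace ℝ R] {f : P × Q → R} (hf : IsBoundedBilinearMap ℝ f)
    {b : V → P} {c : V → Q} {X : Set V} {n : WithTop ℕ∞} (hb : ContDiffOn ℝ n b X)
    (hc : ContDiffOn ℝ n c X) : ContDiffOn ℝ n (fun z => f (b z, c z)) X :=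
  hf.contDiff.comp_contDiffOn (hb.prodMk hc)

theorem isBoundedBilinearMap_wedge {k l : ℕ} : IsBoundedBilinearMap ℝ (fun p : (W [⋀^Fin k]→L[ℝ] A) × (W [⋀^Fin l]→L[ℝ] A) => wedge p.1 p.2) := (wedgeL W A k l).isBoundedBilinearMap

theorem contDiffOn_wedge {k l : ℕ} {V : Type*} [NormedAddCommGroup V] [NormedSpace ℝ V]
    {β : V → W [⋀^Fin k]→L[ℝ] A} {γ : V → W [⋀^Fin l]→L[ℝ] A}
    {X : Set V} {n : WithTop ℕ∞} (hβ : ContDiffOn ℝ n β X) (hγ : ContDiffOn ℝ n γ X) :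
    ContDiffOn ℝ n (fun z => wedge (β z) (γ z)) X := by
  have h := isBoundedBilinearMap_wedge (W := W) (A := A) (k := k) (l := l)
  exact h.contDiffOn_comp hβ hγ

set_option synthInstance.maxHeartbeats 200000 in
theorem contDiffOn_extDeriv {k : ℕ} {F : Type*} [NormedAddCommGroup F] [NormedSpace ℝ F]
    {β : W → W [⋀^Fin k]→L[ℝ] F} {X : Set W} (hX : IsOpen X)
    (hβ : ContDiffOn ℝ ∞ β X) : ContDiffOn ℝ ∞ (fun z => extDeriv β z) X := by
  have h : ContDiffOn ℝ ∞ (fderiv ℝ β) X := hβ.fderiv_of_isOpen hX (by simp)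
  exact (ContinuousLinearMap.contDiff (E := W →L[ℝ] W [⋀^Fin k]→L[ℝ] F)
    (F := W [⋀^Fin (k + 1)]→L[ℝ] F)
    (ContinuousAlternatingMap.alternatizeUncurryFinCLM (n := k) ℝ W F)).comp_contDiffOn h

theorem extDeriv_comp_clm {k : ℕ} {F G : Type*} [NormedAddCommGroup F] [NormedSpace ℝ F]
    [NormedAddCommGroup G] [NormedSpace ℝ G] (L : F →L[ℝ] G)
    {β : W → W [⋀^Fin k]→L[ℝ] F} {z : W} (hβ : DifferentiableAt ℝ β z) :
    extDeriv (fun z => L.compContinuousAlternatingMap (β z)) z =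
      L.compContinuousAlternatingMap (extDeriv β z) := by
  have h : HasFDerivAt (fun z => L.compContinuousAlternatingMap (β z))
      ((ContinuousLinearMap.compContinuousAlternatingMapCLM ℝ W F G (Fin k) L).comp (fderiv ℝ β z)) z :=
    (ContinuousLinearMap.compContinuousAlternatingMapCLM ℝ W F G
      (Fin k) L).hasFDerivAt.comp z hβ.hasFDerivAt
  ext v
  rw [extDeriv, h.fderiv]
  simp [extDeriv, ContinuousAlternatingMap.alternatizeUncurryFin_apply]

theorem contDiffOn_comp_clm {k : ℕ} {V F G : Type*} [NormedAddCommGroup F] [NormedSpace ℝ F]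
    [NormedAddCommGroup V] [NormedSpace ℝ V]
    [NormedAddCommGroup G] [NormedSpace ℝ G] (L : F →L[ℝ] G)
    {β : V → W [⋀^Fin k]→L[ℝ] F} {X : Set V} {n : WithTop ℕ∞} (hβ : ContDiffOn ℝ n β X) :
    ContDiffOn ℝ n (fun z => L.compContinuousAlternatingMap (β z)) X :=
  (ContinuousLinearMap.compContinuousAlternatingMapCLM ℝ W F G (Fin k) L).contDiff.comp_contDiffOn hβ

/-! ### Evaluation in low degrees -/

theorem wedge_constOfIsEmpty {l : ℕ} (a : A) (γ : W [⋀^Fin l]→L[ℝ] A) (v : Fin (0 + l) → W) :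
    wedge (ContinuousAlternatingMap.constOfIsEmpty ℝ W (Fin 0) a) γ v =
      a * γ (fun i => v (Fin.cast (by omega) i)) := by
  have h := altSum_alternating (a • γ) (fun i => v (Fin.cast (by omega) i))
  rw [wedge_eq_altSum]
  have h2 : altSum (fun w : Fin (0 + l) → W =>
      ContinuousAlternatingMap.constOfIsEmpty ℝ W (Fin 0) a (fun i => w (Fin.castAdd l i)) *
        γ (fun i => w (Fin.natAdd 0 i))) v = (l.factorial : ℝ) • (a * γ (fun i => v (Fin.cast (by omega) i))) := by
    rw [← altSum_cast] at h
    refine Eq.trans ?_ h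
    congr 1
    funext w
    simp only [ContinuousAlternatingMap.constOfIsEmpty_apply, ContinuousAlternatingMap.smul_apply, smul_eq_mul]
    congr 2
    funext i; congr 1; ext; simp
  rw [h2, smul_smul]
  simp [Nat.factorial_ne_zero]

/-- A 1-form is the antisymmetrization of a map into 0-forms, so `wedge_alternatizeUncurryFin_left`
with `k = 0` yields the expansion along the first factor. It replaces a sum over (l + 1)!
permutations by one over l + 1 positions. -/
theorem wedge_one_left {l : ℕ} (β : W [⋀^Fin 1]→L[ℝ] A) (γ : W [⋀^Fin l]→L[ℝ] A)
    (v : Fin (l + 1) → W) :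
    wedge β γ (fun i => v (Fin.cast (by omega) i)) =
      ∑ i : Fin (l + 1), (-1 : ℤ) ^ (i : ℕ) • (β ![v i] * γ (i.removeNth v)) := by
  let β' : W →L[ℝ] A := (ContinuousAlternatingMap.ofSubsingleton ℝ W A (0 : Fin 1)).symm β
  have hβ' : ∀ x, β' x = β ![x] := by
    intro x
    simp only [β', ContinuousAlternatingMap.ofSubsingleton_symm_apply_apply]
    congr 1
    funext i; fin_cases i; rfl
  have hβ : β = ContinuousAlternatingMap.alternatizeUncurryFin
      ((ContinuousAlternatingMap.constOfIsEmptyLIE ℝ W A (Fin 0) : A →L[ℝ] _) ∘L β') := by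
    rw [ContinuousAlternatingMap.alternatizeUncurryFin_constOfIsEmptyLIE_comp]
    simp [β']
  conv_lhs => rw [hβ]
  rw [wedge_alternatizeUncurryFin_left (B' := ((wedgeL W A 0 l).flip γ) ∘L
    ((ContinuousAlternatingMap.constOfIsEmptyLIE ℝ W A (Fin 0) : A →L[ℝ] _) ∘L β'))]
  · rw [ContinuousAlternatingMap.alternatizeUncurryFin_apply]
    refine Fintype.sum_equiv (finCongr (by omega)) _ _ fun i => ?_
    simp only [ContinuousLinearMap.comp_apply, ContinuousLinearMap.flip_apply, wedgeL_apply]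
    congr 1
    erw [wedge_constOfIsEmpty]
    simp only [hβ']
    congr 1
    congr 1
    funext j
    simp only [Fin.removeNth_apply]
    congr 1
    ext
    simp [Fin.succAbove, Fin.lt_def]
    split_ifs <;> rfl
  · intro x; rfl

/-- A 2-form is half the antisymmetrization of its currying, because each unordered pair of
positions occurs twice; `wedge_one_left` then applies. The explicit formulas with a 2-form as first
factor rest on this. -/
theorem wedge_two_left {l : ℕ} (f : W [⋀^Fin 2]→L[ℝ] A) (γ : W [⋀^Fin l]→L[ℝ] A)
    (v : Fin (l + 2) → W) :
    wedge f γ (fun i => v (Fin.cast (by omega) i)) = (2⁻¹ : ℝ) •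
      ∑ i : Fin (l + 2), ∑ j : Fin (l + 1), (-1 : ℤ) ^ (i + j : ℕ) •
        (f ![v i, i.removeNth v j] * γ (j.removeNth (i.removeNth v))) := by
  have hf : f = (2⁻¹ : ℝ) • ContinuousAlternatingMap.alternatizeUncurryFin f.curryLeft := by
    rw [ContinuousAlternatingMap.alternatizeUncurryFin_curryLeft]
    ext v
    simp only [ContinuousAlternatingMap.smul_apply]
    rw [← Nat.cast_smul_eq_nsmul ℝ, smul_smul]
    norm_num
  conv_lhs => rw [hf, wedge_smul_left, ContinuousAlternatingMap.smul_apply]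
  congr 1
  rw [wedge_alternatizeUncurryFin_left (B' := ((wedgeL W A 1 l).flip γ) ∘L f.curryLeft)]
  · rw [ContinuousAlternatingMap.alternatizeUncurryFin_apply]
    refine Fintype.sum_equiv (finCongr (by omega)) _ _ fun i => ?_
    simp only [ContinuousLinearMap.comp_apply, ContinuousLinearMap.flip_apply, wedgeL_apply]
    have h := wedge_one_left (f.curryLeft (v ((finCongr (by omega)) i))) γ
      (((finCongr (by omega) : Fin (1 + l + 1) ≃ Fin (l + 1 + 1)) i).removeNth v)
    have e : (fun j : Fin (1 + l) => ((finCongr (by omega) : Fin (1 + l + 1) ≃ Fin (l + 1 + 1)) i).removeNth v (Fin.cast (by omega) j)) =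
      (i.removeNth fun i => v (Fin.cast (by omega) (Fin.cast (by omega : 1 + l + 1 = 1 + 1 + l) i))) := by
      funext j
      simp only [Fin.removeNth_apply]
      congr 1
      ext
      simp [Fin.succAbove, Fin.lt_def]
      split_ifs <;> rfl
    rw [e] at h
    erw [h]
    rw [Finset.smul_sum]
    refine Finset.sum_congr rfl fun j _ => ?_
    rw [smul_smul, ← pow_add]
    rfl
  · intro x; rfl

theorem map_vec2_swap (f : W [⋀^Fin 2]→L[ℝ] A) (x y : W) : f ![y, x] = -f ![x, y] := by
  have := f.toAlternatingMap.map_swap ![x, y] (show (0 : Fin 2) ≠ 1 by decide)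
  change f (![x, y] ∘ Equiv.swap 0 1) = -f ![x, y] at this
  rw [← this]
  congr 1
  funext i
  fin_cases i <;> rfl

theorem map_vec2_self (f : W [⋀^Fin 2]→L[ℝ] A) (x : W) : f ![x, x] = 0 :=
  f.map_eq_zero_of_eq _ (i := 0) (j := 1) rfl (by decide)

theorem wedge11 (β γ : W [⋀^Fin 1]→L[ℝ] A) (x y : W) :
    wedge β γ ![x, y] = β ![x] * γ ![y] - β ![y] * γ ![x] := by
  have h := wedge_one_left β γ ![x, y]
  have e : (fun i => ![x, y] (Fin.cast (by omega) i)) = ![x, y] := by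
    funext i; rfl
  rw [e] at h
  have r0 : Fin.removeNth (0 : Fin 2) ![x, y] = ![y] := by funext i; fin_cases i; rfl
  have r1 : Fin.removeNth (1 : Fin 2) ![x, y] = ![x] := by funext i; fin_cases i; rfl
  rw [h, Fin.sum_univ_two, r0, r1]
  simp [sub_eq_add_neg]

theorem wedge12 (β : W [⋀^Fin 1]→L[ℝ] A) (γ : W [⋀^Fin 2]→L[ℝ] A) (x y z : W) :
    wedge β γ ![x, y, z] = β ![x] * γ ![y, z] - β ![y] * γ ![x, z] + β ![z] * γ ![x, y] := by
  have h := wedge_one_left β γ ![x, y, z]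
  have e : (fun i => ![x, y, z] (Fin.cast (by omega) i)) = ![x, y, z] := by
    funext i; rfl
  rw [e] at h
  have r0 : Fin.removeNth (0 : Fin 3) ![x, y, z] = ![y, z] := by funext i; fin_cases i <;> rfl
  have r1 : Fin.removeNth (1 : Fin 3) ![x, y, z] = ![x, z] := by funext i; fin_cases i <;> rfl
  have r2 : Fin.removeNth (2 : Fin 3) ![x, y, z] = ![x, y] := by funext i; fin_cases i <;> rfl
  rw [h, Fin.sum_univ_three, r0, r1, r2]
  simp [sub_eq_add_neg]

theorem wedge13 (β : W [⋀^Fin 1]→L[ℝ] A) (γ : W [⋀^Fin 3]→L[ℝ] A) (x y z w : W) :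
    wedge β γ ![x, y, z, w] = β ![x] * γ ![y, z, w] - β ![y] * γ ![x, z, w] +
      β ![z] * γ ![x, y, w] - β ![w] * γ ![x, y, z] := by
  have h := wedge_one_left β γ ![x, y, z, w]
  have e : (fun i => ![x, y, z, w] (Fin.cast (by omega) i)) = ![x, y, z, w] := by
    funext i; rfl
  rw [e] at h
  have r0 : Fin.removeNth (0 : Fin 4) ![x, y, z, w] = ![y, z, w] := by
    funext i; fin_cases i <;> rfl
  have r1 : Fin.removeNth (1 : Fin 4) ![x, y, z, w] = ![x, z, w] := by
    funext i; fin_cases i <;> rfl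
  have r2 : Fin.removeNth (2 : Fin 4) ![x, y, z, w] = ![x, y, w] := by
    funext i; fin_cases i <;> rfl
  have r3 : Fin.removeNth (3 : Fin 4) ![x, y, z, w] = ![x, y, z] := by
    funext i; fin_cases i <;> rfl
  rw [h, Fin.sum_univ_four, r0, r1, r2, r3]
  simp [sub_eq_add_neg, pow_succ]

end WedgeCalculus

end EDS

namespace EDS

/-! ### Algebraic ideals of forms, integral elements and polar spaces. -/

section IdealTheory

variable {W : Type*} [NormedAddCommGroup W] [NormedSpace ℝ W]

/-! ### Alternating maps on spans -/

theorem map_eq_zero_of_mem_span_of_lt {k m : ℕ} (hm : m < k) {v : Fin m → W} {w : Fin k → W}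
    (hw : ∀ i, w i ∈ Submodule.span ℝ (Set.range v)) (ψ : W [⋀^Fin k]→L[ℝ] ℝ) : ψ w = 0 := by
  refine ψ.toAlternatingMap.map_linearDependent w fun h => ?_
  have h1 : LinearIndependent ℝ (fun i => (⟨w i, hw i⟩ : Submodule.span ℝ (Set.range v))) :=
    LinearIndependent.of_comp (Submodule.subtype _) h
  have : Module.Finite ℝ (Submodule.span ℝ (Set.range v)) :=
    FiniteDimensional.span_of_finite ℝ (Set.finite_range v)
  have h2 := h1.fintype_card_le_finrank
  have h3 := finrank_range_le_card (R := ℝ) v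
  simp only [Fintype.card_fin] at h2 h3
  have h4 : Module.finrank ℝ (Submodule.span ℝ (Set.range v)) = Set.finrank ℝ (Set.range v) := rfl
  omega

/-- Pulled back along c ↦ Σ c_i v_i, the form has top degree on ℝ^k, so it is zero once it vanishes
on the standard basis. Degenerate frames are thereby covered as well. -/
theorem map_eq_zero_of_mem_span {k : ℕ} {v w : Fin k → W}
    (hw : ∀ i, w i ∈ Submodule.span ℝ (Set.range v)) (ψ : W [⋀^Fin k]→L[ℝ] ℝ)
    (hv : ψ v = 0) : ψ w = 0 := by
  let L : (Fin k → ℝ) →ₗ[ℝ] W := Fintype.linearCombination ℝ v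
  have hL : ∀ i, ∃ c, L c = w i := by
    intro i
    have := hw i
    rw [← Fintype.range_linearCombination] at this
    exact this
  choose c hc using hL
  have h0 : ψ.toAlternatingMap.compLinearMap L = 0 := by
    refine (ψ.toAlternatingMap.compLinearMap L).map_basis_eq_zero_iff (Pi.basisFun ℝ (Fin k)) |>.1 ?_
    simp only [AlternatingMap.compLinearMap_apply]
    have e : (fun i => L (Pi.basisFun ℝ (Fin k) i)) = v := by
      funext i
      simp [L, Fintype.linearCombination_apply, Pi.single_apply]
    rw [e]
    exact hv
  have h1 : ψ.toAlternatingMap.compLinearMap L c = 0 := by rw [h0]; rfl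
  rw [AlternatingMap.compLinearMap_apply] at h1
  convert h1 using 1
  change ψ w = ψ _
  congr 1
  funext i
  exact (hc i).symm

/-- A `k`-form regarded as a `k'`-form, for `k = k'`. -/
def castForm {A : Type*} [NormedAddCommGroup A] [NormedSpace ℝ A] {k k' : ℕ} (h : k = k')
    (β : W [⋀^Fin k]→L[ℝ] A) : W [⋀^Fin k']→L[ℝ] A := h ▸ β

theorem castForm_apply {A : Type*} [NormedAddCommGroup A] [NormedSpace ℝ A] {k k' : ℕ}
    (h : k = k') (β : W [⋀^Fin k]→L[ℝ] A) (v : Fin k' → W) :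
    castForm h β v = β (fun i => v (Fin.cast h i)) := by
  subst h; rfl

/-! ### The ideal generated by a family of forms -/

variable {X : Set W} {G : FormFamily W}

theorem AlgIdeal.cast {k k' : ℕ} (h : k = k') {ψ : W → W [⋀^Fin k]→L[ℝ] ℝ}
    {χ : W → W [⋀^Fin k']→L[ℝ] ℝ} (hψ : AlgIdeal X G k ψ)
    (hχ : ∀ z ∈ X, ∀ v, χ z v = ψ z (fun i => v (Fin.cast h i))) : AlgIdeal X G k' χ := by
  subst h
  refine hψ.congr fun z hz => ?_
  ext v
  exact (hχ z hz v).symm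

theorem AlgIdeal.sum {k : ℕ} {ι : Type*} (s : Finset ι) {ψ : ι → W → W [⋀^Fin k]→L[ℝ] ℝ}
    (h : ∀ i ∈ s, AlgIdeal X G k (ψ i)) : AlgIdeal X G k (fun z => ∑ i ∈ s, ψ i z) := by
  classical
  induction s using Finset.induction_on with
  | empty => simpa using AlgIdeal.zero k
  | insert a s ha ih =>
    simp only [Finset.sum_insert ha]
    exact (h a (by simp)).add (ih fun i hi => h i (by simp [hi]))

theorem AlgIdeal.const_smul {k : ℕ} (c : ℝ) {ψ : W → W [⋀^Fin k]→L[ℝ] ℝ}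
    (h : AlgIdeal X G k ψ) : AlgIdeal X G k (fun z => c • ψ z) :=
  AlgIdeal.smul (f := fun _ => c) contDiffOn_const h

theorem AlgIdeal.contDiffOn (hG : ∀ k, ∀ ψ ∈ G k, ContDiffOn ℝ ∞ ψ X) {k : ℕ}
    {ψ : W → W [⋀^Fin k]→L[ℝ] ℝ} (h : AlgIdeal X G k ψ) : ContDiffOn ℝ ∞ ψ X := by
  induction h with
  | gen h => exact hG _ _ h
  | zero k => exact contDiffOn_const
  | add _ _ ih1 ih2 => exact ih1.add ih2
  | smul hf _ ih => exact hf.smul ih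
  | wedge hβ _ ih => exact contDiffOn_wedge hβ ih
  | congr _ h ih => exact ih.congr fun z hz => (h hz).symm

theorem extDeriv_smul_fun {k : ℕ} {f : W → ℝ} {ψ : W → W [⋀^Fin k]→L[ℝ] ℝ} {z : W}
    (hf : DifferentiableAt ℝ f z) (hψ : DifferentiableAt ℝ ψ z) (v : Fin (k + 1) → W) :
    extDeriv (fun z => f z • ψ z) z v =
      wedge (ContinuousAlternatingMap.ofSubsingleton ℝ W ℝ (0 : Fin 1) (fderiv ℝ f z)) (ψ z)
        (fun i => v (Fin.cast (by omega) i)) + f z * extDeriv ψ z v := by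
  rw [extDeriv, fderiv_fun_smul hf hψ, add_comm (f z • fderiv ℝ ψ z),
    ContinuousAlternatingMap.alternatizeUncurryFin_add, ContinuousAlternatingMap.add_apply,
    ContinuousAlternatingMap.alternatizeUncurryFin_smul]
  congr 1
  rw [wedge_one_left, ContinuousAlternatingMap.alternatizeUncurryFin_apply]
  refine Finset.sum_congr rfl fun i _ => ?_
  simp

/-- An ideal generated by smooth forms whose exterior derivatives lie in it is closed under `d`. -/
theorem diffClosed_ideal (hX : IsOpen X) (hG : ∀ k, ∀ ψ ∈ G k, ContDiffOn ℝ ∞ ψ X)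
    (hd : ∀ k, ∀ ψ ∈ G k, AlgIdeal X G (k + 1) (fun z => extDeriv ψ z)) :
    DiffClosed (ideal X G) := by
  intro k ψ h
  change AlgIdeal X G k ψ at h
  change AlgIdeal X G (k + 1) _
  have hdiff : ∀ {k : ℕ} {β : W → W [⋀^Fin k]→L[ℝ] ℝ}, ContDiffOn ℝ ∞ β X → ∀ z ∈ X,
      DifferentiableAt ℝ β z := fun hβ z hz =>
    (hβ.contDiffAt (hX.mem_nhds hz)).differentiableAt (by simp)
  induction h with
  | gen h => exact hd _ _ h
  | zero k =>
    refine (AlgIdeal.zero _).congr fun z _ => ?_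
    ext v
    simp [extDeriv, ContinuousAlternatingMap.alternatizeUncurryFin_apply]
  | add h1 h2 ih1 ih2 =>
    refine (ih1.add ih2).congr fun z hz => ?_
    exact (extDeriv_fun_add (hdiff (h1.contDiffOn hG) z hz) (hdiff (h2.contDiffOn hG) z hz)).symm
  | @smul k f ψ hf h ih =>
    have hf' : ContDiffOn ℝ ∞ (fun z => ContinuousAlternatingMap.ofSubsingleton ℝ W ℝ (0 : Fin 1)
        (fderiv ℝ f z)) X :=
      (ContinuousAlternatingMap.ofSubsingletonLIE (𝕜 := ℝ) (E := W) (F := ℝ)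
        (0 : Fin 1)).contDiff.comp_contDiffOn (hf.fderiv_of_isOpen hX (by simp))
    -- This difference is df ∧ ψ, a multiple of ψ; the remaining term f dψ comes from the induction
    -- hypothesis.
    have h1 : AlgIdeal X G (k + 1) (fun z => extDeriv (fun z => f z • ψ z) z - f z • extDeriv ψ z) := by
      refine (AlgIdeal.wedge hf' h).cast (by omega) fun z hz v => ?_
      have hfz : DifferentiableAt ℝ f z := (hf.contDiffAt (hX.mem_nhds hz)).differentiableAt (by simp)
      rw [ContinuousAlternatingMap.sub_apply, ContinuousAlternatingMap.smul_apply, smul_eq_mul,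
        extDeriv_smul_fun hfz (hdiff (h.contDiffOn hG) z hz)]
      ring
    refine (h1.add (AlgIdeal.smul hf ih)).congr fun z _ => ?_
    simp
  | @wedge j k β ψ hβ h ih =>
    have h1 : AlgIdeal X G (j + k + 1) (fun z => extDeriv (fun z => EDS.wedge (β z) (ψ z)) z +
        (-(-1) ^ j : ℝ) • EDS.wedge (β z) (extDeriv ψ z)) := by
      refine (AlgIdeal.wedge (contDiffOn_extDeriv hX hβ) h).cast (by omega) fun z hz v => ?_
      have := extDeriv_wedge (hdiff hβ z hz) (hdiff (h.contDiffOn hG) z hz) v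
      change (extDeriv (fun z => EDS.wedge (β z) (ψ z)) z v +
        (-(-1) ^ j : ℝ) • EDS.wedge (β z) (extDeriv ψ z) v) = _
      rw [this, smul_eq_mul, zsmul_eq_mul]
      push_cast
      ring
    refine (h1.add ((AlgIdeal.wedge hβ ih).const_smul ((-1) ^ j))).congr fun z _ => ?_
    ext v
    change (extDeriv (fun z => EDS.wedge (β z) (ψ z)) z v +
        (-(-1) ^ j : ℝ) • EDS.wedge (β z) (extDeriv ψ z) v) +
        ((-1) ^ j : ℝ) • EDS.wedge (β z) (extDeriv ψ z) v = _
    simp only [smul_eq_mul]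
    ring
  | congr h heq ih =>
    refine ih.congr fun z hz => ?_
    -- Forms are total functions; agreement on `X` controls the exterior derivative only because `X`
    -- is open.
    exact ((Filter.eventuallyEq_of_mem (hX.mem_nhds hz) heq)).extDeriv_eq

/-- Every ideal operation preserves vanishing on `E`: in a product the arguments handed to ψ are
still vectors of `E`. -/
theorem isIntegralElement_iff {z : W} (hz : z ∈ X) (E : Submodule ℝ W) :
    IsIntegralElement (ideal X G) z E ↔
      ∀ k, ∀ ψ ∈ G k, ∀ w : Fin k → W, (∀ i, w i ∈ E) → ψ z w = 0 := by
  refine ⟨fun h k ψ hψ => h k ψ (.gen hψ), fun h k ψ hψ => ?_⟩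
  change AlgIdeal X G k ψ at hψ
  induction hψ with
  | gen hψ => exact h _ _ hψ
  | zero k => intro w _; rfl
  | add _ _ ih1 ih2 => intro w hw; simp [ih1 w hw, ih2 w hw]
  | smul _ _ ih => intro w hw; simp [ih w hw]
  | wedge hβ _ ih =>
    intro w hw
    rw [wedge_apply]
    simp [ih _ fun i => hw _]
  | congr _ heq ih => intro w hw; rw [← heq hz]; exact ih w hw

theorem mem_polarSpace_of_isIntegralElement {I : FormFamily W} {z : W} {k : ℕ} {v : Fin k → W}
    {w : W} (h : IsIntegralElement I z
      (Submodule.span ℝ (Set.range (Fin.cons w v : Fin (k + 1) → W)))) :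
    w ∈ polarSpace I z v := fun ψ hψ =>
  h (k + 1) ψ hψ _ fun i => Submodule.subset_span ⟨i, rfl⟩

theorem isIntegralElement_mono {I : FormFamily W} {z : W} {E E' : Submodule ℝ W} (hE : E ≤ E')
    (h : IsIntegralElement I z E') : IsIntegralElement I z E :=
  fun k ψ hψ w hw => h k ψ hψ w fun i => hE (hw i)

/-- If the ideal is generated in degrees `≥ d`, subspaces of smaller dimension are integral. -/
theorem isIntegralElement_span_of_lt {z : W} (hz : z ∈ X) {d k : ℕ} (hG : ∀ j < d, G j = ∅)
    (hk : k < d) (v : Fin k → W) :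
    IsIntegralElement (ideal X G) z (Submodule.span ℝ (Set.range v)) := by
  rw [isIntegralElement_iff hz]
  intro j ψ hψ w hw
  by_cases hj : j < d
  · rw [hG j hj] at hψ; exact hψ.elim
  · exact map_eq_zero_of_mem_span_of_lt (by omega) hw _

/-- A `d`-plane is an integral element of an ideal generated in degrees `≥ d` if and only if the
generators of degree `d` vanish on it. -/
theorem isIntegralElement_span_iff_of_eq {z : W} (hz : z ∈ X) {d : ℕ} (hG : ∀ j < d, G j = ∅)
    (v : Fin d → W) :
    IsIntegralElement (ideal X G) z (Submodule.span ℝ (Set.range v)) ↔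
      ∀ ψ ∈ G d, ψ z v = 0 := by
  rw [isIntegralElement_iff hz]
  refine ⟨fun h ψ hψ => h d ψ hψ v fun i => Submodule.subset_span ⟨i, rfl⟩,
    fun h j ψ hψ w hw => ?_⟩
  rcases lt_trichotomy j d with hj | rfl | hj
  · rw [hG j hj] at hψ; exact hψ.elim
  · exact map_eq_zero_of_mem_span hw _ (h ψ hψ)
  · exact map_eq_zero_of_mem_span_of_lt hj hw _

theorem range_cons_mem {k : ℕ} (w : W) (v : Fin k → W) (x : W)
    (hx : x ∈ Submodule.span ℝ (Set.range v)) :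
    x ∈ Submodule.span ℝ (Set.range (Fin.cons w v : Fin (k + 1) → W)) :=
  Submodule.span_mono (by rw [Fin.range_cons]; exact Set.subset_insert _ _) hx

/-- For an ideal generated in degrees `d` and `d + 1`, the polar space of an integral `d`-plane
consists of the vectors that span an integral element together with it. -/
theorem mem_polarSpace_iff [FiniteDimensional ℝ W] {z : W} (hz : z ∈ X) {d : ℕ}
    (hG : ∀ j, j ≠ d → j ≠ d + 1 → G j = ∅) {v : Fin d → W} (hv : LinearIndependent ℝ v)
    (hvI : IsIntegralElement (ideal X G) z (Submodule.span ℝ (Set.range v))) (w : W) :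
    w ∈ polarSpace (ideal X G) z v ↔ IsIntegralElement (ideal X G) z
      (Submodule.span ℝ (Set.range (Fin.cons w v : Fin (d + 1) → W))) := by
  refine ⟨fun h => ?_, mem_polarSpace_of_isIntegralElement⟩
  rw [isIntegralElement_iff hz]
  intro j ψ hψ y hy
  by_cases hj : j = d + 1
  · subst hj
    exact map_eq_zero_of_mem_span hy _ (h ψ (.gen hψ))
  by_cases hj' : j = d
  swap
  · rw [hG j hj' hj] at hψ; exact hψ.elim
  subst hj'
  set E := Submodule.span ℝ (Set.range (Fin.cons w v : Fin (j + 1) → W))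
  set P := Submodule.span ℝ (Set.range y)
  by_cases hyi : LinearIndependent ℝ y
  swap
  · exact (ψ z).toAlternatingMap.map_linearDependent y hyi
  have hPE : P ≤ E := Submodule.span_le.2 (by rintro _ ⟨i, rfl⟩; exact hy i)
  have hP : Module.finrank ℝ P = j := by simpa using finrank_span_eq_card hyi
  -- The polar condition speaks of degree d + 1 only, so the generators of degree d need an
  -- argument. If the d-plane `P` spanned by `y` fills `E`, then `E` is just the given integral
  -- plane.
  by_cases hEP : E ≤ P
  · have hvE : Submodule.span ℝ (Set.range v) ≤ E := fun x hx => range_cons_mem w v x hx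
    have hvd : Module.finrank ℝ (Submodule.span ℝ (Set.range v)) = j := by
      simpa using finrank_span_eq_card hv
    have hEd : Module.finrank ℝ E = j := by rw [le_antisymm hEP hPE]; exact hP
    have : Submodule.span ℝ (Set.range v) = E :=
      Submodule.eq_of_le_of_finrank_eq hvE (by rw [hvd, hEd])
    exact hvI j ψ (.gen hψ) y fun i => by rw [this]; exact hy i
  · obtain ⟨e, heE, heP⟩ := Set.not_subset.1 hEP
    -- With b zero on `P` and b(e) = 1, the form b ∧ ψ of degree d + 1 lies in the ideal and takes
    -- the value ψ(y) on (e, y). It vanishes on `E` because w lies in the polar space.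
    obtain ⟨b, hb0, hb⟩ : ∃ b : W →ₗ[ℝ] ℝ, (∀ x ∈ P, b x = 0) ∧ b e = 1 := by
      obtain ⟨f, hf, hfP⟩ := Submodule.exists_le_ker_of_notMem heP
      refine ⟨(f e)⁻¹ • f, fun x hx => ?_, ?_⟩
      · have : f x = 0 := hfP hx
        simp [this]
      · simp [hf]
    let β : W [⋀^Fin 1]→L[ℝ] ℝ :=
      ContinuousAlternatingMap.ofSubsingleton ℝ W ℝ (0 : Fin 1) b.toContinuousLinearMap
    have h1 : AlgIdeal X G (1 + j) (fun z => wedge β (ψ z)) :=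
      .wedge (β := fun _ => β) contDiffOn_const (.gen hψ)
    let χ : W → W [⋀^Fin (j + 1)]→L[ℝ] ℝ :=
      fun z => castForm (Nat.add_comm 1 j) (wedge β (ψ z))
    have hχ : ∀ z u, χ z u = wedge β (ψ z) (fun i : Fin (1 + j) =>
        u (Fin.cast (by omega : 1 + j = j + 1) i)) := fun z u => castForm_apply _ _ _
    have h2 : AlgIdeal X G (j + 1) χ := h1.cast (by omega) fun z _ u => hχ z u
    have h3 : χ z (Fin.cons e y : Fin (j + 1) → W) = 0 := by
      refine map_eq_zero_of_mem_span (v := (Fin.cons w v : Fin (j + 1) → W)) ?_ _ (h χ h2)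
      intro i
      refine Fin.cases ?_ (fun i => ?_) i
      · exact heE
      · exact hy i
    rw [hχ, wedge_one_left β (ψ z) (Fin.cons e y : Fin (j + 1) → W), Fin.sum_univ_succ] at h3
    have h4 : ∀ i : Fin j, β ![(Fin.cons e y : Fin (j + 1) → W) i.succ] = 0 := by
      intro i
      change b (y i) = 0
      exact hb0 _ (Submodule.subset_span ⟨i, rfl⟩)
    have h5 : β ![(Fin.cons e y : Fin (j + 1) → W) 0] = 1 := hb
    rw [Finset.sum_eq_zero fun i _ => by rw [h4 i]; simp, h5] at h3
    simpa using h3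

/-! ### Complex-valued forms in the ideal -/

/-- A complex-valued form whose real and imaginary parts belong to the ideal. -/
def CIdeal (X : Set W) (G : FormFamily W) (k : ℕ) (ψ : W → W [⋀^Fin k]→L[ℝ] ℂ) : Prop :=
  AlgIdeal X G k (fun z => reForm (ψ z)) ∧ AlgIdeal X G k (fun z => imForm (ψ z))

@[simp] theorem reForm_apply {k : ℕ} (β : W [⋀^Fin k]→L[ℝ] ℂ) (v : Fin k → W) :
    reForm β v = (β v).re := rfl

@[simp] theorem imForm_apply {k : ℕ} (β : W [⋀^Fin k]→L[ℝ] ℂ) (v : Fin k → W) :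
    imForm β v = (β v).im := rfl

@[simp] theorem conjForm_apply {k : ℕ} (β : W [⋀^Fin k]→L[ℝ] ℂ) (v : Fin k → W) :
    conjForm β v = (starRingEnd ℂ) (β v) := rfl

@[simp] theorem oneForm_apply (L : W →L[ℝ] ℂ) (v : Fin 1 → W) : oneForm L v = L (v 0) := rfl

theorem reForm_wedge {k l : ℕ} (β : W [⋀^Fin k]→L[ℝ] ℂ) (γ : W [⋀^Fin l]→L[ℝ] ℂ) :
    reForm (wedge β γ) = wedge (reForm β) (reForm γ) + (-1 : ℝ) • wedge (imForm β) (imForm γ) := by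
  ext v
  simp only [reForm_apply, wedge_apply, ContinuousAlternatingMap.add_apply,
    ContinuousAlternatingMap.smul_apply, imForm_apply, Complex.smul_re, Complex.re_sum,
    Units.smul_def, Complex.mul_re, smul_eq_mul, Finset.mul_sum,
    ← Finset.sum_add_distrib]
  refine Finset.sum_congr rfl fun σ _ => ?_
  simp only [zsmul_eq_mul]
  ring

theorem imForm_wedge {k l : ℕ} (β : W [⋀^Fin k]→L[ℝ] ℂ) (γ : W [⋀^Fin l]→L[ℝ] ℂ) :
    imForm (wedge β γ) = wedge (reForm β) (imForm γ) + wedge (imForm β) (reForm γ) := by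
  ext v
  simp only [reForm_apply, wedge_apply, ContinuousAlternatingMap.add_apply,
    imForm_apply, Complex.smul_im, Complex.im_sum,
    Units.smul_def, Complex.mul_im, smul_eq_mul, Finset.mul_sum,
    ← Finset.sum_add_distrib]
  refine Finset.sum_congr rfl fun σ _ => ?_
  simp only [zsmul_eq_mul]
  ring

theorem conjForm_wedge {k l : ℕ} (β : W [⋀^Fin k]→L[ℝ] ℂ) (γ : W [⋀^Fin l]→L[ℝ] ℂ) :
    conjForm (wedge β γ) = wedge (conjForm β) (conjForm γ) := by
  ext v
  simp only [conjForm_apply, wedge_apply, map_sum, Complex.real_smul, map_mul, Units.smul_def,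
    Complex.conj_ofReal, zsmul_eq_mul, map_intCast]

theorem CIdeal.congr {k : ℕ} {ψ χ : W → W [⋀^Fin k]→L[ℝ] ℂ} (h : CIdeal X G k ψ)
    (he : Set.EqOn ψ χ X) : CIdeal X G k χ :=
  ⟨h.1.congr fun z hz => by simp only [he hz], h.2.congr fun z hz => by simp only [he hz]⟩

theorem CIdeal.add {k : ℕ} {ψ χ : W → W [⋀^Fin k]→L[ℝ] ℂ} (h : CIdeal X G k ψ)
    (h' : CIdeal X G k χ) : CIdeal X G k (fun z => ψ z + χ z) :=
  ⟨(h.1.add h'.1).congr fun z _ => by ext; simp, (h.2.add h'.2).congr fun z _ => by ext; simp⟩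

theorem CIdeal.sum {k : ℕ} {ι : Type*} (s : Finset ι) {ψ : ι → W → W [⋀^Fin k]→L[ℝ] ℂ}
    (h : ∀ i ∈ s, CIdeal X G k (ψ i)) : CIdeal X G k (fun z => ∑ i ∈ s, ψ i z) :=
  ⟨(AlgIdeal.sum s fun i hi => (h i hi).1).congr fun z _ => by ext; simp,
    (AlgIdeal.sum s fun i hi => (h i hi).2).congr fun z _ => by ext; simp⟩

theorem CIdeal.smul {k : ℕ} {f : W → ℂ} {ψ : W → W [⋀^Fin k]→L[ℝ] ℂ}
    (hf : ContDiffOn ℝ ∞ f X) (h : CIdeal X G k ψ) : CIdeal X G k (fun z => f z • ψ z) := by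
  have hr : ContDiffOn ℝ ∞ (fun z => (f z).re) X := Complex.reCLM.contDiff.comp_contDiffOn hf
  have hi : ContDiffOn ℝ ∞ (fun z => (f z).im) X := Complex.imCLM.contDiff.comp_contDiffOn hf
  refine ⟨((AlgIdeal.smul hr h.1).add ((AlgIdeal.smul hi h.2).const_smul (-1))).congr
    fun z _ => ?_, ((AlgIdeal.smul hr h.2).add (AlgIdeal.smul hi h.1)).congr fun z _ => ?_⟩
  · ext v; simp; ring
  · ext v; simp

theorem CIdeal.const_smul {k : ℕ} (c : ℂ) {ψ : W → W [⋀^Fin k]→L[ℝ] ℂ}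
    (h : CIdeal X G k ψ) : CIdeal X G k (fun z => c • ψ z) :=
  CIdeal.smul (f := fun _ => c) contDiffOn_const h

theorem CIdeal.conj {k : ℕ} {ψ : W → W [⋀^Fin k]→L[ℝ] ℂ}
    (h : CIdeal X G k ψ) : CIdeal X G k (fun z => conjForm (ψ z)) :=
  ⟨h.1.congr fun z _ => by ext; simp, (h.2.const_smul (-1)).congr fun z _ => by ext; simp⟩

theorem CIdeal.wedge {j k : ℕ} {β : W → W [⋀^Fin j]→L[ℝ] ℂ} {ψ : W → W [⋀^Fin k]→L[ℝ] ℂ}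
    (hβ : ContDiffOn ℝ ∞ β X) (h : CIdeal X G k ψ) :
    CIdeal X G (j + k) (fun z => EDS.wedge (β z) (ψ z)) := by
  have hr : ContDiffOn ℝ ∞ (fun z => reForm (β z)) X := contDiffOn_comp_clm _ hβ
  have hi : ContDiffOn ℝ ∞ (fun z => imForm (β z)) X := contDiffOn_comp_clm _ hβ
  exact ⟨((AlgIdeal.wedge hr h.1).add ((AlgIdeal.wedge hi h.2).const_smul (-1))).congr
    fun z _ => (reForm_wedge _ _).symm, ((AlgIdeal.wedge hr h.2).add (AlgIdeal.wedge hi h.1)).congr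
    fun z _ => (imForm_wedge _ _).symm⟩

end IdealTheory

end EDS

namespace EDS

/-! ### Explicit wedge formulas in degrees three to six. -/

section LowDegree

variable {W : Type*} [NormedAddCommGroup W] [NormedSpace ℝ W]

theorem wedge_two_left' {A : Type*} [NormedCommRing A] [NormedAlgebra ℝ A] {l : ℕ}
    (f : W [⋀^Fin 2]→L[ℝ] A) (γ : W [⋀^Fin l]→L[ℝ] A)
    (v : Fin (2 + l) → W) (v' : Fin (l + 2) → W)
    (h : ∀ i, v i = v' (Fin.cast (Nat.add_comm 2 l) i)) :
    wedge f γ v = (2⁻¹ : ℝ) •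
      ∑ i : Fin (l + 2), ∑ j : Fin (l + 1), (-1 : ℤ) ^ (i + j : ℕ) •
        (f ![v' i, i.removeNth v' j] * γ (j.removeNth (i.removeNth v'))) := by
  rw [← wedge_two_left f γ v']
  congr 1
  funext i
  exact h i

theorem vec1_eta {W A : Type*} (g : (Fin 1 → W) → A) (v : Fin 1 → W) : g v = g ![v 0] := by
  congr 1; funext i; fin_cases i; rfl

theorem vec2_eta {W A : Type*} (g : (Fin 2 → W) → A) (v : Fin 2 → W) : g v = g ![v 0, v 1] := by
  congr 1; funext i; fin_cases i <;> rfl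

theorem vec3_eta {W A : Type*} (g : (Fin 3 → W) → A) (v : Fin 3 → W) :
    g v = g ![v 0, v 1, v 2] := by
  congr 1; funext i; fin_cases i <;> rfl

theorem vec4_eta {W A : Type*} (g : (Fin 4 → W) → A) (v : Fin 4 → W) :
    g v = g ![v 0, v 1, v 2, v 3] := by
  congr 1; funext i; fin_cases i <;> rfl

theorem vec5_eta {W A : Type*} (g : (Fin 5 → W) → A) (v : Fin 5 → W) :
    g v = g ![v 0, v 1, v 2, v 3, v 4] := by
  congr 1; funext i; fin_cases i <;> rfl

theorem wedge21 (f : W [⋀^Fin 2]→L[ℝ] ℂ) (g : W [⋀^Fin 1]→L[ℝ] ℂ) (x0 x1 x2 : W) :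
    wedge f g ![x0, x1, x2] =
      f ![x0, x1] * g ![x2] - f ![x0, x2] * g ![x1] + f ![x1, x2] * g ![x0] := by
  rw [wedge_two_left' f g ![x0, x1, x2] ![x0, x1, x2] (by intro i; fin_cases i <;> rfl)]
  have c : ∀ v : Fin 3 → W, ∑ i : Fin (1 + 2), ∑ j : Fin (1 + 1), (-1 : ℤ) ^ (i + j : ℕ) •
        (f ![v i, i.removeNth v j] * g (j.removeNth (i.removeNth v))) =
      ∑ i : Fin 3, ∑ j : Fin 2, (-1 : ℤ) ^ (i + j : ℕ) • (f ![v i, v (i.succAbove j)] *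
        g ![v (i.succAbove (j.succAbove 0))]) := by
    intro v
    refine Finset.sum_congr rfl fun i _ => Finset.sum_congr rfl fun j _ => ?_
    rw [vec1_eta g]
    rfl
  rw [c]
  simp only [Fin.sum_univ_three, Fin.sum_univ_two]
  simp [Fin.succAbove, map_vec2_swap f x0 x1, map_vec2_swap f x0 x2, map_vec2_swap f x1 x2,
    pow_succ]
  ring

theorem wedge22 (f g : W [⋀^Fin 2]→L[ℝ] ℂ) (x0 x1 x2 x3 : W) :
    wedge f g ![x0, x1, x2, x3] =
      f ![x0, x1] * g ![x2, x3] - f ![x0, x2] * g ![x1, x3] + f ![x0, x3] * g ![x1, x2] +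
      f ![x1, x2] * g ![x0, x3] - f ![x1, x3] * g ![x0, x2] + f ![x2, x3] * g ![x0, x1] := by
  rw [wedge_two_left' f g ![x0, x1, x2, x3] ![x0, x1, x2, x3]
    (by intro i; fin_cases i <;> rfl)]
  have c : ∀ v : Fin 4 → W, ∑ i : Fin (2 + 2), ∑ j : Fin (2 + 1), (-1 : ℤ) ^ (i + j : ℕ) •
        (f ![v i, i.removeNth v j] * g (j.removeNth (i.removeNth v))) =
      ∑ i : Fin 4, ∑ j : Fin 3, (-1 : ℤ) ^ (i + j : ℕ) • (f ![v i, v (i.succAbove j)] *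
        g ![v (i.succAbove (j.succAbove 0)), v (i.succAbove (j.succAbove 1))]) := by
    intro v
    refine Finset.sum_congr rfl fun i _ => Finset.sum_congr rfl fun j _ => ?_
    rw [vec2_eta g]
    rfl
  rw [c]
  simp only [Fin.sum_univ_four, Fin.sum_univ_three]
  simp [Fin.succAbove, map_vec2_swap f x0 x1, map_vec2_swap f x0 x2, map_vec2_swap f x0 x3,
    map_vec2_swap f x1 x2, map_vec2_swap f x1 x3, map_vec2_swap f x2 x3, pow_succ]
  ring

theorem wedge23 (f : W [⋀^Fin 2]→L[ℝ] ℂ) (g : W [⋀^Fin 3]→L[ℝ] ℂ) (x0 x1 x2 x3 x4 : W) :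
    wedge f g ![x0, x1, x2, x3, x4] =
      f ![x0, x1] * g ![x2, x3, x4] - f ![x0, x2] * g ![x1, x3, x4] +
      f ![x0, x3] * g ![x1, x2, x4] - f ![x0, x4] * g ![x1, x2, x3] +
      f ![x1, x2] * g ![x0, x3, x4] - f ![x1, x3] * g ![x0, x2, x4] +
      f ![x1, x4] * g ![x0, x2, x3] + f ![x2, x3] * g ![x0, x1, x4] -
      f ![x2, x4] * g ![x0, x1, x3] + f ![x3, x4] * g ![x0, x1, x2] := by
  rw [wedge_two_left' f g ![x0, x1, x2, x3, x4] ![x0, x1, x2, x3, x4]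
    (by intro i; fin_cases i <;> rfl)]
  have c : ∀ v : Fin 5 → W, ∑ i : Fin (3 + 2), ∑ j : Fin (3 + 1), (-1 : ℤ) ^ (i + j : ℕ) •
        (f ![v i, i.removeNth v j] * g (j.removeNth (i.removeNth v))) =
      ∑ i : Fin 5, ∑ j : Fin 4, (-1 : ℤ) ^ (i + j : ℕ) • (f ![v i, v (i.succAbove j)] *
        g ![v (i.succAbove (j.succAbove 0)), v (i.succAbove (j.succAbove 1)),
          v (i.succAbove (j.succAbove 2))]) := by
    intro v
    refine Finset.sum_congr rfl fun i _ => Finset.sum_congr rfl fun j _ => ?_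
    rw [vec3_eta g]
    rfl
  rw [c]
  simp only [Fin.sum_univ_five, Fin.sum_univ_four]
  simp [Fin.succAbove, map_vec2_swap f x0 x1, map_vec2_swap f x0 x2, map_vec2_swap f x0 x3,
    map_vec2_swap f x0 x4, map_vec2_swap f x1 x2, map_vec2_swap f x1 x3, map_vec2_swap f x1 x4,
    map_vec2_swap f x2 x3, map_vec2_swap f x2 x4, map_vec2_swap f x3 x4, pow_succ]
  ring

theorem wedge24 (f : W [⋀^Fin 2]→L[ℝ] ℂ) (g : W [⋀^Fin 4]→L[ℝ] ℂ) (x0 x1 x2 x3 x4 x5 : W) :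
    wedge f g ![x0, x1, x2, x3, x4, x5] =
      f ![x0, x1] * g ![x2, x3, x4, x5] - f ![x0, x2] * g ![x1, x3, x4, x5] +
      f ![x0, x3] * g ![x1, x2, x4, x5] - f ![x0, x4] * g ![x1, x2, x3, x5] +
      f ![x0, x5] * g ![x1, x2, x3, x4] +
      f ![x1, x2] * g ![x0, x3, x4, x5] - f ![x1, x3] * g ![x0, x2, x4, x5] +
      f ![x1, x4] * g ![x0, x2, x3, x5] - f ![x1, x5] * g ![x0, x2, x3, x4] +
      f ![x2, x3] * g ![x0, x1, x4, x5] - f ![x2, x4] * g ![x0, x1, x3, x5] +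
      f ![x2, x5] * g ![x0, x1, x3, x4] +
      f ![x3, x4] * g ![x0, x1, x2, x5] - f ![x3, x5] * g ![x0, x1, x2, x4] +
      f ![x4, x5] * g ![x0, x1, x2, x3] := by
  rw [wedge_two_left' f g ![x0, x1, x2, x3, x4, x5] ![x0, x1, x2, x3, x4, x5]
    (by intro i; fin_cases i <;> rfl)]
  have c : ∀ v : Fin 6 → W, ∑ i : Fin (4 + 2), ∑ j : Fin (4 + 1), (-1 : ℤ) ^ (i + j : ℕ) •
        (f ![v i, i.removeNth v j] * g (j.removeNth (i.removeNth v))) =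
      ∑ i : Fin 6, ∑ j : Fin 5, (-1 : ℤ) ^ (i + j : ℕ) • (f ![v i, v (i.succAbove j)] *
        g ![v (i.succAbove (j.succAbove 0)), v (i.succAbove (j.succAbove 1)),
          v (i.succAbove (j.succAbove 2)), v (i.succAbove (j.succAbove 3))]) := by
    intro v
    refine Finset.sum_congr rfl fun i _ => Finset.sum_congr rfl fun j _ => ?_
    rw [vec4_eta g]
    rfl
  rw [c]
  simp only [Fin.sum_univ_six, Fin.sum_univ_five]
  simp [Fin.succAbove, map_vec2_swap f x0 x1, map_vec2_swap f x0 x2, map_vec2_swap f x0 x3,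
    map_vec2_swap f x0 x4, map_vec2_swap f x0 x5, map_vec2_swap f x1 x2, map_vec2_swap f x1 x3,
    map_vec2_swap f x1 x4, map_vec2_swap f x1 x5, map_vec2_swap f x2 x3, map_vec2_swap f x2 x4,
    map_vec2_swap f x2 x5, map_vec2_swap f x3 x4, map_vec2_swap f x3 x5, map_vec2_swap f x4 x5,
    pow_succ]
  ring

/-- A `k`-form on a space spanned by `k + 1` vectors vanishes if it vanishes on each `k` of
them. -/
theorem eq_zero_of_removeNth {A : Type*} [NormedAddCommGroup A] [NormedSpace ℝ A] {k : ℕ}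
    (b : Module.Basis (Fin (k + 1)) ℝ W) (ψ : W [⋀^Fin k]→L[ℝ] A)
    (h : ∀ i : Fin (k + 1), ψ (i.removeNth b) = 0) : ψ = 0 := by
  have h0 : ψ.toAlternatingMap = 0 := by
    refine Module.Basis.ext_alternating b fun v hv => ?_
    -- An injective choice of k among k + 1 indices misses some i, hence is `i.removeNth` up to a
    -- permutation.
    obtain ⟨i, hi⟩ : ∃ i, i ∉ Set.range v := by
      by_contra hcon
      push Not at hcon
      have hs : Function.Surjective v := hcon
      have := Fintype.card_le_of_surjective v hs
      simp at this
    have h1 : ∀ j, ∃ m : Fin k, i.succAbove m = v j := fun j =>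
      Fin.exists_succAbove_eq (fun hj => hi ⟨j, hj⟩)
    choose m hm using h1
    have hminj : Function.Injective m := fun a b hab => hv (by rw [← hm a, ← hm b, hab])
    let τ : Equiv.Perm (Fin k) := Equiv.ofBijective m (Finite.injective_iff_bijective.1 hminj)
    have h2 := ψ.toAlternatingMap.map_perm (i.removeNth b) τ
    have h3 : (fun j => b (v j)) = (i.removeNth b) ∘ τ := by
      funext j
      simp [τ, Fin.removeNth_apply, hm]
    rw [h3, h2]
    change Equiv.Perm.sign τ • ψ (i.removeNth b) = _
    rw [h i]; simp
  ext v
  exact congrArg (fun φ : W [⋀^Fin k]→ₗ[ℝ] A => φ v) h0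

end LowDegree

end EDS

namespace EDS

/-! ### Complex coframes in real dimension six: types, traces and decompositions. -/

section Coframe

variable {W : Type*} [NormedAddCommGroup W] [NormedSpace ℝ W]

/-- `(e, e')` is the real frame dual to the complex coframe `θ`; `e' = i e`. -/
structure IsDualFrame (θ : Fin 3 → W →L[ℝ] ℂ) (e e' : Fin 3 → W) : Prop where
  apply : ∀ k j, θ k (e j) = if k = j then 1 else 0
  apply' : ∀ k j, θ k (e' j) = if k = j then Complex.I else 0
  decomp : ∀ v, v = ∑ j, ((θ j v).re • e j + (θ j v).im • e' j)

/-- `θ₁ ∧ θ₂ ∧ θ₃`. -/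
noncomputable def volForm (θ : Fin 3 → W →L[ℝ] ℂ) : W [⋀^Fin 3]→L[ℝ] ℂ :=
  wedge (wedge (oneForm (θ 0)) (oneForm (θ 1))) (oneForm (θ 2))

/-- `(i/2) ∑ ε_k θ_k ∧ conj θ_k`. -/
noncomputable def hermForm (ε : Fin 3 → ℝ) (θ : Fin 3 → W →L[ℝ] ℂ) : W [⋀^Fin 2]→L[ℝ] ℂ :=
  ∑ k, ((Complex.I / 2) * (ε k : ℂ)) • wedge (oneForm (θ k)) (conjForm (oneForm (θ k)))

/-- The coefficient of `conj θ_j ∧ conj θ_k` in the form `f`. -/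
noncomputable def antiPart (e e' : Fin 3 → W) (f : W [⋀^Fin 2]→L[ℝ] ℂ) (j k : Fin 3) : ℂ :=
  (1 / 4) * (f ![e j, e k] + Complex.I * f ![e' j, e k] + Complex.I * f ![e j, e' k] -
    f ![e' j, e' k])

theorem antiPart_swap (e e' : Fin 3 → W) (f : W [⋀^Fin 2]→L[ℝ] ℂ) (j k : Fin 3) :
    antiPart e e' f k j = -antiPart e e' f j k := by
  unfold antiPart
  rw [map_vec2_swap f (e j) (e k), map_vec2_swap f (e j) (e' k), map_vec2_swap f (e' j) (e k),
    map_vec2_swap f (e' j) (e' k)]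
  ring

theorem antiPart_self (e e' : Fin 3 → W) (f : W [⋀^Fin 2]→L[ℝ] ℂ) (j : Fin 3) :
    antiPart e e' f j j = 0 := by
  have := antiPart_swap e e' f j j
  linear_combination (1/2) * this

/-- The trace of `f` with respect to the Hermitian form of signature `ε`. -/
noncomputable def hermTrace (ε : Fin 3 → ℝ) (e e' : Fin 3 → W) (f : W [⋀^Fin 2]→L[ℝ] ℂ) : ℂ :=
  ∑ i, (ε i : ℂ) * f ![e i, e' i]

theorem volForm_apply (θ : Fin 3 → W →L[ℝ] ℂ) (x y z : W) : volForm θ ![x, y, z] =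
    (θ 0 x * θ 1 y - θ 0 y * θ 1 x) * θ 2 z - (θ 0 x * θ 1 z - θ 0 z * θ 1 x) * θ 2 y +
      (θ 0 y * θ 1 z - θ 0 z * θ 1 y) * θ 2 x := by
  simp [volForm, wedge21, wedge11]

theorem hermForm_apply (ε : Fin 3 → ℝ) (θ : Fin 3 → W →L[ℝ] ℂ) (x y : W) :
    hermForm ε θ ![x, y] = ∑ k, (Complex.I / 2) * (ε k : ℂ) *
      (θ k x * (starRingEnd ℂ) (θ k y) - θ k y * (starRingEnd ℂ) (θ k x)) := by
  simp [hermForm, wedge11]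

namespace IsDualFrame

variable {θ : Fin 3 → W →L[ℝ] ℂ} {e e' : Fin 3 → W}

theorem linearIndependent (h : IsDualFrame θ e e') : LinearIndependent ℝ ![e 0, e' 0, e 1, e' 1, e 2, e' 2] := by
  rw [Fintype.linearIndependent_iff]
  intro g hg
  simp only [Fin.sum_univ_succ, Finset.univ_unique, Finset.sum_singleton] at hg
  simp at hg
  have key : ∀ k : Fin 3, θ k _ = θ k 0 := fun k => congrArg (θ k) hg
  have k0 := key 0
  have k1 := key 1
  have k2 := key 2
  simp [h.apply, h.apply', Complex.ext_iff] at k0 k1 k2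
  intro i
  fin_cases i <;> simp_all

theorem span_eq_top (h : IsDualFrame θ e e') : ⊤ ≤ Submodule.span ℝ (Set.range ![e 0, e' 0, e 1, e' 1, e 2, e' 2]) := by
  intro v _
  rw [h.decomp v]
  refine Submodule.sum_mem _ fun j _ => Submodule.add_mem _ (Submodule.smul_mem _ _ ?_)
    (Submodule.smul_mem _ _ ?_) <;> refine Submodule.subset_span ?_ <;> fin_cases j
  exacts [⟨0, rfl⟩, ⟨2, rfl⟩, ⟨4, rfl⟩, ⟨1, rfl⟩, ⟨3, rfl⟩, ⟨5, rfl⟩]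

/-- The real basis `e₁, ie₁, e₂, ie₂, e₃, ie₃`. -/
noncomputable def basis (h : IsDualFrame θ e e') : Module.Basis (Fin 6) ℝ W :=
  Module.Basis.mk h.linearIndependent h.span_eq_top

theorem coe_basis (h : IsDualFrame θ e e') : (h.basis : Fin 6 → W) = ![e 0, e' 0, e 1, e' 1, e 2, e' 2] :=
  Module.Basis.coe_mk _ _

theorem eq_zero_of_five (h : IsDualFrame θ e e') {ψ : W [⋀^Fin 5]→L[ℝ] ℂ}
    (h0 : ψ ![e' 0, e 1, e' 1, e 2, e' 2] = 0) (h1 : ψ ![e 0, e 1, e' 1, e 2, e' 2] = 0)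
    (h2 : ψ ![e 0, e' 0, e' 1, e 2, e' 2] = 0) (h3 : ψ ![e 0, e' 0, e 1, e 2, e' 2] = 0)
    (h4 : ψ ![e 0, e' 0, e 1, e' 1, e' 2] = 0) (h5 : ψ ![e 0, e' 0, e 1, e' 1, e 2] = 0) :
    ψ = 0 := by
  refine eq_zero_of_removeNth h.basis ψ fun i => ?_
  rw [h.coe_basis, vec5_eta ψ]
  fin_cases i
  exacts [h0, h1, h2, h3, h4, h5]

theorem eq_zero_of_six (h : IsDualFrame θ e e') {ψ : W [⋀^Fin 6]→L[ℝ] ℂ}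
    (h0 : ψ ![e 0, e' 0, e 1, e' 1, e 2, e' 2] = 0) : ψ = 0 := by
  ext v
  have h1 : ψ.toAlternatingMap = 0 := by
    refine Module.Basis.ext_alternating h.basis fun i hi => ?_
    let τ : Equiv.Perm (Fin 6) := Equiv.ofBijective i (Finite.injective_iff_bijective.1 hi)
    have h2 := ψ.toAlternatingMap.map_perm h.basis τ
    have h3 : ψ.toAlternatingMap h.basis = 0 := by rw [h.coe_basis]; exact h0
    rw [h3, smul_zero] at h2
    exact h2
  exact congrArg (fun φ : W [⋀^Fin 6]→ₗ[ℝ] ℂ => φ v) h1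

/-- On the five frame vectors other than e'_m, the form f ∧ θ₁θ₂θ₃ takes the value ±4 times the
(0,2)-coefficient of f for the two indices different from m. Three evaluations therefore recover the
whole (0,2)-part. -/
theorem antiPart_eq_zero_of_wedge_volForm (h : IsDualFrame θ e e') {f : W [⋀^Fin 2]→L[ℝ] ℂ}
    (hf : wedge f (volForm θ) = 0) (j k : Fin 3) : antiPart e e' f j k = 0 := by
  have v0 : wedge f (volForm θ) ![e 0, e 1, e' 1, e 2, e' 2] = 0 := by rw [hf]; rfl
  have v1 : wedge f (volForm θ) ![e 0, e' 0, e 1, e 2, e' 2] = 0 := by rw [hf]; rfl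
  have v2 : wedge f (volForm θ) ![e 0, e' 0, e 1, e' 1, e 2] = 0 := by rw [hf]; rfl
  rw [wedge23] at v0 v1 v2
  simp [volForm_apply, h.apply, h.apply'] at v0 v1 v2
  have a0 : antiPart e e' f 1 2 = 0 := by
    unfold antiPart
    linear_combination (1/4) * v0
  have a1 : antiPart e e' f 0 2 = 0 := by
    unfold antiPart
    linear_combination (-1/4) * v1
  have a2 : antiPart e e' f 0 1 = 0 := by
    unfold antiPart
    linear_combination (1/4) * v2
  have hs : ∀ j k, antiPart e e' f j k = 0 → antiPart e e' f k j = 0 := fun j k hjk => by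
    rw [antiPart_swap, hjk, neg_zero]
  fin_cases j <;> fin_cases k
  exacts [antiPart_self _ _ _ 0, a2, a1, hs _ _ a2, antiPart_self _ _ _ 1, a0, hs _ _ a1,
    hs _ _ a0, antiPart_self _ _ _ 2]

/-- A 5-form is determined by its values on the six frames with one vector omitted, and each of
these values is ±4 or ±4i times a single `antiPart`. -/
theorem wedge_volForm_eq_zero (h : IsDualFrame θ e e') {f : W [⋀^Fin 2]→L[ℝ] ℂ}
    (ha : ∀ j k, antiPart e e' f j k = 0) : wedge f (volForm θ) = 0 := by
  refine h.eq_zero_of_five ?_ ?_ ?_ ?_ ?_ ?_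
  · refine Eq.trans (b := 4 * Complex.I * antiPart e e' f 1 2) ?_ (by rw [ha, mul_zero])
    rw [wedge23]
    simp [volForm_apply, h.apply, h.apply', antiPart]
    ring_nf
    try simp only [Complex.I_sq]
    try ring
  · refine Eq.trans (b := 4 * antiPart e e' f 1 2) ?_ (by rw [ha, mul_zero])
    rw [wedge23]
    simp [volForm_apply, h.apply, h.apply', antiPart]
    ring_nf
    try simp only [Complex.I_sq]
    try ring
  · refine Eq.trans (b := -4 * Complex.I * antiPart e e' f 0 2) ?_ (by rw [ha, mul_zero])
    rw [wedge23]
    simp [volForm_apply, h.apply, h.apply', antiPart]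
    ring_nf
    try simp only [Complex.I_sq]
    try ring
  · refine Eq.trans (b := -4 * antiPart e e' f 0 2) ?_ (by rw [ha, mul_zero])
    rw [wedge23]
    simp [volForm_apply, h.apply, h.apply', antiPart]
    ring_nf
    try simp only [Complex.I_sq]
    try ring
  · refine Eq.trans (b := 4 * Complex.I * antiPart e e' f 0 1) ?_ (by rw [ha, mul_zero])
    rw [wedge23]
    simp [volForm_apply, h.apply, h.apply', antiPart]
    ring_nf
    try simp only [Complex.I_sq]
    try ring
  · refine Eq.trans (b := 4 * antiPart e e' f 0 1) ?_ (by rw [ha, mul_zero])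
    rw [wedge23]
    simp [volForm_apply, h.apply, h.apply', antiPart]
    ring_nf
    try simp only [Complex.I_sq]
    try ring

/-- `f ∧ θ₁ ∧ θ₂ ∧ θ₃ = 0` if and only if `f` has no `(0,2)`-part. -/
theorem wedge_volForm_eq_zero_iff (h : IsDualFrame θ e e') (f : W [⋀^Fin 2]→L[ℝ] ℂ) :
    wedge f (volForm θ) = 0 ↔ ∀ j k, antiPart e e' f j k = 0 :=
  ⟨fun hf => h.antiPart_eq_zero_of_wedge_volForm hf, h.wedge_volForm_eq_zero⟩

/-- The form η takes the value ε_k on (e_k, e'_k), so η² takes the value 2ε_jε_k on (e_j, e'_j, e_k,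
e'_k), and ε_jε_k = ε₀ε₁ε₂·ε_i because ε_i² = 1. Hence F ∧ η² is a nonzero constant times the trace.
-/
theorem wedge_hermForm_apply (h : IsDualFrame θ e e') {ε : Fin 3 → ℝ} (hε : ε = ![1, 1, 1] ∨ ε = ![1, -1, -1])
    (f : W [⋀^Fin 2]→L[ℝ] ℂ) :
    wedge f (wedge (hermForm ε θ) (hermForm ε θ)) ![e 0, e' 0, e 1, e' 1, e 2, e' 2] =
      2 * (ε 0 * ε 1 * ε 2 : ℝ) * hermTrace ε e e' f := by
  rw [wedge24]
  simp only [wedge22, hermForm_apply, Fin.sum_univ_three, h.apply, h.apply']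
  rcases hε with rfl | rfl <;> simp [hermTrace, Fin.sum_univ_three] <;> ring_nf <;> simp

/-- Multiplied by i this value becomes 8, so the independence form is nonzero on every lift of the
frame. -/
theorem volForm_wedge_conj_apply (h : IsDualFrame θ e e') :
    wedge (volForm θ) (conjForm (volForm θ)) ![e 0, e' 0, e 1, e' 1, e 2, e' 2] =
      -8 * Complex.I := by
  unfold volForm
  rw [wedge_assoc, ← volForm]
  have hv : (fun i : Fin (1 + 1 + (1 + 3)) => (![e 0, e' 0, e 1, e' 1, e 2, e' 2] : Fin 6 → W)
      (Fin.cast (by omega) i)) = ![e 0, e' 0, e 1, e' 1, e 2, e' 2] := by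
    funext i; fin_cases i <;> rfl
  rw [hv]
  rw [wedge24]
  simp [wedge13, wedge11, volForm_apply, h.apply, h.apply']
  ring_nf

theorem eq_zero_of_two (h : IsDualFrame θ e e') {ψ : W [⋀^Fin 2]→L[ℝ] ℂ}
    (h0 : ∀ i j : Fin 6, i < j → ψ ![h.basis i, h.basis j] = 0) : ψ = 0 := by
  have h2 : ψ.toAlternatingMap = 0 := by
    refine Module.Basis.ext_alternating h.basis fun v hv => ?_
    change ψ (fun i => h.basis (v i)) = 0
    rw [vec2_eta ψ]
    rcases lt_trichotomy (v 0) (v 1) with hlt | heq | hgt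
    · exact h0 _ _ hlt
    · exact absurd (hv heq) (by simp)
    · rw [map_vec2_swap, h0 _ _ hgt, neg_zero]
  ext v
  exact congrArg (fun φ : W [⋀^Fin 2]→ₗ[ℝ] ℂ => φ v) h2

/-- The covector `f(Z, ·)`, `Z = (e - i e')/2`. -/
noncomputable def _root_.EDS.contractZ (f : W [⋀^Fin 2]→L[ℝ] ℂ) (x x' : W) : W →L[ℝ] ℂ :=
  (1 / 2 : ℂ) • ((ContinuousAlternatingMap.ofSubsingleton ℝ W ℂ (0 : Fin 1)).symm (f.curryLeft x) -
    Complex.I • (ContinuousAlternatingMap.ofSubsingleton ℝ W ℂ (0 : Fin 1)).symm (f.curryLeft x'))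

theorem _root_.EDS.contractZ_apply (f : W [⋀^Fin 2]→L[ℝ] ℂ) (x x' v : W) :
    contractZ f x x' v = (1 / 2) * (f ![x, v] - Complex.I * f ![x', v]) := by
  have h1 : ∀ y : W, f.curryLeft y ![v] = f ![y, v] := fun y => rfl
  rw [← h1, ← h1]
  have h2 : ∀ y : W, (ContinuousAlternatingMap.ofSubsingleton ℝ W ℂ (0 : Fin 1)).symm
      (f.curryLeft y) v = f.curryLeft y ![v] := fun y => by
    change f.curryLeft y (fun _ => v) = _
    congr 1; funext i; fin_cases i; rfl
  simp [contractZ, h2]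

/-- The covectors `β_m` with `f = ∑ θ_m ∧ β_m` when `f` has no `(0,2)`-part. -/
noncomputable def _root_.EDS.betaForm (θ : Fin 3 → W →L[ℝ] ℂ) (e e' : Fin 3 → W)
    (f : W [⋀^Fin 2]→L[ℝ] ℂ) (m : Fin 3) : W →L[ℝ] ℂ :=
  (1 / 2 : ℂ) • contractZ f (e m) (e' m) +
    ∑ n, ((1 / 4 : ℂ) * (contractZ f (e m) (e' m) (e n) +
      Complex.I * contractZ f (e m) (e' m) (e' n))) • (Complex.conjCLE : ℂ →L[ℝ] ℂ).comp (θ n)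

set_option maxHeartbeats 1000000 in
/-- Decomposition of a complex `2`-form. -/
theorem two_form_decomp (h : IsDualFrame θ e e') (f : W [⋀^Fin 2]→L[ℝ] ℂ) :
    f = ∑ m, wedge (oneForm (θ m)) (oneForm (betaForm θ e e' f m)) +
      ∑ m, antiPart e e' f (m + 1) (m + 2) •
        conjForm (wedge (oneForm (θ (m + 1))) (oneForm (θ (m + 2)))) := by
  -- In `betaForm` the (2,0)-part has weight ½, since θ_m ∧ θ_n is produced by both β_m and β_n. The
  -- (1,1)-part needs weight 1, which is why the sum over conj θ_n adds a second half.
  rw [← sub_eq_zero]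
  refine h.eq_zero_of_two fun i j hij => ?_
  rw [h.coe_basis]
  fin_cases i <;> fin_cases j <;> first | (exact absurd hij (by decide)) | skip
  all_goals
    simp [Fin.sum_univ_three, wedge11, betaForm, contractZ_apply, antiPart, h.apply, h.apply',
      map_vec2_self,
      map_vec2_swap f (e 0) (e' 0), map_vec2_swap f (e 0) (e 1), map_vec2_swap f (e 0) (e'
      1), map_vec2_swap f (e' 0) (e 1), map_vec2_swap f (e' 0) (e' 1), map_vec2_swap f (e 0)
      (e 2), map_vec2_swap f (e 0) (e' 2), map_vec2_swap f (e' 0) (e 2), map_vec2_swap f (e'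
      0) (e' 2), map_vec2_swap f (e 1) (e' 1), map_vec2_swap f (e 1) (e 2), map_vec2_swap f
      (e 1) (e' 2), map_vec2_swap f (e' 1) (e 2), map_vec2_swap f (e' 1) (e' 2),
      map_vec2_swap f (e 2) (e' 2)]
    ring_nf
    try simp only [Complex.I_sq, Complex.I_pow_four]
    try ring_nf

/-- The coefficients of a `5`-form in its decomposition into forms of type `(3,2)` and `(2,3)`. -/
noncomputable def _root_.EDS.fiveCoeff (e e' : Fin 3 → W) (c : ℂ) (ρ : W [⋀^Fin 5]→L[ℝ] ℂ) :
    Fin 3 → ℂ :=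
  ![(1 / 8) * (ρ ![e 0, e 1, e' 1, e 2, e' 2] + c * ρ ![e' 0, e 1, e' 1, e 2, e' 2]),
    (1 / 8) * (ρ ![e 0, e' 0, e 1, e 2, e' 2] + c * ρ ![e 0, e' 0, e' 1, e 2, e' 2]),
    (1 / 8) * (ρ ![e 0, e' 0, e 1, e' 1, e 2] + c * ρ ![e 0, e' 0, e 1, e' 1, e' 2])]

/-- In complex dimension three a 5-form has only components of types (3,2) and (2,3), divisible by
θ₁θ₂θ₃ and by its conjugate respectively. This is what places F ∧ (any base 5-form) in the ideal. -/
theorem five_form_decomp (h : IsDualFrame θ e e') (ρ : W [⋀^Fin (2 + 3)]→L[ℝ] ℂ) :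
    ρ = wedge (∑ m, fiveCoeff e e' (-Complex.I) ρ m •
        conjForm (wedge (oneForm (θ (m + 1))) (oneForm (θ (m + 2))))) (volForm θ) +
      wedge (∑ m, fiveCoeff e e' Complex.I ρ m •
        wedge (oneForm (θ (m + 1))) (oneForm (θ (m + 2)))) (conjForm (volForm θ)) := by
  rw [← sub_eq_zero]
  refine h.eq_zero_of_five ?_ ?_ ?_ ?_ ?_ ?_ <;> 
    simp [wedge23, volForm_apply, h.apply, h.apply', Fin.sum_univ_three, wedge11, fiveCoeff] <;>
    ring_nf <;> simp only [Complex.I_sq] <;> ring_nf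

end IsDualFrame

theorem volForm_eq (θ : Fin 3 → W →L[ℝ] ℂ) :
    volForm θ = wedge (oneForm (θ 0)) (wedge (oneForm (θ 1)) (oneForm (θ 2))) := by
  ext v
  rw [vec3_eta (volForm θ), vec3_eta (wedge (oneForm (θ 0)) (wedge (oneForm (θ 1)) (oneForm (θ 2)))),
    volForm_apply, wedge12, wedge11, wedge11, wedge11]
  simp
  ring

/-- The exterior derivative of `θ₁ ∧ θ₂ ∧ θ₃`, given those of the `θ_i`. -/
theorem deriv_volForm_decomp {ε : Fin 3 → ℝ} (hε : ε = ![1, 1, 1] ∨ ε = ![1, -1, -1])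
    (θ : Fin 3 → W →L[ℝ] ℂ) (f : Fin 3 → W [⋀^Fin 2]→L[ℝ] ℂ) (β : Fin 3 → Fin 3 → W →L[ℝ] ℂ)
    (c : ℂ) (hf : ∀ i, f i = ∑ m, wedge (oneForm (θ m)) (oneForm (β i m)) +
      (c * ε i) • conjForm (wedge (oneForm (θ (i + 1))) (oneForm (θ (i + 2))))) (x : Fin 4 → W) :
    wedge (f 0) (wedge (oneForm (θ 1)) (oneForm (θ 2))) ![x 0, x 1, x 2, x 3] -
      wedge (oneForm (θ 0)) (wedge (f 1) (oneForm (θ 2))) ![x 0, x 1, x 2, x 3] +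
      wedge (oneForm (θ 0)) (wedge (oneForm (θ 1)) (f 2)) ![x 0, x 1, x 2, x 3] =
    wedge (oneForm (-∑ i, β i i)) (volForm θ) ![x 0, x 1, x 2, x 3] +
      2 * c * wedge (hermForm ε θ) (hermForm ε θ) ![x 0, x 1, x 2, x 3] := by
  have h' : ∀ i u v, f i ![u, v] = ∑ m, (θ m u * β i m v - θ m v * β i m u) +
      (c * ε i) * (starRingEnd ℂ) (θ (i + 1) u * θ (i + 2) v - θ (i + 1) v * θ (i + 2) u) := by
    intro i u v
    rw [hf i]
    simp [Fin.sum_univ_three, wedge11]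
    ring
  clear hf
  simp only [wedge22, wedge13, wedge12, wedge21, wedge11, volForm_apply, hermForm_apply, h',
    oneForm_apply, Fin.sum_univ_three]
  -- The (0,2)-parts contribute Σ_i c ε_i θ_jθ_k conj(θ_jθ_k). Expanding, η² = ½ Σ_i ε_jε_k θ_jθ_k
  -- conj(θ_jθ_k), and ε_jε_k = ε_i because ε₀ε₁ε₂ = 1 in both signatures; the contribution is
  -- therefore 2c η².
  rcases hε with rfl | rfl
  all_goals
    simp
    ring_nf
    simp only [Complex.I_sq]
    ring

end Coframe
end EDS

namespace EDS

/-! ### Pullback by linear maps, and smooth dependence on parameters. -/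

section Pullback

variable {W W' V : Type*} [NormedAddCommGroup W] [NormedSpace ℝ W]
  [NormedAddCommGroup W'] [NormedSpace ℝ W'] [NormedAddCommGroup V] [NormedSpace ℝ V]

theorem wedge_compCLM {A : Type*} [NormedCommRing A] [NormedAlgebra ℝ A] {k l : ℕ}
    (β : W [⋀^Fin k]→L[ℝ] A) (γ : W [⋀^Fin l]→L[ℝ] A) (L : W' →L[ℝ] W) :
    (wedge β γ).compContinuousLinearMap L =
      wedge (β.compContinuousLinearMap L) (γ.compContinuousLinearMap L) := by
  ext v
  rw [ContinuousAlternatingMap.compContinuousLinearMap_apply, wedge_apply, wedge_apply]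
  rfl

theorem volForm_compCLM (θ : Fin 3 → W →L[ℝ] ℂ) (L : W' →L[ℝ] W) :
    (volForm θ).compContinuousLinearMap L = volForm (fun k => (θ k).comp L) := by
  rw [volForm, wedge_compCLM, wedge_compCLM]
  rfl

theorem hermForm_compCLM (ε : Fin 3 → ℝ) (θ : Fin 3 → W →L[ℝ] ℂ) (L : W' →L[ℝ] W) :
    (hermForm ε θ).compContinuousLinearMap L = hermForm ε (fun k => (θ k).comp L) := by
  ext v
  rw [ContinuousAlternatingMap.compContinuousLinearMap_apply, vec2_eta (hermForm ε θ),
    hermForm_apply, vec2_eta (hermForm ε fun k => (θ k).comp L), hermForm_apply]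
  rfl

theorem contDiffOn_oneForm {θ : V → W →L[ℝ] ℂ} {X : Set V} {n : WithTop ℕ∞}
    (hθ : ContDiffOn ℝ n θ X) : ContDiffOn ℝ n (fun y => oneForm (θ y)) X :=
  (ContinuousLinearMap.contDiff (E := W →L[ℝ] ℂ) (F := W [⋀^Fin 1]→L[ℝ] ℂ)
    (ContinuousAlternatingMap.ofSubsingletonLIE (𝕜 := ℝ) (E := W) (F := ℂ)
      (0 : Fin 1)).toLinearIsometry.toContinuousLinearMap).comp_contDiffOn hθ

theorem contDiffOn_compCLM {F : Type*} [NormedAddCommGroup F] [NormedSpace ℝ F] {k : ℕ}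
    (L : W' →L[ℝ] W) {β : V → W [⋀^Fin k]→L[ℝ] F} {X : Set V} {n : WithTop ℕ∞}
    (hβ : ContDiffOn ℝ n β X) :
    ContDiffOn ℝ n (fun y => (β y).compContinuousLinearMap L) X :=
  (ContinuousLinearMap.contDiff (E := W [⋀^Fin k]→L[ℝ] F) (F := W' [⋀^Fin k]→L[ℝ] F)
    (ContinuousAlternatingMap.compContinuousLinearMapCLM L)).comp_contDiffOn hβ

set_option synthInstance.maxHeartbeats 200000 in
theorem isBoundedBilinearMap_curryLeft {F : Type*} [NormedAddCommGroup F] [NormedSpace ℝ F]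
    {k : ℕ} : IsBoundedBilinearMap ℝ
      (fun p : (W [⋀^Fin (k + 1)]→L[ℝ] F) × W => p.1.curryLeft p.2) where
  add_left f g x := by ext; simp
  smul_left c f x := by ext; simp
  add_right f x y := by simp
  smul_right c f x := by simp
  bound := ⟨1, one_pos, fun f x => by
    rw [one_mul, ← ContinuousAlternatingMap.norm_curryLeft f]
    exact f.curryLeft.le_opNorm x⟩

theorem contDiffOn_form_apply {F : Type*} [NormedAddCommGroup F] [NormedSpace ℝ F] {k : ℕ}
    {β : V → W [⋀^Fin k]→L[ℝ] F} {v : V → Fin k → W} {X : Set V} {n : WithTop ℕ∞}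
    (hβ : ContDiffOn ℝ n β X) (hv : ∀ i, ContDiffOn ℝ n (fun y => v y i) X) :
    ContDiffOn ℝ n (fun y => β y (v y)) X := by
  induction k with
  | zero =>
    have h : ContDiffOn ℝ n (fun y => ContinuousAlternatingMap.apply ℝ W F Fin.elim0 (β y)) X :=
      (ContinuousAlternatingMap.apply ℝ W F Fin.elim0).contDiff.comp_contDiffOn hβ
    refine h.congr fun y _ => ?_
    change β y (v y) = β y Fin.elim0
    congr 1
    exact Subsingleton.elim _ _
  | succ k ih =>
    have h1 : ContDiffOn ℝ n (fun y => (β y).curryLeft (v y 0)) X :=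
      (isBoundedBilinearMap_curryLeft (W := W) (F := F) (k := k)).contDiffOn_comp hβ (hv 0)
    have h2 := ih h1 (v := fun y i => v y i.succ) fun i => hv i.succ
    refine h2.congr fun y _ => ?_
    rw [ContinuousAlternatingMap.curryLeft_apply_apply]
    congr 1
    exact (Fin.cons_self_tail (v y)).symm

theorem contDiffOn_volForm {θ : Fin 3 → V → W →L[ℝ] ℂ} {X : Set V} {n : WithTop ℕ∞}
    (hθ : ∀ k, ContDiffOn ℝ n (θ k) X) : ContDiffOn ℝ n (fun y => volForm fun k => θ k y) X :=
  contDiffOn_wedge (contDiffOn_wedge (contDiffOn_oneForm (hθ 0)) (contDiffOn_oneForm (hθ 1)))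
    (contDiffOn_oneForm (hθ 2))

theorem contDiffOn_hermForm (ε : Fin 3 → ℝ) {θ : Fin 3 → V → W →L[ℝ] ℂ} {X : Set V}
    {n : WithTop ℕ∞}
    (hθ : ∀ k, ContDiffOn ℝ n (θ k) X) : ContDiffOn ℝ n (fun y => hermForm ε fun k => θ k y) X :=
  ContDiffOn.sum fun k _ => ContDiffOn.const_smul _ (contDiffOn_wedge (contDiffOn_oneForm (hθ k))
    (contDiffOn_comp_clm _ (contDiffOn_oneForm (hθ k))))

theorem extDeriv_comp_clm_right {F : Type*} [NormedAddCommGroup F] [NormedSpace ℝ F] {k : ℕ}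
    (L : W' →L[ℝ] W) {β : W → W [⋀^Fin k]→L[ℝ] F} {z : W'} (hβ : DifferentiableAt ℝ β (L z)) :
    extDeriv (fun z => (β (L z)).compContinuousLinearMap L) z =
      (extDeriv β (L z)).compContinuousLinearMap L := by
  have h := extDeriv_pullback (r := ∞) hβ L.contDiff.contDiffAt (by simp; decide)
  simpa only [ContinuousLinearMap.fderiv] using h

end Pullback

/-! ### Moving 2-forms past other factors. -/

section Commute

variable {W : Type*} [NormedAddCommGroup W] [NormedSpace ℝ W]

theorem wedge_comm21 (f : W [⋀^Fin 2]→L[ℝ] ℂ) (a : W [⋀^Fin 1]→L[ℝ] ℂ) :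
    wedge f a = castForm (by omega) (wedge a f) := by
  ext v
  rw [castForm_apply, vec3_eta (wedge f a), wedge21,
    vec3_eta (W := W) (A := ℂ) (fun v : Fin 3 → W => wedge a f v), wedge12]
  simp only [Fin.cast_refl, id]
  ring_nf

theorem wedge_comm22 (f s : W [⋀^Fin 2]→L[ℝ] ℂ) : wedge f s = wedge s f := by
  ext v
  rw [vec4_eta (wedge f s), vec4_eta (wedge s f), wedge22, wedge22]
  ring

theorem wedge_castForm_left {A : Type*} [NormedCommRing A] [NormedAlgebra ℝ A] {k k' l : ℕ}
    (h : k = k') (β : W [⋀^Fin k]→L[ℝ] A) (γ : W [⋀^Fin l]→L[ℝ] A) :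
    wedge (castForm h β) γ = castForm (by omega) (wedge β γ) := by
  subst h; rfl

theorem wedge_castForm_right {A : Type*} [NormedCommRing A] [NormedAlgebra ℝ A] {k k' l : ℕ}
    (h : k = k') (β : W [⋀^Fin l]→L[ℝ] A) (γ : W [⋀^Fin k]→L[ℝ] A) :
    wedge β (castForm h γ) = castForm (by omega) (wedge β γ) := by
  subst h; rfl

theorem castForm_castForm {A : Type*} [NormedAddCommGroup A] [NormedSpace ℝ A] {k k' k'' : ℕ}
    (h : k = k') (h' : k' = k'') (β : W [⋀^Fin k]→L[ℝ] A) :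
    castForm h' (castForm h β) = castForm (h.trans h') β := by
  subst h; subst h'; rfl

theorem castForm_add {A : Type*} [NormedAddCommGroup A] [NormedSpace ℝ A] {k k' : ℕ}
    (h : k = k') (β γ : W [⋀^Fin k]→L[ℝ] A) :
    castForm h (β + γ) = castForm h β + castForm h γ := by
  subst h; rfl

theorem wedge_assoc_form {A : Type*} [NormedCommRing A] [NormedAlgebra ℝ A] {k l m : ℕ}
    (β : W [⋀^Fin k]→L[ℝ] A) (γ : W [⋀^Fin l]→L[ℝ] A) (δ : W [⋀^Fin m]→L[ℝ] A) :
    wedge (wedge β γ) δ = castForm (Nat.add_assoc k l m).symm (wedge β (wedge γ δ)) := by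
  ext v
  rw [wedge_assoc, castForm_apply]

theorem wedge_assoc_form' {A : Type*} [NormedCommRing A] [NormedAlgebra ℝ A] {k l m : ℕ}
    (β : W [⋀^Fin k]→L[ℝ] A) (γ : W [⋀^Fin l]→L[ℝ] A) (δ : W [⋀^Fin m]→L[ℝ] A) :
    wedge β (wedge γ δ) = castForm (Nat.add_assoc k l m) (wedge (wedge β γ) δ) := by
  rw [wedge_assoc_form, castForm_castForm]; rfl

/-- A 2-form has even degree and passes other factors without a sign. This brings a product F ∧ g to
the right-hand end, the position in which the ideal absorbs factors from the left. -/
theorem wedge_left_comm21 {m : ℕ} (f : W [⋀^Fin 2]→L[ℝ] ℂ) (a : W [⋀^Fin 1]→L[ℝ] ℂ)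
    (g : W [⋀^Fin m]→L[ℝ] ℂ) :
    wedge f (wedge a g) = castForm (by omega) (wedge a (wedge f g)) := by
  rw [wedge_assoc_form', wedge_comm21, wedge_castForm_left, wedge_assoc_form, castForm_castForm,
    castForm_castForm]

theorem wedge_left_comm22 {m : ℕ} (f s : W [⋀^Fin 2]→L[ℝ] ℂ) (g : W [⋀^Fin m]→L[ℝ] ℂ) :
    wedge f (wedge s g) = wedge s (wedge f g) := by
  rw [wedge_assoc_form', wedge_comm22, wedge_assoc_form, castForm_castForm]; rfl

theorem CIdeal.castForm {X : Set W} {G : FormFamily W} {k k' : ℕ} (h : k = k')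
    {ψ : W → W [⋀^Fin k]→L[ℝ] ℂ} (hψ : CIdeal X G k ψ) :
    CIdeal X G k' (fun z => EDS.castForm h (ψ z)) := by
  subst h; exact hψ

end Commute

end EDS

/-! ### Dual frames and quasi-integrable coframings. -/

namespace PseudoHYM

open EDS

/-- The real frame dual to the coframe `α`: `frameVec α y 1` is `e` and `frameVec α y i` is `Je`. -/
noncomputable def frameVec (α : R6 → R6 →L[ℝ] (Fin 3 → ℂ)) (y : R6) (c : ℂ) (k : Fin 3) : R6 :=
  (α y).inverse (Pi.single k c)

/-- A smooth coframing on an open set whose structure equations are quasi-integrable. -/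
structure IsQuasiCoframing (ε : Fin 3 → ℝ) (V : Set R6) (α : R6 → R6 →L[ℝ] (Fin 3 → ℂ)) :
    Prop where
  signature : ε = ![1, 1, 1] ∨ ε = ![1, -1, -1]
  isOpen : IsOpen V
  smooth : ContDiffOn ℝ ∞ α V
  bijective : ∀ y ∈ V, Function.Bijective (α y)
  quasi : ∀ y ∈ V, ∃ c : ℂ, ∀ i m, antiPart (frameVec α y 1) (frameVec α y Complex.I)
    (extDeriv (fun y => oneForm (comp α i y)) y) (m + 1) (m + 2) = if i = m then c * ε i else 0

theorem isInvertible_of_bijective {A : R6 →L[ℝ] (Fin 3 → ℂ)} (h : Function.Bijective A) :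
    A.IsInvertible :=
  ⟨(LinearEquiv.ofBijective (A : R6 →ₗ[ℝ] (Fin 3 → ℂ)) h).toContinuousLinearEquiv, by ext; rfl⟩

theorem apply_frameVec {α : R6 → R6 →L[ℝ] (Fin 3 → ℂ)} {y : R6}
    (h : Function.Bijective (α y)) (c : ℂ) (k : Fin 3) :
    α y (frameVec α y c k) = Pi.single k c := by
  obtain ⟨e, he⟩ := isInvertible_of_bijective h
  rw [frameVec, ← he, ContinuousLinearMap.inverse_equiv]
  exact e.apply_symm_apply _

theorem isDualFrame_frameVec {α : R6 → R6 →L[ℝ] (Fin 3 → ℂ)} {y : R6}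
    (h : Function.Bijective (α y)) :
    IsDualFrame (fun k => comp α k y) (frameVec α y 1) (frameVec α y Complex.I) := by
  have ha : ∀ c k j, comp α k y (frameVec α y c j) = if k = j then c else 0 := fun c k j => by
    change α y (frameVec α y c j) k = _
    rw [apply_frameVec h, Pi.single_apply]
  refine ⟨ha 1, ha Complex.I, fun v => h.1 ?_⟩
  funext k
  change comp α k y v = comp α k y _
  rw [map_sum]
  simp only [map_add, map_smul, ha, Complex.real_smul, mul_ite, mul_one, mul_zero,
    Finset.sum_add_distrib, Finset.sum_ite_eq, Finset.mem_univ, if_true]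
  exact (Complex.re_add_im _).symm

theorem isOpen_domX {V : Set R6} (hV : IsOpen V) (r : ℕ) : IsOpen (domX r V) :=
  hV.prod isOpen_univ

/-! ### Smoothness of the tautological and curvature forms on X. -/

section Smooth

variable {ε : Fin 3 → ℝ} {V : Set R6} {α : R6 → R6 →L[ℝ] (Fin 3 → ℂ)} {r : ℕ}

theorem contDiffOn_comp (hα : ContDiffOn ℝ ∞ α V) (k : Fin 3) : ContDiffOn ℝ ∞ (comp α k) V :=
  contDiffOn_const.clm_comp hα

theorem contDiffOn_frameVec (h : IsQuasiCoframing ε V α) (c : ℂ) (k : Fin 3) :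
    ContDiffOn ℝ ∞ (fun y => frameVec α y c k) V := by
  intro y hy
  have h1 : ContDiffAt ℝ ∞ ContinuousLinearMap.inverse (α y) :=
    (isInvertible_of_bijective (h.bijective y hy)).contDiffAt_map_inverse
  have h2 := h1.comp_contDiffWithinAt y (h.smooth y hy)
  exact h2.clm_apply contDiffWithinAt_const

/-- A base form pulled back to `X`. -/
noncomputable def pull (r : ℕ) {k : ℕ} (β : R6 → R6 [⋀^Fin k]→L[ℝ] ℂ) (z : Tot r) :
    Tot r [⋀^Fin k]→L[ℝ] ℂ :=
  (β z.1).compContinuousLinearMap (ContinuousLinearMap.fst ℝ R6 (Fib r))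

theorem contDiffOn_fst_comp {F : Type*} [NormedAddCommGroup F] [NormedSpace ℝ F] {g : R6 → F}
    (hg : ContDiffOn ℝ ∞ g V) : ContDiffOn ℝ ∞ (fun z : Tot r => g z.1) (domX r V) :=
  hg.comp contDiff_fst.contDiffOn fun _ hz => hz.1

theorem contDiffOn_pull {k : ℕ} {β : R6 → R6 [⋀^Fin k]→L[ℝ] ℂ} (hβ : ContDiffOn ℝ ∞ β V) :
    ContDiffOn ℝ ∞ (pull r β) (domX r V) :=
  contDiffOn_compCLM _ (contDiffOn_fst_comp hβ)

theorem extDeriv_pull {k : ℕ} {β : R6 → R6 [⋀^Fin k]→L[ℝ] ℂ} {z : Tot r}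
    (hβ : DifferentiableAt ℝ β z.1) : extDeriv (pull r β) z = pull r (extDeriv β) z :=
  extDeriv_comp_clm_right (ContinuousLinearMap.fst ℝ R6 (Fib r)) hβ

theorem theta123_eq (r : ℕ) (α : R6 → R6 →L[ℝ] (Fin 3 → ℂ)) :
    theta123 r α = pull r (fun y => volForm fun k => comp α k y) := by
  funext z
  exact (volForm_compCLM (fun k => comp α k z.1) _).symm

theorem etaForm_eq (r : ℕ) (ε : Fin 3 → ℝ) (α : R6 → R6 →L[ℝ] (Fin 3 → ℂ)) :
    etaForm r ε α = pull r (fun y => hermForm ε fun k => comp α k y) := by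
  funext z
  exact (hermForm_compCLM ε (fun k => comp α k z.1) _).symm

theorem pull_wedge {k l : ℕ} (β : R6 → R6 [⋀^Fin k]→L[ℝ] ℂ) (γ : R6 → R6 [⋀^Fin l]→L[ℝ] ℂ)
    (z : Tot r) : pull r (fun y => wedge (β y) (γ y)) z = wedge (pull r β z) (pull r γ z) :=
  wedge_compCLM _ _ _

theorem contDiffOn_connMatrix (hα : ContDiffOn ℝ ∞ α V) (i j : Fin r) :
    ContDiffOn ℝ ∞ (fun z : Tot r => connMatrix α z.1 z.2 i j) (domX r V) := by
  have hp : ∀ k i j, ContDiff ℝ ∞ (fun z : Tot r => z.2 k i j) := fun k i j =>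
    (ContinuousLinearMap.contDiff ((ContinuousLinearMap.proj (R := ℝ) (φ := fun _ : Fin r => ℂ) j).comp
      ((ContinuousLinearMap.proj (R := ℝ) (φ := fun _ : Fin r => Fin r → ℂ) i).comp
      ((ContinuousLinearMap.proj (R := ℝ) (φ := fun _ : Fin 3 => Fin r → Fin r → ℂ) k).comp
        (ContinuousLinearMap.snd ℝ R6 (Fib r))))))
  have hc : ∀ k, ContDiffOn ℝ ∞ (fun z : Tot r => comp α k z.1) (domX r V) := fun k =>
    contDiffOn_fst_comp (contDiffOn_comp hα k)
  refine ContDiffOn.sum fun k _ => ContDiffOn.sub ?_ ?_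
  · exact (hp k i j).contDiffOn.smul (hc k)
  · exact (Complex.conjCLE.contDiff.comp_contDiffOn (hp k j i).contDiffOn).smul
      (contDiffOn_const.clm_comp (hc k))

theorem contDiffOn_tautForm (hα : ContDiffOn ℝ ∞ α V) (i j : Fin r) :
    ContDiffOn ℝ ∞ (tautForm α i j) (domX r V) :=
  contDiffOn_oneForm ((contDiffOn_connMatrix hα i j).clm_comp contDiffOn_const)

theorem contDiffOn_curvForm (hV : IsOpen V) (hα : ContDiffOn ℝ ∞ α V) (i j : Fin r) :
    ContDiffOn ℝ ∞ (curvForm α i j) (domX r V) :=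
  (contDiffOn_extDeriv (isOpen_domX hV r) (contDiffOn_tautForm hα i j)).add
    (ContDiffOn.sum fun _ _ => contDiffOn_wedge (contDiffOn_tautForm hα _ _)
      (contDiffOn_tautForm hα _ _))

theorem contDiffOn_theta123 (hα : ContDiffOn ℝ ∞ α V) :
    ContDiffOn ℝ ∞ (theta123 r α) (domX r V) := by
  rw [theta123_eq]
  exact contDiffOn_pull (contDiffOn_volForm fun k => contDiffOn_comp hα k)

theorem contDiffOn_etaForm (hα : ContDiffOn ℝ ∞ α V) :
    ContDiffOn ℝ ∞ (etaForm r ε α) (domX r V) := by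
  rw [etaForm_eq]
  exact contDiffOn_pull (contDiffOn_hermForm ε fun k => contDiffOn_comp hα k)

theorem contDiffOn_Upsilon (hV : IsOpen V) (hα : ContDiffOn ℝ ∞ α V) (i j : Fin r) :
    ContDiffOn ℝ ∞ (Upsilon α i j) (domX r V) :=
  contDiffOn_wedge (contDiffOn_curvForm hV hα i j) (contDiffOn_theta123 hα)

theorem contDiffOn_Psi (hV : IsOpen V) (hα : ContDiffOn ℝ ∞ α V) (i j : Fin r) :
    ContDiffOn ℝ ∞ (Psi ε α i j) (domX r V) :=
  contDiffOn_wedge (contDiffOn_curvForm hV hα i j)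
    (contDiffOn_wedge (contDiffOn_etaForm hα) (contDiffOn_etaForm hα))

theorem differentiableAt_of_contDiffOn {E F : Type*} [NormedAddCommGroup E] [NormedSpace ℝ E]
    [NormedAddCommGroup F] [NormedSpace ℝ F] {g : E → F} {X : Set E} (hX : IsOpen X)
    (hg : ContDiffOn ℝ ∞ g X) {z : E} (hz : z ∈ X) : DifferentiableAt ℝ g z :=
  (hg.contDiffAt (hX.mem_nhds hz)).differentiableAt (by simp)

end Smooth

/-! ### Skew-Hermitian symmetry of F, and the Bianchi identity. -/

section Bianchi

theorem wedge11_apply {W : Type*} [NormedAddCommGroup W] [NormedSpace ℝ W]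
    (β γ : W [⋀^Fin 1]→L[ℝ] ℂ) (v : Fin (1 + 1) → W) :
    wedge β γ v = β ![v 0] * γ ![v 1] - β ![v 1] * γ ![v 0] := by
  rw [← wedge11]
  congr 1
  funext i
  fin_cases i <;> rfl

theorem castForm_sum {W A ι : Type*} [NormedAddCommGroup W] [NormedSpace ℝ W]
    [NormedAddCommGroup A] [NormedSpace ℝ A] {k k' : ℕ} (h : k = k') (s : Finset ι)
    (β : ι → W [⋀^Fin k]→L[ℝ] A) :
    castForm h (∑ i ∈ s, β i) = ∑ i ∈ s, castForm h (β i) := by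
  subst h; rfl

variable {ε : Fin 3 → ℝ} {V : Set R6} {α : R6 → R6 →L[ℝ] (Fin 3 → ℂ)} {r : ℕ}

theorem conj_connMatrix (y : R6) (p : Fib r) (i j : Fin r) (v : R6) :
    (starRingEnd ℂ) (connMatrix α y p j i v) = -connMatrix α y p i j v := by
  simp [connMatrix, Fin.sum_univ_three]

theorem conj_tautForm (i j : Fin r) (z : Tot r) :
    conjForm (tautForm α j i z) = -tautForm α i j z := by
  ext v
  exact conj_connMatrix _ _ _ _ _

/-- The matrix A satisfies A* = −A, and conjugate transposition of A ∧ A reverses two anticommuting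
1-forms, so F* = −F. Through this identity the conjugates of the generators are again multiples of
F. -/
theorem conj_curvForm (hV : IsOpen V) (hα : ContDiffOn ℝ ∞ α V) (i j : Fin r) {z : Tot r}
    (hz : z ∈ domX r V) : conjForm (curvForm α j i z) = -curvForm α i j z := by
  have hd : ∀ i j, DifferentiableAt ℝ (tautForm α i j) z := fun i j =>
    differentiableAt_of_contDiffOn (isOpen_domX hV r) (contDiffOn_tautForm hα i j) hz
  have h1 : conjForm (extDeriv (tautForm α j i) z) = -extDeriv (tautForm α i j) z := by
    have h2 := extDeriv_comp_clm (Complex.conjCLE : ℂ →L[ℝ] ℂ) (hd j i)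
    have h3 : (fun z => (Complex.conjCLE : ℂ →L[ℝ] ℂ).compContinuousAlternatingMap
        (tautForm α j i z)) = fun z => (-ContinuousLinearMap.id ℝ ℂ).compContinuousAlternatingMap
          (tautForm α i j z) := by
      funext z
      ext v
      exact conj_connMatrix _ _ _ _ _
    rw [h3, extDeriv_comp_clm _ (hd i j)] at h2
    exact h2.symm
  have h4 : ∀ k, conjForm (wedge (tautForm α j k z) (tautForm α k i z)) =
      -wedge (tautForm α i k z) (tautForm α k j z) := fun k => by
    rw [conjForm_wedge, conj_tautForm, conj_tautForm]
    ext v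
    rw [ContinuousAlternatingMap.neg_apply, wedge11_apply, wedge11_apply]
    simp only [ContinuousAlternatingMap.neg_apply]
    ring
  have h5 : conjForm (curvForm α j i z) = conjForm (extDeriv (tautForm α j i) z) +
      ∑ k, conjForm (wedge (tautForm α j k z) (tautForm α k i z)) := by
    ext v
    simp [curvForm]
  rw [h5, h1, Finset.sum_congr rfl fun k _ => h4 k, Finset.sum_neg_distrib, curvForm, neg_add]

/-- The Bianchi identity. -/
theorem extDeriv_curvForm (hV : IsOpen V) (hα : ContDiffOn ℝ ∞ α V) (i j : Fin r) {z : Tot r}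
    (hz : z ∈ domX r V) : extDeriv (curvForm α i j) z =
      ∑ k, (wedge (curvForm α i k z) (tautForm α k j z) +
        (-1 : ℂ) • castForm (by omega) (wedge (tautForm α i k z) (curvForm α k j z))) := by
  have hX := isOpen_domX hV r
  have hT := fun i j => contDiffOn_tautForm (r := r) hα i j
  have hd : ∀ i j, DifferentiableAt ℝ (tautForm α i j) z := fun i j =>
    differentiableAt_of_contDiffOn hX (hT i j) hz
  have h1 : extDeriv (extDeriv (tautForm α i j)) z = 0 :=
    extDeriv_extDeriv_apply ((hT i j).contDiffAt (hX.mem_nhds hz)) (by simp; decide)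
  have hdd : DifferentiableAt ℝ (extDeriv (tautForm α i j)) z :=
    differentiableAt_of_contDiffOn hX (contDiffOn_extDeriv hX (hT i j)) hz
  have hdw : ∀ k, DifferentiableAt ℝ (fun z => wedge (tautForm α i k z) (tautForm α k j z)) z :=
    fun k => differentiableAt_of_contDiffOn hX (contDiffOn_wedge (hT i k) (hT k j)) hz
  have h2 : extDeriv (curvForm α i j) z =
      ∑ k, extDeriv (fun z => wedge (tautForm α i k z) (tautForm α k j z)) z := by
    have h3 : curvForm α i j = extDeriv (tautForm α i j) +
        fun z => ∑ k, wedge (tautForm α i k z) (tautForm α k j z) := rfl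
    rw [h3, extDeriv_add hdd (DifferentiableAt.fun_sum fun k _ => hdw k), h1, zero_add]
    ext v
    rw [extDeriv, fderiv_fun_sum fun k _ => hdw k]
    simp [ContinuousAlternatingMap.alternatizeUncurryFin_apply, extDeriv, Finset.smul_sum,
      Finset.sum_comm (s := (Finset.univ : Finset (Fin r)))]
  have h4 : ∀ k, extDeriv (fun z => wedge (tautForm α i k z) (tautForm α k j z)) z =
      wedge (extDeriv (tautForm α i k) z) (tautForm α k j z) +
        (-1 : ℂ) • castForm (by omega) (wedge (tautForm α i k z) (extDeriv (tautForm α k j) z)) := by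
    intro k
    ext v
    rw [extDeriv_wedge (hd i k) (hd k j), pow_one, neg_one_smul,
      ContinuousAlternatingMap.add_apply, ContinuousAlternatingMap.smul_apply, castForm_apply,
      neg_one_smul]
    rfl
  have h5 : ∀ k, wedge (curvForm α i k z) (tautForm α k j z) =
      wedge (extDeriv (tautForm α i k) z) (tautForm α k j z) +
        ∑ l, castForm (by omega)
          (wedge (tautForm α i l z) (wedge (tautForm α l k z) (tautForm α k j z))) := by
    intro k
    rw [curvForm, wedge_add_left, wedge_sum_left]
    simp only [wedge_assoc_form]
  have h6 : ∀ k, castForm (by omega : 1 + 2 = 2 + 1)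
        (wedge (tautForm α i k z) (curvForm α k j z)) =
      castForm (by omega) (wedge (tautForm α i k z) (extDeriv (tautForm α k j) z)) +
        ∑ l, castForm (by omega)
          (wedge (tautForm α i k z) (wedge (tautForm α k l z) (tautForm α l j z))) := by
    intro k
    rw [curvForm, wedge_add_right, wedge_sum_right, castForm_add, castForm_sum]
  rw [h2]
  simp only [h4, h5, h6, Finset.sum_add_distrib, smul_add, ← Finset.smul_sum]
  -- The cubic terms A ∧ A ∧ A of F ∧ A and of A ∧ F are one double sum with the summation indices
  -- exchanged, so they cancel.
  rw [Finset.sum_comm (f := fun k l => castForm _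
          (wedge (tautForm α i l z) (wedge (tautForm α l k z) (tautForm α k j z))))]
  module

end Bianchi

end PseudoHYM

namespace PseudoHYM

open EDS

/-! ### The exterior derivative of α¹ ∧ α² ∧ α³. -/

section Closed

variable {ε : Fin 3 → ℝ} {V : Set R6} {α : R6 → R6 →L[ℝ] (Fin 3 → ℂ)} {r : ℕ}

theorem contDiffOn_extDeriv_comp (h : IsQuasiCoframing ε V α) (i : Fin 3) :
    ContDiffOn ℝ ∞ (fun y => extDeriv (fun y => oneForm (comp α i y)) y) V :=
  contDiffOn_extDeriv h.isOpen (contDiffOn_oneForm (contDiffOn_comp h.smooth i))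

/-- The covector `κ` in `d(α¹∧α²∧α³) = κ ∧ α¹∧α²∧α³ + μ η²`. -/
noncomputable def kappa (α : R6 → R6 →L[ℝ] (Fin 3 → ℂ)) (y : R6) : R6 →L[ℝ] ℂ :=
  -∑ i, betaForm (fun k => comp α k y) (frameVec α y 1) (frameVec α y Complex.I)
    (extDeriv (fun y => oneForm (comp α i y)) y) i

/-- The ideal admits only smooth coefficients, so a decomposition valid point by point is not
enough. The coefficient forms are given by explicit formulas in the dual frame, whose smoothness can
be read off. -/
theorem contDiffOn_betaForm {θ : Fin 3 → R6 → R6 →L[ℝ] ℂ} {e e' : R6 → Fin 3 → R6}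
    {f : R6 → R6 [⋀^Fin 2]→L[ℝ] ℂ} (hθ : ∀ k, ContDiffOn ℝ ∞ (θ k) V)
    (he : ∀ k, ContDiffOn ℝ ∞ (fun y => e y k) V) (he' : ∀ k, ContDiffOn ℝ ∞ (fun y => e' y k) V)
    (hf : ContDiffOn ℝ ∞ f V) (m : Fin 3) :
    ContDiffOn ℝ ∞ (fun y => betaForm (fun k => θ k y) (e y) (e' y) (f y) m) V := by
  have h1 : ∀ v : R6 → R6, ContDiffOn ℝ ∞ v V →
      ContDiffOn ℝ ∞ (fun y => contractZ (f y) (e y m) (e' y m) (v y)) V := by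
    intro v hv
    have h2 : ∀ u : R6 → R6, ContDiffOn ℝ ∞ u V → ContDiffOn ℝ ∞ (fun y => f y ![u y, v y]) V :=
      fun u hu => contDiffOn_form_apply hf fun i => by
        fin_cases i
        exacts [hu, hv]
    simp only [contractZ_apply]
    exact contDiffOn_const.mul ((h2 _ (he m)).sub (contDiffOn_const.mul (h2 _ (he' m))))
  rw [contDiffOn_clm_apply]
  intro v
  have h3 := h1 (fun _ => v) contDiffOn_const
  simp only [betaForm, _root_.add_apply, _root_.smul_apply, _root_.sum_apply, smul_eq_mul]
  refine (contDiffOn_const.mul h3).add (ContDiffOn.sum fun n _ => ContDiffOn.mul ?_ ?_)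
  · exact contDiffOn_const.mul ((h1 _ (he n)).add (contDiffOn_const.mul (h1 _ (he' n))))
  · exact Complex.conjCLE.contDiff.comp_contDiffOn ((hθ n).clm_apply contDiffOn_const)

theorem contDiffOn_kappa (h : IsQuasiCoframing ε V α) : ContDiffOn ℝ ∞ (kappa α) V :=
  (ContDiffOn.sum fun i _ => contDiffOn_betaForm (contDiffOn_comp h.smooth)
    (contDiffOn_frameVec h 1) (contDiffOn_frameVec h Complex.I)
      (contDiffOn_extDeriv_comp h i) i).neg

/-- The function `μ` in `d(α¹∧α²∧α³) = κ ∧ α¹∧α²∧α³ + μ η²`. -/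
noncomputable def muFun (α : R6 → R6 →L[ℝ] (Fin 3 → ℂ)) (y : R6) : ℂ :=
  2 * antiPart (frameVec α y 1) (frameVec α y Complex.I)
    (extDeriv (fun y => oneForm (comp α 0 y)) y) 1 2

theorem contDiffOn_muFun (h : IsQuasiCoframing ε V α) : ContDiffOn ℝ ∞ (muFun α) V := by
  have h1 : ∀ u v : R6 → R6, ContDiffOn ℝ ∞ u V → ContDiffOn ℝ ∞ v V → ContDiffOn ℝ ∞
      (fun y => extDeriv (fun y => oneForm (comp α 0 y)) y ![u y, v y]) V :=
    fun u v hu hv => contDiffOn_form_apply (contDiffOn_extDeriv_comp h 0) fun i => by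
      fin_cases i
      exacts [hu, hv]
  have h2 := contDiffOn_frameVec h 1
  have h3 := contDiffOn_frameVec h Complex.I
  unfold muFun antiPart
  exact contDiffOn_const.mul (contDiffOn_const.mul ((((h1 _ _ (h2 1) (h2 2)).add
    (contDiffOn_const.mul (h1 _ _ (h3 1) (h2 2)))).add
    (contDiffOn_const.mul (h1 _ _ (h2 1) (h3 2)))).sub (h1 _ _ (h3 1) (h3 2))))

theorem wedge_sub_right {W : Type*} [NormedAddCommGroup W] [NormedSpace ℝ W] {k l : ℕ}
    (β : W [⋀^Fin k]→L[ℝ] ℂ) (γ γ' : W [⋀^Fin l]→L[ℝ] ℂ) :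
    wedge β (γ - γ') = wedge β γ - wedge β γ' := by
  rw [eq_sub_iff_add_eq, ← wedge_add_right, sub_add_cancel]

theorem wedge_deriv_rearrange {W : Type*} [NormedAddCommGroup W] [NormedSpace ℝ W]
    (f0 f1 f2 : W [⋀^Fin 2]→L[ℝ] ℂ) (t0 t1 t2 : W [⋀^Fin 1]→L[ℝ] ℂ) (v : Fin 4 → W) {d : ℂ}
    (h : wedge f0 (wedge t1 t2) ![v 0, v 1, v 2, v 3] -
      wedge t0 (wedge f1 t2) ![v 0, v 1, v 2, v 3] +
      wedge t0 (wedge t1 f2) ![v 0, v 1, v 2, v 3] = d) :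
    wedge f0 (wedge t1 t2) (fun i => v (Fin.cast rfl i)) +
      (-1 : ℤ) ^ 1 • wedge t0 (wedge f1 t2 - wedge t1 f2) v = d := by
  have e0 : wedge f0 (wedge t1 t2) (fun i => v (Fin.cast rfl i)) =
      wedge f0 (wedge t1 t2) ![v 0, v 1, v 2, v 3] := by
    congr 1; funext i; fin_cases i <;> rfl
  have e1 : wedge t0 (wedge f1 t2) v = wedge t0 (wedge f1 t2) ![v 0, v 1, v 2, v 3] := by
    congr 1; funext i; fin_cases i <;> rfl
  have e2 : wedge t0 (wedge t1 f2) v = wedge t0 (wedge t1 f2) ![v 0, v 1, v 2, v 3] := by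
    congr 1; funext i; fin_cases i <;> rfl
  rw [wedge_sub_right, pow_one, neg_one_smul, ContinuousAlternatingMap.sub_apply, ← h, e0, e1, e2]
  ring

theorem pull_eq_add {k : ℕ} {ρ a b : R6 → R6 [⋀^Fin k]→L[ℝ] ℂ} {z : Tot r}
    (h : ρ z.1 = a z.1 + b z.1) : pull r ρ z = pull r a z + pull r b z := by
  rw [pull, h]
  rfl

/-- The point at which quasi-integrability enters. For a general almost complex structure the
(2,2)-part of d(α¹α²α³) involves the whole Nijenhuis matrix; when that matrix is λ·diag(ε), it
collapses to the multiple 2λ of η². -/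
theorem extDeriv_volForm (h : IsQuasiCoframing ε V α) {y : R6} (hy : y ∈ V) :
    extDeriv (fun y => volForm fun k => comp α k y) y =
      wedge (oneForm (kappa α y)) (volForm fun k => comp α k y) +
        muFun α y • wedge (hermForm ε fun k => comp α k y) (hermForm ε fun k => comp α k y) := by
  obtain ⟨c, hc⟩ := h.quasi y hy
  have hD := isDualFrame_frameVec (h.bijective y hy)
  have hd : ∀ i, DifferentiableAt ℝ (fun y => oneForm (comp α i y)) y := fun i =>
    differentiableAt_of_contDiffOn h.isOpen (contDiffOn_oneForm (contDiffOn_comp h.smooth i)) hy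
  have hd12 : DifferentiableAt ℝ (fun y => wedge (oneForm (comp α 1 y)) (oneForm (comp α 2 y))) y :=
    differentiableAt_of_contDiffOn h.isOpen (contDiffOn_wedge
      (contDiffOn_oneForm (contDiffOn_comp h.smooth 1))
      (contDiffOn_oneForm (contDiffOn_comp h.smooth 2))) hy
  -- The first sign ε₀ is 1 in both signatures, so the pointwise scalar c is a coefficient of the
  -- first dα; this identifies it with the smooth function `muFun`.
  have hmu : muFun α y = 2 * c := by
    have h1 := hc 0 0
    have h2 : ε 0 = 1 := by rcases h.signature with h | h <;> simp [h]
    simp only [if_true, h2] at h1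
    change antiPart _ _ _ 1 2 = _ at h1
    rw [muFun, h1]
    simp
  have hf := deriv_volForm_decomp h.signature (fun k => comp α k y)
    (fun i => extDeriv (fun y => oneForm (comp α i y)) y)
    (fun i => betaForm (fun k => comp α k y) (frameVec α y 1) (frameVec α y Complex.I)
      (extDeriv (fun y => oneForm (comp α i y)) y)) c (fun i => by
      conv_lhs => rw [hD.two_form_decomp (extDeriv (fun y => oneForm (comp α i y)) y)]
      congr 1
      rw [Finset.sum_eq_single i]
      · rw [hc, if_pos rfl]
      · intro m _ hm
        rw [hc, if_neg (Ne.symm hm)]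
        ext v
        simp
      · simp)
  have hv : (fun y => volForm fun k => comp α k y) =
      fun y => wedge (oneForm (comp α 0 y)) (wedge (oneForm (comp α 1 y)) (oneForm (comp α 2 y))) :=
    funext fun y => volForm_eq _
  ext v
  rw [hv, hmu]
  have h4 := extDeriv_wedge (hd 0) hd12 v
  have h5 : extDeriv (fun y => wedge (oneForm (comp α 1 y)) (oneForm (comp α 2 y))) y =
      wedge (extDeriv (fun y => oneForm (comp α 1 y)) y) (oneForm (comp α 2 y)) -
      wedge (oneForm (comp α 1 y)) (extDeriv (fun y => oneForm (comp α 2 y)) y) := by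
    ext w
    rw [extDeriv_wedge (hd 1) (hd 2), pow_one, neg_one_smul, ← sub_eq_add_neg]
    rfl
  rw [h4, h5]
  rw [wedge_deriv_rearrange _ _ _ _ _ _ v (hf v)]
  have hv4 : (![v 0, v 1, v 2, v 3] : Fin 4 → R6) = v := by
    funext i; fin_cases i <;> rfl
  rw [hv4]
  rfl

theorem extDeriv_volForm_cast (h : IsQuasiCoframing ε V α) {y : R6} (hy : y ∈ V) :
    extDeriv (fun y => volForm fun k => comp α k y) y =
      castForm (by omega) (wedge (oneForm (kappa α y)) (volForm fun k => comp α k y)) +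
        castForm (by omega) (muFun α y •
          wedge (hermForm ε fun k => comp α k y) (hermForm ε fun k => comp α k y)) := by
  rw [extDeriv_volForm h hy]
  rfl

end Closed
end PseudoHYM

namespace PseudoHYM

open EDS

/-! ### Closure of the ideal under d. -/

section Closed

variable {ε : Fin 3 → ℝ} {V : Set R6} {α : R6 → R6 →L[ℝ] (Fin 3 → ℂ)} {r : ℕ}

theorem contDiffOn_fiveCoeff (h : IsQuasiCoframing ε V α)
    {ρ : R6 → R6 [⋀^Fin 5]→L[ℝ] ℂ} (hρ : ContDiffOn ℝ ∞ ρ V) (c : ℂ) (m : Fin 3) :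
    ContDiffOn ℝ ∞ (fun y => fiveCoeff (frameVec α y 1) (frameVec α y Complex.I) c (ρ y) m) V := by
  have h2 := contDiffOn_frameVec h 1
  have h3 := contDiffOn_frameVec h Complex.I
  have h5 : ∀ a b c d e : R6 → R6, ContDiffOn ℝ ∞ a V → ContDiffOn ℝ ∞ b V →
      ContDiffOn ℝ ∞ c V → ContDiffOn ℝ ∞ d V → ContDiffOn ℝ ∞ e V →
      ContDiffOn ℝ ∞ (fun y => ρ y ![a y, b y, c y, d y, e y]) V :=
    fun a b c d e ha hb hc hd he => contDiffOn_form_apply hρ fun i => by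
      fin_cases i
      exacts [ha, hb, hc, hd, he]
  fin_cases m
  · exact contDiffOn_const.mul (ContDiffOn.add (h5 _ _ _ _ _ (h2 0) (h2 1) (h3 1) (h2 2) (h3 2))
      (contDiffOn_const.mul (h5 _ _ _ _ _ (h3 0) (h2 1) (h3 1) (h2 2) (h3 2))))
  · exact contDiffOn_const.mul (ContDiffOn.add (h5 _ _ _ _ _ (h2 0) (h3 0) (h2 1) (h2 2) (h3 2))
      (contDiffOn_const.mul (h5 _ _ _ _ _ (h2 0) (h3 0) (h3 1) (h2 2) (h3 2))))
  · exact contDiffOn_const.mul (ContDiffOn.add (h5 _ _ _ _ _ (h2 0) (h3 0) (h2 1) (h3 1) (h2 2))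
      (contDiffOn_const.mul (h5 _ _ _ _ _ (h2 0) (h3 0) (h2 1) (h3 1) (h3 2))))

theorem exists_five_form_decomp (h : IsQuasiCoframing ε V α)
    {ρ : R6 → R6 [⋀^Fin (2 + 3)]→L[ℝ] ℂ} (hρ : ContDiffOn ℝ ∞ ρ V) :
    ∃ σ σ' : R6 → R6 [⋀^Fin 2]→L[ℝ] ℂ, ContDiffOn ℝ ∞ σ V ∧ ContDiffOn ℝ ∞ σ' V ∧
      ∀ y ∈ V, ρ y = wedge (σ y) (volForm fun k => comp α k y) +
        wedge (σ' y) (conjForm (volForm fun k => comp α k y)) := by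
  have hθ : ∀ k, ContDiffOn ℝ ∞ (fun y => oneForm (comp α k y)) V := fun k =>
    contDiffOn_oneForm (contDiffOn_comp h.smooth k)
  have hσ : ContDiffOn ℝ ∞ (fun y =>
    ∑ m, fiveCoeff (frameVec α y 1) (frameVec α y Complex.I) (-Complex.I) (ρ y) m •
      conjForm (wedge (oneForm (comp α (m + 1) y)) (oneForm (comp α (m + 2) y)))) V :=
    ContDiffOn.sum fun m _ => (contDiffOn_fiveCoeff h hρ _ m).smul
      (contDiffOn_comp_clm _ (contDiffOn_wedge (hθ _) (hθ _)))
  have hσ' : ContDiffOn ℝ ∞ (fun y =>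
    ∑ m, fiveCoeff (frameVec α y 1) (frameVec α y Complex.I) Complex.I (ρ y) m •
      wedge (oneForm (comp α (m + 1) y)) (oneForm (comp α (m + 2) y))) V :=
    ContDiffOn.sum fun m _ => (contDiffOn_fiveCoeff h hρ _ m).smul
      (contDiffOn_wedge (hθ _) (hθ _))
  refine ⟨_, _, hσ, hσ', fun y hy => ?_⟩
  have h0 := (isDualFrame_frameVec (h.bijective y hy)).five_form_decomp (ρ y)
  rw [← h0]

theorem wedge_neg_left {W : Type*} [NormedAddCommGroup W] [NormedSpace ℝ W] {k l : ℕ}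
    (β : W [⋀^Fin k]→L[ℝ] ℂ) (γ : W [⋀^Fin l]→L[ℝ] ℂ) : wedge (-β) γ = -wedge β γ := by
  rw [eq_neg_iff_add_eq_zero, ← wedge_add_left, neg_add_cancel, wedge_zero_left]

theorem wedge_neg_right {W : Type*} [NormedAddCommGroup W] [NormedSpace ℝ W] {k l : ℕ}
    (β : W [⋀^Fin k]→L[ℝ] ℂ) (γ : W [⋀^Fin l]→L[ℝ] ℂ) : wedge β (-γ) = -wedge β γ := by
  rw [eq_neg_iff_add_eq_zero, ← wedge_add_right, neg_add_cancel, wedge_zero_right]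

theorem neg_one_csmul {W : Type*} [NormedAddCommGroup W] [NormedSpace ℝ W] {k : ℕ}
    (β : W [⋀^Fin k]→L[ℝ] ℂ) : (-1 : ℂ) • β = -β := by
  ext v
  simp

theorem neg_one_csmul_wedge {W : Type*} [NormedAddCommGroup W] [NormedSpace ℝ W] {k l m : ℕ}
    (s : W [⋀^Fin k]→L[ℝ] ℂ) (f : W [⋀^Fin l]→L[ℝ] ℂ) (g : W [⋀^Fin m]→L[ℝ] ℂ) :
    (-1 : ℂ) • wedge s (wedge (-f) g) = wedge s (wedge f g) := by
  rw [wedge_neg_left, wedge_neg_right, neg_one_csmul, neg_neg]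

theorem pull_eq_castForm_add {k k₁ k₂ : ℕ} (h₁ : k₁ = k) (h₂ : k₂ = k)
    {ρ : R6 → R6 [⋀^Fin k]→L[ℝ] ℂ} {a : R6 → R6 [⋀^Fin k₁]→L[ℝ] ℂ}
    {b : R6 → R6 [⋀^Fin k₂]→L[ℝ] ℂ} {z : Tot r} {c : ℂ}
    (h : ρ z.1 = castForm h₁ (a z.1) + castForm h₂ (c • b z.1)) :
    pull r ρ z = castForm h₁ (pull r a z) + castForm h₂ (c • pull r b z) := by
  subst h₁; subst h₂
  rw [pull, h]
  rfl

/-- The first term is σ ∧ (F ∧ T). For the second, F_ij ∧ conj T = −conj(F_ji ∧ T) by skew-Hermitian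
symmetry, and the ideal is stable under conjugation, being generated by real and imaginary parts. -/
theorem cIdeal_curv_wedge_add_conj (h : IsQuasiCoframing ε V α) {G : FormFamily (Tot r)} {m : ℕ}
    {T : Tot r → Tot r [⋀^Fin m]→L[ℝ] ℂ}
    (hT : ∀ i j, CIdeal (domX r V) G (2 + m) (fun z => wedge (curvForm α i j z) (T z)))
    {σ σ' : Tot r → Tot r [⋀^Fin 2]→L[ℝ] ℂ} (hσ : ContDiffOn ℝ ∞ σ (domX r V))
    (hσ' : ContDiffOn ℝ ∞ σ' (domX r V)) (i j : Fin r) :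
    CIdeal (domX r V) G (2 + (2 + m)) (fun z => wedge (curvForm α i j z)
      (wedge (σ z) (T z) + wedge (σ' z) (conjForm (T z)))) := by
  have hA := CIdeal.wedge hσ (hT i j)
  have hB := (CIdeal.wedge hσ' (hT j i).conj).const_smul (-1)
  refine (hA.add hB).congr fun z hz => ?_
  beta_reduce
  rw [conjForm_wedge, conj_curvForm h.isOpen h.smooth i j hz, neg_one_csmul_wedge,
    wedge_add_right, wedge_left_comm22, wedge_left_comm22 (curvForm α i j z) (σ' z)]

/-- Products of the curvature with base forms of degree 5 belong to the ideal. -/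
theorem cIdeal_curv_pull_five (h : IsQuasiCoframing ε V α) {G : FormFamily (Tot r)}
    (hU : ∀ i j, CIdeal (domX r V) G (2 + 3)
      (fun z => wedge (curvForm α i j z) (theta123 r α z))) (i j : Fin r)
    {ρ : R6 → R6 [⋀^Fin (2 + 3)]→L[ℝ] ℂ} (hρ : ContDiffOn ℝ ∞ ρ V) :
    CIdeal (domX r V) G (2 + (2 + 3)) (fun z => wedge (curvForm α i j z) (pull r ρ z)) := by
  obtain ⟨σ, σ', hσ, hσ', hdec⟩ := exists_five_form_decomp h hρ
  refine (cIdeal_curv_wedge_add_conj h hU (contDiffOn_pull (r := r) hσ)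
    (contDiffOn_pull (r := r) hσ') i j).congr fun z hz => ?_
  have hA2 : pull r (fun y => wedge (σ y) (volForm fun k => comp α k y)) z =
      wedge (pull r σ z) (theta123 r α z) := by
    rw [theta123_eq]; exact pull_wedge σ _ z
  have hB2 : pull r (fun y => wedge (σ' y) (conjForm (volForm fun k => comp α k y))) z =
      wedge (pull r σ' z) (conjForm (theta123 r α z)) := by
    rw [theta123_eq]; exact pull_wedge σ' (fun y => conjForm (volForm fun k => comp α k y)) z
  have h7 := pull_eq_add (ρ := ρ) (a := fun y => wedge (σ y) (volForm fun k => comp α k y))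
    (b := fun y => wedge (σ' y) (conjForm (volForm fun k => comp α k y))) (z := z) (hdec z.1 hz.1)
  rw [hA2, hB2] at h7
  beta_reduce
  rw [h7]

/-- By the Bianchi identity dF ∧ g is F ∧ A ∧ g − A ∧ F ∧ g, a combination of entries of F ∧ g with
factors A. -/
theorem cIdeal_extDeriv_curvForm_wedge (h : IsQuasiCoframing ε V α) {G : FormFamily (Tot r)}
    {m : ℕ} {g : Tot r → Tot r [⋀^Fin m]→L[ℝ] ℂ}
    (hg : ∀ i j, CIdeal (domX r V) G (2 + m) (fun z => wedge (curvForm α i j z) (g z)))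
    (i j : Fin r) :
    CIdeal (domX r V) G (2 + 1 + m) (fun z => wedge (extDeriv (curvForm α i j) z) (g z)) := by
  have hT := fun i j => contDiffOn_tautForm (r := r) h.smooth i j
  have h1 : ∀ k, CIdeal (domX r V) G (2 + 1 + m) (fun z =>
      castForm (by omega) (wedge (tautForm α k j z) (wedge (curvForm α i k z) (g z))) +
      (-1 : ℂ) • castForm (by omega) (wedge (tautForm α i k z) (wedge (curvForm α k j z) (g z)))) :=
    fun k => (CIdeal.castForm (by omega) (CIdeal.wedge (hT k j) (hg i k))).add
      ((CIdeal.castForm (by omega) (CIdeal.wedge (hT i k) (hg k j))).const_smul (-1))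
  refine (CIdeal.sum Finset.univ fun k _ => h1 k).congr fun z hz => ?_
  beta_reduce
  rw [extDeriv_curvForm h.isOpen h.smooth i j hz, wedge_sum_left]
  refine Finset.sum_congr rfl fun k _ => ?_
  rw [wedge_add_left, wedge_csmul_left, wedge_castForm_left, wedge_assoc_form, wedge_assoc_form,
    wedge_left_comm21, castForm_castForm, castForm_castForm]

/-- Leibniz: d(F ∧ g) = dF ∧ g + F ∧ dg. The first term needs only F ∧ g, so each generator leaves
the single question whether F ∧ dg lies in the ideal. -/
theorem cIdeal_extDeriv_curv_wedge (h : IsQuasiCoframing ε V α) {G : FormFamily (Tot r)}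
    {m : ℕ} {g : Tot r → Tot r [⋀^Fin m]→L[ℝ] ℂ} (hgs : ContDiffOn ℝ ∞ g (domX r V))
    (hg : ∀ i j, CIdeal (domX r V) G (2 + m) (fun z => wedge (curvForm α i j z) (g z)))
    (hdg : ∀ i j, CIdeal (domX r V) G (2 + (m + 1))
      (fun z => wedge (curvForm α i j z) (extDeriv g z))) (i j : Fin r) :
    CIdeal (domX r V) G (2 + m + 1)
      (extDeriv (fun z => wedge (curvForm α i j z) (g z))) := by
  refine ((CIdeal.castForm (by omega) (cIdeal_extDeriv_curvForm_wedge h hg i j)).add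
    (CIdeal.castForm (by omega) (hdg i j))).congr fun z hz => ?_
  have hX := isOpen_domX h.isOpen r
  ext v
  rw [extDeriv_wedge (differentiableAt_of_contDiffOn hX (contDiffOn_curvForm h.isOpen h.smooth i j)
    hz) (differentiableAt_of_contDiffOn hX hgs hz), ContinuousAlternatingMap.add_apply,
    castForm_apply, castForm_apply]
  simp only [even_two, Even.neg_pow, one_pow, one_smul]
  rfl

/-- From d(α¹α²α³) = κ ∧ α¹α²α³ + μη² one gets F ∧ d(α¹α²α³) = κ ∧ Υ + μΨ. The trace equation is
thus produced by differentiating the (0,2)-equation wherever μ ≠ 0. -/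
theorem cIdeal_curv_extDeriv_theta (h : IsQuasiCoframing ε V α) {G : FormFamily (Tot r)}
    (hU : ∀ i j, CIdeal (domX r V) G (2 + 3)
      (fun z => wedge (curvForm α i j z) (theta123 r α z)))
    (hP : ∀ i j, CIdeal (domX r V) G (2 + (2 + 2)) (Psi ε α i j)) (i j : Fin r) :
    CIdeal (domX r V) G (2 + (3 + 1))
      (fun z => wedge (curvForm α i j z) (extDeriv (theta123 r α) z)) := by
  have hκ : ContDiffOn ℝ ∞ (pull r fun y => oneForm (kappa α y)) (domX r V) :=
    contDiffOn_pull (contDiffOn_oneForm (contDiffOn_kappa h))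
  have hμ : ContDiffOn ℝ ∞ (fun z : Tot r => muFun α z.1) (domX r V) :=
    contDiffOn_fst_comp (contDiffOn_muFun h)
  refine ((CIdeal.castForm (by omega) (CIdeal.wedge hκ (hU i j))).add
    (CIdeal.castForm (by omega) (CIdeal.smul hμ (hP i j)))).congr fun z hz => ?_
  have h1 : DifferentiableAt ℝ (fun y => volForm fun k => comp α k y) z.1 :=
    differentiableAt_of_contDiffOn h.isOpen
      (contDiffOn_volForm fun k => contDiffOn_comp h.smooth k) hz.1
  have h2 := pull_eq_castForm_add (z := z) (by omega) (by omega)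
    (ρ := extDeriv fun y => volForm fun k => comp α k y)
    (a := fun y => wedge (oneForm (kappa α y)) (volForm fun k => comp α k y))
    (b := fun y => wedge (hermForm ε fun k => comp α k y) (hermForm ε fun k => comp α k y))
    (extDeriv_volForm_cast h hz.1)
  rw [← extDeriv_pull h1, pull_wedge, pull_wedge, ← theta123_eq, ← etaForm_eq] at h2
  beta_reduce
  rw [h2, wedge_add_right, wedge_castForm_right, wedge_castForm_right, wedge_csmul_right,
    wedge_left_comm21, castForm_castForm]
  congr 1

/-- Since d(η²) is a 5-form on the base, it is covered by the division of base 5-forms, and no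
condition on dη is required. -/
theorem cIdeal_curv_extDeriv_eta (h : IsQuasiCoframing ε V α) {G : FormFamily (Tot r)}
    (hU : ∀ i j, CIdeal (domX r V) G (2 + 3)
      (fun z => wedge (curvForm α i j z) (theta123 r α z))) (i j : Fin r) :
    CIdeal (domX r V) G (2 + (2 + 2 + 1)) (fun z => wedge (curvForm α i j z)
      (extDeriv (fun z => wedge (etaForm r ε α z) (etaForm r ε α z)) z)) := by
  have hs : ContDiffOn ℝ ∞ (fun y => hermForm ε fun k => comp α k y) V :=
    contDiffOn_hermForm ε fun k => contDiffOn_comp h.smooth k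
  have hss := contDiffOn_wedge hs hs
  refine (cIdeal_curv_pull_five h hU i j (contDiffOn_extDeriv h.isOpen hss)).congr fun z hz => ?_
  beta_reduce
  have h1 : (fun z => wedge (etaForm r ε α z) (etaForm r ε α z)) =
      pull r (fun y => wedge (hermForm ε fun k => comp α k y) (hermForm ε fun k => comp α k y)) := by
    funext z
    rw [etaForm_eq, pull_wedge]
  rw [h1, extDeriv_pull (differentiableAt_of_contDiffOn h.isOpen hss hz.1)]

/-- `d I ⊆ I`. -/
theorem diffClosed_hymIdeal (h : IsQuasiCoframing ε V α) : DiffClosed (hymIdeal r ε V α) := by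
  have hX := isOpen_domX h.isOpen r
  have hU : ∀ i j, CIdeal (domX r V) (fun k => {ψ | IsGenerator ε α k ψ}) (2 + 3)
      (Upsilon (r := r) α i j) := fun i j =>
    ⟨AlgIdeal.gen (IsGenerator.upsilon_re i j), AlgIdeal.gen (IsGenerator.upsilon_im i j)⟩
  have hP : ∀ i j, CIdeal (domX r V) (fun k => {ψ | IsGenerator ε α k ψ}) (2 + (2 + 2))
      (Psi (r := r) ε α i j) := fun i j =>
    ⟨AlgIdeal.gen (IsGenerator.psi_re i j), AlgIdeal.gen (IsGenerator.psi_im i j)⟩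
  have hUs := fun i j => contDiffOn_Upsilon (r := r) h.isOpen h.smooth i j
  have hPs := fun i j => contDiffOn_Psi (r := r) (ε := ε) h.isOpen h.smooth i j
  have hdU := cIdeal_extDeriv_curv_wedge h (contDiffOn_theta123 h.smooth) hU
    (cIdeal_curv_extDeriv_theta h hU hP)
  have hdP := cIdeal_extDeriv_curv_wedge h
    (contDiffOn_wedge (contDiffOn_etaForm (r := r) (ε := ε) h.smooth)
      (contDiffOn_etaForm h.smooth)) hP (cIdeal_curv_extDeriv_eta h hU)
  refine diffClosed_ideal hX ?_ ?_
  · intro k ψ hψ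
    cases hψ
    · exact contDiffOn_comp_clm _ (hUs _ _)
    · exact contDiffOn_comp_clm _ (hUs _ _)
    · exact contDiffOn_comp_clm _ (hPs _ _)
    · exact contDiffOn_comp_clm _ (hPs _ _)
  · intro k ψ hψ
    cases hψ with
    | upsilon_re i j => 
      exact (hdU i j).1.congr fun z hz =>
        (extDeriv_comp_clm Complex.reCLM (differentiableAt_of_contDiffOn hX (hUs i j) hz)).symm
    | upsilon_im i j => 
      exact (hdU i j).2.congr fun z hz =>
        (extDeriv_comp_clm Complex.imCLM (differentiableAt_of_contDiffOn hX (hUs i j) hz)).symm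
    | psi_re i j => 
      exact (hdP i j).1.congr fun z hz =>
        (extDeriv_comp_clm Complex.reCLM (differentiableAt_of_contDiffOn hX (hPs i j) hz)).symm
    | psi_im i j => 
      exact (hdP i j).2.congr fun z hz =>
        (extDeriv_comp_clm Complex.imCLM (differentiableAt_of_contDiffOn hX (hPs i j) hz)).symm

end Closed
end PseudoHYM

namespace PseudoHYM

open EDS

/-! ### The curvature form in the fibre directions. -/

section Curvature

variable {ε : Fin 3 → ℝ} {V : Set R6} {α : R6 → R6 →L[ℝ] (Fin 3 → ℂ)} {r : ℕ}

theorem connMatrix_add (y : R6) (p q : Fib r) (i j : Fin r) :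
    connMatrix α y (p + q) i j = connMatrix α y p i j + connMatrix α y q i j := by
  ext v
  simp [connMatrix, Fin.sum_univ_three]
  ring

theorem connMatrix_smul (y : R6) (t : ℝ) (q : Fib r) (i j : Fin r) :
    connMatrix α y (t • q) i j = t • connMatrix α y q i j := by
  ext v
  simp [connMatrix, Fin.sum_univ_three]
  ring

theorem connMatrix_apply (y : R6) (q : Fib r) (i j : Fin r) (v : R6) :
    connMatrix α y q i j v = ∑ k, (q k i j * α y v k -
      (starRingEnd ℂ) (q k j i) * (starRingEnd ℂ) (α y v k)) := by
  simp [connMatrix, comp]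

/-- `π - π*` along the fibre direction `q` is `q α - (q α)*`. -/
theorem fderiv_tautForm_vertical (hV : IsOpen V) (hα : ContDiffOn ℝ ∞ α V) (i j : Fin r)
    {z : Tot r} (hz : z ∈ domX r V) (q : Fib r) : fderiv ℝ (tautForm α i j) z (0, q) =
      oneForm ((connMatrix α z.1 q i j).comp (ContinuousLinearMap.fst ℝ R6 (Fib r))) := by
  have hd : DifferentiableAt ℝ (tautForm α i j) z :=
    differentiableAt_of_contDiffOn (isOpen_domX hV r) (contDiffOn_tautForm hα i j) hz
  rw [← hd.lineDeriv_eq_fderiv, lineDeriv]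
  have h1 : (fun t : ℝ => tautForm α i j (z + t • ((0 : R6), q))) = fun t => tautForm α i j z +
      t • oneForm ((connMatrix α z.1 q i j).comp (ContinuousLinearMap.fst ℝ R6 (Fib r))) := by
    funext t
    ext v
    simp [tautForm, connMatrix_add, connMatrix_smul]
  rw [h1]
  simpa using ((hasDerivAt_id (0 : ℝ)).smul_const (oneForm ((connMatrix α z.1 q i j).comp
    (ContinuousLinearMap.fst ℝ R6 (Fib r))))).const_add (tautForm α i j z) |>.deriv

/-- A is real-linear in the fibre coordinates and vanishes on vertical vectors. Hence A ∧ A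
contributes nothing, and dA contributes only the derivative of A along q. All polar equations are
consequences of this formula. -/
theorem curvForm_vertical (hV : IsOpen V) (hα : ContDiffOn ℝ ∞ α V) (i j : Fin r)
    {z : Tot r} (hz : z ∈ domX r V) (q : Fib r) (w : Tot r) :
    curvForm α i j z ![(0, q), w] = connMatrix α z.1 q i j w.1 := by
  have hd : DifferentiableAt ℝ (tautForm α i j) z :=
    differentiableAt_of_contDiffOn (isOpen_domX hV r) (contDiffOn_tautForm hα i j) hz
  -- The value of A on a fixed vertical vector is identically zero on X, hence so is its derivative
  -- in every direction.
  have h0 : fderiv ℝ (tautForm α i j) z w ![(0, q)] = 0 := by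
    have h1 := fderiv_comp z
      (ContinuousAlternatingMap.apply ℝ (Tot r) ℂ ![((0 : R6), q)]).differentiableAt hd
    have h2 : (ContinuousAlternatingMap.apply ℝ (Tot r) ℂ ![((0 : R6), q)]) ∘ tautForm α i j =
        fun _ => (0 : ℂ) := by
      funext z
      simp [tautForm]
    rw [h2] at h1
    have h3 := congrArg (fun L => L w) h1
    simpa using h3.symm
  have h1 : extDeriv (tautForm α i j) z ![(0, q), w] = connMatrix α z.1 q i j w.1 := by
    rw [extDeriv, ContinuousAlternatingMap.alternatizeUncurryFin_apply, Fin.sum_univ_two]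
    have e0 : (0 : Fin 2).removeNth ![((0 : R6), q), w] = ![w] := by
      funext i; fin_cases i; rfl
    have e1 : (1 : Fin 2).removeNth ![((0 : R6), q), w] = ![(0, q)] := by
      funext i; fin_cases i; rfl
    rw [e0, e1]
    simp [fderiv_tautForm_vertical hV hα i j hz, h0]
  rw [curvForm, ContinuousAlternatingMap.add_apply, h1]
  simp [ContinuousAlternatingMap.sum_apply, wedge11, tautForm]

/-- The fibre point determined by a skew-Hermitian matrix of covectors. -/
noncomputable def fibOf (α : R6 → R6 →L[ℝ] (Fin 3 → ℂ)) (y : R6) (A : Fin r → Fin r → R6 → ℂ) :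
    Fib r := fun k i j => (1 / 2) * (A i j (frameVec α y 1 k) -
      Complex.I * A i j (frameVec α y Complex.I k))

/-- A skew-Hermitian matrix of covectors is determined by its (1,0)-part, whose coefficients are the
values on (e_k − i e'_k)/2. -/
theorem connMatrix_fibOf {y : R6} (hy : Function.Bijective (α y)) (A : Fin r → Fin r → R6 →L[ℝ] ℂ)
    (hA : ∀ i j v, (starRingEnd ℂ) (A j i v) = -A i j v) (i j : Fin r) (v : R6) :
    connMatrix α y (fibOf α y fun i j => A i j) i j v = A i j v := by
  have h := isDualFrame_frameVec hy
  have h1 : A i j v = ∑ k, ((comp α k y v).re • A i j (frameVec α y 1 k) +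
      (comp α k y v).im • A i j (frameVec α y Complex.I k)) := by
    conv_lhs => rw [h.decomp v, map_sum]
    simp
  rw [h1, connMatrix_apply]
  refine Finset.sum_congr rfl fun k _ => ?_
  change fibOf α y (fun i j => A i j) k i j * comp α k y v - _ * (starRingEnd ℂ) (comp α k y v) = _
  obtain ⟨a, b⟩ := comp α k y v
  have e : (⟨a, b⟩ : ℂ) = a + b * Complex.I := by apply Complex.ext <;> simp
  simp only [fibOf, map_mul, map_sub, hA, e, map_add, Complex.conj_I, Complex.conj_ofReal,
    Complex.real_smul, map_div₀, map_one, Complex.conj_ofNat]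
  ring_nf
  simp only [Complex.I_sq]
  ring

end Curvature

/-! ### Integral 6-planes as ranges of sections of the projection to ℝ⁶. -/

section Sections

variable {ε : Fin 3 → ℝ} {V : Set R6} {α : R6 → R6 →L[ℝ] (Fin 3 → ℂ)} {r : ℕ}

/-- The pullback of the curvature form at `z` to `ℝ⁶` by a linear map. -/
noncomputable def curvPull (α : R6 → R6 →L[ℝ] (Fin 3 → ℂ)) (z : Tot r) (L : R6 →L[ℝ] Tot r)
    (i j : Fin r) : R6 [⋀^Fin 2]→L[ℝ] ℂ := (curvForm α i j z).compContinuousLinearMap L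

theorem curvPull_apply (z : Tot r) (L : R6 →L[ℝ] Tot r) (i j : Fin r) (x x' : R6) :
    curvPull α z L i j ![x, x'] = curvForm α i j z ![L x, L x'] := by
  change curvForm α i j z (fun k => L (![x, x'] k)) = _
  rw [vec2_eta (curvForm α i j z)]
  rfl

theorem pull_comp_section {k : ℕ} (β : R6 → R6 [⋀^Fin k]→L[ℝ] ℂ) (z : Tot r)
    {L : R6 →L[ℝ] Tot r} (hL : ∀ x, (L x).1 = x) :
    (pull r β z).compContinuousLinearMap L = β z.1 := by
  ext v
  change β z.1 (fun i => (L (v i)).1) = _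
  simp only [hL]

theorem upsilon_comp_section (z : Tot r) {L : R6 →L[ℝ] Tot r} (hL : ∀ x, (L x).1 = x)
    (i j : Fin r) : (Upsilon α i j z).compContinuousLinearMap L =
      wedge (curvPull α z L i j) (volForm fun k => comp α k z.1) := by
  rw [Upsilon, theta123_eq, wedge_compCLM, pull_comp_section _ z hL]
  rfl

theorem psi_comp_section (z : Tot r) {L : R6 →L[ℝ] Tot r} (hL : ∀ x, (L x).1 = x)
    (i j : Fin r) : (Psi ε α i j z).compContinuousLinearMap L =
      wedge (curvPull α z L i j) (wedge (hermForm ε fun k => comp α k z.1)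
        (hermForm ε fun k => comp α k z.1)) := by
  rw [Psi, etaForm_eq, wedge_compCLM, wedge_compCLM, pull_comp_section _ z hL]
  rfl

theorem indepForm_eq (z : Tot r) (w : Fin 6 → Tot r) : indepForm r α z w =
    (Complex.I * wedge (volForm fun k => comp α k z.1) (conjForm (volForm fun k => comp α k z.1))
      (ContinuousLinearMap.fst ℝ R6 (Fib r) ∘ w)).re := by
  have h1 : wedge (theta123 r α z) (conjForm (theta123 r α z)) =
      (wedge (volForm fun k => comp α k z.1) (conjForm (volForm fun k => comp α k z.1))
        ).compContinuousLinearMap (ContinuousLinearMap.fst ℝ R6 (Fib r)) := by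
    rw [wedge_compCLM, theta123_eq]
    rfl
  rw [indepForm, h1]
  simp only [reForm_apply, ContinuousAlternatingMap.smul_apply,
    ContinuousAlternatingMap.compContinuousLinearMap_apply, smul_eq_mul]

/-- A form pulls back to zero under `L` iff its real and imaginary parts vanish on the range. -/
theorem comp_eq_zero_iff {k : ℕ} (ψ : Tot r [⋀^Fin k]→L[ℝ] ℂ) (L : R6 →L[ℝ] Tot r) :
    ψ.compContinuousLinearMap L = 0 ↔
      (∀ w : Fin k → Tot r, (∀ i, w i ∈ LinearMap.range (L : R6 →ₗ[ℝ] Tot r)) → ψ w = 0) := by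
  constructor
  · intro h w hw
    choose x hx using hw
    have h2 : ψ.compContinuousLinearMap L x = 0 := by rw [h]; rfl
    rw [← h2]
    change _ = ψ (fun i => L (x i))
    exact congrArg ψ (funext fun i => (hx i).symm)
  · intro h
    ext v
    exact h _ fun i => ⟨v i, rfl⟩

theorem isIntegralElement_hym_iff {z : Tot r} (hz : z ∈ domX r V)
    (E : Submodule ℝ (Tot r)) : IsIntegralElement (hymIdeal r ε V α) z E ↔
      ∀ i j, (∀ w : Fin 5 → Tot r, (∀ a, w a ∈ E) → Upsilon α i j z w = 0) ∧
        ∀ w : Fin 6 → Tot r, (∀ a, w a ∈ E) → Psi ε α i j z w = 0 := by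
  rw [hymIdeal, isIntegralElement_iff hz]
  constructor
  · intro H i j
    refine ⟨fun w hw => Complex.ext ?_ ?_, fun w hw => Complex.ext ?_ ?_⟩
    · exact H 5 _ (.upsilon_re i j) w hw
    · exact H 5 _ (.upsilon_im i j) w hw
    · exact H 6 _ (.psi_re i j) w hw
    · exact H 6 _ (.psi_im i j) w hw
  · intro H k ψ hψ w hw
    cases hψ with
    | upsilon_re i j => exact congrArg Complex.re ((H i j).1 w hw)
    | upsilon_im i j => exact congrArg Complex.im ((H i j).1 w hw)
    | psi_re i j => exact congrArg Complex.re ((H i j).2 w hw)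
    | psi_im i j => exact congrArg Complex.im ((H i j).2 w hw)

theorem _root_.EDS.IsDualFrame.eq_zero_of_eq_six {W : Type*} [NormedAddCommGroup W] [NormedSpace ℝ W]
    {θ : Fin 3 → W →L[ℝ] ℂ} {e e' : Fin 3 → W} (h : IsDualFrame θ e e') {k : ℕ} (hk : k = 6)
    {ψ : W [⋀^Fin k]→L[ℝ] ℂ}
    {v : Fin k → W} (hv : ∀ i, v i = ![e 0, e' 0, e 1, e' 1, e 2, e' 2] (Fin.cast hk i))
    (h0 : ψ v = 0) : ψ = 0 := by
  subst hk
  obtain rfl : v = ![e 0, e' 0, e 1, e' 1, e 2, e' 2] := funext hv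
  exact h.eq_zero_of_six h0

/-- The horizontal `6`-plane `range L` is integral iff the pulled back curvature has no
`(0,2)`-part and no trace. -/
theorem isIntegralElement_range_iff (h : IsQuasiCoframing ε V α) {z : Tot r} (hz : z ∈ domX r V)
    {L : R6 →L[ℝ] Tot r} (hL : ∀ x, (L x).1 = x) :
    IsIntegralElement (hymIdeal r ε V α) z (LinearMap.range (L : R6 →ₗ[ℝ] Tot r)) ↔
      ∀ i j, (∀ m n, antiPart (frameVec α z.1 1) (frameVec α z.1 Complex.I)
        (curvPull α z L i j) m n = 0) ∧
        hermTrace ε (frameVec α z.1 1) (frameVec α z.1 Complex.I) (curvPull α z L i j) = 0 := by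
  rw [isIntegralElement_hym_iff hz]
  have hD := isDualFrame_frameVec (h.bijective z.1 hz.1)
  refine forall_congr' fun i => forall_congr' fun j => and_congr ?_ ?_
  · rw [← comp_eq_zero_iff, upsilon_comp_section z hL, hD.wedge_volForm_eq_zero_iff]
  · rw [← comp_eq_zero_iff, psi_comp_section z hL]
    have hne : (2 * (ε 0 * ε 1 * ε 2 : ℝ) : ℂ) ≠ 0 := by
      rcases h.signature with rfl | rfl <;> simp
    have hw := hD.wedge_hermForm_apply h.signature (curvPull α z L i j)
    constructor
    · intro h0
      rw [h0] at hw
      exact (mul_eq_zero.1 hw.symm).resolve_left hne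
    · intro h0
      rw [h0, mul_zero] at hw
      refine hD.eq_zero_of_eq_six (k := 2 + (2 + 2)) rfl (fun i => ?_) hw
      fin_cases i <;> rfl

end Sections

end PseudoHYM

namespace EDS

/-! ### Effect of adding ξ ∧ B to a 2-form. -/

section TwoForms

variable {W : Type*} [NormedAddCommGroup W] [NormedSpace ℝ W]

theorem map_vec2_add_left {A : Type*} [NormedCommRing A] [NormedAlgebra ℝ A]
    (f : W [⋀^Fin 2]→L[ℝ] A) (x x' y : W) : f ![x + x', y] = f ![x, y] + f ![x', y] :=
  f.toMultilinearMap.cons_add ![y] x x'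

theorem map_vec2_smul_left {A : Type*} [NormedCommRing A] [NormedAlgebra ℝ A]
    (f : W [⋀^Fin 2]→L[ℝ] A) (c : ℝ) (x y : W) : f ![c • x, y] = c • f ![x, y] :=
  f.toMultilinearMap.cons_smul ![y] c x

theorem map_vec2_add_right {A : Type*} [NormedCommRing A] [NormedAlgebra ℝ A]
    (f : W [⋀^Fin 2]→L[ℝ] A) (x y y' : W) : f ![x, y + y'] = f ![x, y] + f ![x, y'] := by
  rw [map_vec2_swap, map_vec2_add_left, neg_add, ← map_vec2_swap, ← map_vec2_swap]

theorem map_vec2_smul_right {A : Type*} [NormedCommRing A] [NormedAlgebra ℝ A]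
    (f : W [⋀^Fin 2]→L[ℝ] A) (c : ℝ) (x y : W) : f ![x, c • y] = c • f ![x, y] := by
  rw [map_vec2_swap, map_vec2_smul_left, ← smul_neg, ← map_vec2_swap]

/-- The `(0,1)`-components of a real covector. -/
noncomputable def antiCoeff (e e' : Fin 3 → W) (ξ : W → ℝ) (k : Fin 3) : ℂ :=
  (1 / 2) * (ξ (e k) + Complex.I * ξ (e' k))

/-- Here f' = f + ξ ∧ B, and the two hypotheses on B encode B = Σ (a_k θ_k − b_k conj θ_k). Only the
(0,1)-parts of ξ and B contribute. -/
theorem antiPart_add_wedge {e e' : Fin 3 → W} {f f' : W [⋀^Fin 2]→L[ℝ] ℂ} {ξ : W → ℝ}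
    {B : W → ℂ} {a b : Fin 3 → ℂ}
    (hf : ∀ x x', f' ![x, x'] = f ![x, x'] + ξ x * B x' - ξ x' * B x)
    (hB : ∀ k, B (e k) = a k - b k) (hB' : ∀ k, B (e' k) = Complex.I * (a k + b k))
    (j k : Fin 3) : antiPart e e' f' j k = antiPart e e' f j k -
      antiCoeff e e' ξ j * b k + antiCoeff e e' ξ k * b j := by
  simp only [antiPart, antiCoeff, hf, hB, hB']
  ring_nf
  simp only [Complex.I_sq]
  ring

theorem hermTrace_add_wedge {e e' : Fin 3 → W} {f f' : W [⋀^Fin 2]→L[ℝ] ℂ} {ξ : W → ℝ}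
    {B : W → ℂ} {a b : Fin 3 → ℂ} (ε : Fin 3 → ℝ)
    (hf : ∀ x x', f' ![x, x'] = f ![x, x'] + ξ x * B x' - ξ x' * B x)
    (hB : ∀ k, B (e k) = a k - b k) (hB' : ∀ k, B (e' k) = Complex.I * (a k + b k)) :
    hermTrace ε e e' f' = hermTrace ε e e' f + 2 * Complex.I * ∑ k, ε k *
      (antiCoeff e e' ξ k * a k + (starRingEnd ℂ) (antiCoeff e e' ξ k) * b k) := by
  simp only [hermTrace, antiCoeff, hf, hB, hB', Finset.mul_sum, ← Finset.sum_add_distrib]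
  refine Finset.sum_congr rfl fun k _ => ?_
  simp only [map_mul, map_add, map_div₀, map_one, Complex.conj_ofNat, Complex.conj_ofReal,
    Complex.conj_I]
  ring_nf
  simp only [Complex.I_sq]
  ring

/-- If the `n`-form `ρ` vanishes on the kernel of the nonzero covector `ξ` of an
`(n + 1)`-dimensional space, then `ξ ∧ ρ = 0`. -/
theorem sum_removeNth_eq_zero {n : ℕ} (ρ : W [⋀^Fin n]→L[ℝ] ℂ) (ξ : W →L[ℝ] ℝ)
    (b : Module.Basis (Fin (n + 1)) ℝ W) (hξ : ∀ i : Fin n, ξ (b i.succ) = 0)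
    (hρ : ρ (fun i => b (Fin.succ i)) = 0) (v : Fin (n + 1) → W) :
    ∑ i : Fin (n + 1), (-1 : ℤ) ^ (i : ℕ) • ((ξ (v i) : ℂ) * ρ (i.removeNth v)) = 0 := by
  let ξc : W →L[ℝ] ℂ := Complex.ofRealCLM.comp ξ
  let T : W [⋀^Fin (n + 1)]→L[ℝ] ℂ :=
    castForm (Nat.add_comm 1 n) (wedge (oneForm ξc) ρ)
  have hT : ∀ v : Fin (n + 1) → W, T v =
      ∑ i : Fin (n + 1), (-1 : ℤ) ^ (i : ℕ) • ((ξ (v i) : ℂ) * ρ (i.removeNth v)) := fun v => by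
    have h1 := wedge_one_left (oneForm ξc) ρ v
    rw [← castForm_apply (Nat.add_comm 1 n)] at h1 
    exact h1
  have h0 : T b = 0 := by
    rw [hT, Fin.sum_univ_succ]
    have h1 : ρ ((0 : Fin (n + 1)).removeNth b) = 0 := by
      rw [← hρ]
      rfl
    simp only [h1, hξ]
    simp
  have hre : (reForm T).toAlternatingMap = 0 :=
    ((reForm T).toAlternatingMap.map_basis_eq_zero_iff b).1 (congrArg Complex.re h0)
  have him : (imForm T).toAlternatingMap = 0 :=
    ((imForm T).toAlternatingMap.map_basis_eq_zero_iff b).1 (congrArg Complex.im h0)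
  rw [← hT]
  exact Complex.ext (congrArg (fun g => g v) hre) (congrArg (fun g => g v) him)

/-- If f ∧ θ₁θ₂θ₃ vanishes on the hyperplane ker ξ, then ξ ∧ f ∧ θ₁θ₂θ₃ = 0. Only the (0,3)-form
ξ^{0,1} ∧ f^{0,2} contributes to this product, and it has one coefficient. Its vanishing is the
compatibility condition for extending the hyperplane. -/
theorem IsDualFrame.cyclic_eq_zero {θ : Fin 3 → W →L[ℝ] ℂ} {e e' : Fin 3 → W}
    (h : IsDualFrame θ e e') (f : W [⋀^Fin 2]→L[ℝ] ℂ) (ξ : W →L[ℝ] ℝ)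
    (b : Module.Basis (Fin 6) ℝ W) (hξ : ∀ i : Fin 5, ξ (b i.succ) = 0)
    (ρ : W [⋀^Fin 5]→L[ℝ] ℂ) (hρf : ρ = wedge f (volForm θ))
    {u : Fin 5 → W} (hu : ∀ i : Fin 5, b i.succ = u i) (hρ : ρ u = 0) :
    antiCoeff e e' ξ 0 * antiPart e e' f 1 2 + antiCoeff e e' ξ 1 * antiPart e e' f 2 0 +
      antiCoeff e e' ξ 2 * antiPart e e' f 0 1 = 0 := by
  obtain rfl : (fun i : Fin 5 => b i.succ) = u := funext hu
  have hv := sum_removeNth_eq_zero ρ ξ b hξ hρ ![e 0, e' 0, e 1, e' 1, e 2, e' 2]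
  have hρ2 : ∀ x0 x1 x2 x3 x4, ρ ![x0, x1, x2, x3, x4] =
      wedge f (volForm θ) ![x0, x1, x2, x3, x4] := by
    intro x0 x1 x2 x3 x4
    rw [hρf]
  have r0 : (0 : Fin 6).removeNth ![e 0, e' 0, e 1, e' 1, e 2, e' 2] =
      ![e' 0, e 1, e' 1, e 2, e' 2] := by funext i; fin_cases i <;> rfl
  have r1 : (1 : Fin 6).removeNth ![e 0, e' 0, e 1, e' 1, e 2, e' 2] =
      ![e 0, e 1, e' 1, e 2, e' 2] := by funext i; fin_cases i <;> rfl
  have r2 : (2 : Fin 6).removeNth ![e 0, e' 0, e 1, e' 1, e 2, e' 2] =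
      ![e 0, e' 0, e' 1, e 2, e' 2] := by funext i; fin_cases i <;> rfl
  have r3 : (3 : Fin 6).removeNth ![e 0, e' 0, e 1, e' 1, e 2, e' 2] =
      ![e 0, e' 0, e 1, e 2, e' 2] := by funext i; fin_cases i <;> rfl
  have r4 : (4 : Fin 6).removeNth ![e 0, e' 0, e 1, e' 1, e 2, e' 2] =
      ![e 0, e' 0, e 1, e' 1, e' 2] := by funext i; fin_cases i <;> rfl
  have r5 : (5 : Fin 6).removeNth ![e 0, e' 0, e 1, e' 1, e 2, e' 2] =
      ![e 0, e' 0, e 1, e' 1, e 2] := by funext i; fin_cases i <;> rfl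
  rw [Fin.sum_univ_six, r0, r1, r2, r3, r4, r5] at hv
  simp only [hρ2, wedge23, volForm_apply, h.apply, h.apply'] at hv
  have hs := map_vec2_swap f
  simp [-mul_eq_zero] at hv
  simp only [antiPart, antiCoeff, hs (e 0) (e 2), hs (e' 0) (e 2), hs (e 0) (e' 2), hs (e' 0) (e' 2)]
  -- On the real frame ξ ∧ f ∧ θ₁θ₂θ₃ takes the value 8i times the cyclic sum.
  refine Eq.trans ?_ (mul_eq_zero_of_right (-(Complex.I / 8)) hv)
  ring_nf
  simp only [Complex.I_sq]
  ring

end TwoForms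

end EDS

namespace PseudoHYM

open EDS

/-! ### Algebra of the polar equations of a hyperplane. -/

section SkewHermitian

/-- The skew-Hermitian matrices, as a real subspace. -/
def skewHerm (r : ℕ) : Submodule ℝ (Fin r → Fin r → ℂ) where
  carrier := {c | ∀ i j, (starRingEnd ℂ) (c j i) = -c i j}
  zero_mem' := by intro i j; simp
  add_mem' := by
    intro a b ha hb i j
    simp [ha i j, hb i j, add_comm]
  smul_mem' := by
    intro t a ha i j
    simp [ha i j]

theorem finrank_matrix (r : ℕ) : Module.finrank ℝ (Fin r → Fin r → ℂ) = 2 * r ^ 2 := by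
  simp [Module.finrank_pi_fintype, Complex.finrank_real_complex]
  ring

/-- Every complex matrix is uniquely a + ib with a and b skew-Hermitian, so two copies of the space
make up the real dimension 2r². -/
theorem finrank_skewHerm (r : ℕ) : Module.finrank ℝ (skewHerm r) = r ^ 2 := by
  let Φ : (skewHerm r × skewHerm r) →ₗ[ℝ] (Fin r → Fin r → ℂ) :=
    { toFun := fun p i j => p.1.1 i j + Complex.I * p.2.1 i j
      map_add' := fun p q => by funext i j; simp; ring
      map_smul' := fun t p => by funext i j; simp; ring }
  have hI : Complex.I * Complex.I = -1 := Complex.I_mul_I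
  have hinj : Function.Injective Φ := by
    rw [← LinearMap.ker_eq_bot, LinearMap.ker_eq_bot']
    rintro ⟨⟨a, ha⟩, ⟨b, hb⟩⟩ h0
    have h1 : ∀ i j, a i j + Complex.I * b i j = 0 := fun i j => congrFun (congrFun h0 i) j
    have h2 : ∀ i j, -a i j + Complex.I * b i j = 0 := fun i j => by
      have h3 := congrArg (starRingEnd ℂ) (h1 j i)
      rw [map_add, map_mul, ha i j, hb i j, Complex.conj_I, map_zero] at h3
      rw [← h3]; ring
    have ha0 : a = 0 := by
      funext i j
      have : 2 * a i j = 0 := by linear_combination h1 i j - h2 i j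
      simpa using this
    have hb0 : b = 0 := by
      funext i j
      have : 2 * b i j = 0 := by
        linear_combination (-Complex.I) * (h1 i j + h2 i j) + 2 * b i j * hI
      simpa using this
    subst ha0 hb0
    rfl
  have hsurj : Function.Surjective Φ := by
    intro m
    refine ⟨(⟨fun i j => (1 / 2) * (m i j - (starRingEnd ℂ) (m j i)), fun i j => ?_⟩,
      ⟨fun i j => (-Complex.I / 2) * (m i j + (starRingEnd ℂ) (m j i)), fun i j => ?_⟩), ?_⟩
    · simp [Complex.conj_ofNat]
      ring
    · simp [Complex.conj_ofNat]
      ring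
    · funext i j
      change (1 / 2) * (m i j - (starRingEnd ℂ) (m j i)) +
        Complex.I * ((-Complex.I / 2) * (m i j + (starRingEnd ℂ) (m j i))) = m i j
      linear_combination (-(1 / 2) * (m i j + (starRingEnd ℂ) (m j i))) * hI
  have h := (LinearEquiv.ofBijective Φ ⟨hinj, hsurj⟩).finrank_eq
  rw [Module.finrank_prod, finrank_matrix] at h
  omega

variable {r : ℕ}

/-- The signed square norm of the coefficients of a covector. -/
noncomputable def signedNorm (ε : Fin 3 → ℝ) (s : Fin 3 → ℂ) : ℝ :=
  ∑ k, ε k * Complex.normSq (s k)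

/-- The (0,2)-equations are solved by dividing by the definite norm Σ|s_k|², in either signature;
the signed norm is needed only for the trace equation, and its nonvanishing already forces s ≠ 0. -/
theorem sum_normSq_ne_zero {ε : Fin 3 → ℝ} {s : Fin 3 → ℂ} (hN : signedNorm ε s ≠ 0) :
    (∑ k, s k * (starRingEnd ℂ) (s k)) ≠ 0 := by
  intro h0
  apply hN
  have h1 : ∑ k, Complex.normSq (s k) = 0 := by
    simp only [Complex.mul_conj] at h0
    exact_mod_cast h0
  rw [Finset.sum_eq_zero_iff_of_nonneg fun k _ => Complex.normSq_nonneg _] at h1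
  exact Finset.sum_eq_zero fun k hk => by rw [h1 k hk, mul_zero]

/-- The solutions of the homogeneous polar equations of a hyperplane with coefficients `s`. -/
def polarKernel (r : ℕ) (ε : Fin 3 → ℝ) (s : Fin 3 → ℂ) : Set (Fib r) :=
  {q | ∀ i j, (∀ m n, -s m * (starRingEnd ℂ) (q n j i) + s n * (starRingEnd ℂ) (q m j i) = 0) ∧
    ∑ k, ε k * (s k * q k i j + (starRingEnd ℂ) (s k) * (starRingEnd ℂ) (q k j i)) = 0}

/-- The parametrization of the polar kernel by skew-Hermitian matrices. -/
noncomputable def polarParam (r : ℕ) (s : Fin 3 → ℂ) : skewHerm r →ₗ[ℝ] Fib r where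
  toFun c := fun k i j => (starRingEnd ℂ) (s k) * c.1 i j
  map_add' := fun p q => by funext k i j; simp; ring
  map_smul' := fun t p => by funext k i j; simp; ring

theorem polarParam_injective {ε : Fin 3 → ℝ} {s : Fin 3 → ℂ} (hN : signedNorm ε s ≠ 0) :
    Function.Injective (polarParam r s) := by
  rw [← LinearMap.ker_eq_bot, LinearMap.ker_eq_bot']
  rintro ⟨c, hc⟩ h0
  have h1 : ∀ k i j, (starRingEnd ℂ) (s k) * c i j = 0 := fun k i j =>
    congrFun (congrFun (congrFun h0 k) i) j
  have h2 : c = 0 := by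
    funext i j
    refine (mul_eq_zero.1 ?_).resolve_left (sum_normSq_ne_zero hN)
    rw [Finset.sum_mul]
    exact Finset.sum_eq_zero fun k _ => by rw [mul_assoc, h1, mul_zero]
  subst h2
  rfl

theorem signedNorm_eq (ε : Fin 3 → ℝ) (s : Fin 3 → ℂ) :
    (signedNorm ε s : ℂ) = ∑ k, ε k * (s k * (starRingEnd ℂ) (s k)) := by
  simp [signedNorm, Complex.mul_conj]

/-- The equations s_m conj(q_n) = s_n conj(q_m) say that q is proportional to conj s, with a matrix
factor c. The trace equation becomes Σ ε_k|s_k|² · (c + c*) = 0, so c is skew-Hermitian exactly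
because the signed norm is nonzero. -/
theorem range_polarParam {ε : Fin 3 → ℝ} {s : Fin 3 → ℂ} (hN : signedNorm ε s ≠ 0) :
    (LinearMap.range (polarParam r s) : Set (Fib r)) = polarKernel r ε s := by
  have hs := sum_normSq_ne_zero hN
  ext q
  constructor
  · rintro ⟨⟨c, hc⟩, rfl⟩ i j
    have hc' := hc i j
    refine ⟨fun m n => ?_, ?_⟩
    · simp only [polarParam, LinearMap.coe_mk, AddHom.coe_mk, map_mul, Complex.conj_conj, hc']
      ring
    · refine Finset.sum_eq_zero fun k _ => ?_
      simp only [polarParam, LinearMap.coe_mk, AddHom.coe_mk, map_mul, Complex.conj_conj, hc']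
      ring
  · intro hq
    set S := ∑ k, s k * (starRingEnd ℂ) (s k) with hS
    have hSc : (starRingEnd ℂ) S = S := by
      rw [hS, map_sum]
      exact Finset.sum_congr rfl fun k _ => by rw [map_mul, Complex.conj_conj, mul_comm]
    let c : Fin r → Fin r → ℂ := fun i j => (∑ k, s k * q k i j) / S
    have hqc : ∀ k i j, q k i j = (starRingEnd ℂ) (s k) * c i j := by
      intro k i j
      have h1 : ∀ m, (starRingEnd ℂ) (s m) * q k i j = (starRingEnd ℂ) (s k) * q m i j := by
        intro m
        have h2 := congrArg (starRingEnd ℂ) ((hq j i).1 m k)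
        simp only [map_add, map_mul, map_neg, Complex.conj_conj, map_zero] at h2
        linear_combination -h2
      have h3 : S * q k i j = (starRingEnd ℂ) (s k) * ∑ m, s m * q m i j := by
        rw [hS, Finset.sum_mul, Finset.mul_sum]
        refine Finset.sum_congr rfl fun m _ => ?_
        linear_combination s m * h1 m
      change q k i j = (starRingEnd ℂ) (s k) * ((∑ m, s m * q m i j) / S)
      rw [← mul_div_assoc, ← h3, mul_div_cancel_left₀ _ hs]
    refine ⟨⟨c, fun i j => ?_⟩, ?_⟩
    · have h4 := (hq i j).2
      have h5 : (signedNorm ε s : ℂ) * (c i j + (starRingEnd ℂ) (c j i)) = 0 := by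
        rw [← h4, signedNorm_eq, Finset.sum_mul]
        refine Finset.sum_congr rfl fun k _ => ?_
        rw [hqc k i j, hqc k j i, map_mul, Complex.conj_conj]
        ring
      have h6 := (mul_eq_zero.1 h5).resolve_left (by exact_mod_cast hN)
      linear_combination h6
    · funext k i j
      exact (hqc k i j).symm

/-- The polar equations of an integral hyperplane are solvable. -/
theorem exists_polar_solution {ε : Fin 3 → ℝ} {s : Fin 3 → ℂ} (hN : signedNorm ε s ≠ 0)
    (g : Fin r → Fin r → Fin 3 → Fin 3 → ℂ) (t : Fin r → Fin r → ℂ)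
    (hg : ∀ i j m n, g i j n m = -g i j m n)
    (hcyc : ∀ i j, s 0 * g i j 1 2 + s 1 * g i j 2 0 + s 2 * g i j 0 1 = 0)
    (ht : ∀ i j, (starRingEnd ℂ) (t j i) = -t i j) :
    ∃ q : Fib r, ∀ i j,
      (∀ m n, g i j m n - s m * (starRingEnd ℂ) (q n j i) + s n * (starRingEnd ℂ) (q m j i) = 0) ∧
      t i j + 2 * Complex.I * ∑ k, ε k * (s k * q k i j +
        (starRingEnd ℂ) (s k) * (starRingEnd ℂ) (q k j i)) = 0 := by
  have hs := sum_normSq_ne_zero hN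
  set S := ∑ k, s k * (starRingEnd ℂ) (s k) with hS
  have hg0 : ∀ i j m, g i j m m = 0 := fun i j m => by
    have h1 := hg i j m m
    have h2 : 2 * g i j m m = 0 := by linear_combination h1
    simpa using h2
  -- The identity s ∧ g = 0, written so that contraction with conj s recovers g.
  have hcyc' : ∀ i j l m n, s l * g i j m n = s m * g i j l n - s n * g i j l m := by
    intro i j l m n
    have h1 := hcyc i j
    have h0 := hg0 i j
    have e1 := hg i j 0 1
    have e2 := hg i j 0 2
    have e3 := hg i j 1 2
    fin_cases l <;> fin_cases m <;> fin_cases n <;>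
      simp only [Fin.zero_eta, Fin.mk_one, Fin.reduceFinMk, h0, e1, e2, e3] at h1 ⊢ <;>
      first | ring1 | linear_combination (exp := 1) h1 | linear_combination (exp := 1) -h1
  -- Contraction of g with conj s/|s|² gives a p with s ∧ p = g: exactness of the Koszul complex of
  -- s.
  let p : Fin r → Fin r → Fin 3 → ℂ := fun i j n => (∑ l, (starRingEnd ℂ) (s l) * g i j l n) / S
  have hp : ∀ i j m n, s m * p i j n - s n * p i j m = g i j m n := by
    intro i j m n
    have h1 : S * g i j m n = s m * (∑ l, (starRingEnd ℂ) (s l) * g i j l n) -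
        s n * (∑ l, (starRingEnd ℂ) (s l) * g i j l m) := by
      rw [hS, Finset.sum_mul, Finset.mul_sum, Finset.mul_sum, ← Finset.sum_sub_distrib]
      refine Finset.sum_congr rfl fun l _ => ?_
      linear_combination (starRingEnd ℂ) (s l) * hcyc' i j l m n
    change s m * (_ / S) - s n * (_ / S) = _
    rw [← mul_div_assoc, ← mul_div_assoc, ← sub_div, ← h1, mul_div_cancel_left₀ _ hs]
  -- the particular solution of the `(0,2)`-equations
  let q₀ : Fib r := fun k i j => (starRingEnd ℂ) (p j i k)
  let T : Fin r → Fin r → ℂ := fun i j => t i j + 2 * Complex.I * ∑ k, ε k * (s k * q₀ k i j +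
        (starRingEnd ℂ) (s k) * (starRingEnd ℂ) (q₀ k j i))
  have hT : ∀ i j, (starRingEnd ℂ) (T j i) = -T i j := by
    intro i j
    simp only [T, map_add, map_mul, map_sum, ht i j, Complex.conj_I, Complex.conj_conj,
      Complex.conj_ofReal, Complex.conj_ofNat, neg_add, Finset.mul_sum, ← Finset.sum_neg_distrib]
    congr 1
    refine Finset.sum_congr rfl fun k _ => ?_
    ring
  have hN' : (signedNorm ε s : ℂ) ≠ 0 := by exact_mod_cast hN
  -- Adding conj(s_k) b with b Hermitian leaves the (0,2)-equations intact, since s_m s_n b is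
  -- symmetric in m and n, and changes the trace by 4i·signedNorm·b. The residual trace T is
  -- skew-Hermitian, so this b is Hermitian, and it cancels T.
  let b : Fin r → Fin r → ℂ := fun i j => Complex.I / (4 * signedNorm ε s) * T i j
  have hb : ∀ i j, (starRingEnd ℂ) (b j i) = b i j := by
    intro i j
    simp only [b, map_mul, map_div₀, hT i j, Complex.conj_I, Complex.conj_ofReal,
      Complex.conj_ofNat]
    ring
  refine ⟨fun k i j => q₀ k i j + (starRingEnd ℂ) (s k) * b i j, fun i j => ⟨fun m n => ?_, ?_⟩⟩
  · simp only [q₀, map_add, map_mul, Complex.conj_conj, hb i j]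
    linear_combination -hp i j m n
  · have h1 : t i j + 2 * Complex.I * ∑ k, ε k * (s k * (q₀ k i j + (starRingEnd ℂ) (s k) * b i j) +
        (starRingEnd ℂ) (s k) * (starRingEnd ℂ) (q₀ k j i + (starRingEnd ℂ) (s k) * b j i)) =
        T i j + 4 * Complex.I * signedNorm ε s * b i j := by
      simp only [T, signedNorm_eq, map_add, map_mul, Complex.conj_conj, hb i j, Fin.sum_univ_three]
      ring
    rw [h1]
    simp only [b]
    field_simp
    ring_nf
    simp [Complex.I_sq]

end SkewHermitian

/-! ### The conormal covector of a 5-plane in ℝ⁶. -/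

section Conormal

instance : Fact (Module.finrank ℝ R6 = 6) := ⟨by simp⟩

/-- The volume form of `ℝ⁶`. -/
noncomputable def vol6 : R6 [⋀^Fin 6]→L[ℝ] ℝ :=
  (EuclideanSpace.basisFun (Fin 6) ℝ).toBasis.orientation.volumeForm.mkContinuous 1 fun v => by
    rw [one_mul, Real.norm_eq_abs]
    exact Orientation.abs_volumeForm_apply_le _ _

theorem vol6_ne_zero_iff (v : Fin 6 → R6) : vol6 v ≠ 0 ↔ LinearIndependent ℝ v := by
  have h1 : vol6 v = (EuclideanSpace.basisFun (Fin 6) ℝ).toBasis.det v := by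
    rw [← Orientation.volumeForm_robust _ (EuclideanSpace.basisFun (Fin 6) ℝ) rfl]
    rfl
  rw [h1]
  constructor
  · intro h
    exact ((EuclideanSpace.basisFun (Fin 6) ℝ).toBasis.is_basis_iff_det.2 (isUnit_iff_ne_zero.2 h)).1
  · intro h
    refine isUnit_iff_ne_zero.1 ((EuclideanSpace.basisFun (Fin 6) ℝ).toBasis.is_basis_iff_det.1
      ⟨h, h.span_eq_top_of_card_eq_finrank' (by simp)⟩)

/-- The covector annihilating the `5`-plane spanned by `x`. -/
noncomputable def conormal (x : Fin 5 → R6) : R6 →L[ℝ] ℝ :=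
  (ContinuousAlternatingMap.apply ℝ R6 ℝ x).comp vol6.curryLeft

theorem conormal_apply (x : Fin 5 → R6) (y : R6) : conormal x y = vol6 (Fin.cons y x) := rfl

theorem conormal_self (x : Fin 5 → R6) (i : Fin 5) : conormal x (x i) = 0 := by
  rw [conormal_apply]
  exact vol6.map_eq_zero_of_eq _ (i := 0) (j := i.succ) rfl (Fin.succ_ne_zero i).symm

end Conormal

end PseudoHYM

namespace PseudoHYM

open EDS

/-! ### Ranks of the polar equations. -/

section PolarSpaces

variable {ε : Fin 3 → ℝ} {V : Set R6} {α : R6 → R6 →L[ℝ] (Fin 3 → ℂ)} {r : ℕ}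

/-- The value of `conj θ_k ∧ θ₁ ∧ θ₂ ∧ θ₃`. -/
noncomputable def antiVol {W : Type*} [NormedAddCommGroup W] [NormedSpace ℝ W]
    (θ : Fin 3 → W →L[ℝ] ℂ) (k : Fin 3) (x : Fin 4 → W) : ℂ :=
  (starRingEnd ℂ) (θ k (x 0)) * volForm θ ![x 1, x 2, x 3] -
    (starRingEnd ℂ) (θ k (x 1)) * volForm θ ![x 0, x 2, x 3] +
    (starRingEnd ℂ) (θ k (x 2)) * volForm θ ![x 0, x 1, x 3] -
    (starRingEnd ℂ) (θ k (x 3)) * volForm θ ![x 0, x 1, x 2]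

theorem theta123_apply (z : Tot r) (a b c : Tot r) : theta123 r α z ![a, b, c] =
    volForm (fun k => comp α k z.1) ![a.1, b.1, c.1] := by
  rw [theta123_eq]
  change volForm (fun k => comp α k z.1) _ = _
  rw [vec3_eta (volForm fun k => comp α k z.1)]
  rfl

/-- Only the curvature factor can take the vertical vector, leaving (qα − (qα)*) ∧ α¹α²α³. The
(1,0)-part dies against α¹α²α³, so only conj q_k with indices transposed survives. -/
theorem upsilon_vertical (hV : IsOpen V) (hα : ContDiffOn ℝ ∞ α V) {z : Tot r}
    (hz : z ∈ domX r V) (i j : Fin r) (q : Fib r) (v : Fin 4 → Tot r) :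
    Upsilon α i j z ![(0, q), v 0, v 1, v 2, v 3] = -∑ k, (starRingEnd ℂ) (q k j i) *
      antiVol (fun k => comp α k z.1) k (fun a => (v a).1) := by
  have h0 : ∀ b c : Tot r, theta123 r α z ![(0, q), b, c] = 0 := fun b c =>
    by rw [theta123_apply, volForm_apply]; simp
  rw [Upsilon, wedge23]
  simp only [curvForm_vertical hV hα i j hz, h0, theta123_apply, mul_zero, connMatrix_apply,
    antiVol, volForm_apply, Fin.sum_univ_three]
  simp only [comp, ContinuousLinearMap.comp_apply, ContinuousLinearMap.proj_apply]
  ring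

theorem generators_eq_empty (r : ℕ) (ε : Fin 3 → ℝ) (α : R6 → R6 →L[ℝ] (Fin 3 → ℂ)) (j : ℕ)
    (h5 : j ≠ 5) (h6 : j ≠ 6) : {ψ | IsGenerator (r := r) ε α j ψ} = ∅ := by
  ext ψ
  simp only [Set.mem_ofPred_eq, Set.mem_empty_iff_false, iff_false]
  intro h
  cases h <;> simp at h5 h6

/-- The ideal begins in degree 5, so a plane of dimension at most 3 remains integral after adjoining
any vector. -/
theorem polarRank_of_lt {z : Tot r} (hz : z ∈ domX r V) {k : ℕ} (hk : k < 4)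
    (v : Fin k → Tot r) : polarRank (hymIdeal r ε V α) z v = 0 := by
  have h1 : polarSpace (hymIdeal r ε V α) z v = ⊤ := by
    rw [eq_top_iff]
    intro w _
    refine mem_polarSpace_of_isIntegralElement (isIntegralElement_span_of_lt hz (d := 5)
      (fun j hj => generators_eq_empty r ε α j (by omega) (by omega)) (by omega) _)
  have h2 := (⊤ : Submodule ℝ (Tot r)).finrank_quotient_add_finrank
  rw [finrank_top] at h2
  rw [polarRank, h1]
  omega

theorem forall_generator_five (z : Tot r) (v : Fin 5 → Tot r) :
    (∀ ψ, IsGenerator ε α 5 ψ → ψ z v = 0) ↔ ∀ i j, Upsilon α i j z v = 0 := by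
  constructor
  · intro H i j
    exact Complex.ext (H _ (.upsilon_re i j)) (H _ (.upsilon_im i j))
  · intro H ψ hψ
    cases hψ with
    | upsilon_re i j => exact congrArg Complex.re (H i j)
    | upsilon_im i j => exact congrArg Complex.im (H i j)

/-- An integral `5`-plane is one annihilated by the forms `Υ`. -/
theorem isIntegralElement_five_iff {z : Tot r} (hz : z ∈ domX r V) (v : Fin 5 → Tot r) :
    IsIntegralElement (hymIdeal r ε V α) z (Submodule.span ℝ (Set.range v)) ↔
      ∀ i j, Upsilon α i j z v = 0 := by
  rw [hymIdeal, isIntegralElement_span_iff_of_eq hz (d := 5)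
      (fun j hj => generators_eq_empty r ε α j (by omega) (by omega))]
  exact forall_generator_five z v

/-- The linear map contracting a matrix of forms with `v`. -/
noncomputable def contractMap {W : Type*} [NormedAddCommGroup W] [NormedSpace ℝ W] {n d : ℕ}
    (hd : d = n + 1) (ψ : Fin r → Fin r → W [⋀^Fin d]→L[ℝ] ℂ) (v : Fin n → W) :
    W →ₗ[ℝ] (Fin r → Fin r → ℂ) :=
  LinearMap.pi fun i => LinearMap.pi fun j =>
    ((ContinuousAlternatingMap.apply ℝ W ℂ v).comp (castForm hd (ψ i j)).curryLeft : W →L[ℝ] ℂ)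

theorem contractMap_apply {W : Type*} [NormedAddCommGroup W] [NormedSpace ℝ W] {n d : ℕ}
    (hd : d = n + 1) (ψ : Fin r → Fin r → W [⋀^Fin d]→L[ℝ] ℂ) (v : Fin n → W) (w : W)
    {u : Fin d → W} (hu : ∀ i, u i = (Fin.cons w v : Fin (n + 1) → W) (Fin.cast hd i))
    (i j : Fin r) : contractMap hd ψ v w i j = ψ i j u := by
  subst hd
  rw [show u = Fin.cons w v from funext hu]
  rfl

theorem _root_.EDS.mem_polarSpace_iff_of_eq {W : Type*} [NormedAddCommGroup W] [NormedSpace ℝ W]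
    {X : Set W} {G : FormFamily W} {z : W} (hz : z ∈ X) {k d : ℕ} (hd : d = k + 1)
    (hG : ∀ j < d, G j = ∅) (v : Fin k → W) (w : W) {u : Fin d → W}
    (hu : ∀ i, u i = (Fin.cons w v : Fin (k + 1) → W) (Fin.cast hd i)) :
    w ∈ polarSpace (ideal X G) z v ↔ ∀ ψ ∈ G d, ψ z u = 0 := by
  subst hd
  rw [show u = Fin.cons w v from funext hu]
  exact ⟨fun h ψ hψ => h ψ (.gen hψ), fun h => mem_polarSpace_of_isIntegralElement
    ((isIntegralElement_span_iff_of_eq hz hG _).2 h)⟩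

theorem compCLM_apply_eq {W W' : Type*} [NormedAddCommGroup W] [NormedSpace ℝ W]
    [NormedAddCommGroup W'] [NormedSpace ℝ W'] {k : ℕ} (ψ : W' [⋀^Fin k]→L[ℝ] ℂ) (L : W →L[ℝ] W')
    (u : Fin k → W) {w : Fin k → W'} (h : ∀ a, L (u a) = w a) :
    ψ.compContinuousLinearMap L u = ψ w := by
  rw [← funext h]
  rfl

/-- One nonzero conj α^k ∧ α¹α²α³ suffices: let q have only its k-th component nonzero and divide.
-/
theorem exists_vertical_upsilon (hV : IsOpen V) (hα : ContDiffOn ℝ ∞ α V) {z : Tot r}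
    (hz : z ∈ domX r V) (v : Fin 4 → Tot r) {k : Fin 3}
    (ha : antiVol (fun k => comp α k z.1) k (fun a => (v a).1) ≠ 0) (m : Fin r → Fin r → ℂ) :
    ∃ q : Fib r, ∀ i j, Upsilon α i j z ![(0, q), v 0, v 1, v 2, v 3] = m i j := by
  refine ⟨fun l j i => if l = k then (starRingEnd ℂ)
    (-m i j / antiVol (fun k => comp α k z.1) k (fun a => (v a).1)) else 0, fun i j => ?_⟩
  rw [upsilon_vertical hV hα hz, Finset.sum_eq_single k]
  · rw [if_pos rfl, Complex.conj_conj, div_mul_cancel₀ _ ha, neg_neg]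
  · intro l _ hl
    rw [if_neg hl, map_zero, zero_mul]
  · simp

/-- The polar space is the kernel of w ↦ Υ(w, v₀, …, v₃), which vertical vectors already make
surjective onto the r × r complex matrices. -/
theorem polarRank_four (hV : IsOpen V) (hα : ContDiffOn ℝ ∞ α V) {z : Tot r}
    (hz : z ∈ domX r V) (v : Fin 4 → Tot r) {k : Fin 3}
    (ha : antiVol (fun k => comp α k z.1) k (fun a => (v a).1) ≠ 0) :
    polarRank (hymIdeal r ε V α) z v = 2 * r ^ 2 := by
  have hu : ∀ w i, (![w, v 0, v 1, v 2, v 3] : Fin 5 → Tot r) i =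
      (Fin.cons w v : Fin (4 + 1) → Tot r) (Fin.cast (by norm_num : 5 = 4 + 1) i) := by
    intro w i
    fin_cases i <;> rfl
  have h1 : polarSpace (hymIdeal r ε V α) z v =
      LinearMap.ker (contractMap (by norm_num : 5 = 4 + 1) (fun i j => Upsilon α i j z) v) := by
    ext w
    rw [hymIdeal, mem_polarSpace_iff_of_eq hz (by norm_num : 5 = 4 + 1)
      (fun j hj => generators_eq_empty r ε α j (by omega) (by omega)) v w (hu w), LinearMap.mem_ker]
    refine (forall_generator_five z _).trans ⟨fun h => ?_, fun h i j => ?_⟩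
    · funext i j
      rw [contractMap_apply _ _ _ _ (hu w), h]
      rfl
    · rw [← contractMap_apply _ (fun i j => Upsilon α i j z) _ _ (hu w), h]
      rfl
  have hs : Function.Surjective
      (contractMap (by norm_num : 5 = 4 + 1) (fun i j => Upsilon α i j z) v) := fun m => by
    obtain ⟨q, hq⟩ := exists_vertical_upsilon hV hα hz v ha m
    refine ⟨(0, q), funext fun i => funext fun j => ?_⟩
    rw [contractMap_apply _ _ _ _ (hu _), hq]
  rw [polarRank, h1, (LinearMap.quotKerEquivOfSurjective _ hs).finrank_eq, finrank_matrix]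

theorem connMatrix_frameVec {y : R6} (hy : Function.Bijective (α y)) (q : Fib r) (i j : Fin r)
    (c : ℂ) (k : Fin 3) : connMatrix α y q i j (frameVec α y c k) =
      q k i j * c - (starRingEnd ℂ) (q k j i) * (starRingEnd ℂ) c := by
  rw [connMatrix_apply, apply_frameVec hy, Finset.sum_eq_single k]
  · simp
  all_goals simp +contextual

/-- Two sections that agree on ker ξ and differ by a vertical vector q on a transversal differ by ξ
⊗ q, and bilinearity of F gives the change ξ ∧ (qα − (qα)*). -/
theorem curvPull_add_vertical (hV : IsOpen V) (hα : ContDiffOn ℝ ∞ α V) {z : Tot r}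
    (hz : z ∈ domX r V) {L : R6 →L[ℝ] Tot r} (hL : ∀ x, (L x).1 = x) (ξ : R6 →L[ℝ] ℝ)
    (q : Fib r) (i j : Fin r) (x x' : R6) :
    curvPull α z (L + ξ.smulRight ((0 : R6), q)) i j ![x, x'] = curvPull α z L i j ![x, x'] +
      ξ x * connMatrix α z.1 q i j x' - ξ x' * connMatrix α z.1 q i j x := by
  have h1 : ∀ w : Tot r, curvForm α i j z ![(0, q), w] = connMatrix α z.1 q i j w.1 :=
    curvForm_vertical hV hα i j hz q
  rw [curvPull_apply, curvPull_apply]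
  simp only [_root_.add_apply, ContinuousLinearMap.smulRight_apply, map_vec2_add_left,
    map_vec2_add_right, map_vec2_smul_left, map_vec2_smul_right, h1, hL,
    map_vec2_swap _ ((0 : R6), q) (L x), map_zero, Complex.real_smul]
  simp
  ring

theorem curvPull_add_antiPart (h : IsQuasiCoframing ε V α) {z : Tot r}
    (hz : z ∈ domX r V) {L : R6 →L[ℝ] Tot r} (hL : ∀ x, (L x).1 = x) (ξ : R6 →L[ℝ] ℝ)
    (q : Fib r) (i j : Fin r) (m n : Fin 3) :
    antiPart (frameVec α z.1 1) (frameVec α z.1 Complex.I)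
        (curvPull α z (L + ξ.smulRight ((0 : R6), q)) i j) m n =
      antiPart (frameVec α z.1 1) (frameVec α z.1 Complex.I) (curvPull α z L i j) m n -
        antiCoeff (frameVec α z.1 1) (frameVec α z.1 Complex.I) ξ m * (starRingEnd ℂ) (q n j i) +
        antiCoeff (frameVec α z.1 1) (frameVec α z.1 Complex.I) ξ n * (starRingEnd ℂ) (q m j i) :=
  antiPart_add_wedge (a := fun k => q k i j) (b := fun k => (starRingEnd ℂ) (q k j i))
    (curvPull_add_vertical h.isOpen h.smooth hz hL ξ q i j)
    (fun k => by rw [connMatrix_frameVec (h.bijective _ hz.1)]; simp)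
    (fun k => by rw [connMatrix_frameVec (h.bijective _ hz.1), Complex.conj_I]; ring) m n

theorem curvPull_add_hermTrace (h : IsQuasiCoframing ε V α) {z : Tot r}
    (hz : z ∈ domX r V) {L : R6 →L[ℝ] Tot r} (hL : ∀ x, (L x).1 = x) (ξ : R6 →L[ℝ] ℝ)
    (q : Fib r) (i j : Fin r) :
    hermTrace ε (frameVec α z.1 1) (frameVec α z.1 Complex.I)
        (curvPull α z (L + ξ.smulRight ((0 : R6), q)) i j) =
      hermTrace ε (frameVec α z.1 1) (frameVec α z.1 Complex.I) (curvPull α z L i j) +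
        2 * Complex.I * ∑ k, ε k *
          (antiCoeff (frameVec α z.1 1) (frameVec α z.1 Complex.I) ξ k * q k i j +
          (starRingEnd ℂ) (antiCoeff (frameVec α z.1 1) (frameVec α z.1 Complex.I) ξ k) *
            (starRingEnd ℂ) (q k j i)) :=
  hermTrace_add_wedge (a := fun k => q k i j) (b := fun k => (starRingEnd ℂ) (q k j i)) ε
    (curvPull_add_vertical h.isOpen h.smooth hz hL ξ q i j)
    (fun k => by rw [connMatrix_frameVec (h.bijective _ hz.1)]; simp)
    (fun k => by rw [connMatrix_frameVec (h.bijective _ hz.1), Complex.conj_I]; ring)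

theorem conj_hermTrace_curvPull (h : IsQuasiCoframing ε V α) {z : Tot r}
    (hz : z ∈ domX r V) (L : R6 →L[ℝ] Tot r) (i j : Fin r) :
    (starRingEnd ℂ) (hermTrace ε (frameVec α z.1 1) (frameVec α z.1 Complex.I)
      (curvPull α z L j i)) =
    -hermTrace ε (frameVec α z.1 1) (frameVec α z.1 Complex.I) (curvPull α z L i j) := by
  have h1 : ∀ x x', (starRingEnd ℂ) (curvPull α z L j i ![x, x']) = -curvPull α z L i j ![x, x'] :=
    fun x x' => by
      rw [curvPull_apply, curvPull_apply]
      have h2 := congrArg (fun g => g ![L x, L x']) (conj_curvForm h.isOpen h.smooth i j hz)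
      simpa using h2
  simp [hermTrace, h1]

/-- The `(0,1)`-coefficients of the conormal of a `5`-plane. -/
noncomputable def conormalCoeff (α : R6 → R6 →L[ℝ] (Fin 3 → ℂ)) (y : R6) (x : Fin 5 → R6) :
    Fin 3 → ℂ :=
  antiCoeff (frameVec α y 1) (frameVec α y Complex.I) (conormal x)

theorem finrank_tot (r : ℕ) : Module.finrank ℝ (Tot r) = 6 + 6 * r ^ 2 := by
  rw [Module.finrank_prod, Module.finrank_pi_fintype]
  simp only [finrank_matrix]
  simp
  ring

set_option maxHeartbeats 2000000 in
-- Complete the projected 5-plane by b₀ to a basis of ℝ⁶. Then (b₀, q) is polar exactly when the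
-- section extending the 5-plane and sending b₀ to (b₀, q) has integral range, an affine system in
-- q. It is solvable, and its homogeneous solutions form a copy of the skew-Hermitian matrices. So
-- the polar space maps onto ℝ⁶ with kernel of dimension r², and its codimension is (6 + 6r²) − (6 +
-- r²).
theorem polarRank_five (h : IsQuasiCoframing ε V α) {z : Tot r} (hz : z ∈ domX r V)
    (v : Fin 5 → Tot r)
    (hvI : IsIntegralElement (hymIdeal r ε V α) z (Submodule.span ℝ (Set.range v)))
    (hN : signedNorm ε (conormalCoeff α z.1 fun i => (v i).1) ≠ 0) :
    polarRank (hymIdeal r ε V α) z v = 5 * r ^ 2 := by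
  set x : Fin 5 → R6 := fun i => (v i).1 with hx
  set ξ : R6 →L[ℝ] ℝ := conormal x with hξ
  set s := conormalCoeff α z.1 x with hs
  have hs' : s = antiCoeff (frameVec α z.1 1) (frameVec α z.1 Complex.I) ξ := rfl
  have hD := isDualFrame_frameVec (h.bijective z.1 hz.1)
  -- The conormal is nonzero, for otherwise the signed norm would vanish; as ξ(b₀) is a volume, this
  -- also makes (b₀, x) a basis.
  obtain ⟨b₀, hb₀⟩ : ∃ b₀, ξ b₀ = 1 := by
    have h1 : ∃ y, ξ y ≠ 0 := by
      by_contra hc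
      push Not at hc
      apply hN
      simp [signedNorm, hs', antiCoeff, hc]
    obtain ⟨y, hy⟩ := h1
    exact ⟨(ξ y)⁻¹ • y, by simp [hy]⟩
  have hli : LinearIndependent ℝ (Fin.cons b₀ x : Fin 6 → R6) := by
    rw [← vol6_ne_zero_iff, ← conormal_apply, ← hξ, hb₀]
    exact one_ne_zero
  let bx : Module.Basis (Fin 6) ℝ R6 := basisOfLinearIndependentOfCardEqFinrank hli (by simp)
  have hbx : ∀ i, bx i = (Fin.cons b₀ x : Fin 6 → R6) i := fun i => by
    rw [coe_basisOfLinearIndependentOfCardEqFinrank]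
  have hbx0 : bx 0 = b₀ := hbx 0
  have hbxs : ∀ i : Fin 5, bx i.succ = x i := fun i => hbx i.succ
  have hvli : LinearIndependent ℝ v := by
    have h1 : LinearIndependent ℝ x := hli.comp (Fin.succ : Fin 5 → Fin 6) (Fin.succ_injective 5)
    exact LinearIndependent.of_comp (LinearMap.fst ℝ R6 (Fib r)) h1
  let L₀ : R6 →L[ℝ] Tot r :=
    (bx.constr ℝ (Fin.cons (b₀, (0 : Fib r)) v : Fin 6 → Tot r)).toContinuousLinearMap
  have hL0 : ∀ i, L₀ (bx i) = (Fin.cons (b₀, (0 : Fib r)) v : Fin 6 → Tot r) i := fun i =>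
    bx.constr_basis ℝ _ i
  have hLx : ∀ i : Fin 5, L₀ (x i) = v i := fun i => by rw [← hbxs]; exact hL0 i.succ
  have hL1 : ∀ y, (L₀ y).1 = y := by
    have h1 : (LinearMap.fst ℝ R6 (Fib r)).comp (L₀ : R6 →ₗ[ℝ] Tot r) = LinearMap.id := by
      refine bx.ext fun i => ?_
      change (L₀ (bx i)).1 = bx i
      rw [hL0]
      refine Fin.cases ?_ (fun i => ?_) i
      · exact hbx0.symm
      · exact (hbxs i).symm
    exact fun y => LinearMap.congr_fun h1 y
  -- Since ξ(b₀) = 1 and ξ kills the projected 5-plane, this section moves the image of b₀ by (0, q)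
  -- and fixes the images of the other basis vectors.
  let Lq : Fib r → R6 →L[ℝ] Tot r := fun q => L₀ + ξ.smulRight ((0 : R6), q)
  have hLq1 : ∀ q y, (Lq q y).1 = y := fun q y => by
    simp [Lq, hL1]
  have hLqb : ∀ q i, Lq q (bx i) = (Fin.cons (b₀, q) v : Fin 6 → Tot r) i := by
    intro q i
    change L₀ (bx i) + ξ (bx i) • ((0 : R6), q) = _
    rw [hL0]
    refine Fin.cases ?_ (fun i => ?_) i
    · rw [hbx0, hb₀]
      simp
    · rw [hbxs, hξ, conormal_self]
      simp
  have hrange : ∀ q, LinearMap.range (Lq q : R6 →ₗ[ℝ] Tot r) =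
      Submodule.span ℝ (Set.range (Fin.cons (b₀, q) v : Fin 6 → Tot r)) := by
    intro q
    rw [LinearMap.range_eq_map, ← bx.span_eq, Submodule.map_span, ← Set.range_comp]
    congr 2
    funext i
    exact hLqb q i
  have hmem : ∀ q, ((b₀, q) : Tot r) ∈ polarSpace (hymIdeal r ε V α) z v ↔
      ∀ i j, (∀ m n, antiPart (frameVec α z.1 1) (frameVec α z.1 Complex.I) (curvPull α z L₀ i j) m n
        - s m * (starRingEnd ℂ) (q n j i) + s n * (starRingEnd ℂ) (q m j i) = 0) ∧
      hermTrace ε (frameVec α z.1 1) (frameVec α z.1 Complex.I) (curvPull α z L₀ i j) +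
        2 * Complex.I * ∑ k, ε k * (s k * q k i j +
          (starRingEnd ℂ) (s k) * (starRingEnd ℂ) (q k j i)) = 0 := by
    intro q
    rw [hymIdeal, mem_polarSpace_iff hz (fun j h5 h6 => generators_eq_empty r ε α j h5 h6) hvli hvI,
      ← hymIdeal, ← hrange, isIntegralElement_range_iff h hz (hLq1 q)]
    simp only [Lq, curvPull_add_antiPart h hz hL1, curvPull_add_hermTrace h hz hL1, ← hs']
  have hcyc : ∀ i j, s 0 * antiPart (frameVec α z.1 1) (frameVec α z.1 Complex.I)
        (curvPull α z L₀ i j) 1 2 +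
      s 1 * antiPart (frameVec α z.1 1) (frameVec α z.1 Complex.I) (curvPull α z L₀ i j) 2 0 +
      s 2 * antiPart (frameVec α z.1 1) (frameVec α z.1 Complex.I) (curvPull α z L₀ i j) 0 1 = 0 := by
    intro i j
    have h1 := (isIntegralElement_five_iff hz v).1 hvI i j
    have h2 := compCLM_apply_eq (Upsilon α i j z) L₀ x hLx
    have h3 := upsilon_comp_section (α := α) z hL1 i j
    rw [h1] at h2
    generalize (Upsilon α i j z).compContinuousLinearMap L₀ = ρ at h2 h3
    exact hD.cyclic_eq_zero _ ξ bx (fun i => by rw [hbxs, hξ, conormal_self]) ρ h3 hbxs h2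
  obtain ⟨q₀, hq₀⟩ := exists_polar_solution hN _ _
    (fun i j m n => antiPart_swap _ _ (curvPull α z L₀ i j) m n) hcyc
    (fun i j => conj_hermTrace_curvPull (ε := ε) h hz L₀ i j)
  have hq₀' := (hmem q₀).2 hq₀
  set H := polarSpace (hymIdeal r ε V α) z v with hH
  -- Differences of solutions of the affine system are the vertical polar vectors; subtracting the
  -- particular solution q₀ leaves the homogeneous system.
  have hvert : ∀ q, ((0, q) : Tot r) ∈ H ↔ q ∈ polarKernel r ε s := by
    intro q
    have h1 : ((0, q) : Tot r) ∈ H ↔ ((b₀, q₀ + q) : Tot r) ∈ H := by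
      have h2 : ((b₀, q₀ + q) : Tot r) = (b₀, q₀) + (0, q) := by simp
      rw [h2]
      exact (Submodule.add_mem_iff_right H hq₀').symm
    rw [h1, hmem]
    refine forall_congr' fun i => forall_congr' fun j => and_congr ?_ ?_
    · refine forall_congr' fun m => forall_congr' fun n => ?_
      have h3 := (hq₀ i j).1 m n
      simp only [Pi.add_apply, map_add]
      constructor
      · intro h4
        linear_combination h4 - h3
      · intro h4
        linear_combination h4 + h3
    · have h3 := (hq₀ i j).2
      have h5 : ∀ q : Fib r, ∑ k, ε k * (s k * (q₀ + q) k i j +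
          (starRingEnd ℂ) (s k) * (starRingEnd ℂ) ((q₀ + q) k j i)) =
          ∑ k, ε k * (s k * q₀ k i j + (starRingEnd ℂ) (s k) * (starRingEnd ℂ) (q₀ k j i)) +
          ∑ k, ε k * (s k * q k i j + (starRingEnd ℂ) (s k) * (starRingEnd ℂ) (q k j i)) := by
        intro q
        rw [← Finset.sum_add_distrib]
        refine Finset.sum_congr rfl fun k _ => ?_
        simp only [Pi.add_apply, map_add]
        ring
      rw [h5, mul_add, ← add_assoc, h3, zero_add]
      simp
  -- The projection is onto because (b₀, q₀) and the 5-plane itself lie in the polar space; its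
  -- kernel consists of the vertical polar vectors.
  let φ : H →ₗ[ℝ] R6 := (LinearMap.fst ℝ R6 (Fib r)).comp H.subtype
  have hφr : LinearMap.range φ = ⊤ := by
    rw [eq_top_iff, ← bx.span_eq, Submodule.span_le]
    rintro _ ⟨i, rfl⟩
    refine Fin.cases ?_ (fun i => ?_) i
    · exact ⟨⟨(b₀, q₀), hq₀'⟩, hbx0.symm⟩
    · have hvi : v i ∈ H := fun ψ _ =>
        (ψ z).map_eq_zero_of_eq _ (i := 0) (j := i.succ) rfl (Fin.succ_ne_zero i).symm
      exact ⟨⟨v i, hvi⟩, (hbxs i).symm⟩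
  have hφk : Module.finrank ℝ (LinearMap.ker φ) = r ^ 2 := by
    have h1 : (LinearMap.ker φ).map H.subtype =
        LinearMap.range ((LinearMap.inr ℝ R6 (Fib r)).comp (polarParam r s)) := by
      ext w
      constructor
      · rintro ⟨⟨⟨y, q⟩, hw⟩, hk, rfl⟩
        obtain rfl : y = 0 := hk
        have h2 : q ∈ (LinearMap.range (polarParam r s) : Set (Fib r)) := by
          rw [range_polarParam hN]
          exact (hvert q).1 hw
        obtain ⟨c, rfl⟩ := h2
        exact ⟨c, rfl⟩
      · rintro ⟨c, rfl⟩
        have h2 : polarParam r s c ∈ polarKernel r ε s := by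
          rw [← range_polarParam hN]
          exact ⟨c, rfl⟩
        exact ⟨⟨(0, polarParam r s c), (hvert _).2 h2⟩, rfl, rfl⟩
    rw [← Submodule.finrank_map_subtype_eq H, h1, LinearMap.finrank_range_of_inj, finrank_skewHerm]
    exact LinearMap.inr_injective.comp (polarParam_injective hN)
  have hHf : Module.finrank ℝ H = 6 + r ^ 2 := by
    rw [← φ.finrank_range_add_finrank_ker, hφr, hφk]
    simp
  have hq := H.finrank_quotient_add_finrank
  rw [hHf, finrank_tot] at hq
  rw [polarRank, ← hH]
  omega

end PolarSpaces

end PseudoHYM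

namespace PseudoHYM

open EDS

/-! ### Admissible integral elements: description and existence. -/

section Admissible

variable {ε : Fin 3 → ℝ} {V : Set R6} {α : R6 → R6 →L[ℝ] (Fin 3 → ℂ)} {r : ℕ}

theorem form_map_linearDependent {W A : Type*} [NormedAddCommGroup W] [NormedSpace ℝ W]
    [NormedAddCommGroup A] [NormedSpace ℝ A] {k : ℕ} (β : W [⋀^Fin k]→L[ℝ] A) {v : Fin k → W}
    (hv : ¬LinearIndependent ℝ v) : β v = 0 :=
  β.toAlternatingMap.map_linearDependent v hv

theorem linearIndependent_of_indepForm_ne_zero {z : Tot r} {w : Fin 6 → Tot r}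
    (h : indepForm r α z w ≠ 0) :
    LinearIndependent ℝ (ContinuousLinearMap.fst ℝ R6 (Fib r) ∘ w) := by
  by_contra hc
  apply h
  rw [indepForm_eq, form_map_linearDependent _ hc, mul_zero, Complex.zero_re]

/-- An admissible `6`-plane is the range of a section of the projection to `ℝ⁶`. -/
theorem exists_section_of_isAdmissible {I : FormFamily (Tot r)} {z : Tot r}
    {E : Submodule ℝ (Tot r)} (h : IsAdmissibleElement I (indepForm r α) z E) :
    ∃ L : R6 →L[ℝ] Tot r, (∀ x, (L x).1 = x) ∧ LinearMap.range (L : R6 →ₗ[ℝ] Tot r) = E := by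
  obtain ⟨hE, -, w, hw, hne⟩ := h
  have hli := linearIndependent_of_indepForm_ne_zero hne
  let φ : E →ₗ[ℝ] R6 := (LinearMap.fst ℝ R6 (Fib r)).comp E.subtype
  have hs : Function.Surjective φ := by
    rw [← LinearMap.range_eq_top, eq_top_iff,
      ← hli.span_eq_top_of_card_eq_finrank' (by simp), Submodule.span_le]
    rintro _ ⟨i, rfl⟩
    exact ⟨⟨w i, hw i⟩, rfl⟩
  have hφ : Function.Bijective φ :=
    ⟨(LinearMap.injective_iff_surjective_of_finrank_eq_finrank (by rw [hE]; simp)).2 hs, hs⟩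
  let e := LinearEquiv.ofBijective φ hφ
  refine ⟨(E.subtype.comp (e.symm : R6 →ₗ[ℝ] E)).toContinuousLinearMap, fun x => ?_, ?_⟩
  · exact e.apply_symm_apply x
  · ext y
    constructor
    · rintro ⟨x, rfl⟩
      exact (e.symm x).2
    · intro hy
      exact ⟨e ⟨y, hy⟩, congrArg Subtype.val (e.symm_apply_apply ⟨y, hy⟩)⟩

theorem indepForm_frame {z : Tot r} (hy : Function.Bijective (α z.1)) {L : R6 →L[ℝ] Tot r}
    (hL : ∀ x, (L x).1 = x) : indepForm r α z (fun i => L ((isDualFrame_frameVec hy).basis i)) ≠ 0 := by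
  have h1 : (ContinuousLinearMap.fst ℝ R6 (Fib r) ∘
      fun i => L ((isDualFrame_frameVec hy).basis i)) =
      ![frameVec α z.1 1 0, frameVec α z.1 Complex.I 0, frameVec α z.1 1 1,
        frameVec α z.1 Complex.I 1, frameVec α z.1 1 2, frameVec α z.1 Complex.I 2] := by
    rw [← (isDualFrame_frameVec hy).coe_basis]
    funext i
    exact hL _
  rw [indepForm_eq, h1, (isDualFrame_frameVec hy).volForm_wedge_conj_apply]
  simp

theorem isAdmissible_range {z : Tot r} (hy : Function.Bijective (α z.1)) {I : FormFamily (Tot r)}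
    {L : R6 →L[ℝ] Tot r} (hL : ∀ x, (L x).1 = x)
    (hI : IsIntegralElement I z (LinearMap.range (L : R6 →ₗ[ℝ] Tot r))) :
    IsAdmissibleElement I (indepForm r α) z (LinearMap.range (L : R6 →ₗ[ℝ] Tot r)) := by
  refine ⟨?_, hI, fun i => L ((isDualFrame_frameVec hy).basis i), fun i => ⟨_, rfl⟩,
    indepForm_frame hy hL⟩
  rw [LinearMap.finrank_range_of_inj]
  · simp
  · intro x y hxy
    rw [← hL x, ← hL y]
    exact congrArg Prod.fst hxy

/-- The pulled back curvature `τ(x, ·)` as a covector. -/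
noncomputable def contractCurv (α : R6 → R6 →L[ℝ] (Fin 3 → ℂ)) (z : Tot r) (x : R6)
    (i j : Fin r) : R6 →L[ℝ] ℂ :=
  LinearMap.toContinuousLinearMap
    { toFun := fun v => -(1 / 2) * curvForm α i j z ![(x, 0), (v, 0)]
      map_add' := fun v v' => by
        have h1 : ((v + v', 0) : Tot r) = (v, 0) + (v', 0) := by simp
        rw [h1, map_vec2_add_right, mul_add]
      map_smul' := fun t v => by
        have h1 : ((t • v, 0) : Tot r) = t • (v, 0) := by simp
        rw [h1, map_vec2_smul_right, Complex.real_smul, RingHom.id_apply, Complex.real_smul]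
        ring }

theorem contractCurv_apply (z : Tot r) (x v : R6) (i j : Fin r) :
    contractCurv α z x i j v = -(1 / 2) * curvForm α i j z ![(x, 0), (v, 0)] := rfl

/-- The whole curvature can be made to vanish. If q(x) is chosen with q(x)α − (q(x)α)* = −½F((x,0),
·) on horizontal vectors, the two vertical corrections of the section x ↦ (x, q(x)) add up to
−F((x,0), (x',0)). Such q(x) exists because F is skew-Hermitian. -/
theorem exists_isAdmissible (h : IsQuasiCoframing ε V α) {z : Tot r} (hz : z ∈ domX r V) :
    ∃ E, IsAdmissibleElement (hymIdeal r ε V α) (indepForm r α) z E := by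
  have hy := h.bijective z.1 hz.1
  let q : R6 → Fib r := fun x => fibOf α z.1 fun i j => contractCurv α z x i j
  have hq_add : ∀ x x', q (x + x') = q x + q x' := fun x x' => by
    funext k i j
    have h1 : ((x + x', 0) : Tot r) = (x, 0) + (x', 0) := by simp
    simp only [q, Pi.add_apply, fibOf, contractCurv_apply, h1, map_vec2_add_left]
    ring
  have hq_smul : ∀ (t : ℝ) x, q (t • x) = t • q x := fun t x => by
    funext k i j
    have h1 : ((t • x, 0) : Tot r) = t • (x, 0) := by simp
    simp only [q, Pi.smul_apply, fibOf, contractCurv_apply, h1, map_vec2_smul_left,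
      Complex.real_smul]
    ring
  let L : R6 →L[ℝ] Tot r := LinearMap.toContinuousLinearMap
    { toFun := fun x => (x, q x)
      map_add' := fun x x' => Prod.ext rfl (hq_add x x')
      map_smul' := fun t x => Prod.ext rfl (hq_smul t x) }
  have hL : ∀ x, L x = (x, 0) + (0, q x) := fun x => by
    change (x, q x) = _
    simp
  have hB : ∀ x i j v, connMatrix α z.1 (q x) i j v =
      -(1 / 2) * curvForm α i j z ![(x, 0), (v, 0)] := by
    intro x i j v
    refine connMatrix_fibOf hy (contractCurv α z x) (fun i j v => ?_) i j v
    have h2 := congrArg (fun g => g ![((x, 0) : Tot r), (v, 0)])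
      (conj_curvForm h.isOpen h.smooth i j hz)
    simp only [conjForm_apply, ContinuousAlternatingMap.neg_apply] at h2
    rw [contractCurv_apply, contractCurv_apply, map_mul, h2]
    simp [Complex.conj_ofNat]
  have hf : ∀ i j x x', curvPull α z L i j ![x, x'] = 0 := by
    intro i j x x'
    rw [curvPull_apply, hL, hL, map_vec2_add_left, map_vec2_add_right,
      curvForm_vertical h.isOpen h.smooth i j hz, map_vec2_swap _ ((0 : R6), _) ((x, 0) : Tot r),
      curvForm_vertical h.isOpen h.smooth i j hz, hB]
    have h3 : ((x', (0 : Fib r)) + (0, q x')).1 = x' := by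
      simp
    rw [h3, hB, map_vec2_swap _ ((x, 0) : Tot r) (x', 0)]
    ring
  refine ⟨_, isAdmissible_range hy (L := L) (fun x => rfl) ?_⟩
  rw [isIntegralElement_range_iff h hz (fun x => rfl)]
  exact fun i j => ⟨fun m n => by simp [antiPart, hf], by simp [hermTrace, hf]⟩

end Admissible

/-! ### A frame of ℝ⁶ in general position. -/

section GoodFrame

variable {ε : Fin 3 → ℝ} {V : Set R6} {α : R6 → R6 →L[ℝ] (Fin 3 → ℂ)} {r : ℕ}

/-- A frame all of whose initial planes have the generic type. -/
noncomputable def goodFrame (α : R6 → R6 →L[ℝ] (Fin 3 → ℂ)) (y : R6) : Fin 6 → R6 :=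
  ![frameVec α y 1 0, frameVec α y Complex.I 0, frameVec α y 1 1, frameVec α y 1 2,
    frameVec α y Complex.I 1, frameVec α y Complex.I 2]

theorem linearIndependent_goodFrame {y : R6} (hy : Function.Bijective (α y)) :
    LinearIndependent ℝ (goodFrame α y) := by
  have h1 := (isDualFrame_frameVec hy).linearIndependent.comp ![0, 1, 2, 4, 3, 5] (by decide)
  have h2 : goodFrame α y = ![frameVec α y 1 0, frameVec α y Complex.I 0, frameVec α y 1 1,
      frameVec α y Complex.I 1, frameVec α y 1 2, frameVec α y Complex.I 2] ∘
        (![0, 1, 2, 4, 3, 5] : Fin 6 → Fin 6) := by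
    funext i
    fin_cases i <;> rfl
  rw [h2]
  exact h1

/-- The first four vectors contain one J-invariant pair and single vectors from the other two.
Taking two full pairs first would give a complex 2-plane, on which α¹α²α³ and all the relevant
products vanish. -/
theorem antiVol_goodFrame_four {y : R6} (hy : Function.Bijective (α y)) :
    antiVol (fun k => comp α k y) 0
      (fun a : Fin 4 => goodFrame α y (Fin.castLE (by norm_num) a)) ≠ 0 := by
  have h := isDualFrame_frameVec hy
  have h1 : antiVol (fun k => comp α k y) 0
      (fun a : Fin 4 => goodFrame α y (Fin.castLE (by norm_num) a)) = 2 * Complex.I := by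
    change (starRingEnd ℂ) (comp α 0 y (frameVec α y 1 0)) *
        volForm (fun k => comp α k y) ![frameVec α y Complex.I 0, frameVec α y 1 1,
          frameVec α y 1 2] -
      (starRingEnd ℂ) (comp α 0 y (frameVec α y Complex.I 0)) *
        volForm (fun k => comp α k y) ![frameVec α y 1 0, frameVec α y 1 1, frameVec α y 1 2] +
      (starRingEnd ℂ) (comp α 0 y (frameVec α y 1 1)) * volForm (fun k => comp α k y)
        ![frameVec α y 1 0, frameVec α y Complex.I 0, frameVec α y 1 2] -
      (starRingEnd ℂ) (comp α 0 y (frameVec α y 1 2)) * volForm (fun k => comp α k y)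
        ![frameVec α y 1 0, frameVec α y Complex.I 0, frameVec α y 1 1] = _
    simp only [volForm_apply, h.apply, h.apply']
    simp
    ring
  rw [h1]
  simp

/-- The first vector of the 5-plane is left out here, because it is the one to be varied vertically
when the differentials of Υ are shown to be independent. -/
theorem antiVol_goodFrame_five {y : R6} (hy : Function.Bijective (α y)) :
    antiVol (fun k => comp α k y) 1
      ![goodFrame α y 1, goodFrame α y 2, goodFrame α y 3, goodFrame α y 4] ≠ 0 := by
  have h := isDualFrame_frameVec hy
  have h1 : antiVol (fun k => comp α k y) 1
      ![goodFrame α y 1, goodFrame α y 2, goodFrame α y 3, goodFrame α y 4] = -2 := by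
    change (starRingEnd ℂ) (comp α 1 y (frameVec α y Complex.I 0)) *
        volForm (fun k => comp α k y) ![frameVec α y 1 1, frameVec α y 1 2,
          frameVec α y Complex.I 1] -
      (starRingEnd ℂ) (comp α 1 y (frameVec α y 1 1)) * volForm (fun k => comp α k y)
        ![frameVec α y Complex.I 0, frameVec α y 1 2, frameVec α y Complex.I 1] +
      (starRingEnd ℂ) (comp α 1 y (frameVec α y 1 2)) * volForm (fun k => comp α k y)
        ![frameVec α y Complex.I 0, frameVec α y 1 1, frameVec α y Complex.I 1] -
      (starRingEnd ℂ) (comp α 1 y (frameVec α y Complex.I 1)) * volForm (fun k => comp α k y)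
        ![frameVec α y Complex.I 0, frameVec α y 1 1, frameVec α y 1 2] = _
    simp only [volForm_apply, h.apply, h.apply']
    simp
    norm_num
  rw [h1]
  simp

/-- The first five vectors miss only Je₃, so the conormal is a multiple of its dual covector and the
signed norm is ε₂ times a positive number: the hyperplane is not null even for the indefinite
signature. -/
theorem signedNorm_goodFrame (hε : ε = ![1, 1, 1] ∨ ε = ![1, -1, -1]) {y : R6}
    (hy : Function.Bijective (α y)) :
    signedNorm ε (conormalCoeff α y
      (fun a : Fin 5 => goodFrame α y (Fin.castLE (by norm_num) a))) ≠ 0 := by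
  set x : Fin 5 → R6 := fun a : Fin 5 => goodFrame α y (Fin.castLE (by norm_num) a) with hx
  have h0 : conormal x (frameVec α y 1 0) = 0 := conormal_self x 0
  have h1 : conormal x (frameVec α y Complex.I 0) = 0 := conormal_self x 1
  have h2 : conormal x (frameVec α y 1 1) = 0 := conormal_self x 2
  have h3 : conormal x (frameVec α y 1 2) = 0 := conormal_self x 3
  have h4 : conormal x (frameVec α y Complex.I 1) = 0 := conormal_self x 4
  have h5 : conormal x (frameVec α y Complex.I 2) ≠ 0 := by
    rw [conormal_apply, vol6_ne_zero_iff]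
    have h6 := (linearIndependent_goodFrame hy).comp ![5, 0, 1, 2, 3, 4] (by decide)
    have h7 : (Fin.cons (frameVec α y Complex.I 2) x : Fin 6 → R6) =
        goodFrame α y ∘ (![5, 0, 1, 2, 3, 4] : Fin 6 → Fin 6) := by
      funext i
      fin_cases i <;> rfl
    rw [h7]
    exact h6
  have hN : signedNorm ε (conormalCoeff α y x) =
      ε 2 * (1 / 4 * conormal x (frameVec α y Complex.I 2) ^ 2) := by
    simp only [signedNorm, conormalCoeff, antiCoeff, Fin.sum_univ_three, h0, h1, h2, h3, h4]
    simp
    left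
    ring
  rw [hN]
  have h7 : ε 2 ≠ 0 := by rcases hε with rfl | rfl <;> simp
  positivity

end GoodFrame

end PseudoHYM

/-! ### Kähler-ordinary elements and analytic genericity. -/

namespace EDS

variable {W : Type*} [NormedAddCommGroup W] [NormedSpace ℝ W]

theorem differentiableAt_form_apply {A : Type*} [NormedAddCommGroup A] [NormedSpace ℝ A] {X : Set W}
    (hX : IsOpen X) {k : ℕ}
    {ψ : W → W [⋀^Fin k]→L[ℝ] A} (hψ : ContDiffOn ℝ ∞ ψ X) {z : W} (hz : z ∈ X) (v : Fin k → W) :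
    DifferentiableAt ℝ (fun p : W × (Fin k → W) => ψ p.1 p.2) (z, v) := by
  have h1 : ContDiffOn ℝ ∞ (fun p : W × (Fin k → W) => ψ p.1 p.2) (X ×ˢ Set.univ) := by
    refine contDiffOn_form_apply (hψ.comp contDiff_fst.contDiffOn fun p hp => hp.1) fun i => ?_
    exact ((contDiff_apply ℝ W i).comp contDiff_snd).contDiffOn
  exact (h1.contDiffAt ((hX.prod isOpen_univ).mem_nhds ⟨hz, trivial⟩)).differentiableAt (by simp)

/-- The derivative of `(z, v) ↦ ψ(z)(v)` with respect to one of the vectors. -/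
theorem fderiv_form_apply_single {A : Type*} [NormedAddCommGroup A] [NormedSpace ℝ A] {X : Set W}
    (hX : IsOpen X) {k : ℕ}
    {ψ : W → W [⋀^Fin k]→L[ℝ] A} (hψ : ContDiffOn ℝ ∞ ψ X) {z : W} (hz : z ∈ X) (v : Fin k → W)
    (i : Fin k) (w : W) :
    fderiv ℝ (fun p : W × (Fin k → W) => ψ p.1 p.2) (z, v) (0, Pi.single i w) =
      ψ z (Function.update v i w) := by
  rw [← (differentiableAt_form_apply hX hψ hz v).lineDeriv_eq_fderiv, lineDeriv]
  have h1 : (fun t : ℝ => ψ ((z, v) + t • ((0 : W), (Pi.single i w : Fin k → W))).1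
      ((z, v) + t • ((0 : W), (Pi.single i w : Fin k → W))).2) =
      fun t => ψ z v + t • ψ z (Function.update v i w) := by
    funext t
    have h2 : ((z, v) + t • ((0 : W), (Pi.single i w : Fin k → W))).1 = z := by simp
    have h3 : ((z, v) + t • ((0 : W), (Pi.single i w : Fin k → W))).2 =
        Function.update v i (v i + t • w) := by
      funext j
      by_cases hj : j = i
      · subst hj; simp
      · simp [hj]
    rw [h2, h3, (ψ z).map_update_add, (ψ z).map_update_smul, Function.update_eq_self]
  rw [h1]
  simpa using ((hasDerivAt_id (0 : ℝ)).smul_const (ψ z (Function.update v i w))).const_add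
    (ψ z v) |>.deriv

/-- Below the degree of the generators every nearby plane is integral, so the empty family of
equations serves. -/
theorem isKahlerOrdinary_of_lt {X : Set W} {G : FormFamily W} (hX : IsOpen X) {z : W} (hz : z ∈ X)
    {d k : ℕ} (hG : ∀ j < d, G j = ∅) (hk : k < d) {v : Fin k → W} (hv : LinearIndependent ℝ v) :
    IsKahlerOrdinary (ideal X G) z v := by
  refine ⟨hv, isIntegralElement_span_of_lt hz hG hk v, 0, Fin.elim0, fun a => a.elim0,
    linearIndependent_empty_type, ?_⟩
  have h1 : ∀ᶠ p : W × (Fin k → W) in 𝓝 (z, v), p.1 ∈ X :=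
    continuousAt_fst.eventually_mem (hX.mem_nhds hz)
  filter_upwards [h1] with p hp
  exact ⟨fun _ a => a.elim0, fun _ => isIntegralElement_span_of_lt hp hG hk p.2⟩

/-- An analytic function on the line that is nonzero at one point is nonzero near `0`. -/
theorem eventually_ne_zero_of_contDiff {A : Type*} [NormedAddCommGroup A] [NormedSpace ℝ A]
    {g : ℝ → A} (hg : ContDiff ℝ ω g) (h1 : g 1 ≠ 0) :
    ∀ᶠ s in 𝓝[≠] (0 : ℝ), g s ≠ 0 := by
  have ha : AnalyticOnNhd ℝ g Set.univ := hg.analyticOnNhd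
  rcases (ha 0 trivial).eventually_eq_zero_or_eventually_ne_zero with h | h
  · exact absurd (ha.eqOn_zero_of_preconnected_of_eventuallyEq_zero isPreconnected_univ trivial h
      (Set.mem_univ 1)) h1
  · exact h

end EDS

namespace PseudoHYM

open EDS

/-! ### Kähler-regularity in dimensions up to five. -/

section Regular

variable {ε : Fin 3 → ℝ} {V : Set R6} {α : R6 → R6 →L[ℝ] (Fin 3 → ℂ)} {r : ℕ}

/-- `antiVol` in terms of the components of the vectors. -/
noncomputable def antiPoly (k : Fin 3) (M : Fin 4 → Fin 3 → ℂ) : ℂ :=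
  antiVol (W := Fin 3 → ℂ) (fun k => ContinuousLinearMap.proj k) k M

theorem antiVol_eq (y : R6) (k : Fin 3) (x : Fin 4 → R6) :
    antiVol (fun k => comp α k y) k x = antiPoly k fun a => α y (x a) := by
  simp only [antiVol, antiPoly, volForm_apply]
  simp [comp]

/-- The function is polynomial in the real and imaginary parts of the entries. Smoothness class ω is
wanted, so that it cannot vanish on a whole interval of a line without vanishing identically there.
-/
theorem contDiff_antiPoly (k : Fin 3) : ContDiff ℝ ω (antiPoly k) := by
  have h1 : ∀ a b, ContDiff ℝ ω (fun M : Fin 4 → Fin 3 → ℂ => M a b) := fun a b =>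
    contDiff_apply_apply ℝ ℂ a b
  have h2 : ∀ a b, ContDiff ℝ ω (fun M : Fin 4 → Fin 3 → ℂ => (starRingEnd ℂ) (M a b)) :=
    fun a b => Complex.conjCLE.contDiff.comp (h1 a b)
  have h3 : antiPoly k = fun M => antiVol (W := Fin 3 → ℂ) (fun k => ContinuousLinearMap.proj k) k M :=
    rfl
  rw [h3]
  simp only [antiVol, volForm_apply, ContinuousLinearMap.proj_apply]
  have h4 : ∀ a b c, ContDiff ℝ ω (fun M : Fin 4 → Fin 3 → ℂ =>
      (M a 0 * M b 1 - M b 0 * M a 1) * M c 2 - (M a 0 * M c 1 - M c 0 * M a 1) * M b 2 +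
        (M b 0 * M c 1 - M c 0 * M b 1) * M a 2) := by
    intro a b c
    have := h1
    fun_prop
  exact ((((h2 0 k).mul (h4 1 2 3)).sub ((h2 1 k).mul (h4 0 2 3))).add
    ((h2 2 k).mul (h4 0 1 3))).sub ((h2 3 k).mul (h4 0 1 2))

theorem continuousAt_fst_fst (hV : IsOpen V) {F : Type*} [TopologicalSpace F] {g : R6 → F}
    (hg : ContinuousOn g V) {z : Tot r} (hz : z ∈ domX r V) {k : ℕ} (v : Fin k → Tot r) :
    ContinuousAt (fun p : Tot r × (Fin k → Tot r) => g p.1.1) (z, v) :=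
  ContinuousAt.comp (f := fun p : Tot r × (Fin k → Tot r) => p.1.1) (g := g)
    (hg.continuousAt (hV.mem_nhds hz.1)) (by fun_prop)

theorem eventually_antiVol_ne_zero (hV : IsOpen V) (hα : ContDiffOn ℝ ∞ α V) {z : Tot r}
    (hz : z ∈ domX r V) (v : Fin 4 → Tot r) {k : Fin 3}
    (ha : antiVol (fun k => comp α k z.1) k (fun a => (v a).1) ≠ 0) :
    ∀ᶠ p : Tot r × (Fin 4 → Tot r) in 𝓝 (z, v),
      antiVol (fun k => comp α k p.1.1) k (fun a => (p.2 a).1) ≠ 0 := by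
  have h1 : ContinuousAt (fun p : Tot r × (Fin 4 → Tot r) =>
      antiVol (fun k => comp α k p.1.1) k (fun a => (p.2 a).1)) (z, v) := by
    simp only [antiVol_eq]
    refine ContinuousAt.comp (g := antiPoly k) (contDiff_antiPoly k).continuous.continuousAt ?_
    refine continuousAt_pi.2 fun a => ?_
    exact (continuousAt_fst_fst hV hα.continuousOn hz v).clm_apply (by fun_prop)
  exact h1.eventually_ne ha

theorem signedNorm_def (ε : Fin 3 → ℝ) (y : R6) (x : Fin 5 → R6) :
    signedNorm ε (conormalCoeff α y x) = ∑ k, ε k * Complex.normSq ((1 / 2) *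
      (((vol6 (Fin.cons (frameVec α y 1 k) x) : ℝ) : ℂ) + Complex.I *
        ((vol6 (Fin.cons (frameVec α y Complex.I k) x) : ℝ) : ℂ))) := rfl

theorem continuousAt_cons {T : Type*} [TopologicalSpace T] {n : ℕ} {f : T → R6} {g : T → Fin n → R6}
    {t : T} (hf : ContinuousAt f t) (hg : ContinuousAt g t) :
    ContinuousAt (fun t => (Fin.cons (f t) (g t) : Fin (n + 1) → R6)) t := by
  refine continuousAt_pi.2 fun i => ?_
  refine Fin.cases ?_ (fun i => ?_) i
  · exact hf
  · exact continuousAt_pi.1 hg i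

theorem eventually_signedNorm_ne_zero (h : IsQuasiCoframing ε V α) {z : Tot r}
    (hz : z ∈ domX r V) (v : Fin 5 → Tot r)
    (ha : signedNorm ε (conormalCoeff α z.1 fun a => (v a).1) ≠ 0) :
    ∀ᶠ p : Tot r × (Fin 5 → Tot r) in 𝓝 (z, v),
      signedNorm ε (conormalCoeff α p.1.1 fun a => (p.2 a).1) ≠ 0 := by
  have h1 : ContinuousAt (fun p : Tot r × (Fin 5 → Tot r) =>
      signedNorm ε (conormalCoeff α p.1.1 fun a => (p.2 a).1)) (z, v) := by
    simp only [signedNorm_def]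
    have h2 : ∀ c k, ContinuousAt (fun p : Tot r × (Fin 5 → Tot r) =>
        vol6 (Fin.cons (frameVec α p.1.1 c k) fun a => (p.2 a).1)) (z, v) := fun c k =>
      ContinuousAt.comp (g := vol6) vol6.cont.continuousAt (continuousAt_cons
        (continuousAt_fst_fst h.isOpen (contDiffOn_frameVec h c k).continuousOn hz v)
        (by fun_prop))
    have h3 : ∀ c k, ContinuousAt (fun p : Tot r × (Fin 5 → Tot r) =>
        ((vol6 (Fin.cons (frameVec α p.1.1 c k) fun a => (p.2 a).1) : ℝ) : ℂ)) (z, v) := fun c k =>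
      ContinuousAt.comp (g := Complex.ofReal) Complex.continuous_ofReal.continuousAt (h2 c k)
    refine tendsto_finsetSum _ fun k _ => ContinuousAt.mul continuousAt_const ?_
    refine ContinuousAt.comp (g := Complex.normSq) Complex.continuous_normSq.continuousAt ?_
    exact continuousAt_const.mul ((h3 1 k).add (continuousAt_const.mul (h3 Complex.I k)))
  exact h1.eventually_ne ha

theorem isKahlerOrdinary_lt_five (hV : IsOpen V) {z : Tot r} (hz : z ∈ domX r V) {k : ℕ}
    (hk : k < 5) {v : Fin k → Tot r} (hv : LinearIndependent ℝ v) :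
    IsKahlerOrdinary (hymIdeal r ε V α) z v :=
  isKahlerOrdinary_of_lt (isOpen_domX hV r) hz
    (fun j hj => generators_eq_empty r ε α j (by omega) (by omega)) hk hv

/-- The real and imaginary parts of the forms `Υ`. -/
noncomputable def upsilonParts (α : R6 → R6 →L[ℝ] (Fin 3 → ℂ)) :
    (Fin r × Fin r) ⊕ (Fin r × Fin r) → Tot r → Tot r [⋀^Fin 5]→L[ℝ] ℝ :=
  Sum.elim (fun a z => reForm (Upsilon α a.1 a.2 z)) (fun a z => imForm (Upsilon α a.1 a.2 z))

theorem upsilonParts_inl (i j : Fin r) (z : Tot r) (v : Fin 5 → Tot r) :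
    upsilonParts α (Sum.inl (i, j)) z v = (Upsilon α i j z v).re := by
  simp only [upsilonParts, Sum.elim_inl, reForm_apply]

theorem upsilonParts_inr (i j : Fin r) (z : Tot r) (v : Fin 5 → Tot r) :
    upsilonParts α (Sum.inr (i, j)) z v = (Upsilon α i j z v).im := by
  simp only [upsilonParts, Sum.elim_inr, imForm_apply]

theorem upsilonParts_mem (a : (Fin r × Fin r) ⊕ (Fin r × Fin r)) :
    upsilonParts α a ∈ hymIdeal r ε V α 5 := by
  rcases a with ⟨i, j⟩ | ⟨i, j⟩
  · have h1 : IsGenerator ε α 5 (upsilonParts α (Sum.inl (i, j))) := .upsilon_re i j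
    exact AlgIdeal.gen h1
  · have h1 : IsGenerator ε α 5 (upsilonParts α (Sum.inr (i, j))) := .upsilon_im i j
    exact AlgIdeal.gen h1

/-- Near v the integral 5-planes are the common zeros of the 2r² functions Re Υ_ij and Im Υ_ij.
Their differentials are independent already in the directions that move v₀ vertically: there the
derivative is Υ((0,q), v₁, …, v₄), which can be any prescribed matrix. -/
theorem isKahlerOrdinary_five (hV : IsOpen V) (hα : ContDiffOn ℝ ∞ α V) {z : Tot r}
    (hz : z ∈ domX r V) {v : Fin 5 → Tot r} (hv : LinearIndependent ℝ v)
    (hI : IsIntegralElement (hymIdeal r ε V α) z (Submodule.span ℝ (Set.range v))) {k : Fin 3}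
    (ha : antiVol (fun k => comp α k z.1) k ![(v 1).1, (v 2).1, (v 3).1, (v 4).1] ≠ 0) :
    IsKahlerOrdinary (hymIdeal r ε V α) z v := by
  have hX := isOpen_domX hV r
  let e := (Fintype.equivFin ((Fin r × Fin r) ⊕ (Fin r × Fin r))).symm
  have hsm : ∀ a, ContDiffOn ℝ ∞ (upsilonParts α a) (domX r V) := by
    rintro (a | a)
    · exact contDiffOn_comp_clm Complex.reCLM (contDiffOn_Upsilon hV hα a.1 a.2)
    · exact contDiffOn_comp_clm Complex.imCLM (contDiffOn_Upsilon hV hα a.1 a.2)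
  have hex : ∀ m : Fin r → Fin r → ℂ, ∃ q : Fib r, ∀ i j,
      Upsilon α i j z (Function.update v 0 (0, q)) = m i j := by
    intro m
    obtain ⟨q, hq⟩ := exists_vertical_upsilon hV hα hz ![v 1, v 2, v 3, v 4] (k := k) (by
      have h1 : (fun a => ((![v 1, v 2, v 3, v 4] : Fin 4 → Tot r) a).1) =
          ![(v 1).1, (v 2).1, (v 3).1, (v 4).1] := by funext a; fin_cases a <;> rfl
      rw [h1]; exact ha) m
    refine ⟨q, fun i j => ?_⟩
    have h2 : Function.update v 0 ((0 : R6), q) = ![(0, q), (![v 1, v 2, v 3, v 4] : Fin 4 → Tot r) 0,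
        (![v 1, v 2, v 3, v 4] : Fin 4 → Tot r) 1, (![v 1, v 2, v 3, v 4] : Fin 4 → Tot r) 2,
        (![v 1, v 2, v 3, v 4] : Fin 4 → Tot r) 3] := by
      funext a; fin_cases a <;> simp [Function.update]
    rw [h2, hq]
  have hli : LinearIndependent ℝ (fun a => fderiv ℝ
      (fun p : Tot r × (Fin 5 → Tot r) => upsilonParts α a p.1 p.2) (z, v)) := by
    rw [Fintype.linearIndependent_iff]
    intro c hc
    have h1 : ∀ q : Fib r, ∑ a, c a * upsilonParts α a z (Function.update v 0 (0, q)) = 0 := by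
      intro q
      have h2 := congrArg (fun D => D ((0 : Tot r), (Pi.single 0 ((0 : R6), q) : Fin 5 → Tot r))) hc
      simpa [_root_.sum_apply, fderiv_form_apply_single hX (hsm _) hz] using h2
    rintro (⟨i₀, j₀⟩ | ⟨i₀, j₀⟩)
    -- A matrix unit isolates the coefficient of one real part; i times a matrix unit will isolate
    -- that of an imaginary part.
    · obtain ⟨q, hq⟩ := hex fun i j => if i = i₀ ∧ j = j₀ then 1 else 0
      have h2 := h1 q
      rw [Fintype.sum_eq_single (Sum.inl (i₀, j₀))] at h2
      · simpa [upsilonParts, hq] using h2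
      · rintro (⟨i, j⟩ | ⟨i, j⟩) hne
        · have : ¬(i = i₀ ∧ j = j₀) := fun h => hne (by rw [h.1, h.2])
          simp [upsilonParts, hq, this]
        · by_cases h : i = i₀ ∧ j = j₀ <;> simp [upsilonParts, hq, h]
    · obtain ⟨q, hq⟩ := hex fun i j => if i = i₀ ∧ j = j₀ then Complex.I else 0
      have h2 := h1 q
      rw [Fintype.sum_eq_single (Sum.inr (i₀, j₀))] at h2
      · simpa [upsilonParts, hq] using h2
      · rintro (⟨i, j⟩ | ⟨i, j⟩) hne
        · by_cases h : i = i₀ ∧ j = j₀ <;> simp [upsilonParts, hq, h]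
        · have : ¬(i = i₀ ∧ j = j₀) := fun h => hne (by rw [h.1, h.2])
          simp [upsilonParts, hq, this]
  refine ⟨hv, hI, _, fun a => upsilonParts α (e a), fun a => upsilonParts_mem _,
    hli.comp e e.injective, ?_⟩
  · have h1 : ∀ᶠ p : Tot r × (Fin 5 → Tot r) in 𝓝 (z, v), p.1 ∈ domX r V :=
      continuousAt_fst.eventually_mem (hX.mem_nhds hz)
    filter_upwards [h1] with p hp
    rw [isIntegralElement_five_iff hp]
    constructor
    · intro h a
      rcases e a with ⟨i, j⟩ | ⟨i, j⟩
      · rw [upsilonParts_inl, h, Complex.zero_re]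
      · rw [upsilonParts_inr, h, Complex.zero_im]
    · intro h i j
      have h2 := h (e.symm (Sum.inl (i, j)))
      have h3 := h (e.symm (Sum.inr (i, j)))
      rw [e.apply_symm_apply, upsilonParts_inl] at h2
      rw [e.apply_symm_apply, upsilonParts_inr] at h3
      exact Complex.ext h2 h3

theorem isKahlerRegular_lt_four (hV : IsOpen V) {z : Tot r} (hz : z ∈ domX r V) {k : ℕ}
    (hk : k < 4) {v : Fin k → Tot r} (hv : LinearIndependent ℝ v) :
    IsKahlerRegular (hymIdeal r ε V α) z v := by
  refine ⟨isKahlerOrdinary_lt_five hV hz (by omega) hv, ?_⟩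
  have h1 : ∀ᶠ p : Tot r × (Fin k → Tot r) in 𝓝 (z, v), p.1 ∈ domX r V :=
    continuousAt_fst.eventually_mem ((isOpen_domX hV r).mem_nhds hz)
  filter_upwards [h1] with p hp _
  rw [polarRank_of_lt hp hk, polarRank_of_lt hz hk]

theorem isKahlerRegular_four (hV : IsOpen V) (hα : ContDiffOn ℝ ∞ α V) {z : Tot r}
    (hz : z ∈ domX r V) {v : Fin 4 → Tot r} (hv : LinearIndependent ℝ v) {k : Fin 3}
    (ha : antiVol (fun k => comp α k z.1) k (fun a => (v a).1) ≠ 0) :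
    IsKahlerRegular (hymIdeal r ε V α) z v := by
  refine ⟨isKahlerOrdinary_lt_five hV hz (by omega) hv, ?_⟩
  have h1 : ∀ᶠ p : Tot r × (Fin 4 → Tot r) in 𝓝 (z, v), p.1 ∈ domX r V :=
    continuousAt_fst.eventually_mem ((isOpen_domX hV r).mem_nhds hz)
  filter_upwards [h1, eventually_antiVol_ne_zero hV hα hz v ha] with p hp hpa _
  rw [polarRank_four hV hα hp p.2 hpa, polarRank_four hV hα hz v ha]

/-- The nonvanishing of the signed norm is an open condition, and on integral planes satisfying it
`polarRank_five` gives one and the same rank. -/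
theorem isKahlerRegular_five (h : IsQuasiCoframing ε V α) {z : Tot r}
    (hz : z ∈ domX r V) {v : Fin 5 → Tot r} (hv : LinearIndependent ℝ v)
    (hI : IsIntegralElement (hymIdeal r ε V α) z (Submodule.span ℝ (Set.range v))) {k : Fin 3}
    (ha : antiVol (fun k => comp α k z.1) k ![(v 1).1, (v 2).1, (v 3).1, (v 4).1] ≠ 0)
    (hN : signedNorm ε (conormalCoeff α z.1 fun a => (v a).1) ≠ 0) :
    IsKahlerRegular (hymIdeal r ε V α) z v := by
  refine ⟨isKahlerOrdinary_five h.isOpen h.smooth hz hv hI ha, ?_⟩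
  have h1 : ∀ᶠ p : Tot r × (Fin 5 → Tot r) in 𝓝 (z, v), p.1 ∈ domX r V :=
    continuousAt_fst.eventually_mem ((isOpen_domX h.isOpen r).mem_nhds hz)
  filter_upwards [h1, eventually_signedNorm_ne_zero h hz v hN] with p hp hpN hpI
  rw [polarRank_five h hp p.2 hpI hpN, polarRank_five h hz v hI hN]

end Regular

end PseudoHYM

namespace PseudoHYM

open EDS

/-! ### Ordinary flags, involutivity and the characters. -/

section Involutive

variable {ε : Fin 3 → ℝ} {V : Set R6} {α : R6 → R6 →L[ℝ] (Fin 3 → ℂ)} {r : ℕ}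

theorem linearIndependent_initialFrame {W : Type*} [NormedAddCommGroup W] [NormedSpace ℝ W]
    {n : ℕ} {v : Fin n → W} (hv : LinearIndependent ℝ v) (k : ℕ) (hk : k ≤ n) :
    LinearIndependent ℝ (initialFrame v k hk) :=
  hv.comp (Fin.castLE hk) (Fin.castLE_injective hk)

theorem span_initialFrame_le {W : Type*} [NormedAddCommGroup W] [NormedSpace ℝ W]
    {n : ℕ} (v : Fin n → W) (k : ℕ) (hk : k ≤ n) :
    Submodule.span ℝ (Set.range (initialFrame v k hk)) ≤ Submodule.span ℝ (Set.range v) :=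
  Submodule.span_mono (by rintro _ ⟨i, rfl⟩; exact ⟨_, rfl⟩)

/-- An admissible plane is the range of a section, and the nondegeneracy conditions depend only on
projections to ℝ⁶; lifting the good frame therefore works in every such plane. -/
theorem exists_isOrdinaryFlag (h : IsQuasiCoframing ε V α) {z : Tot r} (hz : z ∈ domX r V)
    {E : Submodule ℝ (Tot r)}
    (hE : IsAdmissibleElement (hymIdeal r ε V α) (indepForm r α) z E) :
    ∃ v : Fin 6 → Tot r, Submodule.span ℝ (Set.range v) = E ∧
      IsOrdinaryFlag (hymIdeal r ε V α) z v := by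
  obtain ⟨L, hL, rfl⟩ := exists_section_of_isAdmissible hE
  have hy := h.bijective z.1 hz.1
  have hg := linearIndependent_goodFrame hy
  let v : Fin 6 → Tot r := fun a => L (goodFrame α z.1 a)
  have hspan : Submodule.span ℝ (Set.range v) = LinearMap.range (L : R6 →ₗ[ℝ] Tot r) := by
    rw [LinearMap.range_eq_map, ← hg.span_eq_top_of_card_eq_finrank' (by simp),
      Submodule.map_span, ← Set.range_comp]
    rfl
  have hv : LinearIndependent ℝ v := by
    refine LinearIndependent.of_comp (LinearMap.fst ℝ R6 (Fib r)) ?_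
    have h1 : (LinearMap.fst ℝ R6 (Fib r)) ∘ v = goodFrame α z.1 := funext fun a => hL _
    rw [h1]
    exact hg
  have hI : IsIntegralElement (hymIdeal r ε V α) z (Submodule.span ℝ (Set.range v)) := by
    rw [hspan]; exact hE.2.1
  refine ⟨v, hspan, hv, hI, fun k hk => ?_⟩
  have hvk := linearIndependent_initialFrame hv k hk.le
  rcases (by omega : k < 4 ∨ k = 4 ∨ k = 5) with h4 | rfl | rfl
  · exact isKahlerRegular_lt_four h.isOpen hz h4 hvk
  · refine isKahlerRegular_four h.isOpen h.smooth hz hvk (k := 0) ?_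
    have h1 : (fun a => (initialFrame v 4 hk.le a).1) =
        fun a : Fin 4 => goodFrame α z.1 (Fin.castLE (by norm_num) a) := funext fun a => hL _
    rw [h1]
    exact antiVol_goodFrame_four hy
  · refine isKahlerRegular_five h hz hvk
      (isIntegralElement_mono (span_initialFrame_le v 5 hk.le) hI) (k := 1) ?_ ?_
    · have h1 : ![(initialFrame v 5 hk.le 1).1, (initialFrame v 5 hk.le 2).1,
          (initialFrame v 5 hk.le 3).1, (initialFrame v 5 hk.le 4).1] =
          ![goodFrame α z.1 1, goodFrame α z.1 2, goodFrame α z.1 3, goodFrame α z.1 4] := by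
        funext a
        fin_cases a <;> exact hL _
      rw [h1]
      exact antiVol_goodFrame_five hy
    · have h1 : (fun a => (initialFrame v 5 hk.le a).1) =
          fun a : Fin 5 => goodFrame α z.1 (Fin.castLE (by norm_num) a) := funext fun a => hL _
      rw [h1]
      exact signedNorm_goodFrame h.signature hy

theorem isInvolutive_hym (h : IsQuasiCoframing ε V α) :
    IsInvolutive (domX r V) (hymIdeal r ε V α) (indepForm r α) :=
  ⟨diffClosed_hymIdeal h, fun _ hz => ⟨exists_isAdmissible h hz,
    fun _ hE => exists_isOrdinaryFlag h hz hE⟩⟩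

/-- A property that holds near `u` holds somewhere on a path through `u` where a generic
condition is satisfied. -/
theorem exists_generic {W : Type*} [NormedAddCommGroup W] [NormedSpace ℝ W] {k : ℕ} {z : W}
    {u : Fin k → W} (u' : Fin k → W) {Q : W × (Fin k → W) → Prop} {P : ℝ → Prop}
    (hQ : ∀ᶠ p in 𝓝 (z, u), Q p) (hP : ∀ᶠ s in 𝓝[≠] (0 : ℝ), P s) :
    ∃ s, P s ∧ Q (z, fun a => (1 - s) • u a + s • u' a) := by
  have hc : Continuous (fun s : ℝ => (z, fun a => (1 - s) • u a + s • u' a)) := by fun_prop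
  have h0 : Filter.Tendsto (fun s : ℝ => (z, fun a => (1 - s) • u a + s • u' a)) (𝓝 0)
      (𝓝 (z, u)) := by
    have := hc.tendsto 0
    simpa using this
  have h1 := (h0.mono_left (nhdsWithin_le_nhds (s := {0}ᶜ))).eventually hQ
  exact (hP.and h1).exists

/-- Along the segment from x to x' the quantity is analytic in s and nonzero at s = 1, so its zeros
cannot accumulate at s = 0. -/
theorem eventually_antiVol_path (y : R6) (k : Fin 3) (x x' : Fin 4 → R6)
    (h : antiVol (fun k => comp α k y) k x' ≠ 0) :
    ∀ᶠ s in 𝓝[≠] (0 : ℝ),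
      antiVol (fun k => comp α k y) k (fun a => (1 - s) • x a + s • x' a) ≠ 0 := by
  refine eventually_ne_zero_of_contDiff ?_ (by simpa using h)
  simp only [antiVol_eq]
  refine (contDiff_antiPoly k).comp (contDiff_pi.2 fun a => ?_)
  exact (α y).contDiff.comp (by fun_prop)

theorem signedNorm_eq_sum_sq (ε : Fin 3 → ℝ) (y : R6) (x : Fin 5 → R6) :
    signedNorm ε (conormalCoeff α y x) = ∑ k, ε k * (1 / 4 *
      (vol6 (Fin.cons (frameVec α y 1 k) x) ^ 2 +
        vol6 (Fin.cons (frameVec α y Complex.I k) x) ^ 2)) := by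
  rw [signedNorm_def]
  refine Finset.sum_congr rfl fun k _ => ?_
  rw [Complex.normSq_apply]
  simp
  left
  ring

theorem eventually_signedNorm_path (y : R6) (x x' : Fin 5 → R6)
    (h : signedNorm ε (conormalCoeff α y x') ≠ 0) :
    ∀ᶠ s in 𝓝[≠] (0 : ℝ),
      signedNorm ε (conormalCoeff α y fun a => (1 - s) • x a + s • x' a) ≠ 0 := by
  refine eventually_ne_zero_of_contDiff (g := fun s : ℝ =>
    signedNorm ε (conormalCoeff α y fun a => (1 - s) • x a + s • x' a)) ?_ (by simpa using h)
  simp only [signedNorm_eq_sum_sq]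
  have h1 : ∀ w : R6, ContDiff ℝ ω (fun s : ℝ =>
      vol6 (Fin.cons w fun a => (1 - s) • x a + s • x' a)) := fun w => by
    rw [← contDiffOn_univ]
    refine contDiffOn_form_apply contDiffOn_const fun i => ?_
    refine Fin.cases ?_ (fun i => ?_) i
    · exact contDiffOn_const
    · have h2 : ContDiff ℝ ω (fun s : ℝ => (1 - s) • x i + s • x' i) := by fun_prop
      exact h2.contDiffOn
  exact ContDiff.sum fun k _ => contDiff_const.mul (contDiff_const.mul
    (((h1 _).pow 2).add ((h1 _).pow 2)))

/-- A regular 4-plane need not itself satisfy the nondegeneracy condition. Its rank, however, equals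
that of all nearby 4-planes, all of them integral, and some of these satisfy it. -/
theorem polarRank_ordinary_four (h : IsQuasiCoframing ε V α) {z : Tot r} (hz : z ∈ domX r V)
    {u : Fin 4 → Tot r} (hu : IsKahlerRegular (hymIdeal r ε V α) z u) :
    polarRank (hymIdeal r ε V α) z u = 2 * r ^ 2 := by
  have hy := h.bijective z.1 hz.1
  obtain ⟨s, hP, hQ⟩ := exists_generic
    (fun a => (goodFrame α z.1 (Fin.castLE (by norm_num) a), 0)) hu.2
    (eventually_antiVol_path z.1 0 (fun a => (u a).1) _ (antiVol_goodFrame_four hy))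
  rw [← hQ (isIntegralElement_span_of_lt hz (d := 5)
    (fun j hj => generators_eq_empty r ε α j (by omega) (by omega)) (by norm_num) _)]
  exact polarRank_four h.isOpen h.smooth hz _ hP

/-- As for 4-planes, except that nearby 5-planes need not be integral; the perturbation is therefore
made inside the given integral 6-plane, by moving towards the lifted good frame. -/
theorem polarRank_ordinary_five (h : IsQuasiCoframing ε V α) {z : Tot r} (hz : z ∈ domX r V)
    {L : R6 →L[ℝ] Tot r} (hL : ∀ x, (L x).1 = x)
    (hI : IsIntegralElement (hymIdeal r ε V α) z (LinearMap.range (L : R6 →ₗ[ℝ] Tot r)))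
    {u : Fin 5 → Tot r} (hu : IsKahlerRegular (hymIdeal r ε V α) z u)
    (huL : ∀ a, u a ∈ LinearMap.range (L : R6 →ₗ[ℝ] Tot r)) :
    polarRank (hymIdeal r ε V α) z u = 5 * r ^ 2 := by
  have hy := h.bijective z.1 hz.1
  obtain ⟨s, hP, hQ⟩ := exists_generic
    (fun a => L (goodFrame α z.1 (Fin.castLE (by norm_num) a))) hu.2
    (eventually_signedNorm_path z.1 (fun a => (u a).1) _ (signedNorm_goodFrame h.signature hy))
  have hI' := isIntegralElement_mono (I := hymIdeal r ε V α) (z := z) (Submodule.span_le.2 (by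
    rintro _ ⟨a, rfl⟩
    exact Submodule.add_mem _ (Submodule.smul_mem _ (1 - s) (huL a))
      (Submodule.smul_mem _ s ⟨goodFrame α z.1 (Fin.castLE (by norm_num) a), rfl⟩)) :
    Submodule.span ℝ (Set.range fun a => (1 - s) • u a +
      s • L (goodFrame α z.1 (Fin.castLE (by norm_num) a))) ≤
        LinearMap.range (L : R6 →ₗ[ℝ] Tot r)) hI
  rw [← hQ hI']
  refine polarRank_five h hz _ hI' ?_
  have h1 : (fun a : Fin 5 => ((1 - s) • u a +
      s • L (goodFrame α z.1 (Fin.castLE (by norm_num) a))).1) =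
      fun a => (1 - s) • (u a).1 + s • goodFrame α z.1 (Fin.castLE (by norm_num) a) := by
    funext a
    simp [hL]
  rw [h1]
  exact hP

theorem flagRank_of_lt {W : Type*} [NormedAddCommGroup W] [NormedSpace ℝ W] {n : ℕ}
    (I : FormFamily W) (z : W) (v : Fin n → W) {k : ℕ} (hk : k < n) :
    flagRank I z v k = polarRank I z (initialFrame v k hk.le) := dif_pos hk

theorem hasCartanCharacters_hym (h : IsQuasiCoframing ε V α) :
    HasCartanCharacters (domX r V) (hymIdeal r ε V α) (indepForm r α)
      ![0, 0, 0, 0, 2 * r ^ 2, 3 * r ^ 2, r ^ 2] := by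
  intro z hz v hv hE
  obtain ⟨L, hL, hLE⟩ := exists_section_of_isAdmissible hE
  have h0 : ∀ k, k < 4 → flagRank (hymIdeal r ε V α) z v k = 0 := fun k hk => by
    rw [flagRank_of_lt _ _ _ (by omega : k < 6), polarRank_of_lt hz hk, Nat.cast_zero]
  have h4 : flagRank (hymIdeal r ε V α) z v 4 = 2 * r ^ 2 := by
    rw [flagRank_of_lt _ _ _ (by norm_num), polarRank_ordinary_four h hz (hv.2.2 4 (by norm_num))]
    push_cast
    ring
  have h5 : flagRank (hymIdeal r ε V α) z v 5 = 5 * r ^ 2 := by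
    rw [flagRank_of_lt _ _ _ (by norm_num), polarRank_ordinary_five h hz hL (by
      rw [hLE]; exact hv.2.1) (hv.2.2 5 (by norm_num)) fun a => by
      rw [hLE]; exact Submodule.subset_span ⟨_, rfl⟩]
    push_cast
    ring
  -- At the end of the flag the value is dim X − 6 by convention, so the last character is 6r² −
  -- 5r².
  have h6 : flagRank (hymIdeal r ε V α) z v 6 = 6 * r ^ 2 := by
    rw [flagRank, dif_neg (by norm_num), finrank_tot]
    push_cast
    ring
  funext k
  fin_cases k
  · simp [cartanCharacter, h0]
  · simp [cartanCharacter, h0]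
  · simp [cartanCharacter, h0]
  · simp [cartanCharacter, h0]
  · simp [cartanCharacter, h0, h4]
  · simp [cartanCharacter, h4, h5]
    ring
  · simp [cartanCharacter, h5, h6]
    ring

end Involutive

end PseudoHYM

namespace PseudoHYM

open EDS

/-! ### Calculus in a chart. -/

section Chart

variable {M : Type*} [TopologicalSpace M] [ChartedSpace R6 M] {φ : OpenPartialHomeomorph M R6}

theorem contMDiffOn_chart (hφ : φ ∈ IsManifold.maximalAtlas (𝓡 6) ∞ M) :
    ContMDiffOn (𝓡 6) (𝓡 6) ∞ φ φ.source :=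
  contMDiffOn_of_mem_maximalAtlas hφ

theorem contMDiffOn_chart_symm (hφ : φ ∈ IsManifold.maximalAtlas (𝓡 6) ∞ M) :
    ContMDiffOn (𝓡 6) (𝓡 6) ∞ φ.symm φ.target :=
  contMDiffOn_symm_of_mem_maximalAtlas hφ

variable [IsManifold (𝓡 6) ∞ M]

theorem mdifferentiable_chart (hφ : φ ∈ IsManifold.maximalAtlas (𝓡 6) ∞ M) :
    φ.MDifferentiable (𝓡 6) (𝓡 6) :=
  ⟨(contMDiffOn_chart hφ).mdifferentiableOn (by simp),
    (contMDiffOn_chart_symm hφ).mdifferentiableOn (by simp)⟩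

theorem mfderiv_tangentMap (hφ : φ ∈ IsManifold.maximalAtlas (𝓡 6) ∞ M) {y : R6}
    (hy : y ∈ φ.target) (v : R6) :
    mfderiv (𝓡 6) (𝓡 6) φ (φ.symm y) (tangentMap φ y v) = v :=
  DFunLike.congr_fun ((mdifferentiable_chart hφ).comp_symm_deriv hy) v

theorem mfderiv_symm_mfderiv (hφ : φ ∈ IsManifold.maximalAtlas (𝓡 6) ∞ M) {x : M}
    (hx : x ∈ φ.source) (v : TangentSpace (𝓡 6) x) :
    mfderiv (𝓡 6) (𝓡 6) φ.symm (φ x) (mfderiv (𝓡 6) (𝓡 6) φ x v) = v :=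
  DFunLike.congr_fun ((mdifferentiable_chart hφ).symm_comp_deriv hx) v

theorem fderiv_comp_chart_symm (hφ : φ ∈ IsManifold.maximalAtlas (𝓡 6) ∞ M) {F : Type*}
    [NormedAddCommGroup F] [NormedSpace ℝ F] {f : M → F} {y : R6}
    (hy : y ∈ φ.target) (hf : MDifferentiableAt (𝓡 6) 𝓘(ℝ, F) f (φ.symm y)) (v : R6) :
    fderiv ℝ (fun y => f (φ.symm y)) y v =
      mfderiv (𝓡 6) 𝓘(ℝ, F) f (φ.symm y) (tangentMap φ y v) := by
  have h1 := mfderiv_comp y hf ((mdifferentiable_chart hφ).mdifferentiableAt_symm hy)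
  rw [← mfderiv_eq_fderiv]
  exact DFunLike.congr_fun h1 v

theorem contDiffOn_comp_chart_symm (hφ : φ ∈ IsManifold.maximalAtlas (𝓡 6) ∞ M) {f : M → ℂ}
    (hf : ContMDiffOn (𝓡 6) 𝓘(ℝ, ℂ) ∞ f φ.source) :
    ContDiffOn ℝ ∞ (fun y => f (φ.symm y)) φ.target :=
  contMDiffOn_iff_contDiffOn.1 (hf.comp (contMDiffOn_chart_symm hφ) fun _ hy => φ.map_target hy)

theorem contMDiffOn_comp_chart (hφ : φ ∈ IsManifold.maximalAtlas (𝓡 6) ∞ M) {F : Type*}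
    [NormedAddCommGroup F] [NormedSpace ℝ F] {g : R6 → F} (hg : ContDiffOn ℝ ∞ g φ.target) :
    ContMDiffOn (𝓡 6) 𝓘(ℝ, F) ∞ (fun x => g (φ x)) φ.source :=
  (contMDiffOn_iff_contDiffOn.2 hg).comp (contMDiffOn_chart hφ) fun _ hx => φ.map_source hx

/-- A vector field with smooth components in a chart is smooth. -/
theorem contMDiffOn_mfderiv_symm (hφ : φ ∈ IsManifold.maximalAtlas (𝓡 6) ∞ M) {w : M → R6}
    (hw : ContMDiffOn (𝓡 6) 𝓘(ℝ, R6) ∞ w φ.source) :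
    ContMDiffOn (𝓡 6) ((𝓡 6).prod 𝓘(ℝ, R6)) ∞
      (fun x => (TotalSpace.mk' R6 x (mfderiv (𝓡 6) (𝓡 6) φ.symm (φ x) (w x)) :
        TangentBundle (𝓡 6) M)) φ.source := by
  intro x hx
  have h1 : ContMDiffAt (𝓡 6) (𝓡 6) ∞ φ x :=
    (contMDiffOn_chart hφ).contMDiffAt (φ.open_source.mem_nhds hx)
  have h2 : ContMDiffAt (𝓡 6) (𝓡 6) ∞ φ.symm (φ x) :=
    (contMDiffOn_chart_symm hφ).contMDiffAt (φ.open_target.mem_nhds (φ.map_source hx))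
  have h3 := (h2.mfderiv_const (m := ∞) (by simp)).comp x h1
  have hw' := hw.contMDiffAt (φ.open_source.mem_nhds hx)
  have h4 : ContMDiffAt (𝓡 6) ((𝓡 6).prod 𝓘(ℝ, R6)) ∞
      (fun x => (TotalSpace.mk' R6 (φ x) (w x) : TangentBundle (𝓡 6) R6)) x := by
    rw [contMDiffAt_totalSpace]
    refine ⟨h1, ?_⟩
    simpa using hw'
  have h5 := ContMDiffAt.clm_apply_of_inCoordinates (b₁ := φ) (b₂ := fun x => φ.symm (φ x))
    (E₁ := fun y : R6 => TangentSpace (𝓡 6) y) (E₂ := fun x : M => TangentSpace (𝓡 6) x)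
    (ϕ := fun x => mfderiv (𝓡 6) (𝓡 6) φ.symm (φ x)) (v := w) h3 h4 (h2.comp x h1)
  refine (h5.congr_of_eventuallyEq ?_).contMDiffWithinAt
  filter_upwards [φ.open_source.mem_nhds hx] with x' hx'
  exact TotalSpace.ext (φ.left_inv hx').symm HEq.rfl

/-- The components in a chart of a smooth vector field are smooth. -/
theorem contMDiffAt_mfderiv_chart (hφ : φ ∈ IsManifold.maximalAtlas (𝓡 6) ∞ M)
    {W : ∀ x : M, TangentSpace (𝓡 6) x} {x : M} (hx : x ∈ φ.source)
    (hW : ContMDiffAt (𝓡 6) ((𝓡 6).prod 𝓘(ℝ, R6)) ∞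
      (fun x => (TotalSpace.mk' R6 x (W x) : TangentBundle (𝓡 6) M)) x) :
    ContMDiffAt (𝓡 6) 𝓘(ℝ, R6) ∞ (fun x => (mfderiv (𝓡 6) (𝓡 6) φ x (W x) : R6)) x := by
  have h1 : ContMDiffAt (𝓡 6) (𝓡 6) ∞ φ x :=
    (contMDiffOn_chart hφ).contMDiffAt (φ.open_source.mem_nhds hx)
  have h5 := ContMDiffAt.clm_apply_of_inCoordinates (b₁ := id) (b₂ := φ)
    (E₁ := fun x : M => TangentSpace (𝓡 6) x) (E₂ := fun y : R6 => TangentSpace (𝓡 6) y)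
    (ϕ := fun x => mfderiv (𝓡 6) (𝓡 6) φ x) (v := W) (h1.mfderiv_const (m := ∞) (by simp)) hW h1
  rw [contMDiffAt_totalSpace] at h5
  simpa using h5.2

end Chart

/-! ### From the unitary structure on M to coframings of an open set in ℝ⁶. -/

section Coframe

variable {ε : Fin 3 → ℝ}
variable {M : Type*} [TopologicalSpace M] [ChartedSpace R6 M] [IsManifold (𝓡 6) ∞ M]
  {φ : OpenPartialHomeomorph M R6}

theorem IsUnitaryCoframe.apply_J_eq {J : R6 →L[ℝ] R6} {η : R6 → R6 → ℝ} {A : R6 →L[ℝ] (Fin 3 → ℂ)}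
    (h : IsUnitaryCoframe ε J η A) {e e' : R6} {k : Fin 3} (he : A e = Pi.single k 1)
    (he' : A e' = Pi.single k Complex.I) : J e = e' ∧ J e' = -e := by
  constructor
  · apply h.1.1
    rw [h.2.1, he, he', ← Pi.single_smul]
    simp
  · apply h.1.1
    rw [h.2.1, he', map_neg, he, ← Pi.single_smul, ← Pi.single_neg]
    simp

theorem part02_eq_antiPart {J : R6 →L[ℝ] R6} {e e' : Fin 3 → R6} (f : R6 [⋀^Fin 2]→L[ℝ] ℂ)
    (h : ∀ k, J (e k) = e' k) (j k : Fin 3) :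
    part02 J (fun v w => f ![v, w]) (e j) (e k) = antiPart e e' f j k := by
  rw [part02, h, h, antiPart]
  simp only [smul_eq_mul]

/-- Evaluating the Nijenhuis identity on the frame vectors e_{m+1}, e_{m+2} picks out the m-th
column of the matrix λ·diag(ε). -/
theorem UnitaryStructure.isQuasiCoframing (hε : ε = ![1, 1, 1] ∨ ε = ![1, -1, -1])
    (S : UnitaryStructure M ε) (hS : S.IsQuasiIntegrable)
    (hφ : φ ∈ IsManifold.maximalAtlas (𝓡 6) ∞ M) {α : R6 → R6 →L[ℝ] (Fin 3 → ℂ)}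
    (hα : S.IsUnitaryCoframing φ α) : IsQuasiCoframing ε φ.target α where
  signature := hε
  isOpen := φ.open_target
  smooth := hα.smooth
  bijective y hy := (hα.unitary y hy).1
  quasi y hy := by
    obtain ⟨c, hc⟩ := hS φ hφ α hα y hy
    have hb := (hα.unitary y hy).1
    refine ⟨c, fun i m => ?_⟩
    have h1 := hc i (frameVec α y 1 (m + 1)) (frameVec α y 1 (m + 2))
    rw [part02_eq_antiPart (e := frameVec α y 1) (e' := frameVec α y Complex.I) _ (fun k =>
      ((hα.unitary y hy).apply_J_eq (apply_frameVec hb 1 k) (apply_frameVec hb _ k)).1)] at h1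
    simp only [apply_frameVec hb, Matrix.diagonal_apply] at h1
    rw [h1, Fin.sum_univ_three]
    fin_cases i <;> fin_cases m <;> simp

end Coframe

end PseudoHYM

namespace PseudoHYM

open EDS

/-! ### Unitary frames of the bundle. -/

namespace HermitianStructure

variable {M : Type*} [TopologicalSpace M] [ChartedSpace R6 M]
  {r : ℕ} {E : M → Type*} [TopologicalSpace (TotalSpace (Fin r → ℂ) E)]
  [∀ x, TopologicalSpace (E x)] [∀ x, AddCommGroup (E x)] [∀ x, Module ℂ (E x)]
  [FiberBundle (Fin r → ℂ) E]

theorem IsUnitaryFrame.eq_sum [VectorBundle ℂ (Fin r → ℂ) E] {h : HermitianStructure r E}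
    {U : Set M} {u : Fin r → ∀ x, E x} (hu : h.IsUnitaryFrame U u) {x : M} (hx : x ∈ U) (a : E x) :
    a = ∑ i, h.inner x (u i x) a • u i x := by
  have hf : Module.finrank ℂ (E x) = r := by
    rw [((trivializationAt (Fin r → ℂ) E x).linearEquivAt ℂ x
      (FiberBundle.mem_baseSet_trivializationAt' x)).finrank_eq]
    simp
  have hli : LinearIndependent ℂ fun i => u i x := by
    rw [Fintype.linearIndependent_iff]
    intro g hg i
    have h1 := congrArg (h.inner x (u i x)) hg
    simpa [map_sum, hu.orthonormal x hx] using h1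
  -- Rank zero is separate, because building a basis from an independent family of the right size
  -- needs a nonempty index type.
  rcases r.eq_zero_or_pos with h0 | hr
  · subst h0
    have : Subsingleton (E x) := ((trivializationAt (Fin 0 → ℂ) E x).linearEquivAt ℂ x
      (FiberBundle.mem_baseSet_trivializationAt' x)).toEquiv.subsingleton
    exact Subsingleton.elim _ _
  · have : Nonempty (Fin r) := ⟨⟨0, hr⟩⟩
    let b := basisOfLinearIndependentOfCardEqFinrank hli (by simp [hf])
    have h1 : a = ∑ i, b.repr a i • u i x := by
      have h2 := (b.sum_repr a).symm
      simpa [b] using h2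
    have h2 : ∀ i, h.inner x (u i x) a = b.repr a i := fun i => by
      conv_lhs => rw [h1]
      simp [map_sum, hu.orthonormal x hx]
    simp only [h2]
    exact h1

theorem IsUnitaryFrame.ext [VectorBundle ℂ (Fin r → ℂ) E] {h : HermitianStructure r E}
    {U : Set M} {u : Fin r → ∀ x, E x} (hu : h.IsUnitaryFrame U u) {x : M} (hx : x ∈ U) {a b : E x}
    (hab : ∀ i, h.inner x (u i x) a = h.inner x (u i x) b) : a = b := by
  rw [hu.eq_sum hx a, hu.eq_sum hx b]
  simp only [hab]

theorem IsUnitaryFrame.inner_sum {h : HermitianStructure r E}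
    {U : Set M} {u : Fin r → ∀ x, E x} (hu : h.IsUnitaryFrame U u) {x : M} (hx : x ∈ U)
    (c : Fin r → ℂ) (i : Fin r) : h.inner x (u i x) (∑ j, c j • u j x) = c i := by
  simp [map_sum, hu.orthonormal x hx]

/-- Parseval's identity in a unitary frame. -/
theorem IsUnitaryFrame.inner_eq_sum [VectorBundle ℂ (Fin r → ℂ) E] {h : HermitianStructure r E}
    {U : Set M} {u : Fin r → ∀ x, E x} (hu : h.IsUnitaryFrame U u) {x : M} (hx : x ∈ U) (a b : E x) :
    h.inner x a b = ∑ i, (starRingEnd ℂ) (h.inner x (u i x) a) * h.inner x (u i x) b := by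
  conv_lhs => rw [hu.eq_sum hx b]
  simp only [map_sum, map_smul, smul_eq_mul, h.conj_symm]
  exact Finset.sum_congr rfl fun i _ => mul_comm _ _

variable [IsManifold (𝓡 6) ∞ M] [∀ x, IsTopologicalAddGroup (E x)]
  [∀ x, ContinuousSMul ℝ (E x)] [VectorBundle ℝ (Fin r → ℂ) E]
  [ContMDiffVectorBundle ∞ (Fin r → ℂ) E (𝓡 6)]

/-- The inner product of a smooth section with a section differentiable at a point. -/
theorem mdifferentiableAt_inner (h : HermitianStructure r E) {U : Set M} (hU : IsOpen U)
    {u s : ∀ x, E x} (hu : ContMDiffOn (𝓡 6) ((𝓡 6).prod 𝓘(ℝ, Fin r → ℂ)) ∞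
      (fun x => TotalSpace.mk' (Fin r → ℂ) x (u x)) U) {x : M} (hx : x ∈ U)
    (hs : MDifferentiableAt (𝓡 6) ((𝓡 6).prod 𝓘(ℝ, Fin r → ℂ))
      (fun x => TotalSpace.mk' (Fin r → ℂ) x (s x)) x) :
    MDifferentiableAt (𝓡 6) 𝓘(ℝ, ℂ) (fun x => h.inner x (u x) (s x)) x := by
  have : ContMDiffVectorBundle 1 (Fin r → ℂ) E (𝓡 6) := ContMDiffVectorBundle.of_le (n := ∞) (by simp)
  -- Smoothness of the Hermitian structure is given for smooth sections only. A section merely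
  -- differentiable at x is expanded in a smooth local frame, and the coefficients carry the
  -- differentiability.
  let e := trivializationAt (Fin r → ℂ) E x
  let b := Module.finBasis ℝ (Fin r → ℂ)
  have hxe : x ∈ e.baseSet := FiberBundle.mem_baseSet_trivializationAt' x
  have h1 : ∀ k, MDifferentiableAt (𝓡 6) 𝓘(ℝ, ℂ)
      (fun x => h.inner x (u x) (e.localFrame b k x)) x := fun k => by
    have h2 := h.smooth (U ∩ e.baseSet) (hU.inter e.open_baseSet) u (e.localFrame b k)
      (hu.mono Set.inter_subset_left)
      ((e.contMDiffOn_localFrame_baseSet (n := ∞) (I := 𝓡 6) b k).mono Set.inter_subset_right)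
    exact (h2.contMDiffAt ((hU.inter e.open_baseSet).mem_nhds ⟨hx, hxe⟩)).mdifferentiableAt (by simp)
  have h2 : ∀ k, MDifferentiableAt (𝓡 6) 𝓘(ℝ, ℝ)
      (fun x => e.localFrameCoeff (𝓡 6) b k x (s x)) x :=
    fun k => mdifferentiableAt_localFrameCoeff b hxe hs k
  have h3 : MDifferentiableAt (𝓡 6) 𝓘(ℝ, ℂ) (fun x => ∑ k,
      e.localFrameCoeff (𝓡 6) b k x (s x) • h.inner x (u x) (e.localFrame b k x)) x := by
    refine MDifferentiableAt.congr_of_eventuallyEq (f := ∑ k, fun x =>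
      e.localFrameCoeff (𝓡 6) b k x (s x) • h.inner x (u x) (e.localFrame b k x))
      (MDifferentiableAt.sum fun k _ => ?_) (.of_forall fun x => by rw [Finset.sum_apply])
    have h4 : MDifferentiableAt 𝓘(ℝ, ℝ × ℂ) 𝓘(ℝ, ℂ) (fun q : ℝ × ℂ => q.1 • q.2)
        (e.localFrameCoeff (𝓡 6) b k x (s x), h.inner x (u x) (e.localFrame b k x)) :=
      mdifferentiableAt_iff_differentiableAt.2 (by fun_prop)
    exact h4.comp x ((h2 k).prodMk_space (h1 k))
  refine h3.congr_of_eventuallyEq ?_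
  filter_upwards [e.open_baseSet.mem_nhds hxe] with x' hx'
  conv_lhs => rw [e.eq_sum_localFrameCoeff_smul (I := 𝓡 6) (b := b) (s := s) hx']
  rw [map_sum]
  refine Finset.sum_congr rfl fun k _ => ?_
  rw [← Complex.coe_smul, ← Complex.coe_smul, map_smul]

theorem contMDiffOn_complex_smul [VectorBundle ℂ (Fin r → ℂ) E] {U : Set M} (hU : IsOpen U)
    {c : M → ℂ} {u : ∀ x, E x} (hc : ContMDiffOn (𝓡 6) 𝓘(ℝ, ℂ) ∞ c U)
    (hu : ContMDiffOn (𝓡 6) ((𝓡 6).prod 𝓘(ℝ, Fin r → ℂ)) ∞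
      (fun x => TotalSpace.mk' (Fin r → ℂ) x (u x)) U) :
    ContMDiffOn (𝓡 6) ((𝓡 6).prod 𝓘(ℝ, Fin r → ℂ)) ∞
      (fun x => TotalSpace.mk' (Fin r → ℂ) x (c x • u x)) U := by
  intro x hx
  have hxe : x ∈ (trivializationAt (Fin r → ℂ) E x).baseSet :=
    FiberBundle.mem_baseSet_trivializationAt' x
  have h1 := contMDiffAt_section (F := Fin r → ℂ) (E := E) (s := u) (n := ∞) (IB := 𝓡 6) x |>.1
    (hu.contMDiffAt (hU.mem_nhds hx))
  refine ((contMDiffAt_section x).2 ?_).contMDiffWithinAt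
  have h2 : ContMDiffAt (𝓡 6) 𝓘(ℝ, Fin r → ℂ) ∞
      (fun y => c y • (trivializationAt (Fin r → ℂ) E x ⟨y, u y⟩).2) x :=
    (contDiff_fst.smul contDiff_snd : ContDiff ℝ ∞ fun q : ℂ × (Fin r → ℂ) => q.1 • q.2
      ).contDiffAt.comp_contMDiffAt ((hc.contMDiffAt (hU.mem_nhds hx)).prodMk_space h1)
  refine h2.congr_of_eventuallyEq ?_
  filter_upwards [(trivializationAt (Fin r → ℂ) E x).open_baseSet.mem_nhds hxe] with y hy
  exact ((trivializationAt (Fin r → ℂ) E x).linearEquivAt ℂ y hy).map_smul (c y) (u y)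

end HermitianStructure

end PseudoHYM

namespace PseudoHYM

open EDS

/-! ### Compatible connections in a unitary frame. -/

section Connection

variable {M : Type*} [TopologicalSpace M] [ChartedSpace R6 M] [IsManifold (𝓡 6) ∞ M]
  {r : ℕ} {E : M → Type*} [TopologicalSpace (TotalSpace (Fin r → ℂ) E)]
  [∀ x, TopologicalSpace (E x)] [∀ x, AddCommGroup (E x)] [∀ x, Module ℂ (E x)]
  [FiberBundle (Fin r → ℂ) E]
  {h : HermitianStructure r E} {φ : OpenPartialHomeomorph M R6}
  {α : R6 → R6 →L[ℝ] (Fin 3 → ℂ)} {u : Fin r → ∀ x, E x}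

theorem coordCov_symm_apply {cov : (∀ x, E x) → ∀ x : M, TangentSpace (𝓡 6) x →L[ℝ] E x}
    {s : ∀ x, E x} {y : R6} (hy : y ∈ φ.target) (v : R6) :
    coordCov φ cov v s (φ.symm y) = cov s (φ.symm y) (tangentMap φ y v) := by
  -- The base points φ(φ⁻¹y) and y are equal only propositionally; the tangent vectors are compared
  -- in the model ℝ⁶.
  have h1 : ∀ y', y' = y → (mfderiv (𝓡 6) (𝓡 6) φ.symm y' v : R6) =
      (mfderiv (𝓡 6) (𝓡 6) φ.symm y v : R6) := by
    rintro _ rfl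
    rfl
  exact congrArg (fun w : R6 => cov s (φ.symm y) w) (h1 _ (φ.right_inv hy))

/-- The components, in a chart, of a section in a unitary frame. -/
noncomputable def frameCoord (h : HermitianStructure r E) (φ : OpenPartialHomeomorph M R6)
    (u : Fin r → ∀ x, E x) (s : ∀ x, E x) (i : Fin r) (y : R6) : ℂ :=
  h.inner (φ.symm y) (u i (φ.symm y)) (s (φ.symm y))

theorem contDiffOn_frameCoord (hφ : φ ∈ IsManifold.maximalAtlas (𝓡 6) ∞ M)
    (hu : h.IsUnitaryFrame φ.source u) {s : ∀ x, E x}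
    (hs : ContMDiffOn (𝓡 6) ((𝓡 6).prod 𝓘(ℝ, Fin r → ℂ)) ∞
      (fun x => TotalSpace.mk' (Fin r → ℂ) x (s x)) φ.source) (i : Fin r) :
    ContDiffOn ℝ ∞ (frameCoord h φ u s i) φ.target :=
  contDiffOn_comp_chart_symm hφ (h.smooth _ φ.open_source _ _ (hu.smooth i) hs)

theorem frameCoord_frame (hu : h.IsUnitaryFrame φ.source u) {y : R6} (hy : y ∈ φ.target)
    (i j : Fin r) : frameCoord h φ u (u j) i y = if i = j then 1 else 0 :=
  hu.orthonormal _ (φ.map_target hy) i j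

theorem mdifferentiableAt_of_comp_chart_symm (hφ : φ ∈ IsManifold.maximalAtlas (𝓡 6) ∞ M)
    {f : M → ℂ} {y : R6} (hy : y ∈ φ.target)
    (hf : DifferentiableAt ℝ (fun y => f (φ.symm y)) y) :
    MDifferentiableAt (𝓡 6) 𝓘(ℝ, ℂ) f (φ.symm y) := by
  have h1 : MDifferentiableAt (𝓡 6) (𝓡 6) φ (φ.symm y) :=
    (mdifferentiable_chart hφ).mdifferentiableAt (φ.map_target hy)
  have h2 : MDifferentiableAt (𝓡 6) 𝓘(ℝ, ℂ) (fun y => f (φ.symm y)) (φ (φ.symm y)) := by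
    rw [φ.right_inv hy]
    exact hf.mdifferentiableAt
  refine (h2.comp (φ.symm y) h1).congr_of_eventuallyEq ?_
  filter_upwards [φ.open_source.mem_nhds (φ.map_target hy)] with x hx
  exact (congrArg f (φ.left_inv hx)).symm

variable [∀ x, IsTopologicalAddGroup (E x)] [∀ x, ContinuousSMul ℝ (E x)]
  [VectorBundle ℂ (Fin r → ℂ) E] [VectorBundle ℝ (Fin r → ℂ) E]
  [ContMDiffVectorBundle ∞ (Fin r → ℂ) E (𝓡 6)]

theorem differentiableAt_frameCoord (hφ : φ ∈ IsManifold.maximalAtlas (𝓡 6) ∞ M)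
    (hu : h.IsUnitaryFrame φ.source u) {s : ∀ x, E x} {y : R6} (hy : y ∈ φ.target)
    (hs : MDifferentiableAt (𝓡 6) ((𝓡 6).prod 𝓘(ℝ, Fin r → ℂ))
      (fun x => TotalSpace.mk' (Fin r → ℂ) x (s x)) (φ.symm y)) (i : Fin r) :
    DifferentiableAt ℝ (frameCoord h φ u s i) y :=
  ((h.mdifferentiableAt_inner φ.open_source (hu.smooth i) (φ.map_target hy) hs).comp y
    ((mdifferentiable_chart hφ).mdifferentiableAt_symm hy)).differentiableAt

theorem mfderiv_inner (hφ : φ ∈ IsManifold.maximalAtlas (𝓡 6) ∞ M)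
    (hu : h.IsUnitaryFrame φ.source u) {s t : ∀ x, E x} {y : R6} (hy : y ∈ φ.target)
    (hs : MDifferentiableAt (𝓡 6) ((𝓡 6).prod 𝓘(ℝ, Fin r → ℂ))
      (fun x => TotalSpace.mk' (Fin r → ℂ) x (s x)) (φ.symm y))
    (ht : MDifferentiableAt (𝓡 6) ((𝓡 6).prod 𝓘(ℝ, Fin r → ℂ))
      (fun x => TotalSpace.mk' (Fin r → ℂ) x (t x)) (φ.symm y)) (v : R6) :
    (mfderiv (𝓡 6) 𝓘(ℝ, ℂ) (fun x => h.inner x (s x) (t x)) (φ.symm y) (tangentMap φ y v) : ℂ) =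
      ∑ i, ((starRingEnd ℂ) (fderiv ℝ (frameCoord h φ u s i) y v) * frameCoord h φ u t i y +
        (starRingEnd ℂ) (frameCoord h φ u s i y) * fderiv ℝ (frameCoord h φ u t i) y v) := by
  have hf := differentiableAt_frameCoord hφ hu hy hs
  have hg := differentiableAt_frameCoord hφ hu hy ht
  have h1 : (fun y => h.inner (φ.symm y) (s (φ.symm y)) (t (φ.symm y))) =ᶠ[𝓝 y]
      fun y => ∑ i, (starRingEnd ℂ) (frameCoord h φ u s i y) * frameCoord h φ u t i y := by
    filter_upwards [φ.open_target.mem_nhds hy] with y' hy'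
    exact hu.inner_eq_sum (φ.map_target hy') _ _
  have h2 : ∀ i, HasFDerivAt (fun y => (starRingEnd ℂ) (frameCoord h φ u s i y))
      ((Complex.conjCLE : ℂ →L[ℝ] ℂ).comp (fderiv ℝ (frameCoord h φ u s i) y)) y := fun i =>
    (Complex.conjCLE : ℂ →L[ℝ] ℂ).hasFDerivAt.comp y (hf i).hasFDerivAt
  have h3 := (HasFDerivAt.fun_sum (u := Finset.univ) fun i _ =>
    (h2 i).mul (hg i).hasFDerivAt).congr_of_eventuallyEq h1
  rw [← fderiv_comp_chart_symm hφ hy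
    (mdifferentiableAt_of_comp_chart_symm hφ hy h3.differentiableAt), h3.fderiv]
  simp only [_root_.sum_apply, _root_.add_apply, _root_.smul_apply, smul_eq_mul]
  refine Finset.sum_congr rfl fun i _ => ?_
  rw [add_comm, mul_comm (frameCoord h φ u t i y)]
  rfl

variable {cov : (∀ x, E x) → ∀ x : M, TangentSpace (𝓡 6) x →L[ℝ] E x}

theorem mdifferentiableAt_unitaryFrame (hu : h.IsUnitaryFrame φ.source u) {y : R6}
    (hy : y ∈ φ.target) (i : Fin r) : MDifferentiableAt (𝓡 6) ((𝓡 6).prod 𝓘(ℝ, Fin r → ℂ))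
      (fun x => TotalSpace.mk' (Fin r → ℂ) x (u i x)) (φ.symm y) :=
  ((hu.smooth i).contMDiffAt (φ.open_source.mem_nhds (φ.map_target hy))).mdifferentiableAt (by simp)

/-- The products h(u_i, u_j) are constant, so differentiating them shows that the connection matrix
is skew-Hermitian. -/
theorem inner_frame_cov_frame (hφ : φ ∈ IsManifold.maximalAtlas (𝓡 6) ∞ M)
    (hu : h.IsUnitaryFrame φ.source u) (hcov : h.IsCompatibleConnectionOn φ.source cov) {y : R6}
    (hy : y ∈ φ.target) (i j : Fin r) (v : R6) :
    (starRingEnd ℂ) (h.inner (φ.symm y) (u j (φ.symm y)) (cov (u i) (φ.symm y) (tangentMap φ y v)))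
      = -h.inner (φ.symm y) (u i (φ.symm y)) (cov (u j) (φ.symm y) (tangentMap φ y v)) := by
  have h1 := hcov.compatible (u i) (u j) _ (φ.map_target hy)
    (mdifferentiableAt_unitaryFrame hu hy i) (mdifferentiableAt_unitaryFrame hu hy j)
    (tangentMap φ y v)
  have h0 : ∀ i j, fderiv ℝ (frameCoord h φ u (u j) i) y = 0 := fun i j => by
    have h2 : frameCoord h φ u (u j) i =ᶠ[𝓝 y] fun _ => if i = j then 1 else 0 := by
      filter_upwards [φ.open_target.mem_nhds hy] with y' hy'
      exact frameCoord_frame hu hy' i j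
    rw [h2.fderiv_eq]
    simp
  rw [mfderiv_inner hφ hu hy (mdifferentiableAt_unitaryFrame hu hy i)
    (mdifferentiableAt_unitaryFrame hu hy j)] at h1
  simp only [h0, _root_.zero_apply, map_zero, zero_mul, mul_zero, add_zero,
    Finset.sum_const_zero] at h1
  rw [h.conj_symm]
  exact eq_neg_of_add_eq_zero_left h1.symm

/-- A compatible connection in a unitary frame: `∇s = df + A f`. -/
theorem inner_frame_cov (hφ : φ ∈ IsManifold.maximalAtlas (𝓡 6) ∞ M)
    (hu : h.IsUnitaryFrame φ.source u) (hcov : h.IsCompatibleConnectionOn φ.source cov)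
    {p : R6 → Fib r} (hp : IsConnectionMatrix φ α u cov p) {y : R6} (hy : y ∈ φ.target)
    {s : ∀ x, E x} (hs : MDifferentiableAt (𝓡 6) ((𝓡 6).prod 𝓘(ℝ, Fin r → ℂ))
      (fun x => TotalSpace.mk' (Fin r → ℂ) x (s x)) (φ.symm y)) (i : Fin r) (v : R6) :
    h.inner (φ.symm y) (u i (φ.symm y)) (cov s (φ.symm y) (tangentMap φ y v)) =
      fderiv ℝ (frameCoord h φ u s i) y v +
        ∑ k, connMatrix α y (p y) i k v * frameCoord h φ u s k y := by
  -- Compatibility applied to (u_i, s) expresses h(u_i, ∇s) as d h(u_i, s) − h(∇u_i, s), and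
  -- skew-Hermitian symmetry turns the last term into the action of A.
  have h1 := hcov.compatible (u i) s _ (φ.map_target hy)
    (mdifferentiableAt_unitaryFrame hu hy i) hs (tangentMap φ y v)
  have h2 := fderiv_comp_chart_symm hφ hy (h.mdifferentiableAt_inner φ.open_source (hu.smooth i)
    (φ.map_target hy) hs) v
  have h3 : h.inner (φ.symm y) (cov (u i) (φ.symm y) (tangentMap φ y v)) (s (φ.symm y)) =
      -∑ k, connMatrix α y (p y) i k v * frameCoord h φ u s k y := by
    rw [hp y hy, map_sum, LinearMap.sum_apply, ← Finset.sum_neg_distrib]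
    refine Finset.sum_congr rfl fun k _ => ?_
    rw [LinearMap.map_smulₛₗ, LinearMap.smul_apply, conj_connMatrix, smul_eq_mul, neg_mul]
    rfl
  change fderiv ℝ (frameCoord h φ u s i) y v = _ at h2
  rw [h2]
  erw [h1]
  rw [h3]
  ring

theorem contMDiffOn_cov (hφ : φ ∈ IsManifold.maximalAtlas (𝓡 6) ∞ M)
    (hcov : h.IsCompatibleConnectionOn φ.source cov) {s : ∀ x, E x}
    (hs : ContMDiffOn (𝓡 6) ((𝓡 6).prod 𝓘(ℝ, Fin r → ℂ)) ∞
      (fun x => TotalSpace.mk' (Fin r → ℂ) x (s x)) φ.source) {w : M → R6}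
    (hw : ContMDiffOn (𝓡 6) 𝓘(ℝ, R6) ∞ w φ.source) :
    ContMDiffOn (𝓡 6) ((𝓡 6).prod 𝓘(ℝ, Fin r → ℂ)) ∞ (fun x => TotalSpace.mk' (Fin r → ℂ) x
      (cov s x (mfderiv (𝓡 6) (𝓡 6) φ.symm (φ x) (w x)))) φ.source :=
  (hcov.smooth.contMDiff hs).clm_bundle_apply (contMDiffOn_mfderiv_symm hφ hw)

theorem contMDiffOn_coordCov (hφ : φ ∈ IsManifold.maximalAtlas (𝓡 6) ∞ M)
    (hcov : h.IsCompatibleConnectionOn φ.source cov) {s : ∀ x, E x}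
    (hs : ContMDiffOn (𝓡 6) ((𝓡 6).prod 𝓘(ℝ, Fin r → ℂ)) ∞
      (fun x => TotalSpace.mk' (Fin r → ℂ) x (s x)) φ.source) (w : R6) :
    ContMDiffOn (𝓡 6) ((𝓡 6).prod 𝓘(ℝ, Fin r → ℂ)) ∞ (fun x => TotalSpace.mk' (Fin r → ℂ) x
      (coordCov φ cov w s x)) φ.source :=
  contMDiffOn_cov hφ hcov hs contMDiffOn_const

/-- Every compatible connection is described by smooth functions `p`. -/
theorem exists_isConnectionMatrix {ε : Fin 3 → ℝ} (hφ : φ ∈ IsManifold.maximalAtlas (𝓡 6) ∞ M)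
    (hα : IsQuasiCoframing ε φ.target α)
    (hu : h.IsUnitaryFrame φ.source u) (hcov : h.IsCompatibleConnectionOn φ.source cov) :
    ∃ p : R6 → Fib r, ContDiffOn ℝ ∞ p φ.target ∧ IsConnectionMatrix φ α u cov p := by
  -- The connection matrix in the unitary frame; p is its (1,0)-part, which determines it.
  let A : R6 → Fin r → Fin r → R6 → ℂ := fun y i j v =>
    h.inner (φ.symm y) (u i (φ.symm y)) (cov (u j) (φ.symm y) (tangentMap φ y v))
  refine ⟨fun y => fibOf α y (A y), ?_, ?_⟩
  · have hA : ∀ c k i j, ContDiffOn ℝ ∞ (fun y => A y i j (frameVec α y c k)) φ.target :=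
      fun c k i j => by
      have h1 := contMDiffOn_comp_chart hφ (contDiffOn_frameVec hα c k)
      have h2 := contDiffOn_frameCoord hφ hu (contMDiffOn_cov hφ hcov (hu.smooth j) h1) i
      refine h2.congr fun y hy => ?_
      have h3 : ∀ y', y' = y → (mfderiv (𝓡 6) (𝓡 6) φ.symm y (frameVec α y c k) : R6) =
          (mfderiv (𝓡 6) (𝓡 6) φ.symm y' (frameVec α y' c k) : R6) := by
        rintro _ rfl
        rfl
      exact congrArg (fun w : R6 => h.inner (φ.symm y) (u i (φ.symm y)) (cov (u j) (φ.symm y) w))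
        (h3 _ (φ.right_inv hy))
    refine contDiffOn_pi.2 fun k => contDiffOn_pi.2 fun i => contDiffOn_pi.2 fun j => ?_
    exact contDiffOn_const.mul ((hA 1 k i j).sub (contDiffOn_const.mul (hA Complex.I k i j)))
  · intro y hy j v
    let B : Fin r → Fin r → R6 →L[ℝ] ℂ := fun i j => LinearMap.toContinuousLinearMap
      ((((h.inner (φ.symm y) (u i (φ.symm y))).restrictScalars ℝ).comp
        (cov (u j) (φ.symm y) : TangentSpace (𝓡 6) (φ.symm y) →ₗ[ℝ] E (φ.symm y))).comp
        (tangentMap φ y : R6 →ₗ[ℝ] TangentSpace (𝓡 6) (φ.symm y)))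
    have h1 := connMatrix_fibOf (hα.bijective y hy) B
      (fun i j v => inner_frame_cov_frame hφ hu hcov hy i j v)
    have h2 : ∀ i, connMatrix α y (fibOf α y (A y)) i j v = A y i j v := fun i => h1 i j v
    simp only [h2]
    exact hu.eq_sum (φ.map_target hy) _

end Connection

end PseudoHYM

namespace PseudoHYM

open EDS

/-! ### Graphs as integral manifolds. -/

section Graph

variable {r : ℕ} {ε : Fin 3 → ℝ} {V : Set R6} {α : R6 → R6 →L[ℝ] (Fin 3 → ℂ)} {p : R6 → Fib r}

theorem isIntegralGraph_iff (I : FormFamily (Tot r)) : IsIntegralGraph V I p ↔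
    ∀ y ∈ V, IsIntegralElement I (y, p y)
      (LinearMap.range (fderiv ℝ (fun y => (y, p y)) y : R6 →ₗ[ℝ] Tot r)) := by
  constructor
  · intro h y hy k ψ hψ w hw
    choose x hx using hw
    have h1 := h k ψ hψ y hy
    have h2 : w = fun i => fderiv ℝ (fun y => (y, p y)) y (x i) := funext fun i => (hx i).symm
    rw [h2]
    exact DFunLike.congr_fun h1 x
  · intro h k ψ hψ y hy
    ext x
    exact h y hy k ψ hψ _ fun i => ⟨x i, rfl⟩

theorem hasFDerivAt_graph (hV : IsOpen V) (hp : ContDiffOn ℝ ∞ p V) {y : R6} (hy : y ∈ V) :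
    HasFDerivAt (fun y => (y, p y)) ((ContinuousLinearMap.id ℝ R6).prod (fderiv ℝ p y)) y :=
  (hasFDerivAt_id y).prodMk (differentiableAt_of_contDiffOn hV hp hy).hasFDerivAt

theorem contDiffOn_connMatrix_graph (hα : ContDiffOn ℝ ∞ α V) (hp : ContDiffOn ℝ ∞ p V)
    (i j : Fin r) : ContDiffOn ℝ ∞ (fun y => connMatrix α y (p y) i j) V := by
  have h1 : ContDiffOn ℝ ∞ (fun y => ((y, p y) : Tot r)) V :=
    contDiffOn_id.prodMk hp
  have h2 : Set.MapsTo (fun y => ((y, p y) : Tot r)) V (domX r V) := fun y hy => ⟨hy, trivial⟩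
  have h3 := ContDiffOn.comp (contDiffOn_connMatrix hα i j) h1 h2
  exact h3

/-- The pullback to the graph of `p` of `dA + A ∧ A`. -/
theorem curvPull_graph (hV : IsOpen V) (hα : ContDiffOn ℝ ∞ α V) (hp : ContDiffOn ℝ ∞ p V)
    {y : R6} (hy : y ∈ V) (i j : Fin r) (v w : R6) :
    curvPull α (y, p y) (fderiv ℝ (fun y => (y, p y)) y) i j ![v, w] =
      fderiv ℝ (fun y => connMatrix α y (p y) i j) y v w -
        fderiv ℝ (fun y => connMatrix α y (p y) i j) y w v +
      ∑ k, (connMatrix α y (p y) i k v * connMatrix α y (p y) k j w -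
        connMatrix α y (p y) i k w * connMatrix α y (p y) k j v) := by
  have hg := hasFDerivAt_graph hV hp hy
  have hz : ((y, p y) : Tot r) ∈ domX r V := ⟨hy, trivial⟩
  set L := fderiv ℝ (fun y => (y, p y)) y with hL
  have hL1 : ∀ x, (L x).1 = x := fun x => by rw [hL, hg.fderiv]; rfl
  have hd : DifferentiableAt ℝ (tautForm α i j) (y, p y) :=
    differentiableAt_of_contDiffOn (isOpen_domX hV r) (contDiffOn_tautForm hα i j) hz
  have hA := differentiableAt_of_contDiffOn hV (contDiffOn_connMatrix_graph hα hp i j) hy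
  have h1 : ∀ v w, fderiv ℝ (tautForm α i j) (y, p y) (L v) ![L w] =
      fderiv ℝ (fun y => connMatrix α y (p y) i j) y v w := fun v w => by
    have h2 := ((ContinuousAlternatingMap.apply ℝ (Tot r) ℂ ![L w]).hasFDerivAt.comp y
      (hd.hasFDerivAt.comp y hg)).fderiv
    have h3 := (hA.hasFDerivAt.clm_apply (hasFDerivAt_const w y)).fderiv
    have h4 : (ContinuousAlternatingMap.apply ℝ (Tot r) ℂ ![L w]) ∘
        (tautForm α i j ∘ fun y => (y, p y)) = fun y => connMatrix α y (p y) i j w := by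
      funext y'
      change connMatrix α y' (p y') i j (L w).1 = _
      rw [hL1]
    rw [h4, h3] at h2
    have h5 := DFunLike.congr_fun h2 v
    rw [← hg.fderiv] at h5
    simpa using h5.symm
  rw [curvPull_apply, curvForm, ContinuousAlternatingMap.add_apply,
    ContinuousAlternatingMap.sum_apply]
  congr 1
  · rw [extDeriv, ContinuousAlternatingMap.alternatizeUncurryFin_apply, Fin.sum_univ_two]
    have e0 : (0 : Fin 2).removeNth ![L v, L w] = ![L w] := by
      funext i; fin_cases i; rfl
    have e1 : (1 : Fin 2).removeNth ![L v, L w] = ![L v] := by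
      funext i; fin_cases i; rfl
    rw [e0, e1]
    simp [h1, sub_eq_add_neg]
  · simp [wedge11, tautForm, hL1]

end Graph

/-! ### The curvature of a connection in a unitary frame. -/

section Curvature

variable {M : Type*} [TopologicalSpace M] [ChartedSpace R6 M] [IsManifold (𝓡 6) ∞ M]
  {r : ℕ} {E : M → Type*} [TopologicalSpace (TotalSpace (Fin r → ℂ) E)]
  [∀ x, TopologicalSpace (E x)] [∀ x, AddCommGroup (E x)] [∀ x, Module ℂ (E x)]
  [FiberBundle (Fin r → ℂ) E]
  [∀ x, IsTopologicalAddGroup (E x)] [∀ x, ContinuousSMul ℝ (E x)]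
  [VectorBundle ℂ (Fin r → ℂ) E] [VectorBundle ℝ (Fin r → ℂ) E]
  [ContMDiffVectorBundle ∞ (Fin r → ℂ) E (𝓡 6)]
  {h : HermitianStructure r E} {φ : OpenPartialHomeomorph M R6}
  {α : R6 → R6 →L[ℝ] (Fin 3 → ℂ)} {u : Fin r → ∀ x, E x}
  {cov : (∀ x, E x) → ∀ x : M, TangentSpace (𝓡 6) x →L[ℝ] E x} {p : R6 → Fib r}

theorem mdifferentiableAt_of_contMDiffOn {s : ∀ x, E x}
    (hs : ContMDiffOn (𝓡 6) ((𝓡 6).prod 𝓘(ℝ, Fin r → ℂ)) ∞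
      (fun x => TotalSpace.mk' (Fin r → ℂ) x (s x)) φ.source) {y : R6} (hy : y ∈ φ.target) :
    MDifferentiableAt (𝓡 6) ((𝓡 6).prod 𝓘(ℝ, Fin r → ℂ))
      (fun x => TotalSpace.mk' (Fin r → ℂ) x (s x)) (φ.symm y) :=
  (hs.contMDiffAt (φ.open_source.mem_nhds (φ.map_target hy))).mdifferentiableAt (by simp)

/-- The curvature in a unitary frame is `dA + A ∧ A`. -/
theorem inner_frame_curvature (hφ : φ ∈ IsManifold.maximalAtlas (𝓡 6) ∞ M)
    (hα : ContDiffOn ℝ ∞ α φ.target)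
    (hu : h.IsUnitaryFrame φ.source u) (hcov : h.IsCompatibleConnectionOn φ.source cov)
    (hps : ContDiffOn ℝ ∞ p φ.target) (hp : IsConnectionMatrix φ α u cov p)
    {s : ∀ x, E x} (hs : ContMDiffOn (𝓡 6) ((𝓡 6).prod 𝓘(ℝ, Fin r → ℂ)) ∞
      (fun x => TotalSpace.mk' (Fin r → ℂ) x (s x)) φ.source) {y : R6} (hy : y ∈ φ.target)
    (i : Fin r) (v w : R6) :
    h.inner (φ.symm y) (u i (φ.symm y)) (curvature φ cov s y v w) =
      ∑ k, curvPull α (y, p y) (fderiv ℝ (fun y => (y, p y)) y) i k ![v, w] *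
        frameCoord h φ u s k y := by
  set A : Fin r → Fin r → R6 → R6 →L[ℝ] ℂ := fun i k y => connMatrix α y (p y) i k with hAdef
  set f : Fin r → R6 → ℂ := fun k => frameCoord h φ u s k with hfdef
  have hAd : ∀ i k, DifferentiableAt ℝ (A i k) y := fun i k =>
    differentiableAt_of_contDiffOn φ.open_target (contDiffOn_connMatrix_graph hα hps i k) hy
  have hfc : ∀ k, ContDiffOn ℝ ∞ (f k) φ.target := contDiffOn_frameCoord hφ hu hs
  have hfd : ∀ k, DifferentiableAt ℝ (f k) y := fun k =>
    differentiableAt_of_contDiffOn φ.open_target (hfc k) hy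
  have hff : DifferentiableAt ℝ (fderiv ℝ (f i)) y :=
    (((hfc i).contDiffAt (φ.open_target.mem_nhds hy)).fderiv_right (m := ∞)
      (by simp)).differentiableAt (by simp)
  have hsymm : ∀ v w, fderiv ℝ (fderiv ℝ (f i)) y v w = fderiv ℝ (fderiv ℝ (f i)) y w v :=
    ((hfc i).contDiffAt (φ.open_target.mem_nhds hy)).isSymmSndFDerivAt (by
      rw [minSmoothness_of_isRCLikeNormedField]
      exact ENat.LEInfty.out)
  have h1 : ∀ (w y') (_ : y' ∈ φ.target) (i), frameCoord h φ u (coordCov φ cov w s) i y' =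
      fderiv ℝ (f i) y' w + ∑ k, A i k y' w * f k y' := fun w y' hy' i => by
    rw [frameCoord, coordCov_symm_apply hy',
      inner_frame_cov hφ hu hcov hp hy' (mdifferentiableAt_of_contMDiffOn hs hy')]
  have h2 : ∀ v w, fderiv ℝ (frameCoord h φ u (coordCov φ cov w s) i) y v =
      fderiv ℝ (fderiv ℝ (f i)) y v w + ∑ k, (fderiv ℝ (A i k) y v w * f k y +
        A i k y w * fderiv ℝ (f k) y v) := fun v w => by
    have h3 : frameCoord h φ u (coordCov φ cov w s) i =ᶠ[𝓝 y]
        fun y' => fderiv ℝ (f i) y' w + ∑ k, A i k y' w * f k y' := by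
      filter_upwards [φ.open_target.mem_nhds hy] with y' hy'
      exact h1 w y' hy' i
    have h4 := (hff.hasFDerivAt.clm_apply (hasFDerivAt_const w y)).add
      (HasFDerivAt.fun_sum (u := Finset.univ) fun k _ =>
        ((hAd i k).hasFDerivAt.clm_apply (hasFDerivAt_const w y)).mul (hfd k).hasFDerivAt)
    rw [(h4.congr_of_eventuallyEq h3).fderiv]
    simp [add_comm, mul_comm]
  have h5 : ∀ v w, h.inner (φ.symm y) (u i (φ.symm y))
      (coordCov φ cov v (coordCov φ cov w s) (φ.symm y)) =
      fderiv ℝ (fderiv ℝ (f i)) y v w + ∑ k, (fderiv ℝ (A i k) y v w * f k y +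
        A i k y w * fderiv ℝ (f k) y v) + ∑ k, A i k y v * (fderiv ℝ (f k) y w +
          ∑ l, A k l y w * f l y) := fun v w => by
    rw [coordCov_symm_apply hy, inner_frame_cov hφ hu hcov hp hy
      (mdifferentiableAt_of_contMDiffOn (contMDiffOn_coordCov hφ hcov hs w) hy), h2]
    simp only [h1 w y hy]
    rfl
  rw [curvature, map_sub, h5, h5, hsymm w v]
  simp only [curvPull_graph φ.open_target hα hps hy]
  have h6 : ∀ v w, ∑ k, A i k y v * ∑ l, A k l y w * f l y =
      ∑ k, (∑ l, A i l y v * A l k y w) * f k y := fun v w => by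
    simp only [Finset.mul_sum, Finset.sum_mul]
    rw [Finset.sum_comm]
    simp only [mul_assoc]
  -- The second derivatives of the components cancel by symmetry, and the mixed terms A(v) df(w) +
  -- A(w) df(v) cancel because they are symmetric in v and w. What is left is dA + A ∧ A.
  simp only [mul_add, add_mul, sub_mul, Finset.sum_add_distrib, Finset.sum_sub_distrib, h6]
  simp only [Finset.sum_mul]
  ring

end Curvature

end PseudoHYM

namespace PseudoHYM

open EDS

/-! ### The (0,2)-part and the trace, intrinsically and in a frame. -/

section Types

variable {ε : Fin 3 → ℝ} {J : R6 →L[ℝ] R6} {η : R6 → R6 → ℝ}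
  {α : R6 → R6 →L[ℝ] (Fin 3 → ℂ)} {y : R6}

theorem map_part02 {Z Z' : Type*} [AddCommGroup Z] [Module ℂ Z] [AddCommGroup Z'] [Module ℂ Z']
    (l : Z →ₗ[ℂ] Z') (J : R6 →L[ℝ] R6) (τ : R6 → R6 → Z) (v w : R6) :
    l (part02 J τ v w) = part02 J (fun v w => l (τ v w)) v w := by
  simp [part02]

theorem part02_sum_mul {ι : Type*} [Fintype ι] (J : R6 →L[ℝ] R6) (τ : ι → R6 → R6 → ℂ)
    (c : ι → ℂ) (v w : R6) : part02 J (fun v w => ∑ k, τ k v w * c k) v w =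
      ∑ k, part02 J (τ k) v w * c k := by
  simp only [part02, smul_eq_mul, Finset.mul_sum, ← Finset.sum_add_distrib,
    ← Finset.sum_sub_distrib]
  exact Finset.sum_congr rfl fun k _ => by ring

theorem IsUnitaryCoframe.J_frameVec (h : IsUnitaryCoframe ε J η (α y)) (k : Fin 3) :
    J (frameVec α y 1 k) = frameVec α y Complex.I k ∧
      J (frameVec α y Complex.I k) = -frameVec α y 1 k :=
  h.apply_J_eq (apply_frameVec h.1 1 k) (apply_frameVec h.1 _ k)

theorem IsUnitaryCoframe.J_J (h : IsUnitaryCoframe ε J η (α y)) (v : R6) : J (J v) = -v := by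
  apply h.1.1
  rw [h.2.1, h.2.1, smul_smul, Complex.I_mul_I, map_neg, neg_one_smul]

theorem part02_swap (J : R6 →L[ℝ] R6) (f : R6 [⋀^Fin 2]→L[ℝ] ℂ) (v w : R6) :
    part02 J (fun v w => f ![v, w]) w v = -part02 J (fun v w => f ![v, w]) v w := by
  simp only [part02, smul_eq_mul]
  rw [map_vec2_swap f v w, map_vec2_swap f v (J w), map_vec2_swap f (J v) w,
    map_vec2_swap f (J v) (J w)]
  ring

theorem IsUnitaryCoframe.part02_J (h : IsUnitaryCoframe ε J η (α y)) (f : R6 [⋀^Fin 2]→L[ℝ] ℂ)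
    (v w : R6) : part02 J (fun v w => f ![v, w]) (J v) w =
      -Complex.I * part02 J (fun v w => f ![v, w]) v w := by
  have h1 : ∀ x, f ![-v, x] = -f ![v, x] := fun x => by
    have h2 := map_vec2_smul_left f (-1) v x
    simpa using h2
  simp only [part02, h.J_J, smul_eq_mul, h1]
  linear_combination (1 / 4 * f ![J v, w] + 1 / 4 * f ![v, J w]) * Complex.I_mul_I

/-- The `(0,2)`-part of a `2`-form is linear in its first argument. -/
noncomputable def part02Left (J : R6 →L[ℝ] R6) (f : R6 [⋀^Fin 2]→L[ℝ] ℂ) (w : R6) :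
    R6 →ₗ[ℝ] ℂ where
  toFun v := part02 J (fun v w => f ![v, w]) v w
  map_add' v v' := by
    simp only [part02, map_add, map_vec2_add_left, smul_eq_mul]
    ring
  map_smul' c v := by
    simp only [part02, map_smul, map_vec2_smul_left, smul_eq_mul, Complex.real_smul,
      RingHom.id_apply]
    ring

/-- The (0,2)-part is conjugate-linear for J in each argument, so its vanishing on e_m forces its
vanishing on Je_m, and these vectors span ℝ⁶. -/
theorem IsUnitaryCoframe.part02_eq_zero_of_frame (h : IsUnitaryCoframe ε J η (α y))
    {f : R6 [⋀^Fin 2]→L[ℝ] ℂ} {w : R6}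
    (h0 : ∀ m, part02 J (fun v w => f ![v, w]) (frameVec α y 1 m) w = 0) (v : R6) :
    part02 J (fun v w => f ![v, w]) v w = 0 := by
  have h1 : ∀ m, part02 J (fun v w => f ![v, w]) (frameVec α y Complex.I m) w = 0 := fun m => by
    rw [← (h.J_frameVec m).1, h.part02_J, h0, mul_zero]
  change part02Left J f w v = 0
  rw [(isDualFrame_frameVec h.1).decomp v, map_sum]
  refine Finset.sum_eq_zero fun m _ => ?_
  rw [map_add, map_smul, map_smul]
  rw [show part02Left J f w (frameVec α y 1 m) = 0 from h0 m,
    show part02Left J f w (frameVec α y Complex.I m) = 0 from h1 m, smul_zero, smul_zero, add_zero]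

theorem IsUnitaryCoframe.part02_eq_zero_iff (h : IsUnitaryCoframe ε J η (α y))
    (f : R6 [⋀^Fin 2]→L[ℝ] ℂ) : (∀ v w, part02 J (fun v w => f ![v, w]) v w = 0) ↔
      ∀ m n, antiPart (frameVec α y 1) (frameVec α y Complex.I) f m n = 0 := by
  have h1 := part02_eq_antiPart (J := J) f (fun k => (h.J_frameVec k).1)
  constructor
  · intro h2 m n
    rw [← h1, h2]
  · intro h2 v w
    refine h.part02_eq_zero_of_frame (fun m => ?_) v
    rw [part02_swap, h.part02_eq_zero_of_frame (fun n => ?_) w, neg_zero]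
    rw [h1, h2]

theorem IsUnitaryCoframe.hermForm_apply (h : IsUnitaryCoframe ε J η (α y)) (v w : R6) :
    hermForm ε (fun k => comp α k y) ![v, w] = η v w := by
  rw [EDS.hermForm_apply, h.2.2]
  rfl

theorem IsUnitaryCoframe.hermForm_eq {β : R6 → R6 →L[ℝ] (Fin 3 → ℂ)}
    (hα : IsUnitaryCoframe ε J η (α y)) (hβ : IsUnitaryCoframe ε J η (β y)) :
    hermForm ε (fun k => comp α k y) = hermForm ε (fun k => comp β k y) := by
  ext v
  have h1 : v = ![v 0, v 1] := by
    funext i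
    fin_cases i <;> rfl
  rw [h1, hα.hermForm_apply, hβ.hermForm_apply]

/-- The trace is independent of the unitary coframe. -/
theorem IsUnitaryCoframe.trace_eq_zero_iff (hε : ε = ![1, 1, 1] ∨ ε = ![1, -1, -1])
    (h : IsUnitaryCoframe ε J η (α y)) (f : R6 [⋀^Fin 2]→L[ℝ] ℂ) :
    (∀ A : R6 →L[ℝ] (Fin 3 → ℂ), IsUnitaryCoframe ε J η A →
      ∀ e : Fin 3 → R6, (∀ i, A (e i) = Pi.single i 1) →
        ∑ i, (ε i : ℂ) * f ![e i, J (e i)] = 0) ↔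
      hermTrace ε (frameVec α y 1) (frameVec α y Complex.I) f = 0 := by
  constructor
  · intro h1
    have h2 := h1 (α y) h (frameVec α y 1) (apply_frameVec h.1 1)
    simpa only [hermTrace, (h.J_frameVec _).1] using h2
  · intro h1 A hA e he
    have h2 := (isDualFrame_frameVec h.1).wedge_hermForm_apply hε f
    rw [h1, mul_zero] at h2
    -- Each trace is a nonzero multiple of the coefficient of f ∧ η², and η does not depend on the
    -- coframe; so vanishing in one coframe is vanishing in all.
    have h3 : wedge f (wedge (hermForm ε fun k => comp α k y) (hermForm ε fun k => comp α k y))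
        = 0 := by
      refine (isDualFrame_frameVec h.1).eq_zero_of_eq_six (k := 2 + (2 + 2)) rfl (fun i => ?_) h2
      fin_cases i <;> rfl
    have hA' : IsUnitaryCoframe ε J η ((fun _ : R6 => A) y) := hA
    rw [h.hermForm_eq (β := fun _ => A) hA'] at h3
    have h4 := (isDualFrame_frameVec (α := fun _ => A) (y := y) hA'.1).wedge_hermForm_apply hε f
    rw [h3] at h4
    have hne : (2 * (ε 0 * ε 1 * ε 2 : ℝ) : ℂ) ≠ 0 := by
      rcases hε with rfl | rfl <;> simp
    have h5 := (mul_eq_zero.1 h4.symm).resolve_left hne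
    obtain rfl : e = frameVec (fun _ => A) y 1 :=
      funext fun i => hA.1.1 ((he i).trans (apply_frameVec (α := fun _ => A) (y := y) hA'.1 1 i).symm)
    simpa only [hermTrace, (IsUnitaryCoframe.J_frameVec (α := fun _ => A) hA' _).1] using h5

end Types

/-! ### Solutions and integral graphs. -/

section Solution

variable {M : Type*} [TopologicalSpace M] [ChartedSpace R6 M] [IsManifold (𝓡 6) ∞ M]
  {r : ℕ} {E : M → Type*} [TopologicalSpace (TotalSpace (Fin r → ℂ) E)]
  [∀ x, TopologicalSpace (E x)] [∀ x, AddCommGroup (E x)] [∀ x, Module ℂ (E x)]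
  [FiberBundle (Fin r → ℂ) E]
  [∀ x, IsTopologicalAddGroup (E x)] [∀ x, ContinuousSMul ℝ (E x)]
  [VectorBundle ℂ (Fin r → ℂ) E] [VectorBundle ℝ (Fin r → ℂ) E]
  [ContMDiffVectorBundle ∞ (Fin r → ℂ) E (𝓡 6)]
  {h : HermitianStructure r E} {φ : OpenPartialHomeomorph M R6}
  {α : R6 → R6 →L[ℝ] (Fin 3 → ℂ)} {u : Fin r → ∀ x, E x}
  {cov : (∀ x, E x) → ∀ x : M, TangentSpace (𝓡 6) x →L[ℝ] E x} {p : R6 → Fib r}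
  {ε : Fin 3 → ℝ}

/-- A connection solves the system iff the graph of its connection matrix is integral. -/
theorem isSolution_iff_isIntegralGraph (S : UnitaryStructure M ε) (hα : S.IsUnitaryCoframing φ α)
    (hq : IsQuasiCoframing ε φ.target α) (hφ : φ ∈ IsManifold.maximalAtlas (𝓡 6) ∞ M)
    (hu : h.IsUnitaryFrame φ.source u) (hcov : h.IsCompatibleConnectionOn φ.source cov)
    (hps : ContDiffOn ℝ ∞ p φ.target) (hp : IsConnectionMatrix φ α u cov p) :
    S.IsSolution (r := r) φ cov ↔ IsIntegralGraph φ.target (hymIdeal r ε φ.target α) p := by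
  rw [isIntegralGraph_iff]
  have h1 : (∀ y ∈ φ.target, IsIntegralElement (hymIdeal r ε φ.target α) (y, p y)
      (LinearMap.range (fderiv ℝ (fun y => (y, p y)) y : R6 →ₗ[ℝ] Tot r))) ↔
      ∀ y ∈ φ.target, ∀ i j, (∀ v w, part02 (S.coordJ φ y) (fun v w =>
          curvPull α (y, p y) (fderiv ℝ (fun y => (y, p y)) y) i j ![v, w]) v w = 0) ∧
        (∀ A : R6 →L[ℝ] (Fin 3 → ℂ), IsUnitaryCoframe ε (S.coordJ φ y) (S.coordη φ y) A →
          ∀ e : Fin 3 → R6, (∀ i, A (e i) = Pi.single i 1) → ∑ k, (ε k : ℂ) *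
            curvPull α (y, p y) (fderiv ℝ (fun y => (y, p y)) y) i j
              ![e k, S.coordJ φ y (e k)] = 0) := by
    refine forall₂_congr fun y hy => ?_
    have hz : ((y, p y) : Tot r) ∈ domX r φ.target := ⟨hy, trivial⟩
    rw [isIntegralElement_range_iff hq hz fun x => by
      rw [(hasFDerivAt_graph φ.open_target hps hy).fderiv]; rfl]
    exact forall₂_congr fun i j => and_congr ((hα.unitary y hy).part02_eq_zero_iff _).symm
      ((hα.unitary y hy).trace_eq_zero_iff hq.signature _).symm
  rw [h1]
  have hF : ∀ {s : ∀ x, E x}, ContMDiffOn (𝓡 6) ((𝓡 6).prod 𝓘(ℝ, Fin r → ℂ)) ∞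
      (fun x => TotalSpace.mk' (Fin r → ℂ) x (s x)) φ.source → ∀ {y}, y ∈ φ.target → ∀ i v w, _ :=
    fun {s} hs {y} hy i v w =>
      inner_frame_curvature hφ hα.smooth hu hcov hps hp hs hy i v w
  constructor
  -- The frame sections test the equations: the curvature applied to u_j has components F_ij.
  -- Conversely, the curvature of any smooth section is a combination of these with the components
  -- of the section.
  · intro hsol y hy i j
    have hFj : ∀ v w, h.inner (φ.symm y) (u i (φ.symm y)) (curvature φ cov (u j) y v w) =
        curvPull α (y, p y) (fderiv ℝ (fun y => (y, p y)) y) i j ![v, w] := fun v w => by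
      rw [hF (hu.smooth j) hy]
      simp [frameCoord_frame hu hy]
    refine ⟨fun v w => ?_, fun A hA e he => ?_⟩
    · have h2 := congrArg (h.inner (φ.symm y) (u i (φ.symm y)))
        ((hsol (u j) (hu.smooth j) y hy).1 v w)
      rw [map_part02, map_zero] at h2
      simpa only [hFj] using h2
    · have h2 := congrArg (h.inner (φ.symm y) (u i (φ.symm y)))
        ((hsol (u j) (hu.smooth j) y hy).2 A hA e he)
      simpa only [map_sum, map_smul, map_zero, hFj, smul_eq_mul] using h2
  · intro hint s hs y hy
    refine ⟨fun v w => ?_, fun A hA e he => ?_⟩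
    · refine hu.ext (φ.map_target hy) fun i => ?_
      rw [map_part02, map_zero]
      simp only [hF hs hy]
      rw [part02_sum_mul]
      exact Finset.sum_eq_zero fun k _ => by rw [(hint y hy i k).1, zero_mul]
    · refine hu.ext (φ.map_target hy) fun i => ?_
      simp only [map_sum, map_smul, map_zero, hF hs hy, smul_eq_mul, Finset.mul_sum]
      rw [Finset.sum_comm]
      refine Finset.sum_eq_zero fun k _ => ?_
      simp only [← mul_assoc]
      rw [← Finset.sum_mul, (hint y hy i k).2 A hA e he, zero_mul]

end Solution

end PseudoHYM

namespace PseudoHYM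

open EDS

/-! ### Smooth sections of Hom(TM, E). -/

section HomBundle

variable {M : Type*} [TopologicalSpace M] [ChartedSpace R6 M] [IsManifold (𝓡 6) ∞ M]
  {r : ℕ} {E : M → Type*} [TopologicalSpace (TotalSpace (Fin r → ℂ) E)]
  [∀ x, TopologicalSpace (E x)] [∀ x, AddCommGroup (E x)] [∀ x, Module ℂ (E x)]
  [FiberBundle (Fin r → ℂ) E]
  [∀ x, IsTopologicalAddGroup (E x)] [∀ x, ContinuousSMul ℝ (E x)]
  [VectorBundle ℝ (Fin r → ℂ) E] [ContMDiffVectorBundle ∞ (Fin r → ℂ) E (𝓡 6)]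
  {φ : OpenPartialHomeomorph M R6}

theorem contMDiffAt_clm_of_apply {F : Type*} [NormedAddCommGroup F] [NormedSpace ℝ F]
    {f : M → R6 →L[ℝ] F} {x : M}
    (hf : ∀ w, ContMDiffAt (𝓡 6) 𝓘(ℝ, F) ∞ (fun x => f x w) x) :
    ContMDiffAt (𝓡 6) 𝓘(ℝ, R6 →L[ℝ] F) ∞ f x := by
  let b := Module.finBasis ℝ R6
  let Φ : (Fin (Module.finrank ℝ R6) → F) →L[ℝ] R6 →L[ℝ] F :=
    ∑ l, (ContinuousLinearMap.smulRightL ℝ R6 F (b.coord l).toContinuousLinearMap).comp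
      (ContinuousLinearMap.proj l)
  have h1 : f = fun x => Φ fun l => f x (b l) := by
    funext x
    ext w
    conv_lhs => rw [← b.sum_repr w]
    simp only [map_sum, map_smul]
    simp [Φ]
  rw [h1]
  exact Φ.contDiff.contDiffAt.comp_contMDiffAt (contMDiffAt_pi_space.2 fun l => hf (b l))

/-- The differential `T_x M → ℝ⁶` of a chart. -/
noncomputable def chartDeriv (φ : OpenPartialHomeomorph M R6) (x : M) :
    TangentSpace (𝓡 6) x →L[ℝ] R6 :=
  mfderiv (𝓡 6) (𝓡 6) φ x

/-- The coordinate vector fields of a chart. -/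
noncomputable def coordVec (φ : OpenPartialHomeomorph M R6) (x : M) :
    R6 →L[ℝ] TangentSpace (𝓡 6) x :=
  mfderiv (𝓡 6) (𝓡 6) φ.symm (φ x)

theorem coordVec_chartDeriv (hφ : φ ∈ IsManifold.maximalAtlas (𝓡 6) ∞ M) {x : M}
    (hx : x ∈ φ.source) (v : TangentSpace (𝓡 6) x) : coordVec φ x (chartDeriv φ x v) = v :=
  mfderiv_symm_mfderiv hφ hx v

theorem chartDeriv_tangentMap (hφ : φ ∈ IsManifold.maximalAtlas (𝓡 6) ∞ M) {y : R6}
    (hy : y ∈ φ.target) (v : R6) : chartDeriv φ (φ.symm y) (tangentMap φ y v) = v :=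
  mfderiv_tangentMap hφ hy v

theorem chartDeriv_coordVec (hφ : φ ∈ IsManifold.maximalAtlas (𝓡 6) ∞ M) {x : M}
    (hx : x ∈ φ.source) (v : R6) : chartDeriv φ x (coordVec φ x v) = v :=
  have h1 : Function.Surjective (chartDeriv φ x) := fun w => by
    obtain ⟨y, hy, rfl⟩ : ∃ y ∈ φ.target, φ.symm y = x := ⟨φ x, φ.map_source hx, φ.left_inv hx⟩
    exact ⟨_, chartDeriv_tangentMap hφ hy w⟩
  by
    obtain ⟨w, rfl⟩ := h1 v
    rw [coordVec_chartDeriv hφ hx]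

theorem exists_tangentMap_eq (hφ : φ ∈ IsManifold.maximalAtlas (𝓡 6) ∞ M) {y : R6}
    (hy : y ∈ φ.target) (v : TangentSpace (𝓡 6) (φ.symm y)) : ∃ w, tangentMap φ y w = v := by
  refine ⟨chartDeriv φ (φ.symm y) v, ?_⟩
  have h1 : Function.Injective (chartDeriv φ (φ.symm y)) :=
    Function.LeftInverse.injective (coordVec_chartDeriv hφ (φ.map_target hy))
  exact h1 (chartDeriv_tangentMap hφ hy _)

/-- Smoothness of a section of `Hom(TM, E)` can be tested on coordinate vector fields. -/
theorem contMDiffOn_hom_of_chart (hφ : φ ∈ IsManifold.maximalAtlas (𝓡 6) ∞ M)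
    {ψ : ∀ x : M, TangentSpace (𝓡 6) x →L[ℝ] E x}
    (hψ : ∀ w : R6, ContMDiffOn (𝓡 6) ((𝓡 6).prod 𝓘(ℝ, Fin r → ℂ)) ∞
      (fun x => TotalSpace.mk' (Fin r → ℂ) x (ψ x (coordVec φ x w)))
      φ.source) :
    ContMDiffOn (𝓡 6) ((𝓡 6).prod 𝓘(ℝ, R6 →L[ℝ] (Fin r → ℂ))) ∞
      (fun x => (⟨x, ψ x⟩ : TotalSpace (R6 →L[ℝ] (Fin r → ℂ))
        fun x : M => TangentSpace (𝓡 6) x →L[ℝ] E x)) φ.source := by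
  intro x₀ hx₀
  refine ((contMDiffAt_hom_bundle _).2 ⟨contMDiffAt_id, ?_⟩).contMDiffWithinAt
  refine contMDiffAt_clm_of_apply fun w => ?_
  let e := trivializationAt R6 (fun x : M => TangentSpace (𝓡 6) x) x₀
  have he : x₀ ∈ e.baseSet := FiberBundle.mem_baseSet_trivializationAt' x₀
  have hE : x₀ ∈ (trivializationAt (Fin r → ℂ) E x₀).baseSet :=
    FiberBundle.mem_baseSet_trivializationAt' x₀
  -- The vector field that is constant in the tangent trivialization. Its coordinates in the chart
  -- are smooth, so its image under ψ is a smooth combination of the images of coordinate fields.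
  let W : ∀ x : M, TangentSpace (𝓡 6) x := fun x => e.symmL ℝ x w
  have hW : ContMDiffAt (𝓡 6) ((𝓡 6).prod 𝓘(ℝ, R6)) ∞
      (fun x => (TotalSpace.mk' R6 x (W x) : TangentBundle (𝓡 6) M)) x₀ := by
    refine (contMDiffAt_section x₀).2 ?_
    refine (contMDiffAt_const (c := w)).congr_of_eventuallyEq ?_
    filter_upwards [e.open_baseSet.mem_nhds he] with x hx
    change (e ⟨x, e.symmL ℝ x w⟩).2 = w
    rw [e.symmL_apply hx, e.apply_mk_symm hx]
  have hc := contMDiffAt_mfderiv_chart hφ hx₀ hW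
  let b := Module.finBasis ℝ R6
  have h1 : ContMDiffAt (𝓡 6) ((𝓡 6).prod 𝓘(ℝ, Fin r → ℂ)) ∞ (fun x =>
      TotalSpace.mk' (Fin r → ℂ) x (∑ l, b.coord l (chartDeriv φ x (W x)) •
        ψ x (coordVec φ x (b l)))) x₀ := by
    refine ContMDiffAt.sum_section fun l _ => ContMDiffAt.smul_section ?_
      ((hψ (b l)).contMDiffAt (φ.open_source.mem_nhds hx₀))
    exact ((b.coord l).toContinuousLinearMap.contDiff.contDiffAt).comp_contMDiffAt hc
  refine ((contMDiffAt_section x₀).1 h1).congr_of_eventuallyEq ?_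
  filter_upwards [φ.open_source.mem_nhds hx₀,
    (trivializationAt (Fin r → ℂ) E x₀).open_baseSet.mem_nhds hE] with x hx hxE
  have h4 : ψ x (W x) = ∑ l, b.coord l (chartDeriv φ x (W x)) • ψ x (coordVec φ x (b l)) := by
    have h2 := congrArg ((ψ x).comp (coordVec φ x)) (b.sum_repr (chartDeriv φ x (W x))).symm
    rw [map_sum, ContinuousLinearMap.comp_apply, coordVec_chartDeriv hφ hx] at h2
    refine h2.trans (Finset.sum_congr rfl fun l _ => ?_)
    rw [map_smul]
    rfl
  change (trivializationAt (Fin r → ℂ) E x₀).continuousLinearMapAt ℝ x (ψ x (W x)) = _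
  rw [Trivialization.continuousLinearMapAt_apply, Trivialization.coe_linearMapAt_of_mem _ hxE, h4]

end HomBundle

/-! ### The connection with a prescribed connection matrix. -/

section FrameConnection

variable {M : Type*} [TopologicalSpace M] [ChartedSpace R6 M]
  {r : ℕ} {E : M → Type*} [TopologicalSpace (TotalSpace (Fin r → ℂ) E)]
  [∀ x, TopologicalSpace (E x)] [∀ x, AddCommGroup (E x)] [∀ x, Module ℂ (E x)]
  [FiberBundle (Fin r → ℂ) E]
  {h : HermitianStructure r E} {φ : OpenPartialHomeomorph M R6}
  {α : R6 → R6 →L[ℝ] (Fin 3 → ℂ)} {u : Fin r → ∀ x, E x} {p : R6 → Fib r}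

/-- The components `d f + A f` of the covariant derivative of a section. -/
noncomputable def covCoord (h : HermitianStructure r E) (φ : OpenPartialHomeomorph M R6)
    (α : R6 → R6 →L[ℝ] (Fin 3 → ℂ)) (u : Fin r → ∀ x, E x) (p : R6 → Fib r) (s : ∀ x, E x)
    (i : Fin r) (y : R6) : R6 →L[ℝ] ℂ :=
  fderiv ℝ (frameCoord h φ u s i) y + ∑ k, frameCoord h φ u s k y • connMatrix α y (p y) i k

theorem covCoord_apply (s : ∀ x, E x) (i : Fin r) (y v : R6) : covCoord h φ α u p s i y v =
    fderiv ℝ (frameCoord h φ u s i) y v +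
      ∑ k, connMatrix α y (p y) i k v * frameCoord h φ u s k y := by
  simp [covCoord, mul_comm]

variable [∀ x, IsTopologicalAddGroup (E x)] [∀ x, ContinuousSMul ℝ (E x)]

/-- The connection with connection matrix given by `p`. -/
noncomputable def frameConnection (h : HermitianStructure r E) (φ : OpenPartialHomeomorph M R6)
    (α : R6 → R6 →L[ℝ] (Fin 3 → ℂ)) (u : Fin r → ∀ x, E x) (p : R6 → Fib r) (s : ∀ x, E x)
    (x : M) : TangentSpace (𝓡 6) x →L[ℝ] E x :=
  -- Continuous linear maps into the fibre are real-linear here, so multiplication of u_i by a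
  -- complex covector is assembled from its real and imaginary parts.
  ∑ i, ((Complex.reCLM.comp (covCoord h φ α u p s i (φ x))).smulRight (u i x) +
    (Complex.imCLM.comp (covCoord h φ α u p s i (φ x))).smulRight (Complex.I • u i x)).comp
      (chartDeriv φ x)

theorem frameConnection_apply (s : ∀ x, E x) (x : M) (v : TangentSpace (𝓡 6) x) :
    frameConnection h φ α u p s x v =
      ∑ i, covCoord h φ α u p s i (φ x) (chartDeriv φ x v) • u i x := by
  rw [frameConnection, _root_.sum_apply]
  refine Finset.sum_congr rfl fun i _ => ?_
  change (covCoord h φ α u p s i (φ x) (chartDeriv φ x v)).re • u i x +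
    (covCoord h φ α u p s i (φ x) (chartDeriv φ x v)).im • (Complex.I • u i x) = _
  rw [← Complex.coe_smul, ← Complex.coe_smul, smul_smul, ← add_smul, Complex.re_add_im]

variable [IsManifold (𝓡 6) ∞ M] [VectorBundle ℂ (Fin r → ℂ) E] [VectorBundle ℝ (Fin r → ℂ) E]
  [ContMDiffVectorBundle ∞ (Fin r → ℂ) E (𝓡 6)]

theorem frameConnection_tangentMap (hφ : φ ∈ IsManifold.maximalAtlas (𝓡 6) ∞ M) (s : ∀ x, E x)
    {y : R6} (hy : y ∈ φ.target) (w : R6) :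
    frameConnection h φ α u p s (φ.symm y) (tangentMap φ y w) =
      ∑ i, covCoord h φ α u p s i y w • u i (φ.symm y) := by
  rw [frameConnection_apply, chartDeriv_tangentMap hφ hy, φ.right_inv hy]

theorem isConnectionMatrix_frameConnection (hφ : φ ∈ IsManifold.maximalAtlas (𝓡 6) ∞ M)
    (hu : h.IsUnitaryFrame φ.source u) :
    IsConnectionMatrix φ α u (frameConnection h φ α u p) p := by
  intro y hy j v
  rw [frameConnection_tangentMap hφ _ hy]
  refine Finset.sum_congr rfl fun i _ => ?_
  have h1 : frameCoord h φ u (u j) i =ᶠ[𝓝 y] fun _ => if i = j then 1 else 0 := by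
    filter_upwards [φ.open_target.mem_nhds hy] with y' hy'
    exact frameCoord_frame hu hy' i j
  rw [covCoord_apply, h1.fderiv_eq]
  simp [frameCoord_frame hu hy]

theorem contMDiff_frameConnection (hφ : φ ∈ IsManifold.maximalAtlas (𝓡 6) ∞ M)
    (hα : ContDiffOn ℝ ∞ α φ.target) (hu : h.IsUnitaryFrame φ.source u)
    (hp : ContDiffOn ℝ ∞ p φ.target) :
    ContMDiffCovariantDerivativeOn (I := 𝓡 6) (Fin r → ℂ) ∞ (frameConnection h φ α u p)
      φ.source where
  contMDiff {s} hs := by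
    have hs' : ContMDiffOn (𝓡 6) ((𝓡 6).prod 𝓘(ℝ, Fin r → ℂ)) ∞
      (fun x => TotalSpace.mk' (Fin r → ℂ) x (s x)) φ.source := hs
    refine contMDiffOn_hom_of_chart hφ fun w => ?_
    have h1 : ∀ i, ContDiffOn ℝ ∞ (fun y => covCoord h φ α u p s i y w) φ.target := fun i => by
      refine ContDiffOn.clm_apply (ContDiffOn.add ?_ (ContDiffOn.sum fun k _ => ?_))
        contDiffOn_const
      · exact (contDiffOn_frameCoord hφ hu hs' i).fderiv_of_isOpen φ.open_target (by simp)
      · exact (contDiffOn_frameCoord hφ hu hs' k).smul (contDiffOn_connMatrix_graph hα hp i k)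
    have h2 : ContMDiffOn (𝓡 6) ((𝓡 6).prod 𝓘(ℝ, Fin r → ℂ)) ∞ (fun x =>
        TotalSpace.mk' (Fin r → ℂ) x (∑ i, covCoord h φ α u p s i (φ x) w • u i x)) φ.source :=
      ContMDiffOn.sum_section fun i _ => HermitianStructure.contMDiffOn_complex_smul
        φ.open_source (contMDiffOn_comp_chart hφ (h1 i)) (hu.smooth i)
    refine h2.congr fun x hx => ?_
    rw [frameConnection_apply, chartDeriv_coordVec hφ hx]

theorem isCovariantDerivativeOn_frameConnection (hφ : φ ∈ IsManifold.maximalAtlas (𝓡 6) ∞ M)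
    (hu : h.IsUnitaryFrame φ.source u) :
    IsCovariantDerivativeOn (I := 𝓡 6) (Fin r → ℂ) (frameConnection h φ α u p) φ.source where
  add {s s' x} hs hs' hx := by
    obtain ⟨y, hy, rfl⟩ : ∃ y ∈ φ.target, φ.symm y = x := ⟨φ x, φ.map_source hx, φ.left_inv hx⟩
    ext v
    obtain ⟨w, rfl⟩ := exists_tangentMap_eq hφ hy v
    rw [_root_.add_apply, frameConnection_tangentMap hφ _ hy, frameConnection_tangentMap hφ _ hy,
      frameConnection_tangentMap hφ _ hy, ← Finset.sum_add_distrib]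
    refine Finset.sum_congr rfl fun i _ => ?_
    rw [← add_smul]
    congr 1
    have h1 : ∀ i, frameCoord h φ u (s + s') i =
        fun y => frameCoord h φ u s i y + frameCoord h φ u s' i y := fun i => by
      funext y
      simp [frameCoord]
    simp only [covCoord_apply, h1]
    rw [fderiv_fun_add (differentiableAt_frameCoord hφ hu hy hs i)
      (differentiableAt_frameCoord hφ hu hy hs' i)]
    simp only [_root_.add_apply, mul_add, Finset.sum_add_distrib]
    ring
  leibniz {s g x} hs hg hx := by
    obtain ⟨y, hy, rfl⟩ : ∃ y ∈ φ.target, φ.symm y = x := ⟨φ x, φ.map_source hx, φ.left_inv hx⟩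
    ext v
    have h1 : ∀ i, frameCoord h φ u (g • s) i =
        fun y => g (φ.symm y) • frameCoord h φ u s i y := fun i => by
      funext y
      change h.inner _ _ (g (φ.symm y) • s (φ.symm y)) = _
      rw [← Complex.coe_smul, map_smul, ← Complex.coe_smul]
      rfl
    have hgd : DifferentiableAt ℝ (fun y => g (φ.symm y)) y :=
      (hg.comp y ((mdifferentiable_chart hφ).mdifferentiableAt_symm hy)).differentiableAt
    obtain ⟨w, rfl⟩ := exists_tangentMap_eq hφ hy v
    have h2 : fderiv ℝ (fun y => g (φ.symm y)) y w = mvfderiv (𝓡 6) g (φ.symm y)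
        (tangentMap φ y w) := fderiv_comp_chart_symm hφ hy hg w
    refine hu.ext (φ.map_target hy) fun i => ?_
    rw [_root_.add_apply, _root_.smul_apply, ContinuousLinearMap.smulRight_apply, ← h2,
      frameConnection_tangentMap hφ _ hy, frameConnection_tangentMap hφ _ hy, map_add,
      ← Complex.coe_smul, ← Complex.coe_smul, map_smul, map_smul,
      hu.inner_sum (φ.map_target hy), hu.inner_sum (φ.map_target hy), covCoord_apply,
      covCoord_apply]
    simp only [h1]
    rw [fderiv_fun_smul hgd (differentiableAt_frameCoord hφ hu hy hs i)]
    simp only [_root_.add_apply, _root_.smul_apply, ContinuousLinearMap.smulRight_apply,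
      Complex.real_smul, smul_eq_mul, mul_add, Finset.mul_sum]
    rw [add_right_comm]
    congr 2
    exact Finset.sum_congr rfl fun k _ => by ring

theorem isCompatibleConnectionOn_frameConnection (hφ : φ ∈ IsManifold.maximalAtlas (𝓡 6) ∞ M)
    (hα : ContDiffOn ℝ ∞ α φ.target) (hu : h.IsUnitaryFrame φ.source u)
    (hp : ContDiffOn ℝ ∞ p φ.target) :
    h.IsCompatibleConnectionOn φ.source (frameConnection h φ α u p) where
  covariant := isCovariantDerivativeOn_frameConnection hφ hu
  smooth := contMDiff_frameConnection hφ hα hu hp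
  complex_linear s x hx hs v := by
    obtain ⟨y, hy, rfl⟩ : ∃ y ∈ φ.target, φ.symm y = x := ⟨φ x, φ.map_source hx, φ.left_inv hx⟩
    obtain ⟨w, rfl⟩ := exists_tangentMap_eq hφ hy v
    rw [frameConnection_tangentMap hφ _ hy, frameConnection_tangentMap hφ _ hy, Finset.smul_sum]
    refine Finset.sum_congr rfl fun i _ => ?_
    have h1 : ∀ i, frameCoord h φ u (fun x => Complex.I • s x) i =
        fun y => Complex.I * frameCoord h φ u s i y := fun i => by
      funext y
      simp [frameCoord]
    rw [smul_smul]
    congr 1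
    simp only [covCoord_apply, h1]
    rw [fderiv_const_mul (differentiableAt_frameCoord hφ hu hy hs i)]
    simp only [_root_.smul_apply, smul_eq_mul, mul_add, Finset.mul_sum]
    congr 1
    exact Finset.sum_congr rfl fun k _ => by ring
  compatible s t x hx hs ht v := by
    obtain ⟨y, hy, rfl⟩ : ∃ y ∈ φ.target, φ.symm y = x := ⟨φ x, φ.map_source hx, φ.left_inv hx⟩
    obtain ⟨w, rfl⟩ := exists_tangentMap_eq hφ hy v
    refine (mfderiv_inner hφ hu hy hs ht w).trans ?_
    rw [hu.inner_eq_sum (φ.map_target hy) (frameConnection h φ α u p s (φ.symm y) _),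
      hu.inner_eq_sum (φ.map_target hy) (s (φ.symm y)) (frameConnection h φ α u p t (φ.symm y) _),
      frameConnection_tangentMap hφ _ hy, frameConnection_tangentMap hφ _ hy]
    simp only [hu.inner_sum (φ.map_target hy)]
    simp only [covCoord_apply, map_add, map_sum, map_mul]
    change _ = ∑ i, _ * frameCoord h φ u t i y + ∑ i, (starRingEnd ℂ) (frameCoord h φ u s i y) * _
    simp only [add_mul, mul_add, Finset.sum_add_distrib, Finset.sum_mul, Finset.mul_sum]
    -- Compatibility of d + A with h comes down to this cancellation of the A-terms, which is the
    -- identity A* = −A.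
    have h1 : ∑ i, ∑ k, (starRingEnd ℂ) (connMatrix α y (p y) i k w) *
          (starRingEnd ℂ) (frameCoord h φ u s k y) * frameCoord h φ u t i y =
        -∑ i, ∑ k, (starRingEnd ℂ) (frameCoord h φ u s i y) *
          (connMatrix α y (p y) i k w * frameCoord h φ u t k y) := by
      rw [Finset.sum_comm, ← Finset.sum_neg_distrib]
      refine Finset.sum_congr rfl fun i _ => ?_
      rw [← Finset.sum_neg_distrib]
      refine Finset.sum_congr rfl fun k _ => ?_
      rw [conj_connMatrix]
      ring
    rw [h1]
    ring

end FrameConnection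

end PseudoHYM
theorem mainTheorem2
    {M : Type*} [TopologicalSpace M] [T2Space M] [SecondCountableTopology M]
    [ChartedSpace PseudoHYM.R6 M] [IsManifold (𝓡 6) ∞ M]
    (ε : Fin 3 → ℝ) (hε : ε = ![1, 1, 1] ∨ ε = ![1, -1, -1])
    (S : PseudoHYM.UnitaryStructure M ε) (hS : S.IsQuasiIntegrable)
    (r : ℕ) (E : M → Type*) [TopologicalSpace (TotalSpace (Fin r → ℂ) E)]
    [∀ x, TopologicalSpace (E x)] [∀ x, AddCommGroup (E x)] [∀ x, Module ℂ (E x)]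
    [∀ x, IsTopologicalAddGroup (E x)] [∀ x, ContinuousSMul ℝ (E x)]
    [FiberBundle (Fin r → ℂ) E] [VectorBundle ℂ (Fin r → ℂ) E] [VectorBundle ℝ (Fin r → ℂ) E]
    [ContMDiffVectorBundle ∞ (Fin r → ℂ) E (𝓡 6)]
    (h : PseudoHYM.HermitianStructure r E)
    (φ : OpenPartialHomeomorph M PseudoHYM.R6) (hφ : φ ∈ IsManifold.maximalAtlas (𝓡 6) ∞ M)
    (α : PseudoHYM.R6 → PseudoHYM.R6 →L[ℝ] (Fin 3 → ℂ)) (hα : S.IsUnitaryCoframing φ α)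
    (u : Fin r → ∀ x, E x) (hu : h.IsUnitaryFrame φ.source u) :
    -- every compatible connection is given by functions `p`, and conversely
    (∀ cov, h.IsCompatibleConnectionOn φ.source cov →
      ∃ p : PseudoHYM.R6 → PseudoHYM.Fib r, ContDiffOn ℝ ∞ p φ.target ∧
        PseudoHYM.IsConnectionMatrix φ α u cov p) ∧
    (∀ p : PseudoHYM.R6 → PseudoHYM.Fib r, ContDiffOn ℝ ∞ p φ.target →
      ∃ cov, h.IsCompatibleConnectionOn φ.source cov ∧
        PseudoHYM.IsConnectionMatrix φ α u cov p) ∧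
    -- solutions of the system correspond to integral graphs
    (∀ cov, h.IsCompatibleConnectionOn φ.source cov →
      ∀ p : PseudoHYM.R6 → PseudoHYM.Fib r, ContDiffOn ℝ ∞ p φ.target →
        PseudoHYM.IsConnectionMatrix φ α u cov p →
        (S.IsSolution (r := r) φ cov ↔
          PseudoHYM.IsIntegralGraph φ.target (PseudoHYM.hymIdeal r ε φ.target α) p)) ∧
    -- the system is involutive, with the stated characters
    EDS.IsInvolutive (PseudoHYM.domX r φ.target) (PseudoHYM.hymIdeal r ε φ.target α)
      (PseudoHYM.indepForm r α) ∧
    EDS.HasCartanCharacters (PseudoHYM.domX r φ.target) (PseudoHYM.hymIdeal r ε φ.target α)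
      (PseudoHYM.indepForm r α) ![0, 0, 0, 0, 2 * r ^ 2, 3 * r ^ 2, r ^ 2] := by
  have hq := S.isQuasiCoframing hε hS hφ hα
  exact ⟨fun cov hcov => PseudoHYM.exists_isConnectionMatrix hφ hq hu hcov,
    fun p hp => ⟨_, PseudoHYM.isCompatibleConnectionOn_frameConnection hφ hα.smooth hu hp,
      PseudoHYM.isConnectionMatrix_frameConnection hφ hu⟩,
    fun cov hcov p hps hp =>
      PseudoHYM.isSolution_iff_isIntegralGraph S hα hq hφ hu hcov hps hp,
    PseudoHYM.isInvolutive_hym hq, PseudoHYM.hasCartanCharacters_hym hq⟩
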